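/- \textbf{Setting.} For $d\in\mathbb N$ let $m_D=\lceil\log d\rceil$ and $m_G=\lceil \log d\,\log\log d\rceil$. For fixed $K,B$ we write $x=1/\mathrm{polylog}(d)$ if $(\log d)^{-B}\le x\le(\log d)^{-K}$. \emph{Data.} $X=s_1u_1+s_2u_2$ with $s_1,s_2\in\{0,1\}$, $u_1,u_2\in\mathbb R^d$, $\|u_1\|_2=\|u_2\|_2=1$, and $\gamma=1/\mathrm{polylog}(d)$. The probabilities of $(s_1,s_2)=(1,0)$ and of $(s_1,s_2)=(0,1)$ are both at least a constant $p_0>0$, and one of the following holds: (1) $\langle u_1,u_2\rangle=\gamma$ and always $X=u_1$ or $X=u_2$ (exactly one of $s_1,s_2$ is $1$); (2) $\langle u_1,u_2\rangle=0$, $\Pr[s_1=s_2=1]=\gamma$ and $\Pr[s_1=s_2=0]\le\gamma$. \emph{Latent law.} $p_z$ is a law on $\{0,1\}^{m_G}\setminus\{0\}$ with $c_1/m_G\le\Pr[z_i=1]\le c_2/m_G$ for all $i$, where $c_1,c_2>0$ are constants, and $\Pr[z_i=z_j=1]=\frac{1}{m_G^2\,\mathrm{polylog}(d)}$ for all $i\ne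 j$. \emph{Model.} $G_V(z)=\sum_{j\le m_G}z_jv_j$ and $D(X)=\mathrm{sigmoid}\big(a\sum_{i\le m_D}\sigma(\langle w_i,X\rangle)+\lambda b\big)$, where $\lambda=\frac{1}{\sqrt d\,\mathrm{polylog}(d)}$, $\Lambda=d^{0.2}$, and $\sigma(x)=x^3$ for $|x|\le\Lambda$, $\sigma(x)=3\Lambda^2x-2\Lambda^3$ for $x>\Lambda$, $\sigma(x)=3\Lambda^2x+2\Lambda^3$ for $x<-\Lambda$. The one-sample loss is $L(X,z)=\log D(X)+\log(1-D(G_V(z)))$. \emph{Initialization.} $b^{(0)}=0$ and, independently, $a^{(0)}\sim\mathcal N\big(0,\frac{1}{m_D\mathrm{polylog}(d)}\big)$, $w_i^{(0)}\sim\mathcal N(0,\frac1d I)$, $v_j^{(0)}\sim\mathcal N(0,\frac1{d^2}I)$. \emph{nSGDA.} At each step draw fresh independent $X\sim p_{data}$ and $z\sim p_z$; with all the gradients $g_a,g_b,g_W,g_V$ of $L(X,z)$ taken at the current parameters, add $\eta_D\,(g_a,g_b,g_W)/(|g_a|+|g_b|+\|g_W\|_2)$ to $(a,b,W)$ and subtract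 $\eta_G\,g_V/\|g_V\|_2$ from $V$. The step sizes satisfy $0<\eta_D\le d^{-K}$ and $\eta_G=\eta_D/\mathrm{polylog}(d)$. \textbf{Theorem (nSGDA recovers the modes separately).} There are absolute constants $K,q\in\mathbb N$ and a function $\tau$ with $(\log d)^{-q}\le\tau(d)\le(\log d)^{q}$ for all large $d$ such that the following holds with $T_1=\lceil\tau(d)/\eta_D\rceil=\tilde\Theta(1/\eta_D)$. For all $B\in\mathbb N$ and all constants $p_0,c_1,c_2>0$ there is a sequence $\varepsilon_d\to0$ such that, for all sufficiently large $d$ and all choices of $u_1,u_2$, of the law of $(s_1,s_2)$, of $p_z$, of $\gamma$, of $\lambda$, of the variance of $a^{(0)}$ and of $\eta_D,\eta_G$ as above (each $\mathrm{polylog}(d)$ being an arbitrary quantity between $(\log d)^K$ and $(\log d)^B$, chosen separately at each occurrence other than that in $\gamma$, which is one number), with probability at least $1-\varepsilon_d$ over the initialization and the training samples, for both $\ell\in\{1,2\}$, $$\Pr_{z\sim p_z}\left(\left\|\frac{G_V^{(T_1)}(z)}{\|G_V^{(T_1)}(z)\|_2}-u_\ell\right\|_2\le\varepsilon_d\right)\ge(\log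 d)^{-q}=\tilde\Omega(1).$$ -/

import Mathlib

open MeasureTheory ProbabilityTheory Filter Topology

noncomputable section

namespace GAN

/-- Vectors of `ℝ^d` with the Euclidean norm. -/
abbrev Vec (d : ℕ) := EuclideanSpace ℝ (Fin d)

/-- A family of `m` vectors of `ℝ^d` (the rows of a weight matrix), with the Frobenius norm. -/
abbrev Rows (m d : ℕ) := PiLp 2 (fun _ : Fin m => Vec d)

/-- `x` is of the form `1 / polylog(d)`, with the exponent of `log d` between `K` and `B`. -/
def InvPolylog (K B d : ℕ) (x : ℝ) : Prop :=
  1 / Real.log d ^ B ≤ x ∧ x ≤ 1 / Real.log d ^ K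

/-- The truncated cubic activation: `x ^ 3` on `[-L, L]`, continued affinely. -/
def activation (L x : ℝ) : ℝ :=
  if |x| ≤ L then x ^ 3
  else if L < x then 3 * L ^ 2 * x - 2 * L ^ 3
  else 3 * L ^ 2 * x + 2 * L ^ 3

/-- The truncation level `Λ = d ^ 0.2`. -/
def truncLevel (d : ℕ) : ℝ := (d : ℝ) ^ (0.2 : ℝ)

/-- The combination `∑ i, z i • v i` with coefficients `z i ∈ {0, 1}` (`true` stands for `1`). -/
def binComb {m d : ℕ} (v : Fin m → Vec d) (z : Fin m → Bool) : Vec d :=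
  ∑ i, (if z i then (1 : ℝ) else 0) • v i

/-- The linear generator `G_V(z) = V z`. -/
def generator {m d : ℕ} (V : Rows m d) (z : Fin m → Bool) : Vec d :=
  binComb (fun i => V i) z

/-- The discriminator `D(X) = sigmoid (a ∑ i, σ ⟨w_i, X⟩ + lam * b)`. -/
def discriminator {m d : ℕ} (lam a b : ℝ) (W : Rows m d) (X : Vec d) : ℝ :=
  Real.sigmoid (a * ∑ i, activation (truncLevel d) (inner ℝ (W i) X) + lam * b)

/-- The one-sample loss `log D(X) + log (1 - D(G(z)))`. -/
def loss {mD mG d : ℕ} (lam a b : ℝ) (W : Rows mD d) (V : Rows mG d)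
    (X : Vec d) (z : Fin mG → Bool) : ℝ :=
  Real.log (discriminator lam a b W X)
    + Real.log (1 - discriminator lam a b W (generator V z))

/-- All trainable parameters. -/
structure State (mD mG d : ℕ) where
  a : ℝ
  b : ℝ
  W : Rows mD d
  V : Rows mG d

/-- One step of normalized SGDA (ascent for `a, b, W`, descent for `V`) on the sample `(X, z)`.
All four one-sample gradients are taken at the current state. The discriminator's gradient is
normalized by `‖g_a‖ + ‖g_b‖ + ‖g_W‖`, the generator's one by its Euclidean norm. -/
def nsgdaStep {mD mG d : ℕ} (lam etaD etaG : ℝ) (X : Vec d) (z : Fin mG → Bool)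
    (S : State mD mG d) : State mD mG d :=
  let ga : ℝ := deriv (fun a => loss lam a S.b S.W S.V X z) S.a
  let gb : ℝ := deriv (fun b => loss lam S.a b S.W S.V X z) S.b
  let gW : Rows mD d := gradient (fun W => loss lam S.a S.b W S.V X z) S.W
  let gV : Rows mG d := gradient (fun V => loss lam S.a S.b S.W V X z) S.V
  let N : ℝ := |ga| + |gb| + ‖gW‖
  { a := S.a + etaD * (ga / N)
    b := S.b + etaD * (gb / N)
    W := S.W + (etaD / N) • gW
    V := S.V - (etaG / ‖gV‖) • gV }

/-- The state after `t` steps, step `n` using `X = s_1 u_1 + s_2 u_2` with `s = (ω n).1`, and the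
latent vector `z = (ω n).2`. -/
def nsgda {mD mG d : ℕ} (lam etaD etaG : ℝ) (u : Fin 2 → Vec d) (S₀ : State mD mG d)
    (ω : ℕ → (Fin 2 → Bool) × (Fin mG → Bool)) : ℕ → State mD mG d
  | 0 => S₀
  | t + 1 => nsgdaStep lam etaD etaG (binComb u (ω t).1) (ω t).2 (nsgda lam etaD etaG u S₀ ω t)

/-- The random numbers used by the initialization: `a`, the entries of the `w_i` and of the
`v_j`. -/
abbrev InitSample (mD mG d : ℕ) := ℝ × (Fin mD → Fin d → ℝ) × (Fin mG → Fin d → ℝ)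

/-- Independent `a ∼ N(0, va)`, `w_i ∼ N(0, I / d)`, `v_j ∼ N(0, I / d ^ 2)`. -/
def initLaw (mD mG d : ℕ) (va : ℝ) : Measure (InitSample mD mG d) :=
  (gaussianReal 0 va.toNNReal).prod
    ((Measure.pi fun _ : Fin mD => Measure.pi fun _ : Fin d =>
        gaussianReal 0 (1 / (d : NNReal))).prod
      (Measure.pi fun _ : Fin mG => Measure.pi fun _ : Fin d =>
        gaussianReal 0 (1 / (d : NNReal) ^ 2)))

/-- The initial state; the bias `b` starts at `0`. -/
def initState {mD mG d : ℕ} (x : InitSample mD mG d) : State mD mG d where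
  a := x.1
  b := 0
  W := WithLp.toLp 2 fun i => WithLp.toLp 2 (x.2.1 i)
  V := WithLp.toLp 2 fun j => WithLp.toLp 2 (x.2.2 j)

/-- The joint law of the initialization and of the i.i.d. training samples `(s, z)`; the
initialization, the data coefficients `s` and the latent vectors `z` are independent. -/
def trainLaw (mD mG d : ℕ) (va : ℝ) (ps : PMF (Fin 2 → Bool)) (pz : PMF (Fin mG → Bool)) :
    Measure (InitSample mD mG d × (ℕ → (Fin 2 → Bool) × (Fin mG → Bool))) :=
  (initLaw mD mG d va).prod
    (Measure.infinitePi fun _ : ℕ => ps.toMeasure.prod pz.toMeasure)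

/-- Structure of the data `X = s_1 u_1 + s_2 u_2`: unit modes, each pure mode has probability at
least `p₀`, and either the modes have inner product `γ` and `X` is always `u_1` or `u_2`, or the
modes are orthogonal, `s_1 = s_2 = 1` has probability `γ` and `s_1 = s_2 = 0` has
probability at most `γ`. -/
def DataStructure {d : ℕ} (p₀ γ : ℝ) (u : Fin 2 → Vec d) (ps : PMF (Fin 2 → Bool)) : Prop :=
  (∀ l, ‖u l‖ = 1) ∧
  p₀ ≤ (ps ![true, false]).toReal ∧ p₀ ≤ (ps ![false, true]).toReal ∧
  ((inner ℝ (u 0) (u 1) = γ ∧ ps ![true, true] = 0 ∧ ps ![false, false] = 0) ∨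
    (inner ℝ (u 0) (u 1) = 0 ∧ (ps ![true, true]).toReal = γ ∧
      (ps ![false, false]).toReal ≤ γ))

/-- Structure of the latent law: `z ≠ 0`, `Pr[z_i = 1] = Θ(1 / m)` with constants `c₁, c₂`, and
`Pr[z_i = z_j = 1] = 1 / (m ^ 2 polylog(d))` for `i ≠ j`. -/
def LatentStructure {m : ℕ} (K B d : ℕ) (c₁ c₂ : ℝ) (pz : PMF (Fin m → Bool)) : Prop :=
  pz (fun _ => false) = 0 ∧
  (∀ i, c₁ / m ≤ pz.toMeasure.real {z | z i = true} ∧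
    pz.toMeasure.real {z | z i = true} ≤ c₂ / m) ∧
  (∀ i j, i ≠ j →
    InvPolylog K B d ((m : ℝ) ^ 2 * pz.toMeasure.real {z | z i = true ∧ z j = true}))

/-- The number `log d` of discriminator neurons. -/
def numD (d : ℕ) : ℕ := ⌈Real.log d⌉₊

/-- The number `log d * log log d` of generator neurons. -/
def numG (d : ℕ) : ℕ := ⌈Real.log d * Real.log (Real.log d)⌉₊

end GAN

end

open MeasureTheory ProbabilityTheory Filter Topology
noncomputable section
set_option maxRecDepth 4000
namespace GAN

/-! ### Explicit gradients while no activation is truncated -/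

/-! The discriminator learns the two modes in two different neurons; the generator, which is slower,
follows them, each column growing along the neuron it happens to prefer at the start. The core is
deterministic: `normalize_nsgda_sub_le` treats every trajectory that satisfies `GoodInit` and
`GoodSamples`, and probability enters only to show that these two events are likely. Polylogarithmic
losses are powers of `e = 1 / log d`, polynomial ones powers of `θ = d ^ (-1/20)`, and `θ` is below
every fixed power of `e` for large `d`. On these scales `⟪w_k, u_l⟫` starts at size `θ ^ 10` and
`⟪w_k, v_j⟫` at size `θ ^ 20`.

Discriminator. As long as no activation is truncated, a step on the data point `u_l` adds `c ⟪w_k,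
u_l⟫² u_l` to each `w_k`, up to a small error, with the same `c` for all `k`; here `c > 0` if `a >
0`, and `a < 0` is reduced to this by the symmetry `flip`. In such a quadratic recursion the largest
initial coordinate runs away from the others (`race`). During the early phase `η t ≤ θ ^ 4` the
weight `a` is practically frozen, and the polylogarithmic initial margin of the leader turns into
domination. Later the normalized step is shared between `a` and the leading alignment `A_l`. Up to
errors, `3 a² - A_0² - A_1²` does not decrease and `a + A_0 + A_1` grows at unit speed in `η t`, so
`a` keeps up (`le_of_balance`) and each `A_l` grows linearly in `η t`. Hence the leading neuron is
`α u_l + O(1)` with large `α` (`norm_lead_sub_le`, `le_alpha_lead`), while distinct neurons stay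
nearly orthogonal (`abs_inner_rows_le`). Generated samples do not disturb this: they are short
because `ηG ≤ e ^ 60 η`, and they enter through the cube of their length.

Generator. If `z_j` is the only active latent coordinate, normalization removes all scalar factors,
and `v_j` moves by `ηG` in the direction of `∑ ⟪w_k, v_j⟫² w_k`. This is again a quadratic race, now
between the correlations with the neurons. Its winner dominates (`PowerSetup.dominated`), so the
step direction is that neuron's, which is `u_l` up to `4 / α`. The steps taken before `α` is large
are a small fraction of all (`norm_final_sub_le`).

Time scale. With `τ = (log log d) ^ (1/8)` the number `α` tends to infinity, so the error tends to
zero, but the score, of order at most `τ ^ 4`, stays below `log log d`, so `1 - D(u_l)` never falls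
below `e` (`abs_score_le`, `le_realGap`).

Probability. Gaussian anti-concentration gives the largest of about `log d` projections a
polylogarithmic margin. The two modes have the same leader with probability at most about `1 / m_D`.
Each generator column prefers a prescribed neuron with probability at least `1 / (4 m_D)`, and the
extra factor `log log d` in `m_G` makes some column do so (`prod_noMatch_le`). Empirical frequencies
are controlled uniformly in time by Chebyshev's inequality on a grid (`prefix_dev_le`); this
suffices because `η` is polynomially small. A latent vector with a prescribed single active
coordinate has probability at least `e ^ 3`, which yields the final lower bound. -/

theorem activation_of_abs_le {L x : ℝ} (h : |x| ≤ L) : activation L x = x ^ 3 := by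
  simp [activation, h]

theorem hasDerivAt_activation {L x : ℝ} (h : |x| < L) :
    HasDerivAt (activation L) (3 * x ^ 2) x := by
  have h1 : HasDerivAt (fun x : ℝ => x ^ 3) (3 * x ^ 2) x := by
    simpa using hasDerivAt_pow 3 x
  refine h1.congr_of_eventuallyEq ?_
  have : ∀ᶠ y in 𝓝 x, |y| < L := (continuous_abs.tendsto x).eventually (gt_mem_nhds h)
  filter_upwards [this] with y hy using activation_of_abs_le hy.le

theorem hasDerivAt_log_sigmoid (x : ℝ) :
    HasDerivAt (fun y => Real.log (Real.sigmoid y)) (Real.sigmoid (-x)) x := by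
  have h := (Real.hasDerivAt_sigmoid x).log (Real.sigmoid_pos x).ne'
  convert h using 1
  rw [Real.sigmoid_neg, mul_comm, mul_div_assoc, div_self (Real.sigmoid_pos x).ne', mul_one]

theorem hasDerivAt_log_one_sub_sigmoid (x : ℝ) :
    HasDerivAt (fun y => Real.log (1 - Real.sigmoid y)) (-Real.sigmoid x) x := by
  have h0 : (1 : ℝ) - Real.sigmoid x ≠ 0 := (sub_pos.2 (Real.sigmoid_lt_one x)).ne'
  have h := ((Real.hasDerivAt_sigmoid x).const_sub 1).log h0
  convert h using 1
  field_simp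

section Grad
variable {mD mG d : ℕ}

theorem rows_inner {m : ℕ} (A B : Rows m d) : inner ℝ A B = ∑ i, inner ℝ (A i) (B i) :=
  PiLp.inner_apply A B

/-- `1 - D(X)` for the untruncated activation. -/
def realGap (lam : ℝ) (S : State mD mG d) (X : Vec d) : ℝ :=
  Real.sigmoid (-(S.a * ∑ i, inner ℝ (S.W i) X ^ 3 + lam * S.b))

/-- `D(G(z))` for the untruncated activation. -/
def fakeScore (lam : ℝ) (S : State mD mG d) (z : Fin mG → Bool) : ℝ :=
  Real.sigmoid (S.a * ∑ i, inner ℝ (S.W i) (generator S.V z) ^ 3 + lam * S.b)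

def gradA (lam : ℝ) (X : Vec d) (z : Fin mG → Bool) (S : State mD mG d) : ℝ :=
  realGap lam S X * ∑ i, inner ℝ (S.W i) X ^ 3
    - fakeScore lam S z * ∑ i, inner ℝ (S.W i) (generator S.V z) ^ 3

def gradB (lam : ℝ) (X : Vec d) (z : Fin mG → Bool) (S : State mD mG d) : ℝ :=
  lam * (realGap lam S X - fakeScore lam S z)

def gradW (lam : ℝ) (X : Vec d) (z : Fin mG → Bool) (S : State mD mG d) : Rows mD d :=
  WithLp.toLp 2 fun i =>
    (3 * S.a * realGap lam S X * inner ℝ (S.W i) X ^ 2) • X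
      - (3 * S.a * fakeScore lam S z * inner ℝ (S.W i) (generator S.V z) ^ 2) • generator S.V z

/-- The direction in which every active row of the generator moves. -/
def pull (S : State mD mG d) (z : Fin mG → Bool) : Vec d :=
  ∑ i, (inner ℝ (S.W i) (generator S.V z) ^ 2) • S.W i

def gradV (lam : ℝ) (z : Fin mG → Bool) (S : State mD mG d) : Rows mG d :=
  WithLp.toLp 2 fun j =>
    if z j then (-(3 * S.a * fakeScore lam S z)) • pull S z else 0

def gradNorm (lam : ℝ) (X : Vec d) (z : Fin mG → Bool) (S : State mD mG d) : ℝ :=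
  |gradA lam X z S| + |gradB lam X z S| + ‖gradW lam X z S‖

/-- One step of the algorithm for the untruncated activation. -/
def cubicStep (lam etaD etaG : ℝ) (X : Vec d) (z : Fin mG → Bool) (S : State mD mG d) :
    State mD mG d where
  a := S.a + etaD * (gradA lam X z S / gradNorm lam X z S)
  b := S.b + etaD * (gradB lam X z S / gradNorm lam X z S)
  W := S.W + (etaD / gradNorm lam X z S) • gradW lam X z S
  V := S.V - (etaG / ‖gradV lam z S‖) • gradV lam z S

variable {lam : ℝ} {X : Vec d} {z : Fin mG → Bool} {S : State mD mG d}

theorem sum_activation_eq {W : Rows mD d} {Y : Vec d}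
    (h : ∀ i, |inner ℝ (W i) Y| < truncLevel d) :
    ∑ i, activation (truncLevel d) (inner ℝ (W i) Y) = ∑ i, inner ℝ (W i) Y ^ 3 :=
  Finset.sum_congr rfl fun i _ => activation_of_abs_le (h i).le

theorem hasFDerivAt_row_inner (W : Rows mD d) (i : Fin mD) (X : Vec d) :
    HasFDerivAt (fun W : Rows mD d => inner ℝ (W i) X)
      ((innerSL ℝ X).comp (PiLp.proj 2 (fun _ : Fin mD => Vec d) i : Rows mD d →L[ℝ] Vec d)) W := by
  have h : (fun W : Rows mD d => inner ℝ (W i) X)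
      = ((innerSL ℝ X).comp (PiLp.proj 2 (fun _ : Fin mD => Vec d) i : Rows mD d →L[ℝ] Vec d)) := by
    ext W; simp [real_inner_comm]
  rw [h]
  exact ContinuousLinearMap.hasFDerivAt _

theorem hasFDerivAt_score_W (a c : ℝ) (W : Rows mD d) (X : Vec d)
    (h : ∀ i, |inner ℝ (W i) X| < truncLevel d) :
    HasFDerivAt (fun W : Rows mD d =>
        a * ∑ i, activation (truncLevel d) (inner ℝ (W i) X) + c)
      (a • ∑ i, (3 * inner ℝ (W i) X ^ 2) •
        ((innerSL ℝ X).comp (PiLp.proj 2 (fun _ : Fin mD => Vec d) i : Rows mD d →L[ℝ] Vec d)))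
      W := by
  refine HasFDerivAt.add_const _ (HasFDerivAt.const_mul ?_ a)
  exact HasFDerivAt.fun_sum fun i _ => HasDerivAt.comp_hasFDerivAt
    (f := fun W : Rows mD d => inner ℝ (W i) X) W (hasDerivAt_activation (h i))
    (hasFDerivAt_row_inner W i X)

/-- The generator as a continuous linear map of its weights. -/
def generatorCLM (z : Fin mG → Bool) : Rows mG d →L[ℝ] Vec d :=
  ∑ j, (if z j then (1 : ℝ) else 0) • (PiLp.proj 2 (fun _ : Fin mG => Vec d) j)

theorem generatorCLM_apply (z : Fin mG → Bool) (V : Rows mG d) :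
    generatorCLM z V = generator V z := by
  simp only [generatorCLM, generator, binComb, sum_apply, smul_apply, PiLp.proj_apply]

theorem hasFDerivAt_score_V (a c : ℝ) (W : Rows mD d) (V : Rows mG d) (z : Fin mG → Bool)
    (h : ∀ i, |inner ℝ (W i) (generator V z)| < truncLevel d) :
    HasFDerivAt (fun V : Rows mG d =>
        a * ∑ i, activation (truncLevel d) (inner ℝ (W i) (generator V z)) + c)
      (a • ∑ i, (3 * inner ℝ (W i) (generator V z) ^ 2) •
        ((innerSL ℝ (W i)).comp (generatorCLM z)))
      V := by
  refine HasFDerivAt.add_const _ (HasFDerivAt.const_mul ?_ a)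
  refine HasFDerivAt.fun_sum fun i _ => HasDerivAt.comp_hasFDerivAt
    (f := fun V : Rows mG d => inner ℝ (W i) (generator V z)) V (hasDerivAt_activation (h i)) ?_
  have h : (fun V : Rows mG d => inner ℝ (W i) (generator V z))
      = ((innerSL ℝ (W i)).comp (generatorCLM z)) := by
    ext V; simp [generatorCLM_apply]
  rw [h]
  exact ContinuousLinearMap.hasFDerivAt _

theorem realGap_eq (hX : ∀ i, |inner ℝ (S.W i) X| < truncLevel d) :
    realGap lam S X = Real.sigmoid
      (-(S.a * ∑ i, activation (truncLevel d) (inner ℝ (S.W i) X) + lam * S.b)) := by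
  rw [sum_activation_eq hX, realGap]

theorem fakeScore_eq (hG : ∀ i, |inner ℝ (S.W i) (generator S.V z)| < truncLevel d) :
    fakeScore lam S z = Real.sigmoid
      (S.a * ∑ i, activation (truncLevel d) (inner ℝ (S.W i) (generator S.V z)) + lam * S.b) := by
  rw [sum_activation_eq hG, fakeScore]

theorem deriv_loss_a (hX : ∀ i, |inner ℝ (S.W i) X| < truncLevel d)
    (hG : ∀ i, |inner ℝ (S.W i) (generator S.V z)| < truncLevel d) :
    deriv (fun a => loss lam a S.b S.W S.V X z) S.a = gradA lam X z S := by
  have key : ∀ Y : Vec d, HasDerivAt (fun a : ℝ =>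
      a * ∑ i, activation (truncLevel d) (inner ℝ (S.W i) Y) + lam * S.b)
      (∑ i, activation (truncLevel d) (inner ℝ (S.W i) Y)) S.a := fun Y => by
    simpa using ((hasDerivAt_id S.a).mul_const _).add_const (lam * S.b)
  have h1 := (hasDerivAt_log_sigmoid _).comp S.a (key X)
  have h2 := (hasDerivAt_log_one_sub_sigmoid _).comp S.a (key (generator S.V z))
  refine ((h1.add h2).congr_deriv ?_).deriv
  rw [gradA, realGap_eq hX, fakeScore_eq hG, sum_activation_eq hX, sum_activation_eq hG]
  ring

theorem deriv_loss_b (hX : ∀ i, |inner ℝ (S.W i) X| < truncLevel d)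
    (hG : ∀ i, |inner ℝ (S.W i) (generator S.V z)| < truncLevel d) :
    deriv (fun b => loss lam S.a b S.W S.V X z) S.b = gradB lam X z S := by
  have key : ∀ Y : Vec d, HasDerivAt (fun b : ℝ =>
      S.a * ∑ i, activation (truncLevel d) (inner ℝ (S.W i) Y) + lam * b) lam S.b := fun Y => by
    simpa using ((hasDerivAt_id S.b).const_mul lam).const_add
      (S.a * ∑ i, activation (truncLevel d) (inner ℝ (S.W i) Y))
  have h1 := (hasDerivAt_log_sigmoid _).comp S.b (key X)
  have h2 := (hasDerivAt_log_one_sub_sigmoid _).comp S.b (key (generator S.V z))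
  refine ((h1.add h2).congr_deriv ?_).deriv
  rw [gradB, realGap_eq hX, fakeScore_eq hG]
  ring

theorem gradient_loss_W (hX : ∀ i, |inner ℝ (S.W i) X| < truncLevel d)
    (hG : ∀ i, |inner ℝ (S.W i) (generator S.V z)| < truncLevel d) :
    gradient (fun W => loss lam S.a S.b W S.V X z) S.W = gradW lam X z S := by
  have h1 := (hasDerivAt_log_sigmoid _).comp_hasFDerivAt S.W
    (hasFDerivAt_score_W S.a (lam * S.b) S.W X hX)
  have h2 := (hasDerivAt_log_one_sub_sigmoid _).comp_hasFDerivAt S.W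
    (hasFDerivAt_score_W S.a (lam * S.b) S.W (generator S.V z) hG)
  refine HasGradientAt.gradient (hasGradientAt_iff_hasFDerivAt.2 ((h1.add h2).congr_fderiv ?_))
  rw [← realGap_eq hX, ← fakeScore_eq hG]
  ext v
  simp only [add_apply, smul_apply,
    sum_apply, ContinuousLinearMap.comp_apply, innerSL_apply_apply,
    InnerProductSpace.toDual_apply_apply, rows_inner, gradW, PiLp.proj_apply, smul_eq_mul,
    inner_sub_left, real_inner_smul_left, Finset.mul_sum, ← Finset.sum_add_distrib]
  refine Finset.sum_congr rfl fun i _ => ?_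
  ring

theorem gradient_loss_V (hG : ∀ i, |inner ℝ (S.W i) (generator S.V z)| < truncLevel d) :
    gradient (fun V => loss lam S.a S.b S.W V X z) S.V = gradV lam z S := by
  have h2 := (hasDerivAt_log_one_sub_sigmoid _).comp_hasFDerivAt S.V
    (hasFDerivAt_score_V S.a (lam * S.b) S.W S.V z hG)
  refine HasGradientAt.gradient (hasGradientAt_iff_hasFDerivAt.2
    ((h2.const_add (Real.log (discriminator lam S.a S.b S.W X))).congr_fderiv ?_))
  rw [← fakeScore_eq hG]
  ext v
  simp only [smul_apply,
    sum_apply, ContinuousLinearMap.comp_apply, innerSL_apply_apply,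
    InnerProductSpace.toDual_apply_apply, rows_inner, gradV, smul_eq_mul,
    generatorCLM_apply, generator, binComb]
  have : ∀ j, inner ℝ ((if z j = true then -(3 * S.a * fakeScore lam S z) • pull S z else 0 : Vec d))
      (v j) = -(3 * S.a * fakeScore lam S z) *
        ((if z j = true then (1 : ℝ) else 0) * inner ℝ (pull S z) (v j)) := by
    intro j; split_ifs <;> simp [real_inner_smul_left]
  simp only [this]
  simp only [pull, sum_inner, inner_sum, real_inner_smul_left, real_inner_smul_right,
    generator, binComb, Finset.mul_sum]
  rw [Finset.sum_comm]
  refine Finset.sum_congr rfl fun i _ => Finset.sum_congr rfl fun j _ => ?_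
  ring

/-- As long as no activation is truncated, the algorithm follows the untruncated dynamics. -/
theorem nsgdaStep_eq_cubicStep {etaD etaG : ℝ} (hX : ∀ i, |inner ℝ (S.W i) X| < truncLevel d)
    (hG : ∀ i, |inner ℝ (S.W i) (generator S.V z)| < truncLevel d) :
    nsgdaStep lam etaD etaG X z S = cubicStep lam etaD etaG X z S := by
  simp only [nsgdaStep, cubicStep, deriv_loss_a hX hG, deriv_loss_b hX hG, gradient_loss_W hX hG,
    gradient_loss_V hG, gradNorm]

/-- The symmetry `(a, W) ↦ (-a, -W)` of the untruncated dynamics. -/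
def flip (S : State mD mG d) : State mD mG d := { S with a := -S.a, W := -S.W }

theorem flip_flip (S : State mD mG d) : flip (flip S) = S := by simp [flip]

/-- Cubes are odd, so the score, and with it both sigmoid factors, is unchanged when `a` and `W`
change sign together. This allows `a > 0` to be assumed throughout the analysis. -/
theorem cubicStep_flip (etaD etaG : ℝ) :
    cubicStep lam etaD etaG X z (flip S) = flip (cubicStep lam etaD etaG X z S) := by
  have hc : ∀ Y : Vec d, ∑ i, inner ℝ ((-S.W) i) Y ^ 3 = -∑ i, inner ℝ (S.W i) Y ^ 3 := fun Y => by
    rw [← Finset.sum_neg_distrib]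
    exact Finset.sum_congr rfl fun i _ => by rw [PiLp.neg_apply, inner_neg_left]; ring
  have h1 : realGap lam (flip S) X = realGap lam S X := by
    simp only [realGap, flip, hc, neg_mul_neg]
  have h2 : fakeScore lam (flip S) z = fakeScore lam S z := by
    simp only [fakeScore, flip, hc, neg_mul_neg]
  have h3 : gradA lam X z (flip S) = -gradA lam X z S := by
    simp only [gradA, h1, h2]; simp only [flip, hc]; ring
  have h4 : gradB lam X z (flip S) = gradB lam X z S := by simp only [gradB, h1, h2]
  have h5 : gradW lam X z (flip S) = -gradW lam X z S := by
    ext1 i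
    simp only [gradW, h1, h2, PiLp.neg_apply]
    simp only [flip, PiLp.neg_apply, inner_neg_left, neg_sub, even_two, Even.neg_pow]
    rw [mul_neg, neg_mul, neg_mul, neg_mul, neg_mul, neg_smul, neg_smul]
    abel
  have h6 : pull (flip S) z = -pull S z := by
    simp [pull, flip, inner_neg_left, Finset.sum_neg_distrib]
  have h7 : gradV lam z (flip S) = gradV lam z S := by
    simp only [gradV, h2, h6]; simp [flip]
  have h8 : gradNorm lam X z (flip S) = gradNorm lam X z S := by
    simp [gradNorm, h3, h4, h5]
  simp only [cubicStep, h3, h4, h5, h7, h8]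
  simp only [flip, State.mk.injEq, true_and]
  refine ⟨by ring, ?_⟩
  simp only [smul_neg, neg_add, and_true]

end Grad

/-! ### Growth of the leading coordinate of a perturbed quadratic recursion -/

/-- The profile `y ↦ y / (1 + c √y)`, written in `p = √y`, grows with slope at least
`(r² + r) / 2`, where `r = 1 / (1 + c √y)`. -/
theorem profile_growth {c p p' κ : ℝ} (hc : 0 < c) (hp : 0 < p) (hpp : p ≤ p')
    (hκ : p' ≤ (1 + κ) * p) :
    p ^ 2 / (1 + c * p) + (1 - κ) * (((1 / (1 + c * p)) ^ 2 + 1 / (1 + c * p)) / 2)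
      * (p' ^ 2 - p ^ 2) ≤ p' ^ 2 / (1 + c * p') := by
  have hp' : 0 < p' := hp.trans_le hpp
  have hκ0 : 0 ≤ κ := by nlinarith
  have hu : 0 < c * p := mul_pos hc hp
  have hu' : 0 < c * p' := mul_pos hc hp'
  have huu : c * p ≤ c * p' := by gcongr
  have hD : 0 ≤ p' ^ 2 - p ^ 2 := by nlinarith
  have e1 : ((1 / (1 + c * p)) ^ 2 + 1 / (1 + c * p)) / 2 = (1 + c * p / 2) / (1 + c * p) ^ 2 := by
    field_simp
    ring
  have e2 : p' ^ 2 / (1 + c * p') - p ^ 2 / (1 + c * p)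
      = (1 + c * (p * p') / (p + p')) / ((1 + c * p) * (1 + c * p')) * (p' ^ 2 - p ^ 2) := by
    have : p + p' ≠ 0 := by positivity
    field_simp
    ring
  have h3 : c * p / 2 ≤ c * (p * p') / (p + p') := by
    rw [div_le_div_iff₀ (by norm_num) (by positivity)]
    nlinarith [mul_pos hc hp]
  have h4 : (1 - κ) * ((1 + c * p / 2) / (1 + c * p) ^ 2)
      ≤ (1 + c * (p * p') / (p + p')) / ((1 + c * p) * (1 + c * p')) := by
    rw [← mul_div_assoc, div_le_div_iff₀ (by positivity) (by positivity)]
    have h5 : (1 - κ) * (1 + c * p') ≤ 1 + c * p := by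
      have : c * p' ≤ (1 + κ) * (c * p) := by nlinarith
      rcases le_or_gt 1 κ with h | h
      · nlinarith
      · nlinarith [mul_le_mul_of_nonneg_left this (sub_pos.2 h).le, sq_nonneg κ,
          mul_nonneg (mul_nonneg hκ0 hκ0) hu.le]
    calc (1 - κ) * (1 + c * p / 2) * ((1 + c * p) * (1 + c * p'))
        = (1 + c * p / 2) * (1 + c * p) * ((1 - κ) * (1 + c * p')) := by ring
      _ ≤ (1 + c * p / 2) * (1 + c * p) * (1 + c * p) := by gcongr
      _ = (1 + c * p / 2) * (1 + c * p) ^ 2 := by ring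
      _ ≤ (1 + c * (p * p') / (p + p')) * (1 + c * p) ^ 2 := by gcongr
  rw [e1]
  have := mul_le_mul_of_nonneg_right h4 hD
  linarith [e2]

/-- The profile bounding the competitors of the leading coordinate. -/
def profile (g κ y₀ y : ℝ) : ℝ := y / (1 + g / 2 / √y₀ * √y) + 20 * κ * y

/-- A competitor with ratio `r` to the leader has slope `r²` as a function of the leader. The exact
solution `y / (1 + c y)` has no slack. With `√y` in place of `y` the slope is `(r² + r) / 2`, and
the surplus `r (1 - r) / 2`, together with the linear term `20 κ y`, absorbs the errors. -/
theorem profile_step {g κ y₀ y y' r : ℝ} (hy₀ : 0 < y₀) (hy : y₀ ≤ y) (hyy : y ≤ y')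
    (hκ0 : 0 < κ) (hg0 : 0 < g) (hg1 : g ≤ 1) (hκ : κ ≤ g / 2000)
    (hstep : y' ≤ (1 + κ) * y) (hr0 : 0 ≤ r) (hr : r * y ≤ profile g κ y₀ y + 4 * κ * y) :
    profile g κ y₀ y + r ^ 2 * (y' - y) ≤ profile g κ y₀ y' := by
  have hypos : 0 < y := hy₀.trans_le hy
  have hy'pos : 0 < y' := hypos.trans_le hyy
  set p := √y with hp
  set p' := √y' with hp'
  set c := g / 2 / √y₀ with hc
  have hs0 : 0 < √y₀ := Real.sqrt_pos.2 hy₀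
  have hcpos : 0 < c := by positivity
  have hppos : 0 < p := Real.sqrt_pos.2 hypos
  have hpp : p ≤ p' := Real.sqrt_le_sqrt hyy
  have hp2 : p ^ 2 = y := Real.sq_sqrt hypos.le
  have hp2' : p' ^ 2 = y' := Real.sq_sqrt hy'pos.le
  have hkp : p' ≤ (1 + κ) * p := by
    refine (pow_le_pow_iff_left₀ (Real.sqrt_nonneg _) (by positivity) two_ne_zero).1 ?_
    rw [mul_pow, hp2, hp2']
    nlinarith [mul_pos hκ0 hypos, mul_pos (mul_pos hκ0 hκ0) hypos]
  have hG := profile_growth hcpos hppos hpp hkp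
  rw [hp2, hp2'] at hG
  set R := 1 / (1 + c * p) with hR
  have hcp : g / 2 ≤ c * p := by
    have : √y₀ ≤ p := Real.sqrt_le_sqrt hy
    rw [hc, div_mul_eq_mul_div, le_div_iff₀ hs0]
    gcongr
  have hR0 : 0 < R := by positivity
  have hR1 : R ≤ 1 - g / 3 := by
    rw [hR, div_le_iff₀ (by positivity)]
    nlinarith
  have hr' : r ≤ R + 24 * κ := by
    have : profile g κ y₀ y = R * y + 20 * κ * y := by
      simp only [profile, ← hc, ← hp, hR]; ring
    rw [this] at hr
    exact le_of_mul_le_mul_right (by linarith) hypos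
  have key : r ^ 2 ≤ (1 - κ) * ((R ^ 2 + R) / 2) + 20 * κ := by
    have h1 : r ^ 2 ≤ (R + 24 * κ) ^ 2 := by gcongr
    refine h1.trans ?_
    have hk : κ ≤ 1 / 2000 := by linarith
    have hR11 : R ≤ 1 := by linarith
    have h3 : κ * ((R ^ 2 + R) / 2) ≤ κ := by
      have : (R ^ 2 + R) / 2 ≤ 1 := by nlinarith
      exact mul_le_of_le_one_right hκ0.le this
    have h5 : 576 * (κ * κ) ≤ κ := by nlinarith
    have e : (R + 24 * κ) ^ 2 = R ^ 2 + 48 * (κ * R) + 576 * (κ * κ) := by ring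
    have e' : (1 - κ) * ((R ^ 2 + R) / 2) + 20 * κ
      = R ^ 2 + R * (1 - R) / 2 - κ * ((R ^ 2 + R) / 2) + 20 * κ := by ring
    rw [e, e']
    -- For small `R` the error `48 κ R` is at most `12 κ` and is paid by `20 κ`. Otherwise the
    -- surplus `R (1 - R) / 2 ≥ g / 24` pays for it, because `48 κ ≤ 48 g / 2000`.
    rcases le_or_gt R (1 / 4) with h | h
    · have h2 : 0 ≤ R * (1 - R) / 2 := by
        have := mul_nonneg hR0.le (sub_nonneg.2 hR11); linarith
      have h4 : κ * R ≤ κ * (1 / 4) := by gcongr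
      linarith
    · have h2 : g / 24 ≤ R * (1 - R) / 2 := by
        have : 1 / 4 * (g / 3) ≤ R * (1 - R) := by gcongr; linarith
        linarith
      have h4 : κ * R ≤ κ * 1 := by gcongr
      linarith
  have hd : 0 ≤ y' - y := by linarith
  have := mul_le_mul_of_nonneg_right key hd
  simp only [profile, ← hc, ← hp, ← hp']
  nlinarith

theorem profile_le_two_mul {g κ y₀ y : ℝ} (hg0 : 0 < g) (hκ0 : 0 < κ) (hκ : κ ≤ 1 / 2000)
    (hy : 0 ≤ y) : profile g κ y₀ y ≤ 2 * y := by
  have h : y / (1 + g / 2 / √y₀ * √y) ≤ y := div_le_self hy (by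
    have : 0 ≤ g / 2 / √y₀ * √y := by positivity
    linarith)
  simp only [profile]
  nlinarith

/-- A leading coordinate of a perturbed quadratic recursion stays in the lead. -/
theorem race {ι : Type*} {T : ℕ} {x A : ℕ → ι → ℝ} {act : ℕ → Prop} [DecidablePred act]
    {c : ℕ → ℝ} {i : ι} {η L M g κ κ₁ y₀ : ℝ}
    (hy₀ : 0 < y₀) (hη : 0 < η) (hL : 1 ≤ L) (hM : 1 ≤ M) (hg0 : 0 < g) (hg1 : g ≤ 1)
    (hκ₁0 : 0 < κ₁) (hκ0 : 0 ≤ κ)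
    (hκ : κ * (16 * L ^ 2 * M) ≤ κ₁) (hκ₁ : κ₁ ≤ g / 2000) (hηy : 2 * η ≤ κ₁ * y₀)
    (hA0 : ∀ k, A 0 k = 0) (hx0 : x 0 i = y₀) (hxL : ∀ k, |x 0 k| ≤ L * y₀)
    (hgap : ∀ k, k ≠ i → x 0 k ≤ (1 - g) * y₀)
    (hA : ∀ t, t < T → act t → ∀ k, A (t + 1) k = A t k + c t * x t k ^ 2)
    (hA' : ∀ t, t < T → ¬ act t → ∀ k, A (t + 1) k = A t k)
    (hc : ∀ t, t < T → act t → 0 ≤ c t)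
    (hlow : ∀ t, t < T → act t → ∀ Z, (∀ k, x t k ^ 2 ≤ Z) → η / 2 ≤ c t * (M * Z))
    (hup : ∀ t, t < T → act t → ∀ k, c t * x t k ^ 2 ≤ 2 * η)
    (herr : ∀ t, t ≤ T → ∀ k, |x t k - x 0 k - A t k| ≤ κ * (y₀ + η * Nat.count act t)) :
    ∀ t, t ≤ T → (η * Nat.count act t ≤ 16 * L ^ 2 * M * A t i) ∧
      (∀ k, 0 ≤ A t k) ∧
      (∀ k, k ≠ i → x 0 k + A t k ≤ profile g κ₁ y₀ (y₀ + A t i)) ∧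
      (∀ k, |x t k - x 0 k - A t k| ≤ κ₁ * (y₀ + A t i)) := by
  intro t
  induction t with
  | zero =>
    intro hT
    refine ⟨by simp [hA0], fun k => (hA0 k).ge, fun k hk => ?_, fun k => ?_⟩
    · rw [hA0, hA0, add_zero, add_zero]
      refine (hgap k hk).trans ?_
      have hs0 : 0 < √y₀ := Real.sqrt_pos.2 hy₀
      have : (1 - g) * y₀ ≤ y₀ / (1 + g / 2 / √y₀ * √y₀) := by
        rw [div_mul_cancel₀ _ hs0.ne', le_div_iff₀ (by positivity)]
        nlinarith [mul_pos hg0 hy₀]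
      simp only [profile]
      nlinarith [mul_pos hκ₁0 hy₀]
    · refine (herr 0 hT k).trans ?_
      have hLM : 1 ≤ 16 * L ^ 2 * M := by nlinarith [mul_le_mul hL hL (by norm_num) (by linarith)]
      simp only [hA0, Nat.count_zero, Nat.cast_zero, mul_zero, add_zero]
      gcongr
      nlinarith
  | succ t ih =>
    intro hT
    have htT : t < T := hT
    obtain ⟨h1, h2, h3, h4⟩ := ih htT.le
    have hL2 : 1 ≤ L ^ 2 := one_le_pow₀ hL
    have hLM : 1 ≤ 16 * L ^ 2 * M := by nlinarith
    have hLM0 : 0 < 16 * L ^ 2 * M := by linarith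
    set y := y₀ + A t i with hy
    have hyy : y₀ ≤ y := by have := h2 i; linarith
    have hypos : 0 < y := hy₀.trans_le hyy
    have hk1 : κ₁ ≤ 1 / 2000 := by linarith
    -- the error bound follows from the count bound
    have herr' : ∀ s, s ≤ T → η * Nat.count act s ≤ 16 * L ^ 2 * M * A s i →
        ∀ k, |x s k - x 0 k - A s k| ≤ κ₁ * (y₀ + A s i) := by
      intro s hs hcnt k
      refine (herr s hs k).trans ?_
      calc κ * (y₀ + η * Nat.count act s)
          ≤ κ * (16 * L ^ 2 * M * (y₀ + A s i)) := by
            gcongr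
            have := mul_le_mul_of_nonneg_right hLM hy₀.le
            linarith
        _ = κ * (16 * L ^ 2 * M) * (y₀ + A s i) := by ring
        _ ≤ κ₁ * (y₀ + A s i) := by
            have : 0 ≤ y₀ + A s i := by
              have : 0 ≤ 16 * L ^ 2 * M * A s i := le_trans (by positivity) hcnt
              have := nonneg_of_mul_nonneg_right this hLM0
              linarith
            gcongr
    by_cases hact : act t
    · have hAk := hA t htT hact
      have hc0 := hc t htT hact
      have hX : (1 - κ₁) * y ≤ x t i := by
        have := (abs_le.1 (h4 i)).1
        rw [hx0] at this
        nlinarith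
      have hXpos : 0 < x t i := lt_of_lt_of_le (mul_pos (by linarith) hypos) hX
      -- Competitors stay below about `1.5 y` by the profile and above `-2 L y` because accumulated
      -- increments are nonnegative, so `(2 L y)²` is an admissible `Z` in `hlow`.
      have hsq : ∀ k, x t k ^ 2 ≤ (2 * L * y) ^ 2 := by
        intro k
        rw [← sq_abs]
        gcongr
        by_cases hk : k = i
        · subst hk
          rw [abs_of_pos hXpos]
          have := (abs_le.1 (h4 k)).2
          rw [hx0] at this
          nlinarith
        · rw [abs_le]
          have h5 := abs_le.1 (h4 k)
          have h6 := h3 k hk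
          have h7 := profile_le_two_mul (y₀ := y₀) hg0 hκ₁0 hk1 hypos.le
          have h8 := (abs_le.1 (hxL k)).1
          have h9 := h2 k
          have hp : profile g κ₁ y₀ y ≤ 1.5 * y := by
            have h : y / (1 + g / 2 / √y₀ * √y) ≤ y := div_le_self hypos.le (by
              have : 0 ≤ g / 2 / √y₀ * √y := by positivity
              linarith)
            simp only [profile]
            nlinarith
          constructor
          · have a1 := mul_le_mul_of_nonneg_left hyy (by linarith : (0:ℝ) ≤ L)
            have a2 : κ₁ * y ≤ L * y := by gcongr; linarith
            linarith
          · have a1 : 1 * y ≤ L * y := by gcongr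
            have a2 : κ₁ * y ≤ 1 / 2000 * y := by gcongr
            linarith
      have hstepi : A (t + 1) i = A t i + c t * x t i ^ 2 := hAk i
      -- From `hlow` with `Z = (2 L y)²` and `y² ≤ 2 x_i²`: each active step gives the leader at
      -- least `η / (16 L² M)`. So errors measured by the number of active steps become errors
      -- relative to the leader.
      have hinc : η ≤ 16 * L ^ 2 * M * (c t * x t i ^ 2) := by
        have h5 := hlow t htT hact _ hsq
        have h6 : y ^ 2 ≤ 2 * x t i ^ 2 := by
          have : ((1 - κ₁) * y) ^ 2 ≤ x t i ^ 2 := by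
            have : 0 ≤ (1 - κ₁) * y := mul_nonneg (by linarith) hypos.le
            gcongr
          have h8 : 1 / 2 ≤ (1 - κ₁) ^ 2 := by nlinarith
          have h9 := mul_le_mul_of_nonneg_right h8 (sq_nonneg y)
          rw [mul_pow] at this
          linarith
        have h7 : c t * (M * (2 * L * y) ^ 2) ≤ c t * (M * (8 * L ^ 2 * x t i ^ 2)) := by
          have : (2 * L * y) ^ 2 ≤ 8 * L ^ 2 * x t i ^ 2 := by
            have := mul_le_mul_of_nonneg_left h6 (sq_nonneg L)
            linarith [mul_pow (2 * L) y 2, mul_pow 2 L 2]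
          gcongr
        linarith
      have hcnt' : η * Nat.count act (t + 1) ≤ 16 * L ^ 2 * M * A (t + 1) i := by
        rw [Nat.count_succ, if_pos hact, hstepi]
        push_cast
        linarith
      refine ⟨hcnt', fun k => ?_, fun k hk => ?_, herr' _ hT hcnt'⟩
      · rw [hAk]
        have := h2 k
        positivity
      · rw [hAk, hstepi, ← add_assoc y₀, ← hy]
        set D := c t * x t i ^ 2 with hD
        have hD0 : 0 ≤ D := by positivity
        have hD2 : D ≤ κ₁ * y := by
          have := hup t htT hact i
          have : κ₁ * y₀ ≤ κ₁ * y := by gcongr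
          linarith
        have hstep : y + D ≤ (1 + κ₁) * y := by linarith
        rcases le_or_gt 0 (x t k) with hxk | hxk
        · set r := x t k / x t i with hr
          have hr0 : 0 ≤ r := div_nonneg hxk hXpos.le
          have hrX : c t * x t k ^ 2 = r ^ 2 * D := by
            rw [hD, hr, div_pow]; field_simp
          have hxk' : x t k ≤ profile g κ₁ y₀ y + κ₁ * y := by
            have h5 := abs_le.1 (h4 k)
            have h6 := h3 k hk
            linarith
          have hry : r * y ≤ profile g κ₁ y₀ y + 4 * κ₁ * y := by
            have h5 : r * x t i = x t k := div_mul_cancel₀ _ hXpos.ne'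
            have h6 : r * ((1 - κ₁) * y) ≤ profile g κ₁ y₀ y + κ₁ * y := by
              refine le_trans ?_ hxk'
              rw [← h5]
              gcongr
            have h7 := profile_le_two_mul (y₀ := y₀) hg0 hκ₁0 hk1 hypos.le
            have h8 : r ≤ 2.5 := by
              by_contra hcon
              push Not at hcon
              have : 2.5 * ((1 - κ₁) * y) ≤ r * ((1 - κ₁) * y) := by
                have : 0 ≤ (1 - κ₁) * y := mul_nonneg (by linarith) hypos.le
                gcongr
              have a2 : κ₁ * y ≤ 1 / 2000 * y := by gcongr
              linarith
            have a3 : r * (κ₁ * y) ≤ 2.5 * (κ₁ * y) := by gcongr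
            have a4 : 0 < κ₁ * y := by positivity
            linarith
          have := profile_step hy₀ hyy (by linarith : y ≤ y + D) hκ₁0 hg0 hg1 hκ₁ hstep hr0 hry
          rw [add_sub_cancel_left, ← hrX] at this
          have := h3 k hk
          linarith
        -- If `x t k < 0`, the accumulated value is below `κ₁ y`, and one increment of at most `2 η
        -- ≤ κ₁ y₀` leaves it under the linear term of the profile.
        · have h5 := (abs_le.1 (h4 k)).1
          have h6 := hup t htT hact k
          have h7 : κ₁ * y₀ ≤ κ₁ * y := by gcongr
          have h8 : 0 ≤ (y + D) / (1 + g / 2 / √y₀ * √(y + D)) := by positivity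
          have h9 : 0 ≤ κ₁ * D := mul_nonneg hκ₁0.le hD0
          have h10 : 0 < κ₁ * y := by positivity
          simp only [profile]
          linarith
    · have hAk := hA' t htT hact
      have hcnt' : η * Nat.count act (t + 1) ≤ 16 * L ^ 2 * M * A (t + 1) i := by
        rw [Nat.count_succ, if_neg hact, hAk]
        simpa using h1
      refine ⟨hcnt', fun k => ?_, fun k hk => ?_, herr' _ hT hcnt'⟩
      · rw [hAk]; exact h2 k
      · rw [hAk, hAk]; exact h3 k hk

/-! ### A priori bounds for one step -/

section OneStep
variable {mD mG d : ℕ}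

theorem norm_smul_rows_le {m : ℕ} (c : Fin m → ℝ) (Y : Vec d) :
    ‖(WithLp.toLp 2 fun i => c i • Y : Rows m d)‖ ≤ (∑ i, |c i|) * ‖Y‖ := by
  rw [PiLp.norm_eq_of_L2, Finset.sum_mul]
  refine Real.sqrt_le_iff.2 ⟨by positivity, ?_⟩
  simp only [norm_smul, Real.norm_eq_abs]
  exact Finset.sum_sq_le_sq_sum_of_nonneg fun i _ => by positivity

theorem norm_row_le {m : ℕ} (A : Rows m d) (i : Fin m) : ‖A i‖ ≤ ‖A‖ :=
  PiLp.norm_apply_le A i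

theorem gradNorm_nonneg {lam : ℝ} {X : Vec d} {z : Fin mG → Bool} {S : State mD mG d} :
    0 ≤ gradNorm lam X z S := by
  unfold gradNorm; positivity

/-- The normalizer is exactly the sum of the three norms, so all discriminator parameters together
travel at most `etaD` per step, however large or small the gradients are. -/
theorem cubicStep_displacement {lam etaD etaG : ℝ} {X : Vec d} {z : Fin mG → Bool}
    {S : State mD mG d} (h : 0 ≤ etaD) :
    |(cubicStep lam etaD etaG X z S).a - S.a| + |(cubicStep lam etaD etaG X z S).b - S.b|
      + ‖(cubicStep lam etaD etaG X z S).W - S.W‖ ≤ etaD := by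
  have hN := gradNorm_nonneg (lam := lam) (X := X) (z := z) (S := S)
  simp only [cubicStep, add_sub_cancel_left, abs_mul, abs_div, abs_of_nonneg h, abs_of_nonneg hN,
    norm_smul, norm_div, Real.norm_eq_abs]
  -- If the normalizer vanishes, division by zero gives zero and nothing moves.
  rcases hN.eq_or_lt with h0 | h0
  · rw [← h0]; simpa
  · refine le_of_eq ?_
    have : gradNorm lam X z S
        = |gradA lam X z S| + |gradB lam X z S| + ‖gradW lam X z S‖ := rfl
    field_simp
    rw [this]

theorem cubicStep_displacement_V {lam etaD etaG : ℝ} {X : Vec d} {z : Fin mG → Bool}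
    {S : State mD mG d} (h : 0 ≤ etaG) :
    ‖(cubicStep lam etaD etaG X z S).V - S.V‖ ≤ etaG := by
  simp only [cubicStep, sub_sub_cancel_left, norm_neg, norm_smul, norm_div, Real.norm_eq_abs,
    abs_of_nonneg h, abs_norm]
  rcases (norm_nonneg (gradV lam z S)).eq_or_lt with h0 | h0
  · rw [← h0]; simpa
  · rw [div_mul_cancel₀ _ h0.ne']

theorem cubicStep_V_of_not {lam etaD etaG : ℝ} {X : Vec d} {z : Fin mG → Bool}
    {S : State mD mG d} {j : Fin mG} (h : z j = false) :
    (cubicStep lam etaD etaG X z S).V j = S.V j := by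
  simp [cubicStep, gradV, h]

/-- The trajectory of the untruncated dynamics. -/
def cubicRun (lam etaD etaG : ℝ) (X : ℕ → Vec d) (z : ℕ → Fin mG → Bool) (S₀ : State mD mG d) :
    ℕ → State mD mG d
  | 0 => S₀
  | t + 1 => cubicStep lam etaD etaG (X t) (z t) (cubicRun lam etaD etaG X z S₀ t)

theorem cubicRun_flip (lam etaD etaG : ℝ) (X : ℕ → Vec d) (z : ℕ → Fin mG → Bool)
    (S₀ : State mD mG d) (t : ℕ) :
    cubicRun lam etaD etaG X z (flip S₀) t = flip (cubicRun lam etaD etaG X z S₀ t) := by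
  induction t with
  | zero => rfl
  | succ t ih => rw [cubicRun, ih, cubicStep_flip, cubicRun]

theorem cubicRun_displacement {lam etaD etaG : ℝ} {X : ℕ → Vec d} {z : ℕ → Fin mG → Bool}
    {S₀ : State mD mG d} (h : 0 ≤ etaD) (t : ℕ) :
    |(cubicRun lam etaD etaG X z S₀ t).a - S₀.a| + |(cubicRun lam etaD etaG X z S₀ t).b - S₀.b|
      + ‖(cubicRun lam etaD etaG X z S₀ t).W - S₀.W‖ ≤ etaD * t := by
  induction t with
  | zero => simp [cubicRun]
  | succ t ih =>
    have := cubicStep_displacement (lam := lam) (etaG := etaG) (X := X t) (z := z t)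
      (S := cubicRun lam etaD etaG X z S₀ t) h
    rw [cubicRun]
    set S := cubicRun lam etaD etaG X z S₀ t
    set S' := cubicStep lam etaD etaG (X t) (z t) S
    have h1 := abs_sub_le S'.a S.a S₀.a
    have h2 := abs_sub_le S'.b S.b S₀.b
    have h3 := norm_sub_le_norm_sub_add_norm_sub S'.W S.W S₀.W
    push_cast
    linarith

theorem cubicRun_displacement_V {lam etaD etaG : ℝ} {X : ℕ → Vec d} {z : ℕ → Fin mG → Bool}
    {S₀ : State mD mG d} (h : 0 ≤ etaG) (t : ℕ) :
    ‖(cubicRun lam etaD etaG X z S₀ t).V - S₀.V‖ ≤ etaG * t := by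
  induction t with
  | zero => simp [cubicRun]
  | succ t ih =>
    have := cubicStep_displacement_V (lam := lam) (etaD := etaD) (X := X t) (z := z t)
      (S := cubicRun lam etaD etaG X z S₀ t) h
    rw [cubicRun]
    have h3 := norm_sub_le_norm_sub_add_norm_sub
      (cubicStep lam etaD etaG (X t) (z t) (cubicRun lam etaD etaG X z S₀ t)).V
      (cubicRun lam etaD etaG X z S₀ t).V S₀.V
    push_cast
    linarith

theorem abs_sum_cube_le {m : ℕ} (f : Fin m → ℝ) : |∑ i, f i ^ 3| ≤ ∑ i, |f i| ^ 3 := by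
  refine (Finset.abs_sum_le_sum_abs _ _).trans ?_
  simp only [abs_pow, le_refl]

theorem norm_generator_le (V : Rows mG d) (z : Fin mG → Bool) :
    ‖generator V z‖ ≤ ∑ j, ‖V j‖ := by
  unfold generator binComb
  refine (norm_sum_le _ _).trans (Finset.sum_le_sum fun j _ => ?_)
  split_ifs <;> simp

/-- The absence of truncation has to be checked only along the untruncated trajectory, so the entire
analysis can be done for `cubicRun`. -/
theorem nsgda_eq_cubicRun {lam etaD etaG : ℝ} {u : Fin 2 → Vec d} {S₀ : State mD mG d}
    {ω : ℕ → (Fin 2 → Bool) × (Fin mG → Bool)} {T : ℕ}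
    (h : ∀ t, t < T → ∀ i,
      |inner ℝ ((cubicRun lam etaD etaG (fun t => binComb u (ω t).1) (fun t => (ω t).2) S₀ t).W i)
        (binComb u (ω t).1)| < truncLevel d ∧
      |inner ℝ ((cubicRun lam etaD etaG (fun t => binComb u (ω t).1) (fun t => (ω t).2) S₀ t).W i)
        (generator (cubicRun lam etaD etaG (fun t => binComb u (ω t).1) (fun t => (ω t).2) S₀ t).V
          (ω t).2)| < truncLevel d) :
    ∀ t, t ≤ T → nsgda lam etaD etaG u S₀ ω t
      = cubicRun lam etaD etaG (fun t => binComb u (ω t).1) (fun t => (ω t).2) S₀ t := by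
  intro t
  induction t with
  | zero => intro; rfl
  | succ t ih =>
    intro ht
    rw [nsgda, ih (Nat.le_of_succ_le ht), cubicRun]
    exact nsgdaStep_eq_cubicStep (fun i => (h t ht i).1) (fun i => (h t ht i).2)

/-! ### Size of the gradients -/

variable {lam : ℝ} {X : Vec d} {z : Fin mG → Bool} {S : State mD mG d}

theorem realGap_pos : 0 < realGap lam S X := Real.sigmoid_pos _
theorem realGap_le_one : realGap lam S X ≤ 1 := Real.sigmoid_le_one _
theorem fakeScore_pos : 0 < fakeScore lam S z := Real.sigmoid_pos _
theorem fakeScore_le_one : fakeScore lam S z ≤ 1 := Real.sigmoid_le_one _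

/-- The size of the contribution of the generated sample to the gradient in `W`. -/
def fakeSize (S : State mD mG d) (z : Fin mG → Bool) : ℝ :=
  (∑ i, inner ℝ (S.W i) (generator S.V z) ^ 2) * ‖generator S.V z‖

theorem fakeSize_nonneg : 0 ≤ fakeSize S z := by unfold fakeSize; positivity

/-- The part of the gradient in `W` due to the generated sample. -/
def fakeGradW (lam : ℝ) (z : Fin mG → Bool) (S : State mD mG d) : Rows mD d :=
  WithLp.toLp 2 fun i =>
    (3 * S.a * fakeScore lam S z * inner ℝ (S.W i) (generator S.V z) ^ 2) • generator S.V z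

theorem gradW_eq : gradW lam X z S = (WithLp.toLp 2 fun i =>
    (3 * S.a * realGap lam S X * inner ℝ (S.W i) X ^ 2) • X) - fakeGradW lam z S := rfl

theorem norm_fakeGradW_le (ha : 0 ≤ S.a) : ‖fakeGradW lam z S‖ ≤ 3 * S.a * fakeSize S z := by
  refine (norm_smul_rows_le _ _).trans ?_
  rw [fakeSize, ← mul_assoc, Finset.mul_sum]
  gcongr with i
  have h1 := fakeScore_pos (lam := lam) (S := S) (z := z)
  rw [abs_of_nonneg (by positivity)]
  have := fakeScore_le_one (lam := lam) (S := S) (z := z)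
  have h3 : 3 * S.a * fakeScore lam S z ≤ 3 * S.a * 1 := by gcongr
  rw [mul_one] at h3
  gcongr

theorem norm_gradW_le (ha : 0 ≤ S.a) (hX : ‖X‖ = 1) :
    ‖gradW lam X z S‖ ≤ 3 * S.a * realGap lam S X * ∑ i, inner ℝ (S.W i) X ^ 2
      + 3 * S.a * fakeSize S z := by
  rw [gradW_eq]
  refine (norm_sub_le _ _).trans (add_le_add ?_ (norm_fakeGradW_le ha))
  refine (norm_smul_rows_le _ _).trans ?_
  rw [hX, mul_one, Finset.mul_sum]
  gcongr with i
  have h1 := realGap_pos (lam := lam) (S := S) (X := X)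
  rw [abs_of_nonneg (by positivity)]

theorem le_norm_gradW (ha : 0 ≤ S.a) (hX : ‖X‖ = 1) (k : Fin mD) :
    3 * S.a * realGap lam S X * inner ℝ (S.W k) X ^ 2 - 3 * S.a * fakeSize S z
      ≤ ‖gradW lam X z S‖ := by
  have h1 := realGap_pos (lam := lam) (S := S) (X := X)
  have h2 := norm_row_le (WithLp.toLp 2 fun i =>
    (3 * S.a * realGap lam S X * inner ℝ (S.W i) X ^ 2) • X : Rows mD d) k
  have h3 := norm_sub_norm_le (WithLp.toLp 2 fun i =>
    (3 * S.a * realGap lam S X * inner ℝ (S.W i) X ^ 2) • X : Rows mD d) (fakeGradW lam z S)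
  rw [← gradW_eq] at h3
  have h4 := norm_fakeGradW_le (lam := lam) (z := z) ha
  rw [PiLp.toLp_apply, norm_smul, hX, mul_one, Real.norm_eq_abs,
    abs_of_nonneg (by positivity)] at h2
  linarith

theorem le_gradNorm (ha : 0 ≤ S.a) (hX : ‖X‖ = 1) (k : Fin mD) :
    3 * S.a * realGap lam S X * inner ℝ (S.W k) X ^ 2 - 3 * S.a * fakeSize S z
      ≤ gradNorm lam X z S := by
  refine (le_norm_gradW (lam := lam) (z := z) ha hX k).trans ?_
  unfold gradNorm
  linarith [abs_nonneg (gradA lam X z S), abs_nonneg (gradB lam X z S)]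

theorem sum_abs_cube_fake_le {ω : ℝ} (hW : ∀ k, ‖S.W k‖ ≤ ω) :
    ∑ i, |inner ℝ (S.W i) (generator S.V z)| ^ 3 ≤ ω * fakeSize S z := by
  rw [fakeSize, mul_left_comm, Finset.sum_mul]
  refine Finset.sum_le_sum fun i _ => ?_
  have h := abs_real_inner_le_norm (S.W i) (generator S.V z)
  rw [pow_succ, sq_abs]
  refine mul_le_mul_of_nonneg_left (h.trans ?_) (sq_nonneg _)
  gcongr
  exact hW i

theorem abs_gradA_sub_le {ω : ℝ} (hW : ∀ k, ‖S.W k‖ ≤ ω) :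
    |gradA lam X z S - realGap lam S X * ∑ i, inner ℝ (S.W i) X ^ 3| ≤ ω * fakeSize S z := by
  rw [gradA, sub_sub_cancel_left, abs_neg, abs_mul, abs_of_pos fakeScore_pos]
  refine (mul_le_of_le_one_left (abs_nonneg _) fakeScore_le_one).trans ?_
  exact (abs_sum_cube_le _).trans (sum_abs_cube_fake_le hW)

theorem fakeSize_le {ω : ℝ} (hW : ∀ k, ‖S.W k‖ ≤ ω) :
    fakeSize S z ≤ mD * ω ^ 2 * ‖generator S.V z‖ ^ 3 := by
  have : ∑ i, inner ℝ (S.W i) (generator S.V z) ^ 2 ≤ mD * (ω ^ 2 * ‖generator S.V z‖ ^ 2) := by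
    have h : ∀ i ∈ Finset.univ, inner ℝ (S.W i) (generator S.V z) ^ 2
        ≤ ω ^ 2 * ‖generator S.V z‖ ^ 2 := fun i _ => by
      rw [← sq_abs, ← mul_pow]
      gcongr
      refine (abs_real_inner_le_norm _ _).trans ?_
      gcongr
      exact hW i
    simpa using Finset.sum_le_card_nsmul _ _ _ h
  rw [fakeSize]
  calc _ ≤ mD * (ω ^ 2 * ‖generator S.V z‖ ^ 2) * ‖generator S.V z‖ := by gcongr
    _ = _ := by ring

theorem abs_sigmoid_sub_le (x y : ℝ) : |Real.sigmoid x - Real.sigmoid y| ≤ |x - y| := by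
  have := Convex.norm_image_sub_le_of_norm_deriv_le (f := Real.sigmoid) (s := Set.univ) (C := 1)
    (x := y) (y := x) (fun x _ => differentiableAt_sigmoid) (fun x _ => by
      rw [Real.deriv_sigmoid, Real.norm_eq_abs, abs_of_nonneg]
      · nlinarith [Real.sigmoid_pos x, Real.sigmoid_lt_one x]
      · exact mul_nonneg (Real.sigmoid_nonneg x) (sub_nonneg.2 (Real.sigmoid_le_one x)))
    convex_univ (Set.mem_univ _) (Set.mem_univ _)
  simpa using this

theorem abs_gradB_le (hlam : 0 ≤ lam) : |gradB lam X z S| ≤ lam := by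
  rw [gradB, abs_mul, abs_of_nonneg hlam]
  refine mul_le_of_le_one_right hlam (abs_le.2 ⟨?_, ?_⟩) <;>
  linarith [realGap_pos (lam := lam) (S := S) (X := X), fakeScore_pos (lam := lam) (S := S) (z := z),
    realGap_le_one (lam := lam) (S := S) (X := X), fakeScore_le_one (lam := lam) (S := S) (z := z)]

/-- The two sigmoids agree at score zero, so the gradient in `b` is small with the scores. The crude
bound `lam` would not do in the early phase, where the gradient in `W` is of order only `θ ^ 20`
times polylogarithmic factors. -/
theorem abs_gradB_le' {ω : ℝ} (hlam : 0 ≤ lam) (ha : 0 ≤ S.a) (hW : ∀ k, ‖S.W k‖ ≤ ω) :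
    |gradB lam X z S| ≤ lam * (S.a * (∑ i, |inner ℝ (S.W i) X| ^ 3 + ω * fakeSize S z)
      + 2 * lam * |S.b|) := by
  rw [gradB, abs_mul, abs_of_nonneg hlam]
  refine mul_le_mul_of_nonneg_left ((abs_sigmoid_sub_le _ _).trans ?_) hlam
  have h1 := abs_sum_cube_le fun i => inner ℝ (S.W i) X
  have h2 := (abs_sum_cube_le fun i => inner ℝ (S.W i) (generator S.V z)).trans
    (sum_abs_cube_fake_le hW)
  set s1 := ∑ i, inner ℝ (S.W i) X ^ 3
  set s2 := ∑ i, inner ℝ (S.W i) (generator S.V z) ^ 3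
  calc |-(S.a * s1 + lam * S.b) - (S.a * s2 + lam * S.b)|
      = |S.a * s1 + S.a * s2 + 2 * lam * S.b| := by rw [← abs_neg]; congr 1; ring
    _ ≤ |S.a * s1| + |S.a * s2| + |2 * lam * S.b| := abs_add_three _ _ _
    _ = S.a * |s1| + S.a * |s2| + 2 * lam * |S.b| := by
        rw [abs_mul, abs_mul, abs_mul, abs_of_nonneg ha, abs_of_nonneg (by positivity : 0 ≤ 2 * lam)]
    _ ≤ S.a * (∑ i, |inner ℝ (S.W i) X| ^ 3) + S.a * (ω * fakeSize S z) + 2 * lam * |S.b| := by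
        gcongr
    _ = _ := by ring

end OneStep

/-! ### Elementary estimates with a small parameter -/

/-- Bookkeeping device: each spare power of `e` pays for a factor `1000`. -/
theorem mul_pow_le_pow {e c : ℝ} (he0 : 0 ≤ e) (he : e ≤ 1 / 1000) (k q : ℕ) (_hc0 : 0 ≤ c)
    (hc : c ≤ 1000 ^ k) : c * e ^ (q + k) ≤ e ^ q := by
  have h1 : e ^ k ≤ (1 / 1000) ^ k := by gcongr
  have h2 : c * e ^ k ≤ 1 := by
    calc c * e ^ k ≤ 1000 ^ k * (1 / 1000) ^ k := by gcongr
      _ = 1 := by rw [← mul_pow]; norm_num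
  calc c * e ^ (q + k) = (c * e ^ k) * e ^ q := by ring
    _ ≤ 1 * e ^ q := by gcongr
    _ = e ^ q := one_mul _

theorem pow_le_pow_small {e : ℝ} (he0 : 0 ≤ e) (he : e ≤ 1) {p q : ℕ} (h : q ≤ p) :
    e ^ p ≤ e ^ q := pow_le_pow_of_le_one he0 he h

/-! ### The generated sample compared with the leading alignment. -/

section Cube
variable {e θ s Y fs : ℝ}

theorem cube_add_le {a b : ℝ} (ha : 0 ≤ a) (hb : 0 ≤ b) : (a + b) ^ 3 ≤ 4 * (a ^ 3 + b ^ 3) := by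
  nlinarith [mul_nonneg (add_nonneg ha hb) (sq_nonneg (a - b))]

/-- The initial length `θ ^ 9` of a generated sample may exceed the alignment `Y`, of order `θ ^
10`, but only its cube `θ ^ 27` competes with `Y²`. The growing part is smaller than `Y` by powers
of `e`, and its cube has a factor `s ≤ 1 / e` to spare. -/
theorem fake_le_sq (he0 : 0 < e) (he : e ≤ 1 / 1000) (hθ0 : 0 < θ) (hθ : θ ≤ e ^ 200)
    (hs0 : 0 ≤ s) (hs : e * s ≤ 1) (hY : θ ^ 10 + e ^ 7 * s ≤ 4 * Y)
    (hfs : e ^ 9 * fs ≤ 2 * (θ ^ 9 + e ^ 60 * s) ^ 3) : fs ≤ e ^ 101 * Y ^ 2 := by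
  have he1 : e ≤ 1 := by linarith
  have hθ1 : θ ≤ 1 := hθ.trans (pow_le_one₀ he0.le he1)
  have h1 := cube_add_le (a := θ ^ 9) (b := e ^ 60 * s) (by positivity) (by positivity)
  have h2 : (θ ^ 9) ^ 3 ≤ e ^ 165 * (θ ^ 10) ^ 2 := by
    calc (θ ^ 9) ^ 3 = θ ^ 6 * θ * (θ ^ 10) ^ 2 := by ring
      _ ≤ 1 * e ^ 165 * (θ ^ 10) ^ 2 := by
        gcongr
        · exact pow_le_one₀ hθ0.le hθ1
        · exact hθ.trans (pow_le_pow_small he0.le he1 (by norm_num))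
      _ = _ := by ring
  have h3 : (e ^ 60 * s) ^ 3 ≤ e ^ 165 * (e ^ 7 * s) ^ 2 := by
    calc (e ^ 60 * s) ^ 3 = e ^ 179 * s ^ 2 * (e * s) := by ring
      _ ≤ e ^ 179 * s ^ 2 * 1 := by gcongr
      _ = _ := by ring
  have h4 : (θ ^ 10) ^ 2 + (e ^ 7 * s) ^ 2 ≤ (4 * Y) ^ 2 := by
    have : (θ ^ 10 + e ^ 7 * s) ^ 2 ≤ (4 * Y) ^ 2 := by gcongr
    nlinarith [mul_nonneg (pow_nonneg hθ0.le 10) (mul_nonneg (pow_nonneg he0.le 7) hs0)]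
  have h5 : e ^ 165 * ((θ ^ 10) ^ 2 + (e ^ 7 * s) ^ 2) ≤ e ^ 165 * (4 * Y) ^ 2 := by gcongr
  have h6 : e ^ 9 * fs ≤ e ^ 9 * (128 * e ^ 156 * Y ^ 2) := by nlinarith
  have h7 := le_of_mul_le_mul_left h6 (by positivity)
  have h8 : 128 * e ^ 156 ≤ e ^ 101 :=
    (mul_pow_le_pow he0.le he 1 155 (by norm_num) (by norm_num)).trans
      (pow_le_pow_small he0.le he1 (by norm_num))
  exact h7.trans (by gcongr)

/-- For `s ≤ θ ^ 4` the gain over `Y²` is polynomial, a factor `θ ^ 2`. The early phase needs this,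
since there the fake part must be negligible against errors already divided by the possibly small
weight `a`. -/
theorem fake_le_sq_early (he0 : 0 < e) (he : e ≤ 1 / 1000) (hθ0 : 0 < θ) (hθ : θ ≤ e ^ 200)
    (hs0 : 0 ≤ s) (hs : s ≤ θ ^ 4) (hY : θ ^ 10 + e ^ 7 * s ≤ 4 * Y)
    (hfs : e ^ 9 * fs ≤ 2 * (θ ^ 9 + e ^ 60 * s) ^ 3) : fs ≤ θ ^ 2 * Y ^ 2 := by
  have he1 : e ≤ 1 := by linarith
  have hθ1 : θ ≤ 1 := hθ.trans (pow_le_one₀ he0.le he1)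
  have h1 := cube_add_le (a := θ ^ 9) (b := e ^ 60 * s) (by positivity) (by positivity)
  have h2 : e ^ 14 * (θ ^ 9) ^ 3 ≤ θ ^ 4 * (θ ^ 10) ^ 2 := by
    calc e ^ 14 * (θ ^ 9) ^ 3 = e ^ 14 * (θ ^ 3 * (θ ^ 4 * (θ ^ 10) ^ 2)) := by ring
      _ ≤ 1 * (1 * (θ ^ 4 * (θ ^ 10) ^ 2)) := by
        gcongr
        · exact pow_le_one₀ he0.le he1
        · exact pow_le_one₀ hθ0.le hθ1
      _ = _ := by ring
  have h3 : e ^ 14 * (e ^ 60 * s) ^ 3 ≤ θ ^ 4 * (e ^ 7 * s) ^ 2 := by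
    calc e ^ 14 * (e ^ 60 * s) ^ 3 = e ^ 180 * (s * (e ^ 7 * s) ^ 2) := by ring
      _ ≤ 1 * (θ ^ 4 * (e ^ 7 * s) ^ 2) := by
        gcongr
        exact pow_le_one₀ he0.le he1
      _ = _ := by ring
  have h4 : (θ ^ 10) ^ 2 + (e ^ 7 * s) ^ 2 ≤ (4 * Y) ^ 2 := by
    have : (θ ^ 10 + e ^ 7 * s) ^ 2 ≤ (4 * Y) ^ 2 := by gcongr
    nlinarith [mul_nonneg (pow_nonneg hθ0.le 10) (mul_nonneg (pow_nonneg he0.le 7) hs0)]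
  have h5 : θ ^ 4 * ((θ ^ 10) ^ 2 + (e ^ 7 * s) ^ 2) ≤ θ ^ 4 * (4 * Y) ^ 2 := by gcongr
  have h6 : e ^ 14 * (e ^ 9 * fs) ≤ e ^ 14 * (2 * (θ ^ 9 + e ^ 60 * s) ^ 3) := by gcongr
  have h9 : e ^ 14 * (θ ^ 9 + e ^ 60 * s) ^ 3
      ≤ e ^ 14 * (4 * ((θ ^ 9) ^ 3 + (e ^ 60 * s) ^ 3)) := by gcongr
  have h7 : e ^ 23 * fs ≤ 128 * θ ^ 2 * (θ ^ 2 * Y ^ 2) := by nlinarith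
  have h8 : 128 * θ ^ 2 ≤ e ^ 23 := by
    calc 128 * θ ^ 2 = 128 * (θ * θ) := by ring
      _ ≤ 128 * (1 * e ^ 200) := by gcongr
      _ = 128 * e ^ (199 + 1) := by ring
      _ ≤ e ^ 199 := mul_pow_le_pow he0.le he 1 199 (by norm_num) (by norm_num)
      _ ≤ e ^ 23 := pow_le_pow_small he0.le he1 (by norm_num)
  have : e ^ 23 * fs ≤ e ^ 23 * (θ ^ 2 * Y ^ 2) := h7.trans (by gcongr)
  exact le_of_mul_le_mul_left this (by positivity)

/-- The gradient in `a` has main term `Y³`, so a comparison with a cube is needed. It holds once `s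
≥ θ ^ 4 / 2`, because then the initial length `θ ^ 9` is negligible in the base of the cube. -/
theorem fake_le_cube (he0 : 0 < e) (he : e ≤ 1 / 1000) (hθ0 : 0 < θ) (hθ : θ ≤ e ^ 200)
    (hs : θ ^ 4 / 2 ≤ s) (hY : θ ^ 10 + e ^ 7 * s ≤ 4 * Y)
    (hfs : e ^ 9 * fs ≤ 2 * (θ ^ 9 + e ^ 60 * s) ^ 3) : fs ≤ e ^ 130 * Y ^ 3 := by
  have he1 : e ≤ 1 := by linarith
  have hθ1 : θ ≤ 1 := hθ.trans (pow_le_one₀ he0.le he1)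
  have hs0 : 0 ≤ s := le_trans (by positivity) hs
  have h1 : θ ^ 9 ≤ e ^ 60 * s := by
    calc θ ^ 9 = (2 * θ * θ ^ 4) * (θ ^ 4 / 2) := by ring
      _ ≤ (2 * e ^ 200 * 1) * s := by
        gcongr
        exact pow_le_one₀ hθ0.le hθ1
      _ ≤ e ^ 60 * s := by
        rw [mul_one]
        gcongr
        exact (mul_pow_le_pow he0.le he 1 199 (by norm_num) (by norm_num)).trans
          (pow_le_pow_small he0.le he1 (by norm_num))
  have h2 : (θ ^ 9 + e ^ 60 * s) ^ 3 ≤ (2 * e ^ 60 * s) ^ 3 := by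
    gcongr
    linarith
  have h3 : (e ^ 7 * s) ^ 3 ≤ (4 * Y) ^ 3 := by
    have h30 : e ^ 7 * s ≤ 4 * Y := by
      have : 0 < θ ^ 10 := by positivity
      linarith
    gcongr
  have h4 : e ^ 30 * fs ≤ e ^ 30 * (1024 * e ^ 150 * Y ^ 3) := by
    calc e ^ 30 * fs = e ^ 21 * (e ^ 9 * fs) := by ring
      _ ≤ e ^ 21 * (2 * (2 * e ^ 60 * s) ^ 3) := by
        refine mul_le_mul_of_nonneg_left (hfs.trans ?_) (by positivity)
        linarith
      _ = 16 * e ^ 180 * (e ^ 7 * s) ^ 3 := by ring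
      _ ≤ 16 * e ^ 180 * (4 * Y) ^ 3 := by gcongr
      _ = _ := by ring
  have h5 := le_of_mul_le_mul_left h4 (by positivity)
  have hY0 : 0 ≤ Y := by
    have : 0 < θ ^ 10 := by positivity
    have : 0 ≤ e ^ 7 * s := by positivity
    linarith
  have h8 : 1024 * e ^ 150 ≤ e ^ 130 :=
    (mul_pow_le_pow he0.le he 2 148 (by norm_num) (by norm_num)).trans
      (pow_le_pow_small he0.le he1 (by norm_num))
  exact h5.trans (by gcongr)

end Cube

/-! ### The discriminator -/

/-- The standing assumptions on the run, on its initial state and on the samples that are used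
in the analysis of the discriminator. The small parameters are `e = 1 / log d` and
`θ = d ^ (-1/20)`; `lab t = some l` means that the data point at time `t` is `u l`. -/
structure DiscSetup {mD mG d : ℕ} (S : ℕ → State mD mG d) (X : ℕ → Vec d) (z : ℕ → Fin mG → Bool)
    (u : Fin 2 → Vec d) (lab : ℕ → Option (Fin 2)) (iw : Fin 2 → Fin mD)
    (lam η ηG e θ cp : ℝ) (n T : ℕ) : Prop where
  he0 : 0 < e
  he : e ≤ 1 / 1000
  hθ0 : 0 < θ
  hθa : θ ≤ (S 0).a * e ^ 200
  ha1 : (S 0).a ≤ 1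
  hb : (S 0).b = 0
  hη0 : 0 < η
  hη : η ≤ θ ^ 30
  hT : e * (2 + η * T) ≤ 1
  hlam0 : 0 ≤ lam
  hlam : lam ≤ θ ^ 10
  hm : (mD : ℝ) * e ≤ 2
  hstep : ∀ t, S (t + 1) = cubicStep lam η ηG (X t) (z t) (S t)
  hu : ∀ l, ‖u l‖ = 1
  hγ0 : 0 ≤ inner ℝ (u 0) (u 1)
  hγ : inner ℝ (u 0) (u 1) ≤ e ^ 60
  hX : ∀ t l, lab t = some l → X t = u l
  hcp : e ≤ cp
  hcp1 : cp ≤ 1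
  hcount : ∀ t, t ≤ T → ∀ l, cp * t ≤ Nat.count (fun i => lab i = some l) t + n
  hbad : ∀ t, t ≤ T → (Nat.count (fun i => lab i = none) t : ℝ) ≤ e ^ 60 * t + n
  hn : η * n ≤ θ ^ 30
  hG : ∀ t, t ≤ T → e ^ 2 * ‖generator (S t).V (z t)‖ ≤ θ ^ 9 + e ^ 60 * (η * t)
  hp : ∀ t, t ≤ T → ∀ l, lab t = some l → e ≤ realGap lam (S t) (u l)
  hW0 : ∀ k, ‖(S 0).W k‖ ≤ 3 / 2
  hiw : iw 0 ≠ iw 1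
  hwin : ∀ l, θ ^ 10 / 2 ≤ inner ℝ ((S 0).W (iw l)) (u l)
  hini : ∀ l k, e ^ 2 * |inner ℝ ((S 0).W k) (u l)| ≤ θ ^ 10
  hgap : ∀ l k, k ≠ iw l →
    inner ℝ ((S 0).W k) (u l) ≤ inner ℝ ((S 0).W (iw l)) (u l) - e ^ 6 * θ ^ 10

section Disc
variable {mD mG d : ℕ} (S : ℕ → State mD mG d) (X : ℕ → Vec d) (z : ℕ → Fin mG → Bool)
    (u : Fin 2 → Vec d) (lab : ℕ → Option (Fin 2)) (lam η : ℝ)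

/-- The alignment of the `k`-th discriminator neuron with the mode `l`. -/
def align (t : ℕ) (l : Fin 2) (k : Fin mD) : ℝ := inner ℝ ((S t).W k) (u l)

/-- The common factor of the increments of all neurons in a step that uses the mode `l`. -/
def rate (t : ℕ) (l : Fin 2) : ℝ :=
  if lab t = some l then
    η * (3 * (S t).a * realGap lam (S t) (u l) / gradNorm lam (X t) (z t) (S t)) else 0

/-- The accumulated displacement of the `k`-th neuron along the mode `l`. -/
def alpha (t : ℕ) (l : Fin 2) (k : Fin mD) : ℝ :=
  ∑ i ∈ Finset.range t, rate S X z u lab lam η i l * align S u i l k ^ 2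

/-- The part of the displacement of the discriminator that is not along the modes. -/
def resid (t : ℕ) : Rows mD d :=
  (S t).W - (S 0).W
    - ∑ l, (WithLp.toLp 2 fun k => alpha S X z u lab lam η t l k • u l : Rows mD d)

theorem alpha_succ (t : ℕ) (l : Fin 2) (k : Fin mD) :
    alpha S X z u lab lam η (t + 1) l k = alpha S X z u lab lam η t l k
      + rate S X z u lab lam η t l * align S u t l k ^ 2 := by
  rw [alpha, Finset.sum_range_succ]; rfl

theorem resid_zero : resid S X z u lab lam η 0 = 0 := by
  ext1 k
  simp [resid, alpha]

theorem row_eq (t : ℕ) (k : Fin mD) : (S t).W k = (S 0).W k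
    + alpha S X z u lab lam η t 0 k • u 0 + alpha S X z u lab lam η t 1 k • u 1
    + resid S X z u lab lam η t k := by
  simp only [resid, Fin.sum_univ_two, PiLp.sub_apply, PiLp.add_apply]
  abel

theorem resid_succ_sub (t : ℕ) : resid S X z u lab lam η (t + 1) - resid S X z u lab lam η t
    = (S (t + 1)).W - (S t).W - ∑ l, (WithLp.toLp 2 fun k =>
      (rate S X z u lab lam η t l * align S u t l k ^ 2) • u l : Rows mD d) := by
  have : ∀ l, (WithLp.toLp 2 fun k => alpha S X z u lab lam η (t + 1) l k • u l : Rows mD d)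
      = (WithLp.toLp 2 fun k => alpha S X z u lab lam η t l k • u l : Rows mD d)
      + (WithLp.toLp 2 fun k =>
      (rate S X z u lab lam η t l * align S u t l k ^ 2) • u l : Rows mD d) := fun l => by
    ext1 k
    simp only [PiLp.add_apply, alpha_succ, add_smul]
  simp only [resid, this, Finset.sum_add_distrib]
  abel

end Disc

namespace DiscSetup
variable {mD mG d : ℕ} {S : ℕ → State mD mG d} {X : ℕ → Vec d} {z : ℕ → Fin mG → Bool}
    {u : Fin 2 → Vec d} {lab : ℕ → Option (Fin 2)} {iw : Fin 2 → Fin mD}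
    {lam η ηG e θ cp : ℝ} {n T : ℕ}
variable (H : DiscSetup S X z u lab iw lam η ηG e θ cp n T)
include H

theorem he1 : e ≤ 1 := by linarith [H.he]

theorem a0_pos : 0 < (S 0).a :=
  pos_of_mul_pos_left (H.hθ0.trans_le H.hθa) (pow_nonneg H.he0.le _)

theorem hθ : θ ≤ e ^ 200 :=
  H.hθa.trans (mul_le_of_le_one_left (pow_nonneg H.he0.le _) H.ha1)

theorem hθ1 : θ ≤ 1 := H.hθ.trans (pow_le_one₀ H.he0.le H.he1)

theorem displacement (t : ℕ) :
    |(S t).a - (S 0).a| + |(S t).b| + ‖(S t).W - (S 0).W‖ ≤ η * t := by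
  have : ∀ t, S t = cubicRun lam η ηG X z (S 0) t := by
    intro t
    induction t with
    | zero => rfl
    | succ t ih => rw [cubicRun, ← ih, H.hstep]
  have h := cubicRun_displacement (lam := lam) (etaG := ηG) (X := X) (z := z) (S₀ := S 0)
    H.hη0.le t
  rw [← this, H.hb, sub_zero] at h
  exact h

theorem s_nonneg (t : ℕ) : 0 ≤ η * t := mul_nonneg H.hη0.le (Nat.cast_nonneg t)

theorem abs_a_sub_le (t : ℕ) : |(S t).a - (S 0).a| ≤ η * t := by
  linarith [H.displacement t, abs_nonneg (S t).b, norm_nonneg ((S t).W - (S 0).W)]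

theorem abs_b_le (t : ℕ) : |(S t).b| ≤ η * t := by
  linarith [H.displacement t, abs_nonneg ((S t).a - (S 0).a), norm_nonneg ((S t).W - (S 0).W)]

theorem norm_row_sub_le (t : ℕ) (k : Fin mD) : ‖(S t).W k - (S 0).W k‖ ≤ η * t := by
  have := norm_row_le ((S t).W - (S 0).W) k
  rw [PiLp.sub_apply] at this
  linarith [H.displacement t, abs_nonneg (S t).b, abs_nonneg ((S t).a - (S 0).a)]

theorem s_le {t : ℕ} (ht : t ≤ T) : e * (2 + η * t) ≤ 1 := by
  refine le_trans ?_ H.hT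
  have := H.he0
  have := H.hη0
  gcongr

theorem norm_row_le {t : ℕ} (ht : t ≤ T) (k : Fin mD) : ‖(S t).W k‖ ≤ 1 / e := by
  rw [le_div_iff₀ H.he0]
  have h1 := norm_le_norm_add_norm_sub' ((S t).W k) ((S 0).W k)
  have h2 := H.norm_row_sub_le t k
  have h3 := H.hW0 k
  have h4 := H.s_le ht
  have h5 : ‖(S t).W k‖ ≤ 2 + η * t := by linarith
  have := H.he0
  nlinarith

theorem abs_align_sub_le (t : ℕ) (l : Fin 2) (k : Fin mD) :
    |align S u t l k - align S u 0 l k| ≤ η * t := by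
  rw [align, align, ← inner_sub_left]
  refine (abs_real_inner_le_norm _ _).trans ?_
  rw [H.hu, mul_one]
  exact H.norm_row_sub_le t k

theorem fakeSize_bound {t : ℕ} (ht : t ≤ T) :
    e ^ 9 * fakeSize (S t) (z t) ≤ 2 * (θ ^ 9 + e ^ 60 * (η * t)) ^ 3 := by
  have he0 := H.he0
  have h1 := fakeSize_le (z := z t) (H.norm_row_le ht)
  have h2 : (e ^ 2 * ‖generator (S t).V (z t)‖) ^ 3 ≤ (θ ^ 9 + e ^ 60 * (η * t)) ^ 3 := by
    gcongr
    exact H.hG t ht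
  calc e ^ 9 * fakeSize (S t) (z t)
      ≤ e ^ 9 * (mD * (1 / e) ^ 2 * ‖generator (S t).V (z t)‖ ^ 3) := by gcongr
    _ = (mD * e) * (e ^ 2 * ‖generator (S t).V (z t)‖) ^ 3 := by field_simp
    _ ≤ 2 * (θ ^ 9 + e ^ 60 * (η * t)) ^ 3 := by
      have := H.hm
      gcongr

/-- The alignment of the leading neuron is bounded below, and the output weight is positive. -/
def Reg (S : ℕ → State mD mG d) (u : Fin 2 → Vec d) (iw : Fin 2 → Fin mD) (η e θ : ℝ)
    (t : ℕ) : Prop :=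
  0 < (S t).a ∧ ∀ l, θ ^ 10 + e ^ 7 * (η * t) ≤ 4 * align S u t l (iw l)

section Step
variable {t : ℕ} (ht : t ≤ T) (hr : Reg S u iw η e θ t)
include ht hr

omit ht in
theorem lead_pos (l : Fin 2) : 0 < align S u t l (iw l) := by
  have h1 := hr.2 l
  have h2 : 0 < θ ^ 10 := pow_pos H.hθ0 _
  have h3 : 0 ≤ e ^ 7 * (η * t) := mul_nonneg (pow_nonneg H.he0.le _) (H.s_nonneg t)
  linarith

theorem fakeSize_le_sq (l : Fin 2) :
    fakeSize (S t) (z t) ≤ e ^ 101 * align S u t l (iw l) ^ 2 :=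
  fake_le_sq H.he0 H.he H.hθ0 H.hθ (H.s_nonneg t)
    (by nlinarith [H.s_le ht, H.he0]) (hr.2 l) (H.fakeSize_bound ht)

variable {l : Fin 2} (hl : lab t = some l)
include hl

theorem fakeSize_le_gap :
    fakeSize (S t) (z t) ≤ e ^ 100 * (realGap lam (S t) (u l) * align S u t l (iw l) ^ 2) := by
  refine (H.fakeSize_le_sq ht hr l).trans ?_
  calc e ^ 101 * align S u t l (iw l) ^ 2 = e ^ 100 * (e * align S u t l (iw l) ^ 2) := by ring
    _ ≤ _ := by
      have := H.hp t ht l hl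
      have := H.he0
      gcongr

/-- The fake part is at most a quarter of the leading neuron's real part, hence at most a third of
the norm, hence it costs no other neuron more than that either. -/
theorem main_le_gradNorm (k : Fin mD) :
    3 * (S t).a * realGap lam (S t) (u l) * align S u t l k ^ 2
      ≤ 2 * gradNorm lam (X t) (z t) (S t) := by
  have ha := hr.1
  rw [H.hX t l hl]
  have hp := realGap_pos (lam := lam) (S := S t) (X := u l)
  have h1 := le_gradNorm (lam := lam) (z := z t) ha.le (H.hu l) k
  have h2 := le_gradNorm (lam := lam) (z := z t) ha.le (H.hu l) (iw l)
  have h3 := H.fakeSize_le_gap ht hr hl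
  have he : e ^ 100 ≤ 1 / 4 := by
    calc e ^ 100 ≤ e ^ 1 := pow_le_pow_small H.he0.le H.he1 (by norm_num)
      _ ≤ 1 / 4 := by rw [pow_one]; linarith [H.he]
  have h4 : fakeSize (S t) (z t) ≤ 1 / 4 * (realGap lam (S t) (u l) * align S u t l (iw l) ^ 2) :=
    h3.trans (by gcongr)
  have h5 := mul_le_mul_of_nonneg_left h4 (by positivity : 0 ≤ 3 * (S t).a)
  clear h3 he
  have hN := gradNorm_nonneg (lam := lam) (X := u l) (z := z t) (S := S t)
  simp only [align] at *
  generalize gradNorm lam (u l) (z t) (S t) = N at *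
  generalize fakeSize (S t) (z t) = F at *
  have h6 : 3 * (S t).a * (1 / 4 * (realGap lam (S t) (u l) * inner ℝ ((S t).W (iw l)) (u l) ^ 2))
    = 1 / 4 * (3 * (S t).a * realGap lam (S t) (u l) * inner ℝ ((S t).W (iw l)) (u l) ^ 2) := by
    ring
  rw [h6] at h5
  linarith

theorem gradNorm_pos : 0 < gradNorm lam (X t) (z t) (S t) := by
  have h1 := H.main_le_gradNorm ht hr hl (iw l)
  have ha := hr.1
  have h2 := H.lead_pos hr l
  have hp := realGap_pos (lam := lam) (S := S t) (X := u l)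
  have : 0 < 3 * (S t).a * realGap lam (S t) (u l) * align S u t l (iw l) ^ 2 := by positivity
  linarith

theorem rate_mul_sq_le (k : Fin mD) :
    rate S X z u lab lam η t l * align S u t l k ^ 2 ≤ 2 * η := by
  have h1 := H.main_le_gradNorm ht hr hl k
  have h2 := H.gradNorm_pos ht hr hl
  have h3 := H.hη0
  rw [rate, if_pos hl, mul_assoc, div_mul_eq_mul_div, mul_comm 2 η]
  gcongr
  rw [div_le_iff₀ h2]
  exact h1

/-- On a labelled sample the real part of the gradient is exactly what `alpha` records, so only the
fake part enters the residual. -/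
theorem resid_step_eq : resid S X z u lab lam η (t + 1) - resid S X z u lab lam η t
    = -((η / gradNorm lam (X t) (z t) (S t)) • fakeGradW lam (z t) (S t)) := by
  rw [resid_succ_sub, H.hstep, cubicStep]
  simp only [add_sub_cancel_left]
  have h1 : ∀ l', l' ≠ l → rate S X z u lab lam η t l' = 0 := fun l' h => by
    rw [rate, if_neg]
    rw [hl]
    exact fun hh => h (Option.some.inj hh).symm
  rw [Finset.sum_eq_single l (fun l' _ h => by ext1 k; simp [h1 l' h]) (by simp), gradW_eq,
    smul_sub]
  have : ((η / gradNorm lam (X t) (z t) (S t)) • (WithLp.toLp 2 fun i =>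
      (3 * (S t).a * realGap lam (S t) (X t) * inner ℝ ((S t).W i) (X t) ^ 2) • X t : Rows mD d))
      = (WithLp.toLp 2 fun k =>
      (rate S X z u lab lam η t l * align S u t l k ^ 2) • u l : Rows mD d) := by
    ext1 k
    simp only [PiLp.smul_apply, smul_smul, rate, if_pos hl, H.hX t l hl, align]
    congr 1
    ring
  rw [this]
  abel

theorem norm_resid_step_le :
    ‖resid S X z u lab lam η (t + 1) - resid S X z u lab lam η t‖ ≤ 2 * e ^ 100 * η := by
  rw [H.resid_step_eq ht hr hl, norm_neg, norm_smul]
  have hN := H.gradNorm_pos ht hr hl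
  have hη := H.hη0
  have he := H.he0
  rw [Real.norm_of_nonneg (by positivity), div_mul_eq_mul_div, div_le_iff₀ hN]
  have h1 := norm_fakeGradW_le (lam := lam) (z := z t) hr.1.le
  have h2 := H.fakeSize_le_gap ht hr hl
  have h3 := H.main_le_gradNorm ht hr hl (iw l)
  have ha := hr.1
  calc η * ‖fakeGradW lam (z t) (S t)‖
      ≤ η * (3 * (S t).a * (e ^ 100 * (realGap lam (S t) (u l) * align S u t l (iw l) ^ 2))) := by
        gcongr
        exact h1.trans (by gcongr)
    _ = η * e ^ 100 * (3 * (S t).a * realGap lam (S t) (u l) * align S u t l (iw l) ^ 2) := by ring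
    _ ≤ η * e ^ 100 * (2 * gradNorm lam (X t) (z t) (S t)) := by gcongr
    _ = _ := by ring

end Step

theorem norm_resid_step_le_of_none {t : ℕ} (hl : lab t = none) :
    ‖resid S X z u lab lam η (t + 1) - resid S X z u lab lam η t‖ ≤ η := by
  have h1 : ∀ l, rate S X z u lab lam η t l = 0 := fun l => by simp [rate, hl]
  rw [resid_succ_sub, Finset.sum_eq_zero (fun l _ => by ext1 k; simp [h1 l]), sub_zero, H.hstep]
  linarith [cubicStep_displacement (lam := lam) (etaG := ηG) (X := X t) (z := z t) (S := S t)
    H.hη0.le, abs_nonneg ((cubicStep lam η ηG (X t) (z t) (S t)).a - (S t).a),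
    abs_nonneg ((cubicStep lam η ηG (X t) (z t) (S t)).b - (S t).b)]

/-- Labelled samples contribute `2 e ^ 100 η` each. The others contribute up to `η` each, but they
are rare by `hbad`. -/
theorem norm_resid_le {t : ℕ} (ht : t ≤ T) (hr : ∀ t' < t, Reg S u iw η e θ t') :
    ‖resid S X z u lab lam η t‖ ≤ 2 * e ^ 60 * (η * t) + θ ^ 30 := by
  have key : ∀ t, t ≤ T → (∀ t' < t, Reg S u iw η e θ t') → ‖resid S X z u lab lam η t‖
      ≤ 2 * e ^ 100 * (η * t) + η * Nat.count (fun i => lab i = none) t := by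
    intro t
    induction t with
    | zero => intro _ _; rw [resid_zero]; simp
    | succ t ih =>
      intro ht hr
      have h1 := ih (Nat.le_of_succ_le ht) fun t' h => hr t' (h.trans (Nat.lt_succ_self t))
      have h2 := norm_le_norm_add_norm_sub' (resid S X z u lab lam η (t + 1))
        (resid S X z u lab lam η t)
      have hη := H.hη0
      have he := pow_pos H.he0 100
      rw [Nat.count_succ]
      rcases h : lab t with _ | l
      · have := H.norm_resid_step_le_of_none h
        rw [if_pos rfl]
        push_cast
        nlinarith
      · have := H.norm_resid_step_le (Nat.le_of_succ_le ht) (hr t (Nat.lt_succ_self t)) h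
        rw [if_neg (by simp)]
        push_cast
        nlinarith
  have h1 := key t ht hr
  have h2 := mul_le_mul_of_nonneg_left (H.hbad t ht) H.hη0.le
  have h3 := H.hn
  have h4 : 2 * e ^ 100 ≤ e ^ 60 :=
    (mul_pow_le_pow H.he0.le H.he 1 99 (by norm_num) (by norm_num)).trans
      (pow_le_pow_small H.he0.le H.he1 (by norm_num))
  have h5 := mul_le_mul_of_nonneg_right h4 (H.s_nonneg t)
  linarith

theorem rate_nonneg {t : ℕ} (ha : 0 ≤ (S t).a) (l : Fin 2) : 0 ≤ rate S X z u lab lam η t l := by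
  unfold rate
  have := H.hη0
  have := realGap_pos (lam := lam) (S := S t) (X := u l)
  have := gradNorm_nonneg (lam := lam) (X := X t) (z := z t) (S := S t)
  split_ifs
  · positivity
  · rfl

theorem alpha_nonneg {t : ℕ} (hr : ∀ t' < t, Reg S u iw η e θ t') (l : Fin 2) (k : Fin mD) :
    0 ≤ alpha S X z u lab lam η t l k :=
  Finset.sum_nonneg fun i hi =>
    mul_nonneg (H.rate_nonneg (hr i (Finset.mem_range.1 hi)).1.le l) (sq_nonneg _)

theorem alpha_le {t : ℕ} (ht : t ≤ T) (hr : ∀ t' < t, Reg S u iw η e θ t') (l : Fin 2)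
    (k : Fin mD) : alpha S X z u lab lam η t l k ≤ 2 * (η * t) := by
  have : ∀ i ∈ Finset.range t, rate S X z u lab lam η i l * align S u i l k ^ 2 ≤ 2 * η := by
    intro i hi
    have hit := Finset.mem_range.1 hi
    by_cases hl : lab i = some l
    · exact H.rate_mul_sq_le (hit.le.trans ht) (hr i hit) hl k
    · rw [rate, if_neg hl, zero_mul]
      linarith [H.hη0]
  have := Finset.sum_le_card_nsmul _ _ _ this
  rw [Finset.card_range, nsmul_eq_mul] at this
  rw [alpha]
  linarith

theorem align_eq (t : ℕ) (l l' : Fin 2) (hll : l ≠ l') (k : Fin mD) :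
    align S u t l k = align S u 0 l k + alpha S X z u lab lam η t l k
      + alpha S X z u lab lam η t l' k * inner ℝ (u 0) (u 1)
      + inner ℝ (resid S X z u lab lam η t k) (u l) := by
  have h1 := row_eq S X z u lab lam η t k
  have hs : ∀ l, inner ℝ (u l) (u l) = (1 : ℝ) := fun l => by
    rw [real_inner_self_eq_norm_sq, H.hu]; norm_num
  simp only [align]
  rw [h1]
  simp only [inner_add_left, real_inner_smul_left]
  fin_cases l <;> fin_cases l' <;> first | exact absurd rfl hll | skip
  · simp only [Fin.zero_eta, Fin.mk_one, hs, real_inner_comm (u 0) (u 1)]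
    ring
  · simp only [Fin.zero_eta, Fin.mk_one, hs]
    ring

/-- Besides the residual, the only leakage into mode `l` is the displacement along the other mode
times `⟪u 0, u 1⟫ ≤ e ^ 60`. -/
theorem abs_align_sub_alpha_le {t : ℕ} (ht : t ≤ T) (hr : ∀ t' < t, Reg S u iw η e θ t')
    (l : Fin 2) (k : Fin mD) :
    |align S u t l k - align S u 0 l k - alpha S X z u lab lam η t l k|
      ≤ 4 * e ^ 60 * (η * t) + θ ^ 30 := by
  obtain ⟨l', hl'⟩ : ∃ l' : Fin 2, l ≠ l' := ⟨l + 1, by fin_cases l <;> simp⟩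
  have h1 := H.align_eq t l l' hl' k
  have h2 := H.norm_resid_le ht hr
  have h3 : |inner ℝ (resid S X z u lab lam η t k) (u l)| ≤ ‖resid S X z u lab lam η t‖ := by
    refine (abs_real_inner_le_norm _ _).trans ?_
    rw [H.hu, mul_one]
    exact GAN.norm_row_le _ k
  have h4 := H.alpha_nonneg hr l' k
  have h5 := H.alpha_le ht hr l' k
  have h6 : |alpha S X z u lab lam η t l' k * inner ℝ (u 0) (u 1)| ≤ 2 * (η * t) * e ^ 60 := by
    rw [abs_of_nonneg (mul_nonneg h4 H.hγ0)]
    have := H.hγ0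
    have := H.hγ
    have := H.s_nonneg t
    gcongr
  rw [h1]
  calc _ = |alpha S X z u lab lam η t l' k * inner ℝ (u 0) (u 1)
        + inner ℝ (resid S X z u lab lam η t k) (u l)| := by congr 1; ring
    _ ≤ _ := abs_add_le _ _
    _ ≤ _ := by linarith

end DiscSetup

namespace DiscSetup
variable {mD mG d : ℕ} {S : ℕ → State mD mG d} {X : ℕ → Vec d} {z : ℕ → Fin mG → Bool}
    {u : Fin 2 → Vec d} {lab : ℕ → Option (Fin 2)} {iw : Fin 2 → Fin mD}
    {lam η ηG e θ cp : ℝ} {n T : ℕ}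
variable (H : DiscSetup S X z u lab iw lam η ηG e θ cp n T)
include H

/-! ### The early phase -/

theorem theta_mul_le {c : ℝ} (hc : c ≤ 1000 ^ 50) (hc0 : 0 ≤ c) : c * θ ≤ e ^ 150 := by
  refine (mul_le_mul_of_nonneg_left H.hθ hc0).trans ?_
  exact mul_pow_le_pow H.he0.le H.he 50 150 hc0 hc

theorem theta_pow_le {p q : ℕ} (h : q ≤ p) : θ ^ p ≤ θ ^ q :=
  pow_le_pow_small H.hθ0.le H.hθ1 h

/-- Up to time `θ ^ 4` the parameters move by at most `θ ^ 4`, far less than `a`, which starts above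
`θ`. -/
theorem half_a0_le {t : ℕ} (hs : η * t ≤ θ ^ 4) : (S 0).a / 2 ≤ (S t).a := by
  have h1 := (abs_le.1 (H.abs_a_sub_le t)).1
  have h2 : θ ^ 4 ≤ θ ^ 1 := H.theta_pow_le (by norm_num)
  have h3 : θ ≤ (S 0).a / 2 := by
    refine H.hθa.trans ?_
    have h5 : e ^ 200 ≤ e ^ 1 := pow_le_pow_small H.he0.le H.he1 (by norm_num)
    have h6 := H.he
    have := H.a0_pos
    nlinarith
  linarith

theorem init_pos (l : Fin 2) : 0 < align S u 0 l (iw l) :=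
  lt_of_lt_of_le (by have := H.hθ0; positivity) (H.hwin l)

theorem init_le (l : Fin 2) (k : Fin mD) : |align S u 0 l k| ≤ θ ^ 10 / e ^ 2 := by
  rw [le_div_iff₀ (pow_pos H.he0 _), mul_comm]
  exact H.hini l k

/-- One power of `θ` pays for a factor `1000` and for up to 150 powers of `1 / e`. -/
theorem theta_div_le {p q r : ℕ} (h : q + 1 ≤ p) (hr : r ≤ 150) : 1000 * θ ^ p / e ^ r ≤ θ ^ q := by
  have he0 := H.he0
  have hθ0 := H.hθ0
  rw [div_le_iff₀ (pow_pos H.he0 _)]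
  calc 1000 * θ ^ p ≤ 1000 * θ ^ (q + 1) := by
        have := H.theta_pow_le h
        gcongr
    _ = (1000 * θ) * θ ^ q := by ring
    _ ≤ e ^ 150 * θ ^ q := by
        have := H.theta_mul_le (c := 1000) (by norm_num) (by norm_num)
        gcongr
    _ ≤ e ^ r * θ ^ q := by
        have := pow_le_pow_small H.he0.le H.he1 hr
        gcongr
    _ = _ := mul_comm _ _

theorem abs_align_le_early {t : ℕ} (hs : η * t ≤ θ ^ 4) (l : Fin 2) (k : Fin mD) :
    |align S u t l k| ≤ 2 * θ ^ 4 := by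
  have h1 := H.abs_align_sub_le t l k
  have h2 := H.init_le l k
  have h3 := H.theta_div_le (p := 10) (q := 4) (r := 2) (by norm_num) (by norm_num)
  have h4 := abs_sub_abs_le_abs_sub (align S u t l k) (align S u 0 l k)
  have h5 : 0 ≤ θ ^ 10 / e ^ 2 := by
    have := H.hθ0
    have := H.he0
    positivity
  rw [mul_div_assoc] at h3
  linarith

omit H in
theorem sum_abs_cube_le {t : ℕ} {l : Fin 2} {ξ Q : ℝ} (k0 : Fin mD) (hξ : ∀ k, |align S u t l k| ≤ ξ)
    (hQ : ∑ k, align S u t l k ^ 2 ≤ Q) :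
    ∑ k, |align S u t l k| ^ 3 ≤ ξ * Q := by
  have hξ0 : 0 ≤ ξ := (abs_nonneg _).trans (hξ k0)
  refine le_trans ?_ (mul_le_mul_of_nonneg_left hQ hξ0)
  rw [Finset.mul_sum]
  refine Finset.sum_le_sum fun k _ => ?_
  rw [pow_succ, sq_abs, mul_comm]
  gcongr
  exact hξ k

/-- With `a` frozen and alignments at most `2 θ ^ 4`, the gradients in `a` and `b` and the fake part
are of order `θ` times `Q`, whereas `3 a p ≥ θ`. So the norm exceeds the largest squared alignment
times `a p` by a polylogarithmic factor at most. This is the lower bound on the rate that `race`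
needs. -/
theorem gradNorm_le_early {t : ℕ} (ht : t ≤ T) (hs : η * t ≤ θ ^ 4) (hr : Reg S u iw η e θ t)
    {l : Fin 2} (hl : lab t = some l) {Z : ℝ} (hZ : ∀ k, align S u t l k ^ 2 ≤ Z) :
    gradNorm lam (X t) (z t) (S t)
      ≤ 6 * (S t).a * realGap lam (S t) (u l) * (2 / e * Z) := by
  have he0 := H.he0
  have hθ0 := H.hθ0
  have hθ1 := H.hθ1
  have hZ0 : 0 ≤ Z := (sq_nonneg _).trans (hZ (iw l))
  set Q := 2 / e * Z with hQ
  have hQ0 : 0 ≤ Q := by positivity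
  have hm : (mD : ℝ) ≤ 2 / e := by rw [le_div_iff₀ he0]; exact H.hm
  have hsum : ∑ k, align S u t l k ^ 2 ≤ Q := by
    have := Finset.sum_le_card_nsmul Finset.univ (fun k => align S u t l k ^ 2) Z fun k _ => hZ k
    rw [Finset.card_univ, Fintype.card_fin, nsmul_eq_mul] at this
    exact this.trans (by rw [hQ]; gcongr)
  have hZQ : Z ≤ Q := by
    have : 1 ≤ 2 / e := by rw [le_div_iff₀ he0]; linarith [H.he]
    nlinarith
  have hYQ : align S u t l (iw l) ^ 2 ≤ Q := (hZ _).trans hZQ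
  have hcube := sum_abs_cube_le (iw l) (H.abs_align_le_early hs l) hsum
  have hfs : fakeSize (S t) (z t) ≤ θ ^ 2 * Q :=
    (fake_le_sq_early H.he0 H.he H.hθ0 H.hθ (H.s_nonneg t) hs (hr.2 l)
      (H.fakeSize_bound ht)).trans (by gcongr)
  have ha := hr.1
  have ha2 : (S t).a ≤ 2 := by
    have h1 := (abs_le.1 (H.abs_a_sub_le t)).2
    have h2 : θ ^ 4 ≤ 1 := pow_le_one₀ hθ0.le hθ1
    linarith [H.ha1]
  have hp := realGap_pos (lam := lam) (S := S t) (X := u l)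
  have hp1 := realGap_le_one (lam := lam) (S := S t) (X := u l)
  have hpe := H.hp t ht l hl
  have hW := H.norm_row_le ht
  have hs0 := H.s_nonneg t
  have hfs0 := fakeSize_nonneg (S := S t) (z := z t)
  -- the gradient in `a`
  have hgA : |gradA lam (u l) (z t) (S t)| ≤ 2 * θ ^ 4 * Q + 1 / e * (θ ^ 2 * Q) := by
    have h1 := abs_gradA_sub_le (lam := lam) (X := u l) (z := z t) hW
    have h2 : |realGap lam (S t) (u l) * ∑ i, inner ℝ ((S t).W i) (u l) ^ 3| ≤ 2 * θ ^ 4 * Q := by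
      rw [abs_mul, abs_of_pos hp]
      exact (mul_le_of_le_one_left (abs_nonneg _) hp1).trans ((abs_sum_cube_le _).trans hcube)
    have h3 : 1 / e * fakeSize (S t) (z t) ≤ 1 / e * (θ ^ 2 * Q) := by gcongr
    have h4 := abs_sub_abs_le_abs_sub (gradA lam (u l) (z t) (S t))
      (realGap lam (S t) (u l) * ∑ i, inner ℝ ((S t).W i) (u l) ^ 3)
    linarith
  -- the gradient in `b`
  have hsQ : θ ^ 10 * (η * t) ≤ 4 / e ^ 7 * Q := by
    rw [div_mul_eq_mul_div, le_div_iff₀ (by positivity)]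
    have h1 : (θ ^ 10 + e ^ 7 * (η * t)) ^ 2 ≤ (4 * align S u t l (iw l)) ^ 2 := by
      have := hr.2 l
      gcongr
    nlinarith [sq_nonneg (θ ^ 10 - e ^ 7 * (η * t))]
  have hgB : |gradB lam (u l) (z t) (S t)|
      ≤ θ ^ 10 * (2 * (2 * θ ^ 4 * Q + 1 / e * (θ ^ 2 * Q))) + 8 * θ ^ 10 / e ^ 7 * Q := by
    have h1 := abs_gradB_le' (lam := lam) (X := u l) (z := z t) H.hlam0 ha.le hW
    have hb := H.abs_b_le t
    have hl0 := H.hlam0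
    have hl1 := H.hlam
    calc _ ≤ _ := h1
      _ ≤ θ ^ 10 * (2 * (2 * θ ^ 4 * Q + 1 / e * (θ ^ 2 * Q)) + 2 * θ ^ 10 * (η * t)) := by
        gcongr
        exact hcube
      _ = θ ^ 10 * (2 * (2 * θ ^ 4 * Q + 1 / e * (θ ^ 2 * Q)))
          + 2 * θ ^ 10 * (θ ^ 10 * (η * t)) := by ring
      _ ≤ θ ^ 10 * (2 * (2 * θ ^ 4 * Q + 1 / e * (θ ^ 2 * Q)))
          + 2 * θ ^ 10 * (4 / e ^ 7 * Q) := by gcongr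
      _ = _ := by ring
  -- the gradient in `W`
  have hgW := norm_gradW_le (lam := lam) (z := z t) ha.le (H.hu l)
  have hgW' : ‖gradW lam (u l) (z t) (S t)‖
      ≤ 3 * (S t).a * realGap lam (S t) (u l) * Q + 6 * θ ^ 2 * Q := by
    refine hgW.trans (add_le_add (by gcongr; exact hsum) ?_)
    calc 3 * (S t).a * fakeSize (S t) (z t) ≤ 3 * 2 * (θ ^ 2 * Q) := by gcongr
      _ = _ := by ring
  -- all errors together
  have t1 : 2 * θ ^ 4 ≤ θ / 10 := by
    have := H.theta_div_le (p := 4) (q := 1) (r := 0) (by norm_num) (by norm_num)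
    rw [pow_zero, div_one, pow_one] at this
    linarith
  have t2 : 1 / e * θ ^ 2 ≤ θ / 10 := by
    have := H.theta_div_le (p := 2) (q := 1) (r := 1) (by norm_num) (by norm_num)
    rw [pow_one, pow_one, mul_div_assoc] at this
    rw [one_div, inv_mul_eq_div]
    linarith
  have t3 : 8 * θ ^ 10 / e ^ 7 ≤ θ / 10 := by
    have := H.theta_div_le (p := 10) (q := 1) (r := 7) (by norm_num) (by norm_num)
    rw [pow_one, mul_div_assoc] at this
    rw [mul_div_assoc]
    linarith
  have t4 : 6 * θ ^ 2 ≤ θ / 10 := by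
    have := H.theta_div_le (p := 2) (q := 1) (r := 0) (by norm_num) (by norm_num)
    rw [pow_zero, div_one, pow_one] at this
    linarith
  have t5 : θ ^ 10 ≤ 1 := pow_le_one₀ hθ0.le hθ1
  have t6 : θ ≤ 3 * (S t).a * realGap lam (S t) (u l) := by
    have h1 := H.half_a0_le hs
    have h2 : e ^ 200 ≤ e := by
      calc e ^ 200 ≤ e ^ 1 := pow_le_pow_small he0.le H.he1 (by norm_num)
        _ = e := pow_one e
    calc θ ≤ (S 0).a * e ^ 200 := H.hθa
      _ ≤ (2 * (S t).a) * e := by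
        gcongr
        linarith
      _ ≤ (2 * (S t).a) * realGap lam (S t) (u l) := by gcongr
      _ ≤ _ := by nlinarith [mul_pos ha hp]
  have s1 := mul_le_mul_of_nonneg_right t1 hQ0
  have s2 := mul_le_mul_of_nonneg_right t2 hQ0
  have s3 := mul_le_mul_of_nonneg_right t3 hQ0
  have s4 := mul_le_mul_of_nonneg_right t4 hQ0
  have s6 := mul_le_mul_of_nonneg_right t6 hQ0
  have s7 : θ ^ 10 * (2 * (2 * θ ^ 4 * Q + 1 / e * (θ ^ 2 * Q)))
      ≤ 1 * (2 * (2 * θ ^ 4 * Q + 1 / e * (θ ^ 2 * Q))) := by gcongr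
  have s8 : 1 / e * (θ ^ 2 * Q) = 1 / e * θ ^ 2 * Q := by ring
  have hQθ : 0 ≤ θ * Q := by positivity
  rw [H.hX t l hl, gradNorm]
  linarith

theorem s_le_count {t : ℕ} (ht : t ≤ T) (l : Fin 2) :
    e * (η * t) ≤ η * Nat.count (fun i => lab i = some l) t + θ ^ 30 := by
  have h1 := H.hcount t ht l
  have h2 := H.hn
  have h3 : e * (t : ℝ) ≤ cp * t := by
    have := H.hcp
    gcongr
  nlinarith [mul_le_mul_of_nonneg_left (h3.trans h1) H.hη0.le]

/-- The neurons race along each mode separately, with only the samples of label `l` as active steps.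
Leakage is proportional to the total time, which `s_le_count` bounds by the number of active steps.
-/
theorem early_race {t : ℕ} (ht : t ≤ T) (hs : η * t ≤ θ ^ 4)
    (hr : ∀ t' < t, Reg S u iw η e θ t') (l : Fin 2) :
    (η * Nat.count (fun i => lab i = some l) t ≤ 128 / e ^ 5 * alpha S X z u lab lam η t l (iw l)) ∧
      (∀ k, k ≠ iw l → align S u 0 l k + alpha S X z u lab lam η t l k
        ≤ profile (e ^ 8) (e ^ 44) (align S u 0 l (iw l))
          (align S u 0 l (iw l) + alpha S X z u lab lam η t l (iw l))) ∧
      (∀ k, |align S u t l k - align S u 0 l k - alpha S X z u lab lam η t l k|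
        ≤ e ^ 44 * (align S u 0 l (iw l) + alpha S X z u lab lam η t l (iw l))) := by
  have he0 := H.he0
  have hθ0 := H.hθ0
  have hη0 := H.hη0
  have hθ30 : 4 * θ ^ 30 ≤ e ^ 50 * (θ ^ 10 / 2) := by
    have := H.theta_div_le (p := 30) (q := 10) (r := 50) (by norm_num) (by norm_num)
    rw [div_le_iff₀ (by positivity)] at this
    have : 0 < θ ^ 30 := by positivity
    linarith
  have hwin := H.hwin l
  rw [show inner ℝ ((S 0).W (iw l)) (u l) = align S u 0 l (iw l) from rfl] at hwin
  have hlt : ∀ t', t' ≤ t → η * t' ≤ θ ^ 4 := fun t' h => le_trans (by gcongr) hs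
  -- The initial alignments are at most `θ ^ 10 / e ^ 2` and the leader is at least `θ ^ 10 / 2`,
  -- hence `L`. The factor `M = 2 / e` bounds the number of neurons. The margin `e ^ 6 θ ^ 10`,
  -- relative to a leader of at most `θ ^ 10 / e ^ 2`, is `g = e ^ 8`.
  have hrace := race (ι := Fin mD) (T := t) (x := fun t => align S u t l)
    (A := fun t => alpha S X z u lab lam η t l) (act := fun i => lab i = some l)
    (c := fun t => rate S X z u lab lam η t l) (i := iw l) (η := η) (L := 2 / e ^ 2) (M := 2 / e)
    (g := e ^ 8) (κ := e ^ 50) (κ₁ := e ^ 44) (y₀ := align S u 0 l (iw l))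
    (H.init_pos l) hη0
    (by rw [le_div_iff₀ (by positivity)]; linarith [pow_le_one₀ he0.le H.he1 (n := 2)])
    (by rw [le_div_iff₀ he0]; linarith [H.he1]) (by positivity)
    (pow_le_one₀ he0.le H.he1) (by positivity) (by positivity)
    (by
      have h : e ^ 50 * (16 * (2 / e ^ 2) ^ 2 * (2 / e)) = 128 * e ^ (44 + 1) := by
        field_simp
        ring
      rw [h]
      exact mul_pow_le_pow he0.le H.he 1 44 (by norm_num) (by norm_num))
    (by
      have := mul_pow_le_pow (c := 2000) he0.le H.he 36 8 (by norm_num) (by norm_num)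
      norm_num at this
      linarith)
    (by
      have h1 : e ^ 50 * (θ ^ 10 / 2) ≤ e ^ 44 * align S u 0 l (iw l) := by
        have := pow_le_pow_small he0.le H.he1 (p := 50) (q := 44) (by norm_num)
        gcongr
      have := H.hη
      linarith [pow_pos hθ0 30])
    (fun k => by simp [alpha]) rfl
    (fun k => by
      refine (H.init_le l k).trans ?_
      rw [div_mul_eq_mul_div]
      gcongr
      linarith)
    (fun k hk => by
      have h1 : align S u 0 l k ≤ align S u 0 l (iw l) - e ^ 6 * θ ^ 10 := H.hgap l k hk
      have h2 := (abs_le.1 (H.init_le l (iw l))).2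
      have h3 : e ^ 8 * align S u 0 l (iw l) ≤ e ^ 8 * (θ ^ 10 / e ^ 2) := by gcongr
      have h4 : e ^ 8 * (θ ^ 10 / e ^ 2) = e ^ 6 * θ ^ 10 := by field_simp
      linarith)
    (fun t' _ _ k => alpha_succ S X z u lab lam η t' l k)
    (fun t' _ h k => by rw [alpha_succ, rate, if_neg h, zero_mul, add_zero])
    (fun t' h _ => H.rate_nonneg (hr t' h).1.le l)
    (fun t' h hl Z hZ => by
      have hl' : lab t' = some l := hl
      have h1 := H.gradNorm_le_early (h.le.trans ht) (hlt t' h.le) (hr t' h) hl' hZ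
      have h2 := H.gradNorm_pos (h.le.trans ht) (hr t' h) hl'
      rw [rate, if_pos hl', mul_div_assoc', div_mul_eq_mul_div, div_le_div_iff₀ (by norm_num) h2]
      have := mul_le_mul_of_nonneg_left h1 hη0.le
      linarith)
    (fun t' h hl k => H.rate_mul_sq_le (h.le.trans ht) (hr t' h) hl k)
    (fun t' h k => by
      have h1 := H.abs_align_sub_alpha_le (h.trans ht) (fun i hi => hr i (hi.trans_le h)) l k
      refine h1.trans ?_
      have h2 := H.s_le_count (h.trans ht) l
      have h3 : 4 * e ^ 60 * (η * t') ≤ 4 * e ^ 59 * (η * Nat.count (fun i => lab i = some l) t' + θ ^ 30) := by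
        calc 4 * e ^ 60 * (η * t') = 4 * e ^ 59 * (e * (η * t')) := by ring
          _ ≤ _ := by gcongr
      have h4 : 4 * e ^ 59 ≤ e ^ 50 :=
        (mul_pow_le_pow he0.le H.he 1 58 (by norm_num) (by norm_num)).trans
          (pow_le_pow_small he0.le H.he1 (by norm_num))
      have h5 : 4 * e ^ 59 * (η * Nat.count (fun i => lab i = some l) t' + θ ^ 30)
        ≤ e ^ 50 * (η * Nat.count (fun i => lab i = some l) t' + θ ^ 30) := by gcongr
      have h6 : e ^ 50 * θ ^ 30 ≤ 1 * θ ^ 30 := by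
        gcongr
        exact pow_le_one₀ he0.le H.he1
      have h7 : e ^ 50 * (θ ^ 10 / 2) ≤ e ^ 50 * align S u 0 l (iw l) := by gcongr
      have := pow_pos hθ0 30
      linarith)
  obtain ⟨h1, -, h3, h4⟩ := hrace t le_rfl
  refine ⟨?_, h3, h4⟩
  have h : 16 * (2 / e ^ 2) ^ 2 * (2 / e) = 128 / e ^ 5 := by
    field_simp
    norm_num
  rw [h] at h1
  exact h1

/-- A bootstrap: the race uses `Reg` only at earlier times, and it returns a lower bound for the
leader that is stronger than `Reg`. -/
theorem early_reg (t : ℕ) (ht : t ≤ T) (hs : η * t ≤ θ ^ 4) : Reg S u iw η e θ t := by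
  induction t using Nat.strong_induction_on with
  | _ t ih =>
    have hη0 := H.hη0
    have he0 := H.he0
    have hr : ∀ t' < t, Reg S u iw η e θ t' := fun t' h =>
      ih t' h (h.le.trans ht) (le_trans (by gcongr) hs)
    refine ⟨lt_of_lt_of_le (half_pos H.a0_pos) (H.half_a0_le hs), fun l => ?_⟩
    obtain ⟨h1, -, h4⟩ := H.early_race ht hs hr l
    have h2 := H.s_le_count ht l
    have h5 := (abs_le.1 (h4 (iw l))).1
    have hA := H.alpha_nonneg hr l (iw l)
    have hwin : θ ^ 10 / 2 ≤ align S u 0 l (iw l) := H.hwin l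
    have h6 : e ^ 44 ≤ 1 / 1000 := by
      calc e ^ 44 ≤ e ^ 1 := pow_le_pow_small he0.le H.he1 (by norm_num)
        _ ≤ _ := by rw [pow_one]; exact H.he
    have h7 : e ^ 44 * (align S u 0 l (iw l) + alpha S X z u lab lam η t l (iw l))
        ≤ 1 / 1000 * (align S u 0 l (iw l) + alpha S X z u lab lam η t l (iw l)) := by
      have := H.init_pos l
      gcongr
    have h8 : e ^ 7 * (η * t) ≤ alpha S X z u lab lam η t l (iw l) + θ ^ 30 := by
      calc e ^ 7 * (η * t) = e ^ 6 * (e * (η * t)) := by ring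
        _ ≤ e ^ 6 * (128 / e ^ 5 * alpha S X z u lab lam η t l (iw l) + θ ^ 30) := by
          gcongr
          linarith
        _ = 128 * e * alpha S X z u lab lam η t l (iw l) + e ^ 6 * θ ^ 30 := by
          field_simp
        _ ≤ 1 * alpha S X z u lab lam η t l (iw l) + 1 * θ ^ 30 := by
          have := H.hθ0
          gcongr
          · linarith [H.he]
          · exact pow_le_one₀ he0.le H.he1
        _ = _ := by ring
    have h9 : θ ^ 30 ≤ θ ^ 10 / 1000 := by
      have := H.theta_div_le (p := 30) (q := 10) (r := 0) (by norm_num) (by norm_num)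
      rw [pow_zero, div_one] at this
      linarith
    have h10 := pow_pos H.hθ0 10
    linarith

end DiscSetup

/-! ### The late phase -/

/-- With one dominant neuron the gradients are close to `p Y³` in `a` and `3 a p Y²` in `W`, so the
normalizer is close to `p Y² (Y + 3 a)`. Hence `a` moves by `η Y / (Y + 3 a)` and the alignment by
`3 η a / (Y + 3 a)`: the factor `p` cancels. -/
theorem late_step_real {p Y a η gA gB gW N ε : ℝ} (hp : 0 < p) (hY : 0 < Y) (ha : 0 < a)
    (hη : 0 < η) (hε : 0 < ε) (hε1 : ε ≤ 1 / 100)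
    (hA : |gA - p * Y ^ 3| ≤ ε * (p * Y ^ 3))
    (hB0 : 0 ≤ gB) (hB : gB ≤ ε * (3 * a * p * Y ^ 2))
    (hW1 : (1 - ε) * (3 * a * p * Y ^ 2) ≤ gW) (hW2 : gW ≤ (1 + ε) * (3 * a * p * Y ^ 2))
    (hN : N = |gA| + gB + gW) :
    η * Y * (1 - 4 * ε) ≤ η * (gA / N) * (Y + 3 * a) ∧
    η * (3 * a) * (1 - 4 * ε) ≤ η * (3 * a * p / N) * Y ^ 2 * (Y + 3 * a) ∧
    η * (3 * a * p / N) * Y ^ 2 * (Y + 3 * a) ≤ η * (3 * a) * (1 + 4 * ε) := by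
  have hP : 0 < p * Y ^ 3 := by positivity
  have hM : 0 < 3 * a * p * Y ^ 2 := by positivity
  set P := p * Y ^ 3 with hPd
  set M := 3 * a * p * Y ^ 2 with hMd
  obtain ⟨hA1, hA2⟩ := abs_le.1 hA
  have hgA : 0 < gA := by nlinarith
  rw [abs_of_pos hgA] at hN
  have hN1 : (1 - ε) * (P + M) ≤ N := by rw [hN]; linarith
  have hN2 : N ≤ (1 + 2 * ε) * (P + M) := by
    rw [hN]
    have := mul_pos hε hP
    linarith
  have hN0 : 0 < N := lt_of_lt_of_le (mul_pos (by linarith) (by linarith)) hN1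
  have hPM : P + M = p * Y ^ 2 * (Y + 3 * a) := by rw [hPd, hMd]; ring
  have hpy : 0 < p * Y ^ 2 := by positivity
  have k1 : (1 - 4 * ε) * (1 + 2 * ε) ≤ 1 - ε := by nlinarith
  have k2 : 1 ≤ (1 + 4 * ε) * (1 - ε) := by nlinarith
  have k3 : (1 - 4 * ε) * N ≤ (1 - ε) * (P + M) := by
    calc (1 - 4 * ε) * N ≤ (1 - 4 * ε) * ((1 + 2 * ε) * (P + M)) := by
          apply mul_le_mul_of_nonneg_left hN2; linarith
      _ = ((1 - 4 * ε) * (1 + 2 * ε)) * (P + M) := by ring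
      _ ≤ _ := by gcongr
  have k4 : P + M ≤ (1 + 4 * ε) * N := by
    calc P + M = 1 * (P + M) := by ring
      _ ≤ ((1 + 4 * ε) * (1 - ε)) * (P + M) := by gcongr
      _ = (1 + 4 * ε) * ((1 - ε) * (P + M)) := by ring
      _ ≤ _ := by gcongr
  refine ⟨?_, ?_, ?_⟩
  · have e1 : η * (gA / N) * (Y + 3 * a) = η * (gA * (Y + 3 * a)) / N := by ring
    rw [e1, le_div_iff₀ hN0]
    have h1 : Y * ((1 - ε) * (P + M)) ≤ gA * (Y + 3 * a) := by
      rw [hPM]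
      have : (1 - ε) * P ≤ gA := by linarith
      calc Y * ((1 - ε) * (p * Y ^ 2 * (Y + 3 * a))) = ((1 - ε) * P) * (Y + 3 * a) := by
            rw [hPd]; ring
        _ ≤ _ := by gcongr
    calc η * Y * (1 - 4 * ε) * N = η * (Y * ((1 - 4 * ε) * N)) := by ring
      _ ≤ η * (Y * ((1 - ε) * (P + M))) := by gcongr
      _ ≤ _ := by gcongr
  · have e1 : η * (3 * a * p / N) * Y ^ 2 * (Y + 3 * a) = η * (3 * a) * (P + M) / N := by
      rw [hPM]; ring
    rw [e1, le_div_iff₀ hN0]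
    calc η * (3 * a) * (1 - 4 * ε) * N = η * (3 * a) * ((1 - 4 * ε) * N) := by ring
      _ ≤ η * (3 * a) * ((1 - ε) * (P + M)) := by gcongr
      _ ≤ η * (3 * a) * (1 * (P + M)) := by gcongr; linarith
      _ = _ := by ring
  · have e1 : η * (3 * a * p / N) * Y ^ 2 * (Y + 3 * a) = η * (3 * a) * (P + M) / N := by
      rw [hPM]; ring
    rw [e1, div_le_iff₀ hN0]
    calc η * (3 * a) * (P + M) ≤ η * (3 * a) * ((1 + 4 * ε) * N) := by gcongr
      _ = _ := by ring

/-- If `A₀ > 1.9 a`, then `3 a² ≤ (3 / 3.61) A₀²` and the balance forces both `A₀` and `A₁` below `s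
/ 400`. Then `a` is small as well, and the sum cannot reach `0.9 s`. -/
theorem le_of_balance {a A₀ A₁ s : ℝ} (ha : 0 < a) (h0 : 0 ≤ A₀) (h1 : 0 ≤ A₁) (hs : 0 < s)
    (hJ : -(s ^ 2 / 1000000) ≤ 3 * a ^ 2 - A₀ ^ 2 - A₁ ^ 2) (hS : 0.9 * s ≤ a + A₀ + A₁) :
    A₀ ≤ 1.9 * a := by
  by_contra hcon
  push Not at hcon
  have k1 : 3.61 * a ^ 2 ≤ A₀ ^ 2 := by nlinarith
  have k2 : A₀ ^ 2 ≤ (s / 400) ^ 2 := by nlinarith [sq_nonneg A₁]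
  have k3 : A₁ ^ 2 ≤ (s / 400) ^ 2 := by nlinarith [sq_nonneg A₀]
  have k4 : A₀ ≤ s / 400 := (pow_le_pow_iff_left₀ h0 (by positivity) two_ne_zero).1 k2
  have k5 : A₁ ≤ s / 400 := (pow_le_pow_iff_left₀ h1 (by positivity) two_ne_zero).1 k3
  linarith

/-- When the leader has grown from `y₀` to `y`, competitors are left at the geometric mean `√(y₀
y)`, up to polylogarithmic factors and the error term. -/
theorem profile_le_sqrt {g κ y₀ y : ℝ} (hg : 0 < g) (hy₀ : 0 < y₀) (hy : 0 < y) :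
    profile g κ y₀ y ≤ 2 / g * √(y₀ * y) + 20 * κ * y := by
  have h0 := Real.sqrt_pos.2 hy₀
  have h1 := Real.sqrt_pos.2 hy
  have h2 : y / (1 + g / 2 / √y₀ * √y) ≤ 2 / g * √(y₀ * y) := by
    rw [div_le_iff₀ (by positivity), Real.sqrt_mul hy₀.le]
    have h3 : √y * √y = y := Real.mul_self_sqrt hy.le
    calc y = 2 / g * (√y₀ * √y) * (g / 2 / √y₀ * √y) := by
          field_simp
          nlinarith
      _ ≤ 2 / g * (√y₀ * √y) * (1 + g / 2 / √y₀ * √y) := by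
          gcongr
          linarith
  simp only [profile]
  linarith

namespace DiscSetup
variable {mD mG d : ℕ} {S : ℕ → State mD mG d} {X : ℕ → Vec d} {z : ℕ → Fin mG → Bool}
    {u : Fin 2 → Vec d} {lab : ℕ → Option (Fin 2)} {iw : Fin 2 → Fin mD}
    {lam η ηG e θ cp : ℝ} {n T : ℕ}

/-- In the late phase the leading neurons dominate and the output weight keeps up with them. -/
def Late (S : ℕ → State mD mG d) (u : Fin 2 → Vec d) (iw : Fin 2 → Fin mD) (η e θ : ℝ)
    (t : ℕ) : Prop :=
  Reg S u iw η e θ t ∧ (∀ l k, k ≠ iw l → |align S u t l k| ≤ e ^ 20 * align S u t l (iw l)) ∧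
    (∀ l, align S u t l (iw l) ≤ 2 * (S t).a) ∧ e ^ 9 * (S 0).a ≤ (S t).a

variable (H : DiscSetup S X z u lab iw lam η ηG e θ cp n T)
include H

theorem pow_le_tiny {q : ℕ} (h : 2 ≤ q) : 1000 * e ^ q ≤ e ^ (q - 1) := by
  have := mul_pow_le_pow (c := 1000) H.he0.le H.he 1 (q - 1) (by norm_num) (by norm_num)
  rwa [Nat.sub_add_cancel (by omega)] at this

/-- Checks the hypotheses of `late_step_real` with relative error `e ^ 20`: the other neurons are
negligible by domination, the generated sample by the cubic estimates. -/
theorem late_step {t : ℕ} (ht : t ≤ T) (hs : θ ^ 4 / 2 ≤ η * t) (hL : Late S u iw η e θ t)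
    {l : Fin 2} (hl : lab t = some l) :
    η * align S u t l (iw l) * (1 - 4 * e ^ 20)
      ≤ ((S (t + 1)).a - (S t).a) * (align S u t l (iw l) + 3 * (S t).a) ∧
    η * (3 * (S t).a) * (1 - 4 * e ^ 20)
      ≤ rate S X z u lab lam η t l * align S u t l (iw l) ^ 2
        * (align S u t l (iw l) + 3 * (S t).a) ∧
    rate S X z u lab lam η t l * align S u t l (iw l) ^ 2 * (align S u t l (iw l) + 3 * (S t).a)
      ≤ η * (3 * (S t).a) * (1 + 4 * e ^ 20) := by
  obtain ⟨hr, hdom, -, ha0⟩ := hL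
  have he0 := H.he0
  have he1 := H.he1
  have hθ0 := H.hθ0
  have ha := hr.1
  have hY := H.lead_pos hr l
  have hp := realGap_pos (lam := lam) (S := S t) (X := u l)
  have hp1 := realGap_le_one (lam := lam) (S := S t) (X := u l)
  have hpe := H.hp t ht l hl
  have hW := H.norm_row_le ht
  set Y := align S u t l (iw l) with hYd
  set p := realGap lam (S t) (u l) with hpd
  have hfs2 := H.fakeSize_le_gap ht hr hl
  have hfs3 := fake_le_cube H.he0 H.he H.hθ0 H.hθ hs (hr.2 l) (H.fakeSize_bound ht)
  rw [← hYd] at hfs2 hfs3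
  have hmD : (mD : ℝ) ≤ 2 / e := by rw [le_div_iff₀ he0]; exact H.hm
  -- sums over the neurons
  have hsq : ∀ k, k ≠ iw l → align S u t l k ^ 2 ≤ e ^ 40 * Y ^ 2 := fun k hk => by
    have := hdom l k hk
    rw [← sq_abs]
    calc |align S u t l k| ^ 2 ≤ (e ^ 20 * Y) ^ 2 := by gcongr
      _ = _ := by ring
  have hcu : ∀ k, k ≠ iw l → |align S u t l k| ^ 3 ≤ e ^ 60 * Y ^ 3 := fun k hk => by
    have := hdom l k hk
    calc |align S u t l k| ^ 3 ≤ (e ^ 20 * Y) ^ 3 := by gcongr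
      _ = _ := by ring
  have hsumsq : ∑ k, align S u t l k ^ 2 ≤ (1 + e ^ 30) * Y ^ 2 := by
    rw [← Finset.add_sum_erase _ _ (Finset.mem_univ (iw l)), ← hYd]
    have h1 : ∑ k ∈ Finset.univ.erase (iw l), align S u t l k ^ 2 ≤ mD * (e ^ 40 * Y ^ 2) := by
      have := Finset.sum_le_card_nsmul (Finset.univ.erase (iw l)) (fun k => align S u t l k ^ 2)
        (e ^ 40 * Y ^ 2) fun k hk => hsq k (Finset.ne_of_mem_erase hk)
      rw [nsmul_eq_mul] at this
      refine this.trans ?_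
      gcongr
      exact (Finset.card_le_univ _).trans (by simp)
    have h2 : mD * (e ^ 40 * Y ^ 2) ≤ e ^ 30 * Y ^ 2 := by
      calc mD * (e ^ 40 * Y ^ 2) = (mD * e) * e ^ 39 * Y ^ 2 := by ring
        _ ≤ 2 * e ^ 39 * Y ^ 2 := by have := H.hm; gcongr
        _ ≤ e ^ 30 * Y ^ 2 := by
          have := (mul_pow_le_pow he0.le H.he 1 38 (c := 2) (by norm_num) (by norm_num)).trans
            (pow_le_pow_small he0.le he1 (by norm_num : 30 ≤ 38))
          gcongr
    linarith
  have hsumcu : |∑ k, align S u t l k ^ 3 - Y ^ 3| ≤ e ^ 30 * Y ^ 3 := by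
    rw [← Finset.add_sum_erase _ _ (Finset.mem_univ (iw l)), ← hYd, add_sub_cancel_left]
    refine (Finset.abs_sum_le_sum_abs _ _).trans ?_
    have h1 : ∑ k ∈ Finset.univ.erase (iw l), |align S u t l k ^ 3| ≤ mD * (e ^ 60 * Y ^ 3) := by
      have := Finset.sum_le_card_nsmul (Finset.univ.erase (iw l)) (fun k => |align S u t l k ^ 3|)
        (e ^ 60 * Y ^ 3) fun k hk => by
          rw [abs_pow]; exact hcu k (Finset.ne_of_mem_erase hk)
      rw [nsmul_eq_mul] at this
      refine this.trans ?_
      gcongr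
      exact (Finset.card_le_univ _).trans (by simp)
    refine h1.trans ?_
    calc mD * (e ^ 60 * Y ^ 3) = (mD * e) * e ^ 59 * Y ^ 3 := by ring
      _ ≤ 2 * e ^ 59 * Y ^ 3 := by have := H.hm; gcongr
      _ ≤ e ^ 30 * Y ^ 3 := by
        have := (mul_pow_le_pow he0.le H.he 1 58 (c := 2) (by norm_num) (by norm_num)).trans
          (pow_le_pow_small he0.le he1 (by norm_num : 30 ≤ 58))
        gcongr
  -- the three gradients
  have hA : |gradA lam (u l) (z t) (S t) - p * Y ^ 3| ≤ e ^ 20 * (p * Y ^ 3) := by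
    have h1 := abs_gradA_sub_le (lam := lam) (X := u l) (z := z t) hW
    have h2 : |p * ∑ k, align S u t l k ^ 3 - p * Y ^ 3| ≤ p * (e ^ 30 * Y ^ 3) := by
      rw [← mul_sub, abs_mul, abs_of_pos hp]
      gcongr
    have h3 : 1 / e * fakeSize (S t) (z t) ≤ e ^ 30 * (p * Y ^ 3) := by
      calc 1 / e * fakeSize (S t) (z t) ≤ 1 / e * (e ^ 130 * Y ^ 3) := by gcongr
        _ = e ^ 128 * (e * Y ^ 3) := by field_simp
        _ ≤ e ^ 30 * (p * Y ^ 3) := by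
          have := pow_le_pow_small he0.le he1 (by norm_num : 30 ≤ 128)
          gcongr
    have h4 := abs_sub_le (gradA lam (u l) (z t) (S t)) (p * ∑ k, align S u t l k ^ 3) (p * Y ^ 3)
    have h5 : 2 * e ^ 30 ≤ e ^ 20 :=
      (mul_pow_le_pow he0.le H.he 1 29 (c := 2) (by norm_num) (by norm_num)).trans
            (pow_le_pow_small he0.le he1 (by norm_num : 20 ≤ 29))
    have h6 : 2 * e ^ 30 * (p * Y ^ 3) ≤ e ^ 20 * (p * Y ^ 3) := by gcongr
    simp only [align, ← hpd] at h1 h2 h4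
    linarith
  -- After the early phase `Y` is at least of order `e ^ 7 θ ^ 4` and `a ≥ e ^ 9 θ`, so `a p Y²` is
  -- of order `θ ^ 9` up to powers of `e`, and the crude bound `lam ≤ θ ^ 10` suffices.
  have hB : |gradB lam (u l) (z t) (S t)| ≤ e ^ 20 * (3 * (S t).a * p * Y ^ 2) := by
    refine (abs_gradB_le H.hlam0).trans (H.hlam.trans ?_)
    have h1 : e ^ 7 * θ ^ 4 ≤ 8 * Y := by
      have h2 := hr.2 l
      have h3 : 0 < θ ^ 10 := by positivity
      have h4 : e ^ 7 * (θ ^ 4 / 2) ≤ e ^ 7 * (η * t) := by gcongr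
      rw [← hYd] at h2
      linarith
    have h2 : (e ^ 7 * θ ^ 4) ^ 2 ≤ (8 * Y) ^ 2 := by gcongr
    have h3 : θ ≤ (S 0).a := H.hθa.trans
      (mul_le_of_le_one_right H.a0_pos.le (pow_le_one₀ he0.le he1))
    have ha00 := H.a0_pos
    have h5 := H.theta_div_le (p := 10) (q := 9) (r := 44) (by norm_num) (by norm_num)
    rw [div_le_iff₀ (by positivity)] at h5
    calc θ ^ 10 ≤ θ ^ 9 * e ^ 44 / 1000 := by linarith
      _ = e ^ 20 * ((e ^ 9 * θ) * e * ((e ^ 7 * θ ^ 4) ^ 2 / 1000)) := by ring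
      _ ≤ e ^ 20 * ((e ^ 9 * (S 0).a) * e * ((8 * Y) ^ 2 / 1000)) := by gcongr
      _ ≤ e ^ 20 * ((S t).a * p * ((8 * Y) ^ 2 / 1000)) := by gcongr
      _ = e ^ 20 * (0.064 * ((S t).a * p * Y ^ 2)) := by ring
      _ ≤ e ^ 20 * (3 * ((S t).a * p * Y ^ 2)) := by
        gcongr
        norm_num
      _ = _ := by ring
  have h30 : e ^ 30 + e ^ 100 ≤ e ^ 20 := by
    have h1 : 2 * e ^ 30 ≤ e ^ 20 :=
      (mul_pow_le_pow he0.le H.he 1 29 (c := 2) (by norm_num) (by norm_num)).trans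
            (pow_le_pow_small he0.le he1 (by norm_num : 20 ≤ 29))
    have := pow_le_pow_small he0.le he1 (by norm_num : 30 ≤ 100)
    linarith
  have hM0 : 0 ≤ 3 * (S t).a * p * Y ^ 2 := by positivity
  have hfa : 3 * (S t).a * fakeSize (S t) (z t) ≤ e ^ 100 * (3 * (S t).a * p * Y ^ 2) := by
    calc _ ≤ 3 * (S t).a * (e ^ 100 * (p * Y ^ 2)) := by gcongr
      _ = _ := by ring
  have hW1 : (1 - e ^ 20) * (3 * (S t).a * p * Y ^ 2) ≤ ‖gradW lam (u l) (z t) (S t)‖ := by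
    have h1 := le_norm_gradW (lam := lam) (z := z t) ha.le (H.hu l) (iw l)
    rw [← hpd, show inner ℝ ((S t).W (iw l)) (u l) = Y from rfl] at h1
    have := mul_le_mul_of_nonneg_right h30 hM0
    have : 0 ≤ e ^ 30 * (3 * (S t).a * p * Y ^ 2) := by positivity
    linarith
  have hW2 : ‖gradW lam (u l) (z t) (S t)‖ ≤ (1 + e ^ 20) * (3 * (S t).a * p * Y ^ 2) := by
    have h1 := norm_gradW_le (lam := lam) (z := z t) ha.le (H.hu l)
    have h2 : 3 * (S t).a * p * ∑ k, align S u t l k ^ 2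
      ≤ 3 * (S t).a * p * ((1 + e ^ 30) * Y ^ 2) := by gcongr
    have := mul_le_mul_of_nonneg_right h30 hM0
    simp only [align, ← hpd] at h1 h2
    linarith
  have he20 : e ^ 20 ≤ 1 / 100 := by
    calc e ^ 20 ≤ e ^ 1 := pow_le_pow_small he0.le he1 (by norm_num)
      _ ≤ _ := by rw [pow_one]; linarith [H.he]
  have key := late_step_real hp hY ha H.hη0 (by positivity : 0 < e ^ 20) he20 hA (abs_nonneg _) hB
    hW1 hW2 rfl
  have hda : (S (t + 1)).a - (S t).a = η * (gradA lam (u l) (z t) (S t)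
      / (|gradA lam (u l) (z t) (S t)| + |gradB lam (u l) (z t) (S t)|
        + ‖gradW lam (u l) (z t) (S t)‖)) := by
    rw [H.hstep, cubicStep]
    simp only [add_sub_cancel_left, H.hX t l hl, gradNorm]
  have hra : rate S X z u lab lam η t l = η * (3 * (S t).a * p
      / (|gradA lam (u l) (z t) (S t)| + |gradB lam (u l) (z t) (S t)|
        + ‖gradW lam (u l) (z t) (S t)‖)) := by
    rw [rate, if_pos hl, H.hX t l hl, gradNorm]
  rw [hda, hra]
  exact key

end DiscSetup

/-- At the ideal speeds `6 a da = 2 Y dA`, so `3 a² - A²` would be conserved if `Y = A`. The losses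
come from the relative error `ε`, from `|Y - A| ≤ δ` and from the second order term `(A' - A)²`; the
square of the step in `a` has the favourable sign. -/
theorem balance_step {a a' A A' Y η ε s δ : ℝ} (ha : 0 < a) (hY : 0 < Y) (hA : 0 ≤ A)
    (hη : 0 ≤ η)
    (h1 : η * Y * (1 - 4 * ε) ≤ (a' - a) * (Y + 3 * a))
    (h2 : (A' - A) * (Y + 3 * a) ≤ η * (3 * a) * (1 + 4 * ε))
    (h3 : 0 ≤ A' - A) (h4 : A' - A ≤ 2 * η) (hYA : |Y - A| ≤ δ) (hε : 0 ≤ ε)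
    (hYs : Y + A ≤ s) :
    3 * a ^ 2 - A ^ 2 - 2 * η * (4 * ε * s + δ) - 4 * η ^ 2 ≤ 3 * a' ^ 2 - A' ^ 2 := by
  have hD : 0 < Y + 3 * a := by positivity
  have k1 : 3 * a ^ 2 + 6 * a * (a' - a) ≤ 3 * a' ^ 2 := by nlinarith [sq_nonneg (a' - a)]
  have k2 : A' ^ 2 = A ^ 2 + 2 * A * (A' - A) + (A' - A) ^ 2 := by ring
  have k3 : (A' - A) ^ 2 ≤ 4 * η ^ 2 := by nlinarith
  have hδ : 0 ≤ 4 * ε * s + δ := by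
    have := abs_nonneg (Y - A)
    have : 0 ≤ s := by linarith
    have := mul_nonneg hε this
    linarith
  have k4 : -(2 * η * (4 * ε * s + δ)) * (Y + 3 * a)
      ≤ (6 * a * (a' - a) - 2 * A * (A' - A)) * (Y + 3 * a) := by
    have e1 := mul_le_mul_of_nonneg_left h1 (by positivity : 0 ≤ 6 * a)
    have e2 := mul_le_mul_of_nonneg_left h2 (by positivity : 0 ≤ 2 * A)
    have e3 : A - Y ≤ δ := by linarith [(abs_le.1 hYA).1]
    have e4 : 6 * a * (η * (4 * ε * (Y + A) + (A - Y))) ≤ 6 * a * (η * (4 * ε * s + δ)) := by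
      gcongr
    have e5 : 0 ≤ 2 * η * (4 * ε * s + δ) * Y := by positivity
    nlinarith
  have k5 := le_of_mul_le_mul_right k4 hD
  linarith

namespace DiscSetup
variable {mD mG d : ℕ} {S : ℕ → State mD mG d} {X : ℕ → Vec d} {z : ℕ → Fin mG → Bool}
    {u : Fin 2 → Vec d} {lab : ℕ → Option (Fin 2)} {iw : Fin 2 → Fin mD}
    {lam η ηG e θ cp : ℝ} {n T : ℕ}
variable (H : DiscSetup S X z u lab iw lam η ηG e θ cp n T)
include H

theorem theta_le_time {t p r : ℕ} (hs : θ ^ 4 / 2 ≤ η * t) (hp : 5 ≤ p) (hr : r ≤ 150) :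
    400 * θ ^ p ≤ e ^ r * (η * t) := by
  have h := H.theta_div_le (p := p) (q := 4) (r := r) (by omega) hr
  have he := pow_pos H.he0 r
  rw [div_le_iff₀ he] at h
  have := mul_le_mul_of_nonneg_left hs he.le
  have := pow_pos H.hθ0 p
  linarith

theorem abs_align_sub_alpha_le_late {t : ℕ} (ht : t ≤ T) (hs : θ ^ 4 / 2 ≤ η * t)
    (hr : ∀ t' < t, Reg S u iw η e θ t') (l : Fin 2) (k : Fin mD) :
    |align S u t l k - alpha S X z u lab lam η t l k| ≤ e ^ 50 * (η * t) := by
  have h1 := H.abs_align_sub_alpha_le ht hr l k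
  have h2 := H.init_le l k
  have h3 := abs_add_le (align S u t l k - align S u 0 l k - alpha S X z u lab lam η t l k)
    (align S u 0 l k)
  have e1 : align S u t l k - align S u 0 l k - alpha S X z u lab lam η t l k + align S u 0 l k
    = align S u t l k - alpha S X z u lab lam η t l k := by ring
  rw [e1] at h3
  have h4 := H.theta_le_time hs (p := 30) (r := 50) (by norm_num) (by norm_num)
  have h5 := H.theta_le_time hs (p := 10) (r := 52) (by norm_num) (by norm_num)
  have h6 : θ ^ 10 / e ^ 2 ≤ e ^ 50 * (η * t) / 400 := by
    rw [div_le_iff₀ (pow_pos H.he0 2)]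
    calc θ ^ 10 ≤ e ^ 52 * (η * t) / 400 := by linarith
      _ = _ := by ring
  have h7 : 1000 * e ^ 60 ≤ e ^ 50 := (H.pow_le_tiny (q := 60) (by norm_num)).trans
    (pow_le_pow_small H.he0.le H.he1 (by norm_num))
  have h8 := mul_le_mul_of_nonneg_right h7 (H.s_nonneg t)
  have h9 := mul_nonneg (pow_nonneg H.he0.le 50) (H.s_nonneg t)
  linarith

/-- The two speeds add up to `η`, the balance is kept, and `Y ≤ 2 a` gives the leader at least `3 /
5` of the step, up to a factor `1 - 4 e ^ 20`. -/
theorem late_step_summary {t : ℕ} (ht : t ≤ T) (hs : θ ^ 4 / 2 ≤ η * t)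
    (hr : ∀ t' < t, Reg S u iw η e θ t') (hL : Late S u iw η e θ t) {l : Fin 2}
    (hl : lab t = some l) :
    η * (1 - 4 * e ^ 20) ≤ (S (t + 1)).a - (S t).a
      + rate S X z u lab lam η t l * align S u t l (iw l) ^ 2 ∧
    3 * (S t).a ^ 2 - alpha S X z u lab lam η t l (iw l) ^ 2 - 100 * e ^ 20 * η * (η * t)
      ≤ 3 * (S (t + 1)).a ^ 2 - alpha S X z u lab lam η (t + 1) l (iw l) ^ 2 ∧
    η * (1 / 2) ≤ rate S X z u lab lam η t l * align S u t l (iw l) ^ 2 := by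
  have he0 := H.he0
  have hη0 := H.hη0
  have ha := hL.1.1
  obtain ⟨s1, s2, s3⟩ := H.late_step ht hs hL hl
  have hY := H.lead_pos hL.1 l
  have hD : 0 < align S u t l (iw l) + 3 * (S t).a := by positivity
  have he20 : 0 < e ^ 20 := by positivity
  have hΔ0 : 0 ≤ rate S X z u lab lam η t l * align S u t l (iw l) ^ 2 :=
    mul_nonneg (H.rate_nonneg ha.le l) (sq_nonneg _)
  have hΔ2 := H.rate_mul_sq_le ht hL.1 hl (iw l)
  have hA := H.alpha_nonneg hr l (iw l)
  have hYA := H.abs_align_sub_alpha_le_late ht hs hr l (iw l)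
  have hAle := H.alpha_le ht hr l (iw l)
  rw [alpha_succ]
  generalize rate S X z u lab lam η t l * align S u t l (iw l) ^ 2 = ΔA at *
  generalize alpha S X z u lab lam η t l (iw l) = A at *
  refine ⟨?_, ?_, ?_⟩
  · refine le_of_mul_le_mul_right ?_ hD
    linarith
  · have e50 : e ^ 50 ≤ 1 / 1000 := by
      calc e ^ 50 ≤ e ^ 1 := pow_le_pow_small he0.le H.he1 (by norm_num)
        _ ≤ _ := by rw [pow_one]; exact H.he
    have k0 : e ^ 50 * (η * t) ≤ 1 / 1000 * (η * t) := by gcongr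
    have k1 := balance_step (s := 5 * (η * t)) (A' := A + ΔA)
      ha hY hA hη0.le s1 (by rwa [add_sub_cancel_left]) (by rwa [add_sub_cancel_left])
      (by rwa [add_sub_cancel_left]) hYA he20.le
      (by linarith [(abs_le.1 hYA).2, H.s_nonneg t])
    have k2 : 4 * η ^ 2 ≤ η * (e ^ 20 * (η * t)) := by
      have h1 := H.theta_le_time hs (p := 30) (r := 20) (by norm_num) (by norm_num)
      have h2 := H.hη
      have h3 : 4 * η ≤ e ^ 20 * (η * t) := by
        have := pow_pos H.hθ0 30
        linarith
      calc 4 * η ^ 2 = η * (4 * η) := by ring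
        _ ≤ _ := by gcongr
    have k3 : e ^ 50 * (η * t) ≤ e ^ 20 * (η * t) := by
      have := pow_le_pow_small he0.le H.he1 (by norm_num : 20 ≤ 50)
      gcongr
    have k4 : η * (e ^ 50 * (η * t)) ≤ η * (e ^ 20 * (η * t)) := by gcongr
    have k6 : 0 ≤ η * (e ^ 20 * (η * t)) := by positivity
    linarith
  · have h2a := hL.2.2.1 l
    refine le_of_mul_le_mul_right ?_ hD
    refine le_trans ?_ s2
    have he20' : e ^ 20 ≤ 1 / 1000 := by
      calc e ^ 20 ≤ e ^ 1 := pow_le_pow_small he0.le H.he1 (by norm_num)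
        _ ≤ _ := by rw [pow_one]; exact H.he
    have h1 := mul_le_mul_of_nonneg_left h2a hη0.le
    have hηa : 0 < η * (S t).a := by positivity
    have h3 : e ^ 20 * (η * (S t).a) ≤ 1 / 1000 * (η * (S t).a) := by gcongr
    linarith

/-- Summary of the growth since the end of the early phase. -/
theorem late_growth {T₁ t : ℕ} (h1 : T₁ ≤ t) (ht : t ≤ T) (hs : θ ^ 4 / 2 ≤ η * T₁)
    (hr : ∀ t' < T₁, Reg S u iw η e θ t') (hL : ∀ t' < t, T₁ ≤ t' → Late S u iw η e θ t') :
    ((S T₁).a + ∑ l, alpha S X z u lab lam η T₁ l (iw l) + (1 - 4 * e ^ 20) * (η * t - η * T₁)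
        - 2 * (η * Nat.count (fun i => lab i = none) t)
      ≤ (S t).a + ∑ l, alpha S X z u lab lam η t l (iw l)) ∧
    (3 * (S T₁).a ^ 2 - ∑ l, alpha S X z u lab lam η T₁ l (iw l) ^ 2
        - 100 * e ^ 20 * ((S 0).a + η * t) * (η * t)
        - 6 * ((S 0).a + η * t) * (η * Nat.count (fun i => lab i = none) t)
      ≤ 3 * (S t).a ^ 2 - ∑ l, alpha S X z u lab lam η t l (iw l) ^ 2) ∧
    (∀ l, η * Nat.count (fun i => lab i = some l) t
        ≤ 2 * (alpha S X z u lab lam η t l (iw l) - alpha S X z u lab lam η T₁ l (iw l))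
          + η * Nat.count (fun i => lab i = some l) T₁) ∧
    ∀ l, ∀ k, k ≠ iw l → alpha S X z u lab lam η t l k
        ≤ alpha S X z u lab lam η T₁ l k + 2 * e ^ 40 * (η * t) := by
  have he0 := H.he0
  have hη0 := H.hη0
  have hθ0 := H.hθ0
  have ha00 := H.a0_pos
  set R := (S 0).a + η * t with hR
  have hR0 : 0 ≤ R := by positivity
  have key : ∀ t', T₁ ≤ t' → t' ≤ t →
    ((S T₁).a + ∑ l, alpha S X z u lab lam η T₁ l (iw l) + (1 - 4 * e ^ 20) * (η * t' - η * T₁)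
        - 2 * (η * Nat.count (fun i => lab i = none) t')
      ≤ (S t').a + ∑ l, alpha S X z u lab lam η t' l (iw l)) ∧
    (3 * (S T₁).a ^ 2 - ∑ l, alpha S X z u lab lam η T₁ l (iw l) ^ 2
        - 100 * e ^ 20 * R * (η * t')
        - 6 * R * (η * Nat.count (fun i => lab i = none) t')
      ≤ 3 * (S t').a ^ 2 - ∑ l, alpha S X z u lab lam η t' l (iw l) ^ 2) ∧
    (∀ l, η * Nat.count (fun i => lab i = some l) t'
        ≤ 2 * (alpha S X z u lab lam η t' l (iw l) - alpha S X z u lab lam η T₁ l (iw l))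
          + η * Nat.count (fun i => lab i = some l) T₁) ∧
    ∀ l, ∀ k, k ≠ iw l → alpha S X z u lab lam η t' l k
        ≤ alpha S X z u lab lam η T₁ l k + 2 * e ^ 40 * (η * t') := by
    intro t' h1
    induction t', h1 using Nat.le_induction with
    | base =>
      intro _
      refine ⟨?_, ?_, ?_, ?_⟩
      · have : 0 ≤ η * (Nat.count (fun i => lab i = none) T₁ : ℝ) := by positivity
        linarith
      · have : 0 ≤ 6 * R * (η * (Nat.count (fun i => lab i = none) T₁ : ℝ)) := by positivity
        have : 0 ≤ 100 * e ^ 20 * R * (η * (T₁ : ℝ)) := by positivity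
        linarith
      · intro l
        linarith
      · intro l k _
        have : 0 ≤ 2 * e ^ 40 * (η * (T₁ : ℝ)) := by positivity
        linarith
    | succ t' h1 ih =>
      intro h2
      obtain ⟨i1, i2, i3, i4⟩ := ih (Nat.le_of_succ_le h2)
      have ht'T : t' ≤ T := (Nat.le_of_succ_le h2).trans ht
      have hLt := hL t' h2 h1
      have hst : θ ^ 4 / 2 ≤ η * t' := hs.trans (by gcongr)
      have hrt : ∀ t'' < t', Reg S u iw η e θ t'' := fun t'' h => by
        rcases lt_or_ge t'' T₁ with h' | h'
        · exact hr t'' h'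
        · exact (hL t'' (h.trans h2) h').1
      have hcast : ((t' + 1 : ℕ) : ℝ) = t' + 1 := by push_cast; ring
      have hda : |(S (t' + 1)).a - (S t').a| ≤ η := by
        rw [H.hstep]
        linarith [cubicStep_displacement (lam := lam) (etaG := ηG) (X := X t') (z := z t')
          (S := S t') H.hη0.le,
          abs_nonneg ((cubicStep lam η ηG (X t') (z t') (S t')).b - (S t').b),
          norm_nonneg ((cubicStep lam η ηG (X t') (z t') (S t')).W - (S t').W)]
      have he20 : 0 < e ^ 20 := by positivity
      have hpos1 : 0 ≤ 100 * e ^ 20 * R * η := by positivity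
      have ha := hLt.1.1
      have hst' : η * (t' : ℝ) ≤ η * t := by
        have : (t' : ℝ) ≤ t := by exact_mod_cast Nat.le_of_succ_le h2
        gcongr
      have haR : (S t').a ≤ R := by
        have := (abs_le.1 (H.abs_a_sub_le t')).2
        linarith
      rcases hl : lab t' with _ | l
      -- An unlabelled sample leaves `alpha` unchanged and moves `a` by at most `η`. The term `2 η`
      -- pays for the missing growth and for a possible decrease of `a`; `6 R η` pays for the change
      -- of `3 a²`.
      · have hr0 : ∀ l, rate S X z u lab lam η t' l = 0 := fun l => by simp [rate, hl]
        simp only [alpha_succ, hr0, zero_mul, add_zero, Nat.count_succ, hl, if_true, hcast,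
          reduceCtorEq, if_false, Nat.cast_add, Nat.cast_one]
        obtain ⟨d1, d2⟩ := abs_le.1 hda
        refine ⟨by nlinarith, ?_, i3, fun l k hk => ?_⟩
        · have k1 : 3 * (S t').a ^ 2 + 6 * (S t').a * ((S (t' + 1)).a - (S t').a)
              ≤ 3 * (S (t' + 1)).a ^ 2 := by nlinarith [sq_nonneg ((S (t' + 1)).a - (S t').a)]
          have k2 : -(6 * R * η) ≤ 6 * (S t').a * ((S (t' + 1)).a - (S t').a) := by
            calc -(6 * R * η) ≤ -(6 * (S t').a * η) := by
                  apply neg_le_neg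
                  gcongr
              _ = 6 * (S t').a * (-η) := by ring
              _ ≤ _ := by gcongr
          linarith
        · have := i4 l k hk
          have : 0 < 2 * e ^ 40 * η := by positivity
          linarith
      · obtain ⟨s1, s2, s3⟩ := H.late_step_summary ht'T hst hrt hLt hl
        have hother : ∀ l', l' ≠ l → rate S X z u lab lam η t' l' = 0 := fun l' h => by
          rw [rate, if_neg]
          rw [hl]
          exact fun hh => h (Option.some.inj hh).symm
        have hsum : ∀ f : ℕ → Fin 2 → ℝ, (∀ l', l' ≠ l → f (t' + 1) l' = f t' l') →
            ∑ l', f (t' + 1) l' = ∑ l', f t' l' + (f (t' + 1) l - f t' l) := fun f hf => by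
          rw [← sub_eq_iff_eq_add', ← Finset.sum_sub_distrib]
          exact Finset.sum_eq_single l (fun l' _ h => by rw [hf l' h, sub_self]) (by simp)
        refine ⟨?_, ?_, ?_, ?_⟩
        · rw [hsum (fun t l => alpha S X z u lab lam η t l (iw l))
            (fun l' h => by rw [alpha_succ, hother l' h, zero_mul, add_zero]), alpha_succ,
            Nat.count_succ, hl, if_neg (by simp), hcast, add_zero]
          linarith
        · rw [hsum (fun t l => alpha S X z u lab lam η t l (iw l) ^ 2)
            (fun l' h => by simp only [alpha_succ, hother l' h, zero_mul, add_zero]),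
            Nat.count_succ, hl, if_neg (by simp), hcast, add_zero]
          have k1 : 100 * e ^ 20 * η * (η * t') ≤ 100 * e ^ 20 * η * R := by
            gcongr
            linarith
          linarith
        · intro l'
          rw [alpha_succ, Nat.count_succ, hl]
          by_cases h : l' = l
          · subst h
            rw [if_pos rfl]
            have := i3 l'
            push_cast
            linarith
          · rw [if_neg (fun hh => h (Option.some.inj hh).symm), hother l' h, zero_mul]
            push_cast
            linarith [i3 l']
        · intro l' k hk
          rw [alpha_succ, hcast]
          have := i4 l' k hk
          have h40 : 0 < 2 * e ^ 40 * η := by positivity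
          by_cases h : l' = l
          · subst h
            have hdom := hLt.2.1 l' k hk
            have h2 : rate S X z u lab lam η t' l' * align S u t' l' k ^ 2
                ≤ e ^ 40 * (rate S X z u lab lam η t' l' * align S u t' l' (iw l') ^ 2) := by
              have hr0 := H.rate_nonneg ha.le l'
              calc _ = rate S X z u lab lam η t' l' * |align S u t' l' k| ^ 2 := by rw [sq_abs]
                _ ≤ rate S X z u lab lam η t' l' * (e ^ 20 * align S u t' l' (iw l')) ^ 2 := by
                  gcongr
                _ = _ := by ring
            have h3 : e ^ 40 * (rate S X z u lab lam η t' l' * align S u t' l' (iw l') ^ 2)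
              ≤ e ^ 40 * (2 * η) := by
              have := H.rate_mul_sq_le ht'T hLt.1 hl (iw l')
              gcongr
            linarith
          · rw [hother l' h, zero_mul]
            linarith
  exact key t h1 le_rfl

/-- The leader starts below `θ ^ 9` and ends near `θ ^ 4`, so the geometric mean is below `2 θ ^ 6`.
What remains is the linear error term of the profile, with `κ = e ^ 44`. -/
theorem early_alpha_le {t : ℕ} (ht : t ≤ T) (hs : η * t ≤ θ ^ 4) (l : Fin 2) (k : Fin mD)
    (hk : k ≠ iw l) : alpha S X z u lab lam η t l k ≤ e ^ 42 * θ ^ 4 := by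
  have he0 := H.he0
  have hθ0 := H.hθ0
  have hη0 := H.hη0
  have hr : ∀ t' < t, Reg S u iw η e θ t' := fun t' h =>
    H.early_reg t' (h.le.trans ht) (le_trans (by gcongr) hs)
  obtain ⟨-, h2, -⟩ := H.early_race ht hs hr l
  have h3 := h2 k hk
  have hy0 := H.init_pos l
  have hA0 := H.alpha_nonneg hr l (iw l)
  have hA := H.alpha_le ht hr l (iw l)
  have hi := (abs_le.1 (H.init_le l (iw l))).2
  have hik := (abs_le.1 (H.init_le l k)).1
  have h4 := profile_le_sqrt (g := e ^ 8) (κ := e ^ 44) (by positivity) hy0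
    (add_pos_of_pos_of_nonneg hy0 hA0)
  have h10 : 1000 * θ ^ 10 / e ^ 2 ≤ θ ^ 9 := H.theta_div_le (by norm_num) (by norm_num)
  have hy0' : align S u 0 l (iw l) ≤ θ ^ 9 := by
    have : θ ^ 10 / e ^ 2 ≤ 1000 * θ ^ 10 / e ^ 2 := by gcongr; linarith [pow_pos hθ0 10]
    linarith
  have h94 : θ ^ 9 ≤ θ ^ 4 := H.theta_pow_le (by norm_num)
  have hsq : √(align S u 0 l (iw l) * (align S u 0 l (iw l) + alpha S X z u lab lam η t l (iw l)))
      ≤ 2 * θ ^ 6 := by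
    apply Real.sqrt_le_iff.2
    refine ⟨by positivity, ?_⟩
    calc _ ≤ θ ^ 9 * (3 * θ ^ 4) := by
          gcongr
          linarith
      _ = 3 * θ ^ 12 * θ := by ring
      _ ≤ 3 * θ ^ 12 * 1 := by gcongr; exact H.hθ1
      _ ≤ _ := by ring_nf; linarith [pow_pos hθ0 12]
  have h5 : 2 / e ^ 8 * (2 * θ ^ 6) ≤ e ^ 50 * θ ^ 4 := by
    have := H.theta_div_le (p := 6) (q := 4) (r := 58) (by norm_num) (by norm_num)
    rw [div_le_iff₀ (by positivity)] at this
    rw [div_mul_eq_mul_div, div_le_iff₀ (by positivity)]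
    have h58 : e ^ 50 * θ ^ 4 * e ^ 8 = θ ^ 4 * e ^ 58 := by ring
    rw [h58]
    linarith [pow_pos hθ0 6]
  have h6 : 2 / e ^ 8 * √(align S u 0 l (iw l) * (align S u 0 l (iw l)
      + alpha S X z u lab lam η t l (iw l))) ≤ e ^ 50 * θ ^ 4 :=
    le_trans (by gcongr) h5
  have h7 : 20 * e ^ 44 * (align S u 0 l (iw l) + alpha S X z u lab lam η t l (iw l))
      ≤ 20 * e ^ 44 * (3 * θ ^ 4) := by
    gcongr
    linarith
  have h8 : 1000 * e ^ 44 ≤ e ^ 43 := H.pow_le_tiny (by norm_num)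
  have h8' : 1000 * e ^ 43 ≤ e ^ 42 := H.pow_le_tiny (by norm_num)
  have h9 : e ^ 50 ≤ e ^ 44 := pow_le_pow_small he0.le H.he1 (by norm_num)
  have h11 : θ ^ 10 / e ^ 2 ≤ e ^ 44 * θ ^ 4 := by
    have := H.theta_div_le (p := 10) (q := 4) (r := 46) (by norm_num) (by norm_num)
    rw [div_le_iff₀ (by positivity)] at this
    rw [div_le_iff₀ (by positivity)]
    have h58 : e ^ 44 * θ ^ 4 * e ^ 2 = θ ^ 4 * e ^ 46 := by ring
    rw [h58]
    linarith [pow_pos hθ0 10]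
  have hθ4 : 0 < θ ^ 4 := by positivity
  have m1 := mul_le_mul_of_nonneg_right h8 hθ4.le
  have m2 := mul_le_mul_of_nonneg_right h8' hθ4.le
  have m3 := mul_le_mul_of_nonneg_right h9 hθ4.le
  have m4 : 0 < e ^ 44 * θ ^ 4 := by positivity
  linarith

/-! ### Induction through the late phase. -/

section Late
variable {T₁ : ℕ} (hT1 : T₁ ≤ T) (hs1 : η * T₁ ≤ θ ^ 4) (hs2 : θ ^ 4 / 2 ≤ η * T₁)
include hT1 hs1 hs2

set_option maxHeartbeats 1000000 in
-- Inductive step: `late_growth` uses `Late` only before time `t`. It keeps the leaders above `3 e ^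
-- 7 η t` and the other neurons below `e ^ 27 η t`, which restores domination. The comparison of `a`
-- with the leaders comes from the balance.
theorem late_of_late {t : ℕ} (h1 : T₁ ≤ t) (ht : t ≤ T)
    (hL : ∀ t' < t, T₁ ≤ t' → Late S u iw η e θ t') : Late S u iw η e θ t := by
  have he0 := H.he0
  have hη0 := H.hη0
  have hθ0 := H.hθ0
  have ha00 := H.a0_pos
  have hr1 : ∀ t' < T₁, Reg S u iw η e θ t' := fun t' h =>
    H.early_reg t' (h.le.trans hT1) (le_trans (by gcongr) hs1)
  have hr : ∀ t' < t, Reg S u iw η e θ t' := fun t' h => by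
    rcases lt_or_ge t' T₁ with h' | h'
    · exact hr1 t' h'
    · exact (hL t' h h').1
  have hs : θ ^ 4 / 2 ≤ η * t := hs2.trans (by gcongr)
  have hs0 : 0 < η * t := lt_of_lt_of_le (by positivity) hs
  obtain ⟨g1, g2, g3, g4⟩ := H.late_growth h1 ht hs2 hr1 hL
  have hA : ∀ l, 0 ≤ alpha S X z u lab lam η t l (iw l) := fun l => H.alpha_nonneg hr l _
  have hA1 : ∀ l, 0 ≤ alpha S X z u lab lam η T₁ l (iw l) := fun l => H.alpha_nonneg hr1 l _
  have hAT : ∀ l, alpha S X z u lab lam η T₁ l (iw l) ≤ 2 * θ ^ 4 := fun l =>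
    (H.alpha_le hT1 hr1 l _).trans (by linarith)
  have hYA : ∀ l k, _ := H.abs_align_sub_alpha_le_late ht hs hr
  have haT := H.half_a0_le hs1
  have hbad : η * Nat.count (fun i => lab i = none) t ≤ e ^ 60 * (η * t) + θ ^ 30 := by
    have := mul_le_mul_of_nonneg_left (H.hbad t ht) hη0.le
    linarith [H.hn]
  have hθ30 := H.theta_le_time hs (p := 30) (r := 60) (by norm_num) (by norm_num)
  have hθ10 := H.theta_le_time hs (p := 10) (r := 60) (by norm_num) (by norm_num)
  have e20 : e ^ 20 ≤ 1 / 1000000000 := by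
    calc e ^ 20 ≤ (1 / 1000) ^ 20 := by have := H.he; gcongr
      _ ≤ _ := by norm_num
  have e60 : e ^ 60 ≤ 1 / 1000000000 := by
    calc e ^ 60 ≤ e ^ 20 := pow_le_pow_small he0.le H.he1 (by norm_num)
      _ ≤ _ := e20
  have e50 : e ^ 50 ≤ 1 / 1000000000 := by
    calc e ^ 50 ≤ e ^ 20 := pow_le_pow_small he0.le H.he1 (by norm_num)
      _ ≤ _ := e20
  have m20 : e ^ 20 * (η * t) ≤ 1 / 1000000000 * (η * t) := by gcongr
  have m60 : e ^ 60 * (η * t) ≤ 1 / 1000000000 * (η * t) := by gcongr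
  have m50 : e ^ 50 * (η * t) ≤ 1 / 1000000000 * (η * t) := by gcongr
  -- lower bound for the leading alignments
  have hAlow : ∀ l, e ^ 7 * 500 * (η * t) ≤ 128 * alpha S X z u lab lam η t l (iw l) := by
    intro l
    obtain ⟨c1, -, -⟩ := H.early_race hT1 hs1 hr1 l
    have c2 := g3 l
    have c3 := H.s_le_count ht l
    have c4 : 2 * (alpha S X z u lab lam η t l (iw l) - alpha S X z u lab lam η T₁ l (iw l))
          + 128 / e ^ 5 * alpha S X z u lab lam η T₁ l (iw l)
        ≤ 128 / e ^ 5 * alpha S X z u lab lam η t l (iw l) := by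
      have : (2 : ℝ) ≤ 128 / e ^ 5 := by
        rw [le_div_iff₀ (by positivity)]
        have := pow_le_one₀ he0.le H.he1 (n := 5)
        linarith
      have hmono : alpha S X z u lab lam η T₁ l (iw l) ≤ alpha S X z u lab lam η t l (iw l) := by
        refine Finset.sum_le_sum_of_subset_of_nonneg (Finset.range_subset_range.2 h1) ?_
        intro i hi _
        exact mul_nonneg (H.rate_nonneg (hr i (Finset.mem_range.1 hi)).1.le l) (sq_nonneg _)
      nlinarith
    have c5 : e * (η * t) ≤ 128 / e ^ 5 * alpha S X z u lab lam η t l (iw l) + θ ^ 30 := by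
      linarith
    have c6 : e ^ 6 * (η * t) ≤ 128 * alpha S X z u lab lam η t l (iw l) + e ^ 5 * θ ^ 30 := by
      calc e ^ 6 * (η * t) = e ^ 5 * (e * (η * t)) := by ring
        _ ≤ e ^ 5 * (128 / e ^ 5 * alpha S X z u lab lam η t l (iw l) + θ ^ 30) := by gcongr
        _ = _ := by field_simp
    have c7 : e ^ 5 * θ ^ 30 ≤ 1 * θ ^ 30 := by
      gcongr
      exact pow_le_one₀ he0.le H.he1
    have c8 : 1000 * e ^ 7 ≤ e ^ 6 := H.pow_le_tiny (by norm_num)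
    have c9 : e ^ 60 ≤ e ^ 7 := pow_le_pow_small he0.le H.he1 (by norm_num)
    have c10 := mul_le_mul_of_nonneg_right c8 hs0.le
    have c11 := mul_le_mul_of_nonneg_right c9 hs0.le
    have c12 : 0 < e ^ 7 * (η * t) := by positivity
    linarith
  have e50' : 1000 * e ^ 50 ≤ e ^ 7 := (H.pow_le_tiny (q := 50) (by norm_num)).trans
    (pow_le_pow_small he0.le H.he1 (by norm_num))
  have m50' := mul_le_mul_of_nonneg_right e50' hs0.le
  have h7s : 0 < e ^ 7 * (η * t) := by positivity
  have h40s : 0 < e ^ 40 * (η * t) := by positivity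
  have hYlow : ∀ l, 3 * (e ^ 7 * (η * t)) ≤ align S u t l (iw l) := fun l => by
    have := hAlow l
    have := (abs_le.1 (hYA l (iw l))).1
    linarith
  have hdom : ∀ l k, k ≠ iw l → |align S u t l k| ≤ e ^ 20 * align S u t l (iw l) := by
    intro l k hk
    have d1 := H.early_alpha_le hT1 hs1 l k hk
    have d2 := g4 l k hk
    have d3 := H.alpha_nonneg hr l k
    have d4 : |align S u t l k| ≤ alpha S X z u lab lam η t l k + e ^ 50 * (η * t) := by
      have := abs_add_le (align S u t l k - alpha S X z u lab lam η t l k)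
        (alpha S X z u lab lam η t l k)
      rw [sub_add_cancel, abs_of_nonneg d3] at this
      linarith [hYA l k]
    have d5 : e ^ 42 * θ ^ 4 ≤ 2 * (e ^ 40 * (η * t)) := by
      have := pow_le_pow_small he0.le H.he1 (by norm_num : 40 ≤ 42)
      calc e ^ 42 * θ ^ 4 ≤ e ^ 40 * (2 * (η * t)) := by
            gcongr
            linarith
        _ = _ := by ring
    have d6 : e ^ 50 * (η * t) ≤ e ^ 40 * (η * t) := by
      have := pow_le_pow_small he0.le H.he1 (by norm_num : 40 ≤ 50)
      gcongr
    have d7 : 1000 * e ^ 40 ≤ e ^ 27 := (H.pow_le_tiny (q := 40) (by norm_num)).trans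
      (pow_le_pow_small he0.le H.he1 (by norm_num))
    have d8 := mul_le_mul_of_nonneg_right d7 hs0.le
    calc |align S u t l k| ≤ e ^ 27 * (η * t) := by linarith
      _ = e ^ 20 * (e ^ 7 * (η * t)) := by ring
      _ ≤ _ := by
        have := hYlow l
        have : 0 ≤ e ^ 7 * (η * t) := by positivity
        gcongr
        linarith
  have hreg2 : ∀ l, θ ^ 10 + e ^ 7 * (η * t) ≤ 4 * align S u t l (iw l) := fun l => by
    have := hYlow l
    have c9 : e ^ 60 ≤ e ^ 7 := pow_le_pow_small he0.le H.he1 (by norm_num)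
    have c11 := mul_le_mul_of_nonneg_right c9 hs0.le
    have : 0 ≤ e ^ 7 * (η * t) := by positivity
    have := pow_pos hθ0 10
    linarith
  have hmain : 0 < (S t).a ∧ (∀ l, align S u t l (iw l) ≤ 2 * (S t).a)
      ∧ e ^ 9 * (S 0).a ≤ (S t).a := by
    have e9 : e ^ 9 ≤ 1 / 1000 := by
      calc e ^ 9 ≤ e ^ 1 := pow_le_pow_small he0.le H.he1 (by norm_num)
        _ ≤ _ := by rw [pow_one]; exact H.he
    have m9 : e ^ 9 * (S 0).a ≤ 1 / 1000 * (S 0).a := by gcongr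
    -- As long as `η t ≤ a₀ / 2`, neither `a` nor the alignments can have moved far enough to
    -- violate `Y ≤ 2 a`. Later `a₀ ≤ 2 η t`, so all errors are measured by `η t` and the balance
    -- applies.
    rcases le_or_gt (η * t) ((S 0).a / 2) with hcase | hcase
    · have a1 := (abs_le.1 (H.abs_a_sub_le t)).1
      refine ⟨by linarith, fun l => ?_, by linarith⟩
      have y1 := (abs_le.1 (H.abs_align_sub_le t l (iw l))).2
      have y2 := (abs_le.1 (H.init_le l (iw l))).2
      have y3 : 1000 * θ ^ 10 / e ^ 2 ≤ θ ^ 1 := H.theta_div_le (by norm_num) (by norm_num)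
      have y4 : θ ≤ (S 0).a := H.hθa.trans
        (mul_le_of_le_one_right H.a0_pos.le (pow_le_one₀ he0.le H.he1))
      have y5 : 1000 * θ ^ 10 / e ^ 2 = 1000 * (θ ^ 10 / e ^ 2) := by ring
      linarith
    · have hR : (S 0).a + η * t ≤ 3 * (η * t) := by linarith
      have hs0' := hs0.le
      simp only [Fin.sum_univ_two] at g1 g2
      have hS : 0.9 * (η * t) ≤ (S t).a + alpha S X z u lab lam η t 0 (iw 0)
          + alpha S X z u lab lam η t 1 (iw 1) := by
        have q1 : θ ^ 4 ≤ 1 / 1000 * (η * t) := by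
          have w1 : θ ^ 4 ≤ θ ^ 2 := H.theta_pow_le (by norm_num)
          have w2 : 1000 * θ ^ 2 / e ^ 0 ≤ θ ^ 1 := H.theta_div_le (by norm_num) (by norm_num)
          have w3 : θ ≤ (S 0).a * (1 / 1000) := by
            refine H.hθa.trans ?_
            gcongr
            calc e ^ 200 ≤ e ^ 1 := pow_le_pow_small he0.le H.he1 (by norm_num)
              _ ≤ _ := by rw [pow_one]; exact H.he
          rw [pow_zero, div_one, pow_one] at w2
          linarith [pow_pos hθ0 2]
        have q2 : (1 - 4 * e ^ 20) * (η * t - η * T₁) ≥ 0.99 * (η * t) := by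
          have w1 : (0.999 : ℝ) ≤ 1 - 4 * e ^ 20 := by linarith
          have w2 : 0.999 * (η * t) ≤ η * t - η * T₁ := by linarith
          have w3 := mul_le_mul w1 w2 (by positivity) (by linarith)
          linarith
        linarith [hA1 0, hA1 1, H.a0_pos]
      have hJ : -((η * t) ^ 2 / 1000000) ≤ 3 * (S t).a ^ 2 - alpha S X z u lab lam η t 0 (iw 0) ^ 2
          - alpha S X z u lab lam η t 1 (iw 1) ^ 2 := by
        have q1 : 0 ≤ 3 * (S T₁).a ^ 2 - (alpha S X z u lab lam η T₁ 0 (iw 0) ^ 2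
            + alpha S X z u lab lam η T₁ 1 (iw 1) ^ 2) := by
          have w0 : 8 * θ ^ 4 ≤ (S 0).a := by
            have w1 : θ ^ 4 ≤ θ ^ 2 := H.theta_pow_le (by norm_num)
            have w2 : 1000 * θ ^ 2 / e ^ 0 ≤ θ ^ 1 := H.theta_div_le (by norm_num) (by norm_num)
            have w3 : θ ≤ (S 0).a := H.hθa.trans
              (mul_le_of_le_one_right H.a0_pos.le (pow_le_one₀ he0.le H.he1))
            rw [pow_zero, div_one, pow_one] at w2
            linarith [pow_pos hθ0 2]
          have w1 : ∀ l, alpha S X z u lab lam η T₁ l (iw l) ^ 2 ≤ (S T₁).a ^ 2 := fun l => by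
            have := hA1 l
            have := hAT l
            gcongr
            linarith
          nlinarith [w1 0, w1 1, sq_nonneg (S T₁).a]
        have q2 : 100 * e ^ 20 * ((S 0).a + η * t) * (η * t)
            ≤ 100 * (1 / 1000000000) * (3 * (η * t)) * (η * t) := by gcongr
        have q3 : 6 * ((S 0).a + η * t) * (η * Nat.count (fun i => lab i = none) t)
            ≤ 6 * (3 * (η * t)) * (2 / 1000000000 * (η * t)) := by
          have : η * Nat.count (fun i => lab i = none) t ≤ 2 / 1000000000 * (η * t) := by
            linarith
          have : 0 ≤ η * (Nat.count (fun i => lab i = none) t : ℝ) := by positivity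
          gcongr
        have hsq := sq_pos_of_pos hs0
        linarith
      -- The balance controls only `a²`. The sign is inherited from the previous time, where `a ≥ e
      -- ^ 9 a₀` exceeds the length `η` of one step.
      have hapos : 0 < (S t).a := by
        have := (abs_le.1 (hYA 0 (iw 0))).2
        by_contra hcon
        push Not at hcon
        rcases Nat.eq_zero_or_pos t with h0 | h0
        · subst h0; simp at hs0
        · rcases eq_or_lt_of_le h1 with h2 | h2
          · rw [← h2] at hcon; linarith
          · have hLt := hL (t - 1) (by omega) (by omega)
            have hstep := H.hstep (t - 1)
            rw [Nat.sub_add_cancel h0] at hstep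
            have hda := cubicStep_displacement (lam := lam) (etaG := ηG) (X := X (t - 1))
              (z := z (t - 1)) (S := S (t - 1)) H.hη0.le
            rw [← hstep] at hda
            have hda' : |(S t).a - (S (t - 1)).a| ≤ η := by
              linarith [abs_nonneg ((S t).b - (S (t - 1)).b), norm_nonneg ((S t).W - (S (t - 1)).W)]
            have w2 := (abs_le.1 hda').1
            have w3 := hLt.2.2.2
            have w4 : η < e ^ 9 * (S 0).a := by
              have w5 : 1000 * θ ^ 30 / e ^ 9 ≤ θ ^ 1 := H.theta_div_le (by norm_num) (by norm_num)
              have w6 : θ ≤ (S 0).a := H.hθa.trans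
                (mul_le_of_le_one_right H.a0_pos.le (pow_le_one₀ he0.le H.he1))
              rw [div_le_iff₀ (by positivity), pow_one] at w5
              have w7 : θ * e ^ 9 ≤ (S 0).a * e ^ 9 := by gcongr
              have := H.hη
              have := pow_pos hθ0 30
              linarith
            linarith
      have hA0 := le_of_balance hapos (hA 0) (hA 1) hs0 hJ hS
      have hA1' := le_of_balance hapos (hA 1) (hA 0) hs0 (by linarith) (by linarith)
      have halow : 0.18 * (η * t) ≤ (S t).a := by linarith
      refine ⟨hapos, fun l => ?_, by linarith⟩
      have := (abs_le.1 (hYA l (iw l))).2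
      have hAl : alpha S X z u lab lam η t l (iw l) ≤ 1.9 * (S t).a := by
        fin_cases l
        · exact hA0
        · exact hA1'
      linarith
  exact ⟨⟨hmain.1, hreg2⟩, hdom, hmain.2⟩

theorem late_all (t : ℕ) (h1 : T₁ ≤ t) (ht : t ≤ T) : Late S u iw η e θ t := by
  induction t using Nat.strong_induction_on with
  | _ t ih => exact H.late_of_late hT1 hs1 hs2 h1 ht fun t' h h' => ih t' h h' (h.le.trans ht)

theorem reg_all (t : ℕ) (ht : t ≤ T) : Reg S u iw η e θ t := by
  rcases le_total T₁ t with h | h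
  · exact (H.late_all hT1 hs1 hs2 t h ht).1
  · have hη0 := H.hη0
    exact H.early_reg t ht (le_trans (by gcongr) hs1)

/-- In the late phase other neurons gain at most `2 e ^ 40 η` per step, and `η t ≤ 1 / e`. -/
theorem alpha_other_le {t : ℕ} (ht : t ≤ T) (l : Fin 2) {k : Fin mD} (hk : k ≠ iw l) :
    alpha S X z u lab lam η t l k ≤ e ^ 30 := by
  have he0 := H.he0
  have hη0 := H.hη0
  have hr1 : ∀ t' < T₁, Reg S u iw η e θ t' := fun t' h =>
    H.early_reg t' (h.le.trans hT1) (le_trans (by gcongr) hs1)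
  have h42 : e ^ 42 * θ ^ 4 ≤ e ^ 42 * 1 := by
    gcongr
    exact pow_le_one₀ H.hθ0.le H.hθ1
  have h1 : 1000 * e ^ 39 ≤ e ^ 38 := H.pow_le_tiny (by norm_num)
  have h2 : e ^ 38 ≤ e ^ 30 := pow_le_pow_small he0.le H.he1 (by norm_num)
  have h3 : e ^ 42 ≤ e ^ 39 := pow_le_pow_small he0.le H.he1 (by norm_num)
  have h39 := pow_pos he0 39
  rcases le_total T₁ t with h | h
  · obtain ⟨-, -, -, g4⟩ := H.late_growth h ht hs2 hr1 fun t' h h' =>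
      H.late_all hT1 hs1 hs2 t' h' (h.le.trans ht)
    have := g4 l k hk
    have := H.early_alpha_le hT1 hs1 l k hk
    have h4 : e * (η * t) ≤ 1 := by linarith [H.s_le ht]
    have : 2 * e ^ 40 * (η * t) ≤ 2 * e ^ 39 := by
      calc 2 * e ^ 40 * (η * t) = 2 * e ^ 39 * (e * (η * t)) := by ring
        _ ≤ 2 * e ^ 39 * 1 := by gcongr
        _ = _ := by ring
    linarith
  · have := H.early_alpha_le ht (le_trans (by gcongr) hs1) l k hk
    linarith

/-- After `T₁` every sample with label `l` adds at least `η / 2`, and such samples have frequency at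
least `cp`. The term `θ ^ 3` pays for the early phase and for the fluctuations of the frequency. -/
theorem le_alpha_lead {t : ℕ} (ht : t ≤ T) (l : Fin 2) :
    cp * (η * t) / 2 - θ ^ 3 ≤ alpha S X z u lab lam η t l (iw l) := by
  have he0 := H.he0
  have hη0 := H.hη0
  have hθ0 := H.hθ0
  have hr1 : ∀ t' < T₁, Reg S u iw η e θ t' := fun t' h =>
    H.early_reg t' (h.le.trans hT1) (le_trans (by gcongr) hs1)
  have hθ43 : θ ^ 4 ≤ θ ^ 3 := H.theta_pow_le (by norm_num)
  have hθ303 : θ ^ 30 ≤ θ ^ 3 := H.theta_pow_le (by norm_num)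
  rcases le_total T₁ t with h | h
  · obtain ⟨-, -, g3, -⟩ := H.late_growth h ht hs2 hr1 fun t' h h' =>
      H.late_all hT1 hs1 hs2 t' h' (h.le.trans ht)
    have g := g3 l
    have c := mul_le_mul_of_nonneg_left (H.hcount t ht l) hη0.le
    have c1 : η * (Nat.count (fun i => lab i = some l) T₁ : ℝ) ≤ η * T₁ := by
      gcongr
      exact Nat.count_le _
    have := H.alpha_nonneg hr1 l (iw l)
    have := H.hn
    linarith
  · have h1 := H.alpha_nonneg (fun t' h => H.reg_all hT1 hs1 hs2 t' (h.le.trans ht)) l (iw l)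
      (t := t)
    have h2 : η * (t : ℝ) ≤ θ ^ 4 := le_trans (by gcongr) hs1
    have h3 : cp * (η * t) ≤ 1 * (η * t) := by
      have := H.hcp1
      gcongr
    linarith

end Late

end DiscSetup

/-! ### Normalized quadratic power iteration -/

/-- Scaled by `α`, the difference is `x - α u` plus a multiple of a unit vector by `α - ‖x‖`, and
`|α - ‖x‖| ≤ ‖x - α u‖`. -/
theorem norm_normalize_sub_le {d : ℕ} {x u : Vec d} {α : ℝ} (hu : ‖u‖ = 1) (hα : 0 < α) :
    ‖‖x‖⁻¹ • x - u‖ ≤ 2 * ‖x - α • u‖ / α := by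
  rw [le_div_iff₀ hα]
  rcases eq_or_ne x 0 with rfl | hx
  -- The normalization of the zero vector is zero here, at distance one from `u`, and the bound has
  -- the value two.
  · simp only [norm_zero, inv_zero, smul_zero, zero_sub, norm_neg, norm_smul, hu,
      Real.norm_of_nonneg hα.le]
    linarith
  · have hx' : 0 < ‖x‖ := norm_pos_iff.2 hx
    have h1 : α • (‖x‖⁻¹ • x - u) = (x - α • u) + (α - ‖x‖) • (‖x‖⁻¹ • x) := by
      rw [smul_sub, sub_smul, smul_smul ‖x‖, mul_inv_cancel₀ hx'.ne', one_smul]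
      abel
    have h2 : ‖‖x‖⁻¹ • x‖ = 1 := by
      rw [norm_smul, norm_inv, norm_norm, inv_mul_cancel₀ hx'.ne']
    have h3 : |α - ‖x‖| ≤ ‖x - α • u‖ := by
      have := abs_norm_sub_norm_le (α • u) x
      rwa [norm_smul, hu, mul_one, Real.norm_of_nonneg hα.le, norm_sub_rev] at this
    calc ‖‖x‖⁻¹ • x - u‖ * α = ‖α • (‖x‖⁻¹ • x - u)‖ := by
          rw [norm_smul, Real.norm_of_nonneg hα.le, mul_comm]
      _ ≤ ‖x - α • u‖ + |α - ‖x‖| * 1 := by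
          rw [h1]
          refine (norm_add_le _ _).trans ?_
          rw [norm_smul, h2, Real.norm_eq_abs]
      _ ≤ _ := by linarith

/-- A vector `v` that is moved along `∑ k, ⟪w k, v⟫ ^ 2 • w k` at the times in `solo`, with steps
of length `ηG`, where the weights `w` are nearly orthogonal and vary slowly. -/
structure PowerSetup {m d : ℕ} (v : ℕ → Vec d) (w : ℕ → Fin m → Vec d) (solo pair : ℕ → Prop)
    [DecidablePred solo] [DecidablePred pair] (ks : Fin m) (η ηG e θ : ℝ) (n T T₁ : ℕ) :
    Prop where
  he0 : 0 < e
  he : e ≤ 1 / 1000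
  hθ0 : 0 < θ
  hθ : θ ≤ e ^ 200
  hη0 : 0 < η
  hη : η ≤ θ ^ 30
  hηG : ηG ≤ η
  hηG' : θ * η ≤ e ^ 200 * ηG
  hm : (m : ℝ) * e ≤ 2
  hstep : ∀ t < T, solo t → v (t + 1) = v t + (ηG / ‖∑ k, (inner ℝ (w t k) (v t) ^ 2) • w t k‖)
    • ∑ k, (inner ℝ (w t k) (v t) ^ 2) • w t k
  hpairstep : ∀ t, pair t → ‖v (t + 1) - v t‖ ≤ ηG
  hrest : ∀ t, ¬ solo t → ¬ pair t → v (t + 1) = v t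
  hdisj : ∀ t, solo t → ¬ pair t
  hT1 : T₁ ≤ T
  hs1 : η * T₁ ≤ θ ^ 4
  hs2 : θ ^ 4 / 2 ≤ η * T₁
  hnorm : ∀ t ≤ T, ∀ k, ‖w t k‖ ≤ 1 / e
  hcross : ∀ t ≤ T, ∀ i ≤ T, ∀ k k', k ≠ k' → |inner ℝ (w t k) (w i k')| ≤ e ^ 25
  hself : ∀ t ≤ T, ∀ i ≤ T, ∀ k, 1 / 2 ≤ inner ℝ (w t k) (w i k)
  hdisp : ∀ t k, ‖w t k - w 0 k‖ ≤ η * t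
  hinit : ∀ k k', |inner ℝ (w 0 k) (w 0 k') - if k = k' then 1 else 0| ≤ θ
  hv0 : ‖v 0‖ ≤ θ ^ 9
  hwin : θ ^ 20 / 2 ≤ inner ℝ (w 0 ks) (v 0)
  hini : ∀ k, e ^ 2 * |inner ℝ (w 0 k) (v 0)| ≤ θ ^ 20
  hgap : ∀ k, k ≠ ks → inner ℝ (w 0 k) (v 0) ≤ inner ℝ (w 0 ks) (v 0) - e ^ 6 * θ ^ 20
  hsolo : ∀ t ≤ T, e ^ 3 * t ≤ Nat.count solo t + n
  hpair : ∀ t ≤ T, (Nat.count pair t : ℝ) ≤ e ^ 60 * t + n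
  hn : η * n ≤ θ ^ 30

namespace PowerSetup
variable {m d : ℕ} {v : ℕ → Vec d} {w : ℕ → Fin m → Vec d} {solo pair : ℕ → Prop}
    [DecidablePred solo] [DecidablePred pair] {ks : Fin m} {η ηG e θ : ℝ} {n T T₁ : ℕ}

/-- The correlation of the iterate with the `k`-th weight. -/
def corr (v : ℕ → Vec d) (w : ℕ → Fin m → Vec d) (t : ℕ) (k : Fin m) : ℝ := inner ℝ (w t k) (v t)

/-- The unnormalized increment. -/
def incr (v : ℕ → Vec d) (w : ℕ → Fin m → Vec d) (t : ℕ) : Vec d :=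
  ∑ k, (corr v w t k ^ 2) • w t k

/-- The step length relative to the unnormalized increment. -/
def coef (v : ℕ → Vec d) (w : ℕ → Fin m → Vec d) (solo : ℕ → Prop) [DecidablePred solo] (ηG : ℝ)
    (t : ℕ) : ℝ := if solo t then ηG / ‖incr v w t‖ else 0

/-- The accumulated coefficient of the `k`-th weight. -/
def gain (v : ℕ → Vec d) (w : ℕ → Fin m → Vec d) (solo : ℕ → Prop) [DecidablePred solo] (ηG : ℝ)
    (t : ℕ) (k : Fin m) : ℝ := ∑ i ∈ Finset.range t, coef v w solo ηG i * corr v w i k ^ 2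

/-- The displacement that is not due to the steps in `solo`. -/
def junk (v : ℕ → Vec d) (w : ℕ → Fin m → Vec d) (solo : ℕ → Prop) [DecidablePred solo] (ηG : ℝ)
    (t : ℕ) : Vec d := v t - v 0 - ∑ i ∈ Finset.range t, coef v w solo ηG i • incr v w i

theorem gain_succ (t : ℕ) (k : Fin m) : gain v w solo ηG (t + 1) k
    = gain v w solo ηG t k + coef v w solo ηG t * corr v w t k ^ 2 := by
  rw [gain, Finset.sum_range_succ]; rfl

variable (H : PowerSetup v w solo pair ks η ηG e θ n T T₁)
include H

theorem he1 : e ≤ 1 := by linarith [H.he]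

theorem hθ1 : θ ≤ 1 := H.hθ.trans (pow_le_one₀ H.he0.le H.he1)

theorem hηG0 : 0 < ηG :=
  pos_of_mul_pos_right ((mul_pos H.hθ0 H.hη0).trans_le H.hηG') (pow_nonneg H.he0.le _)

theorem tiny {p q : ℕ} (h : q + 1 ≤ p) : 1000 * e ^ p ≤ e ^ q := by
  refine le_trans ?_ (mul_pow_le_pow H.he0.le H.he 1 q (c := 1000) (by norm_num) (by norm_num))
  have := pow_le_pow_small H.he0.le H.he1 h
  linarith

theorem theta_div_le {p q r : ℕ} (h : q + 1 ≤ p) (hr : r ≤ 150) : 1000 * θ ^ p / e ^ r ≤ θ ^ q := by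
  have he0 := H.he0
  have hθ0 := H.hθ0
  rw [div_le_iff₀ (by positivity)]
  calc 1000 * θ ^ p ≤ 1000 * θ ^ (q + 1) := by
        have := pow_le_pow_small hθ0.le H.hθ1 h
        gcongr
    _ = θ ^ q * (1000 * θ) := by ring
    _ ≤ θ ^ q * e ^ r := by
      gcongr
      calc 1000 * θ ≤ 1000 * e ^ 200 := by have := H.hθ; gcongr
        _ ≤ e ^ r := H.tiny (by omega)

theorem coef_nonneg (t : ℕ) : 0 ≤ coef v w solo ηG t := by
  have := H.hηG0
  unfold coef
  split_ifs
  · positivity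
  · rfl

theorem gain_nonneg (t : ℕ) (k : Fin m) : 0 ≤ gain v w solo ηG t k :=
  Finset.sum_nonneg fun i _ => mul_nonneg (H.coef_nonneg i) (sq_nonneg _)

theorem norm_junk_le {t : ℕ} (ht : t ≤ T) :
    ‖junk v w solo ηG t‖ ≤ ηG * Nat.count pair t := by
  induction t with
  | zero => simp [junk]
  | succ t ih =>
    have ih := ih (Nat.le_of_succ_le ht)
    have hs : junk v w solo ηG (t + 1) = junk v w solo ηG t
        + (v (t + 1) - v t - coef v w solo ηG t • incr v w t) := by
      simp only [junk, Finset.sum_range_succ]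
      abel
    rw [hs, Nat.count_succ]
    by_cases h1 : solo t
    · have h2 := H.hstep t ht h1
      rw [if_neg (H.hdisj t h1), add_zero, coef, if_pos h1, h2]
      simpa [incr, corr] using ih
    · rw [coef, if_neg h1, zero_smul, sub_zero]
      by_cases h2 : pair t
      · rw [if_pos h2]
        have := norm_add_le (junk v w solo ηG t) (v (t + 1) - v t)
        have := H.hpairstep t h2
        push_cast
        linarith
      · rw [if_neg h2, H.hrest t h1 h2]
        simpa using ih

/-- Past increments point along weights of past times. Therefore inner products of weights at two
different times appear, and `hcross` and `hself` have to cover pairs of times. -/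
theorem corr_eq (t : ℕ) (k : Fin m) : corr v w t k = inner ℝ (w t k) (v 0)
    + ∑ k', ∑ i ∈ Finset.range t, coef v w solo ηG i * corr v w i k' ^ 2
      * inner ℝ (w t k) (w i k')
    + inner ℝ (w t k) (junk v w solo ηG t) := by
  have h : v t = v 0 + ∑ i ∈ Finset.range t, coef v w solo ηG i • incr v w i
      + junk v w solo ηG t := by
    rw [junk]; abel
  conv_lhs => rw [corr, h]
  rw [inner_add_right, inner_add_right, inner_sum, Finset.sum_comm]
  congr 2
  refine Finset.sum_congr rfl fun i _ => ?_
  rw [real_inner_smul_right, incr, inner_sum, Finset.mul_sum]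
  refine Finset.sum_congr rfl fun k' _ => ?_
  rw [real_inner_smul_right]
  ring

/-- By near orthogonality `‖∑ x_k w_k‖² ≥ ½ ∑ x_k² - e ^ 25 (∑ x_k)²`. With at most `2 / e` terms,
Cauchy–Schwarz leaves `¼ ∑ x_k²`, so no cancellation can make the normalizer small. -/
theorem sq_le_norm_incr {t : ℕ} (ht : t ≤ T) (k : Fin m) :
    corr v w t k ^ 2 ≤ 2 * ‖incr v w t‖ := by
  have he0 := H.he0
  set x := fun k => corr v w t k ^ 2 with hx
  have hx0 : ∀ k, 0 ≤ x k := fun k => sq_nonneg _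
  have h1 : ‖incr v w t‖ ^ 2 = ∑ k, ∑ k', x k * x k' * inner ℝ (w t k) (w t k') := by
    rw [← real_inner_self_eq_norm_sq, incr, sum_inner]
    refine Finset.sum_congr rfl fun k _ => ?_
    rw [inner_sum]
    refine Finset.sum_congr rfl fun k' _ => ?_
    rw [real_inner_smul_left, real_inner_smul_right]
    ring
  have h2 : ∀ k k', (if k = k' then 1 / 2 * x k ^ 2 else 0) - e ^ 25 * (x k * x k')
      ≤ x k * x k' * inner ℝ (w t k) (w t k') := by
    intro k k'
    have hp : 0 ≤ x k * x k' := mul_nonneg (hx0 k) (hx0 k')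
    split_ifs with h
    · subst h
      have := mul_le_mul_of_nonneg_left (H.hself t ht t ht k) hp
      have : 0 ≤ e ^ 25 * (x k * x k) := by positivity
      nlinarith
    · have := (abs_le.1 (H.hcross t ht t ht k k' h)).1
      have := mul_le_mul_of_nonneg_left this hp
      linarith
  have h3 : ∑ k, ∑ k', ((if k = k' then 1 / 2 * x k ^ 2 else 0) - e ^ 25 * (x k * x k'))
      = 1 / 2 * ∑ k, x k ^ 2 - e ^ 25 * (∑ k, x k) ^ 2 := by
    simp only [Finset.sum_sub_distrib, Finset.sum_ite_eq, Finset.mem_univ, if_true,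
      ← Finset.mul_sum, sq (∑ k, x k), Finset.sum_mul_sum]
  have h4 : (∑ k, x k) ^ 2 ≤ m * ∑ k, x k ^ 2 := by
    have := sq_sum_le_card_mul_sum_sq (s := Finset.univ) (f := x)
    simpa using this
  have h5 : e ^ 25 * (m * ∑ k, x k ^ 2) ≤ 1 / 4 * ∑ k, x k ^ 2 := by
    have : e ^ 25 * m ≤ 1 / 4 := by
      have h6 : 1000 * e ^ 24 ≤ e ^ 0 := H.tiny (by norm_num)
      have h7 : e ^ 24 * (m * e) ≤ e ^ 24 * 2 := by have := H.hm; gcongr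
      rw [pow_zero] at h6
      calc e ^ 25 * m = e ^ 24 * (m * e) := by ring
        _ ≤ _ := by linarith
    have hs : 0 ≤ ∑ k, x k ^ 2 := by positivity
    calc _ = e ^ 25 * m * ∑ k, x k ^ 2 := by ring
      _ ≤ _ := by gcongr
  have h6 : x k ^ 2 ≤ ∑ k, x k ^ 2 :=
    Finset.single_le_sum (f := fun k => x k ^ 2) (fun k _ => sq_nonneg _) (Finset.mem_univ k)
  have h7 : 1 / 2 * ∑ k, x k ^ 2 - e ^ 25 * (∑ k, x k) ^ 2 ≤ ‖incr v w t‖ ^ 2 := by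
    rw [h1, ← h3]
    exact Finset.sum_le_sum fun k _ => Finset.sum_le_sum fun k' _ => h2 k k'
  have h8 : e ^ 25 * (∑ k, x k) ^ 2 ≤ e ^ 25 * (m * ∑ k, x k ^ 2) := by gcongr
  have h9 : x k ^ 2 ≤ (2 * ‖incr v w t‖) ^ 2 := by nlinarith
  exact (pow_le_pow_iff_left₀ (hx0 k) (by positivity) two_ne_zero).1 h9

theorem coef_mul_sq_le {t : ℕ} (ht : t ≤ T) (k : Fin m) :
    coef v w solo ηG t * corr v w t k ^ 2 ≤ 2 * ηG := by
  have h1 := H.sq_le_norm_incr ht k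
  have h2 := H.hηG0
  unfold coef
  split_ifs
  · rcases (norm_nonneg (incr v w t)).eq_or_lt with h | h
    · rw [← h, div_zero, zero_mul]; linarith
    · rw [div_mul_eq_mul_div, div_le_iff₀ h]
      nlinarith
  · linarith

theorem gain_sub_le {t₀ t : ℕ} (h0 : t₀ ≤ t) (ht : t ≤ T) (k : Fin m) {ρ : ℝ}
    (hρ : ∀ i, t₀ ≤ i → i < t → solo i → coef v w solo ηG i * corr v w i k ^ 2 ≤ ρ * ηG) :
    gain v w solo ηG t k - gain v w solo ηG t₀ k
      ≤ ρ * (ηG * Nat.count solo t - ηG * Nat.count solo t₀) := by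
  induction t, h0 using Nat.le_induction with
  | base => simp
  | succ t h0 ih =>
    have h1 := ih (Nat.le_of_succ_le ht) fun i h2 h3 => hρ i h2 (h3.trans (Nat.lt_succ_self t))
    rw [gain_succ, Nat.count_succ]
    by_cases h : solo t
    · have := hρ t h0 (Nat.lt_succ_self t) h
      rw [if_pos h]
      push_cast
      linarith
    · rw [coef, if_neg h, if_neg h, zero_mul, add_zero, add_zero]
      exact h1

theorem le_gain_sub {t₀ t : ℕ} (h0 : t₀ ≤ t) (ht : t ≤ T) (k : Fin m) {ρ : ℝ}
    (hρ : ∀ i, t₀ ≤ i → i < t → solo i → ρ * ηG ≤ coef v w solo ηG i * corr v w i k ^ 2) :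
    ρ * (ηG * Nat.count solo t - ηG * Nat.count solo t₀)
      ≤ gain v w solo ηG t k - gain v w solo ηG t₀ k := by
  induction t, h0 using Nat.le_induction with
  | base => simp
  | succ t h0 ih =>
    have h1 := ih (Nat.le_of_succ_le ht) fun i h2 h3 => hρ i h2 (h3.trans (Nat.lt_succ_self t))
    rw [gain_succ, Nat.count_succ]
    by_cases h : solo t
    · have := hρ t h0 (Nat.lt_succ_self t) h
      rw [if_pos h]
      push_cast
      linarith
    · rw [coef, if_neg h, if_neg h, zero_mul, add_zero, add_zero]
      exact h1

theorem gain_le {t : ℕ} (ht : t ≤ T) (k : Fin m) :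
    gain v w solo ηG t k ≤ 2 * (ηG * Nat.count solo t) := by
  have := H.gain_sub_le (Nat.zero_le t) ht k (ρ := 2) fun i _ h _ =>
    H.coef_mul_sq_le (h.le.trans ht) k
  simpa [gain] using this

/-- The elapsed time in terms of the number of effective steps. -/
theorem time_le {t : ℕ} (ht : t ≤ T) :
    e ^ 3 * (ηG * t) ≤ ηG * Nat.count solo t + θ ^ 30 := by
  have h1 := mul_le_mul_of_nonneg_left (H.hsolo t ht) H.hηG0.le
  have h2 : ηG * n ≤ η * n := by have := H.hηG; gcongr
  linarith [H.hn]

/-- Samples with a second active coordinate have frequency `e ^ 60` and solo samples at least `e ^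
3`, whence the ratio `e ^ 57`. -/
theorem pair_le {t : ℕ} (ht : t ≤ T) :
    ηG * Nat.count pair t ≤ e ^ 57 * (ηG * Nat.count solo t) + 2 * θ ^ 30 := by
  have h1 := mul_le_mul_of_nonneg_left (H.hpair t ht) H.hηG0.le
  have h2 : ηG * n ≤ η * n := by have := H.hηG; gcongr
  have h3 := mul_le_mul_of_nonneg_left (H.time_le ht) (pow_nonneg H.he0.le 57)
  have h4 : e ^ 57 * θ ^ 30 ≤ 1 * θ ^ 30 := by
    have := pow_nonneg H.hθ0.le 30
    have := pow_le_one₀ H.he0.le H.he1 (n := 57)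
    gcongr
  linarith [H.hn]

theorem abs_inner_junk_le {t : ℕ} (ht : t ≤ T) (k : Fin m) :
    |inner ℝ (w t k) (junk v w solo ηG t)|
      ≤ 1 / e * (e ^ 57 * (ηG * Nat.count solo t) + 2 * θ ^ 30) := by
  refine (abs_real_inner_le_norm _ _).trans ?_
  have := H.hnorm t ht k
  have := (H.norm_junk_le ht).trans (H.pair_le ht)
  have := H.he0
  gcongr

theorem abs_inner_init_le {t : ℕ} (ht : t ≤ T) (k : Fin m) :
    |inner ℝ (w t k) (v 0)| ≤ 1 / e * θ ^ 9 := by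
  refine (abs_real_inner_le_norm _ _).trans ?_
  have := H.hnorm t ht k
  have := H.hv0
  have := H.he0
  gcongr

/-- By time `θ ^ 4` each weight has moved by at most `θ ^ 4`, so the weights remain orthonormal up
to `2 θ`. -/
theorem inner_early {t i : ℕ} (ht : t ≤ T) (hs : η * t ≤ θ ^ 4) (hi : i ≤ t) (k k' : Fin m) :
    |inner ℝ (w t k) (w i k') - if k = k' then 1 else 0| ≤ 2 * θ := by
  have he0 := H.he0
  have hθ0 := H.hθ0
  have hη0 := H.hη0
  have h1 := H.hinit k k'
  have h2 : |inner ℝ (w t k - w 0 k) (w i k')| ≤ θ ^ 4 * (1 / e) := by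
    refine (abs_real_inner_le_norm _ _).trans ?_
    have := (H.hdisp t k).trans hs
    have := H.hnorm i (hi.trans ht) k'
    gcongr
  have h3 : |inner ℝ (w 0 k) (w i k' - w 0 k')| ≤ 1 / e * θ ^ 4 := by
    refine (abs_real_inner_le_norm _ _).trans ?_
    have : η * (i : ℝ) ≤ η * t := by gcongr
    have := (H.hdisp i k').trans (this.trans hs)
    have := H.hnorm 0 (Nat.zero_le T) k
    gcongr
  have h4 : inner ℝ (w t k) (w i k') - (if k = k' then (1 : ℝ) else 0)
      = (inner ℝ (w 0 k) (w 0 k') - if k = k' then 1 else 0) + inner ℝ (w t k - w 0 k) (w i k')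
        + inner ℝ (w 0 k) (w i k' - w 0 k') := by
    rw [inner_sub_left, inner_sub_right]
    ring
  rw [h4]
  have h5 := abs_add_three (inner ℝ (w 0 k) (w 0 k') - if k = k' then (1 : ℝ) else 0)
    (inner ℝ (w t k - w 0 k) (w i k')) (inner ℝ (w 0 k) (w i k' - w 0 k'))
  have h6 : 1000 * θ ^ 4 / e ^ 1 ≤ θ ^ 1 := H.theta_div_le (by norm_num) (by norm_num)
  have h7 : 1000 * θ ^ 4 / e ^ 1 = 1000 * (1 / e * θ ^ 4) := by ring
  have h8 : 0 < 1 / e * θ ^ 4 := by positivity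
  rw [pow_one θ] at h6
  linarith

/-- Three errors: the drift of the weights against `v 0`, at most `η t θ ^ 9` and converted to
generator time by `θ η ≤ e ^ 200 ηG`; the defect of orthonormality, of order `θ`; and the junk
displacement. -/
theorem abs_corr_sub_le_early {t : ℕ} (ht : t ≤ T) (hs : η * t ≤ θ ^ 4) (k : Fin m) :
    |corr v w t k - corr v w 0 k - gain v w solo ηG t k|
      ≤ e ^ 50 * (corr v w 0 ks + ηG * Nat.count solo t) := by
  have he0 := H.he0
  have hθ0 := H.hθ0
  have hη0 := H.hη0
  have hηG0 := H.hηG0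
  set C := ηG * (Nat.count solo t : ℝ) with hC
  have hC0 : 0 ≤ C := by positivity
  have h1 : |inner ℝ (w t k - w 0 k) (v 0)| ≤ e ^ 197 * (C + θ ^ 30) := by
    refine (abs_real_inner_le_norm _ _).trans ?_
    have h2 := H.hdisp t k
    have h3 := H.hv0
    calc ‖w t k - w 0 k‖ * ‖v 0‖ ≤ η * t * θ ^ 9 := by gcongr
      _ = θ ^ 8 * (θ * η * t) := by ring
      _ ≤ 1 * (e ^ 200 * ηG * t) := by
        have := H.hηG'
        gcongr
        exact pow_le_one₀ hθ0.le H.hθ1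
      _ = e ^ 197 * (e ^ 3 * (ηG * t)) := by ring
      _ ≤ e ^ 197 * (C + θ ^ 30) := by
        have := H.time_le ht
        gcongr
  have h2 : |∑ k', ∑ i ∈ Finset.range t, coef v w solo ηG i * corr v w i k' ^ 2
      * (inner ℝ (w t k) (w i k') - if k = k' then 1 else 0)| ≤ 8 / e * θ * C := by
    calc _ ≤ ∑ k' : Fin m, ∑ i ∈ Finset.range t, coef v w solo ηG i * corr v w i k' ^ 2
          * (2 * θ) := by
          refine (Finset.abs_sum_le_sum_abs _ _).trans (Finset.sum_le_sum fun k' _ => ?_)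
          refine (Finset.abs_sum_le_sum_abs _ _).trans (Finset.sum_le_sum fun i hi => ?_)
          have hc := H.coef_nonneg i
          rw [abs_mul, abs_of_nonneg (by positivity)]
          have := H.inner_early ht hs (Finset.mem_range.1 hi).le k k'
          gcongr
      _ = ∑ k' : Fin m, gain v w solo ηG t k' * (2 * θ) := by
          simp only [gain, Finset.sum_mul]
      _ ≤ ∑ _k' : Fin m, 2 * C * (2 * θ) := by
          gcongr with k'
          exact H.gain_le ht k'
      _ = (m * e) * (4 * θ * C / e) := by
          rw [Finset.sum_const, Finset.card_univ, Fintype.card_fin, nsmul_eq_mul]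
          field_simp
          ring
      _ ≤ 2 * (4 * θ * C / e) := by have := H.hm; gcongr
      _ = _ := by ring
  have h3 := H.abs_inner_junk_le ht k
  have h4 : corr v w t k - corr v w 0 k - gain v w solo ηG t k
      = inner ℝ (w t k - w 0 k) (v 0)
        + ∑ k', ∑ i ∈ Finset.range t, coef v w solo ηG i * corr v w i k' ^ 2
          * (inner ℝ (w t k) (w i k') - if k = k' then 1 else 0)
        + inner ℝ (w t k) (junk v w solo ηG t) := by
    rw [H.corr_eq t k, inner_sub_left]
    simp only [mul_sub, Finset.sum_sub_distrib, mul_ite, mul_one, mul_zero]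
    have : ∑ k', ∑ i ∈ Finset.range t, (if k = k' then coef v w solo ηG i * corr v w i k' ^ 2 else 0)
        = gain v w solo ηG t k := by
      rw [Finset.sum_eq_single k (fun k' _ h => by simp [h.symm]) (by simp)]
      simp [gain]
    rw [this]
    simp only [corr]
    ring
  rw [h4]
  refine (abs_add_three _ _ _).trans ?_
  have hy : θ ^ 20 / 2 ≤ corr v w 0 ks := H.hwin
  have a1 : 1000 * e ^ 197 ≤ e ^ 50 := H.tiny (by norm_num)
  have a2 : 8 / e * θ * C ≤ e ^ 50 * C / 4 := by
    have : 8 / e * θ ≤ e ^ 50 / 4 := by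
      rw [div_mul_eq_mul_div, div_le_iff₀ he0]
      have b1 : 1000 * e ^ 200 ≤ e ^ 51 := H.tiny (by norm_num)
      have b2 : e ^ 50 / 4 * e = e ^ 51 / 4 := by ring
      have := H.hθ
      have := pow_pos he0 200
      rw [b2]
      linarith
    calc _ ≤ e ^ 50 / 4 * C := by gcongr
      _ = _ := by ring
  have a3 : 1 / e * (e ^ 57 * C + 2 * θ ^ 30) = e ^ 56 * C + 2 * (θ ^ 30 / e) := by
    field_simp
  have a4 : 1000 * e ^ 56 ≤ e ^ 50 := H.tiny (by norm_num)
  have a5 : 1000 * θ ^ 30 / e ^ 51 ≤ θ ^ 20 := H.theta_div_le (by norm_num) (by norm_num)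
  have a6 : θ ^ 30 / e ≤ e ^ 50 * θ ^ 20 / 1000 := by
    rw [div_le_iff₀ (by positivity)] at a5 ⊢
    have : e ^ 50 * θ ^ 20 / 1000 * e = θ ^ 20 * e ^ 51 / 1000 := by ring
    linarith
  have a7 : θ ^ 30 ≤ θ ^ 20 := pow_le_pow_small hθ0.le H.hθ1 (by norm_num)
  have a8 : e ^ 50 * (θ ^ 20 / 2) ≤ e ^ 50 * corr v w 0 ks := by gcongr
  have a9 : e ^ 197 * (C + θ ^ 30) ≤ e ^ 50 / 1000 * (C + θ ^ 20) := by
    gcongr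
    linarith
  have a10 := mul_le_mul_of_nonneg_right a4 hC0
  have a11 : 0 ≤ e ^ 50 * C := by positivity
  have a12 : 0 < e ^ 50 * θ ^ 20 := by positivity
  rw [a3] at h3
  linarith

theorem norm_incr_le {t : ℕ} (ht : t ≤ T) {Z : ℝ} (hZ : ∀ k, corr v w t k ^ 2 ≤ Z) :
    ‖incr v w t‖ ≤ 2 / e ^ 2 * Z := by
  have he0 := H.he0
  have hZ0 : 0 ≤ Z := (sq_nonneg _).trans (hZ ks)
  calc ‖incr v w t‖ ≤ ∑ k : Fin m, Z * (1 / e) := by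
        refine (norm_sum_le _ _).trans (Finset.sum_le_sum fun k _ => ?_)
        rw [norm_smul, Real.norm_of_nonneg (sq_nonneg _)]
        have := H.hnorm t ht k
        have := hZ k
        gcongr
    _ = (m * e) * (Z / e ^ 2) := by
        rw [Finset.sum_const, Finset.card_univ, Fintype.card_fin, nsmul_eq_mul]
        field_simp
    _ ≤ 2 * (Z / e ^ 2) := by have := H.hm; gcongr
    _ = _ := by ring

theorem init_pos : 0 < corr v w 0 ks :=
  lt_of_lt_of_le (by have := pow_pos H.hθ0 20; linarith) H.hwin

theorem init_le (k : Fin m) : |corr v w 0 k| ≤ θ ^ 20 / e ^ 2 := by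
  rw [le_div_iff₀ (pow_pos H.he0 2), mul_comm]
  exact H.hini k

/-- The step length is fixed, so the rate is `ηG` over the norm of the increment, which lies within
polylogarithmic factors of the largest squared correlation. Positivity of the leader rules out a
zero increment, for which division by zero would stop the motion. -/
theorem early_race {t : ℕ} (ht : t ≤ T) (hs : η * t ≤ θ ^ 4)
    (hpos : ∀ t' < t, 0 < corr v w t' ks) :
    (ηG * Nat.count solo t ≤ 128 / e ^ 6 * gain v w solo ηG t ks) ∧
      (∀ k, k ≠ ks → corr v w 0 k + gain v w solo ηG t k
        ≤ profile (e ^ 8) (e ^ 43) (corr v w 0 ks) (corr v w 0 ks + gain v w solo ηG t ks)) ∧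
      (∀ k, |corr v w t k - corr v w 0 k - gain v w solo ηG t k|
        ≤ e ^ 43 * (corr v w 0 ks + gain v w solo ηG t ks)) := by
  have he0 := H.he0
  have hθ0 := H.hθ0
  have hη0 := H.hη0
  have hηG0 := H.hηG0
  have hwin : θ ^ 20 / 2 ≤ corr v w 0 ks := H.hwin
  have hlt : ∀ t', t' ≤ t → η * t' ≤ θ ^ 4 := fun t' h => le_trans (by gcongr) hs
  have hrace := race (ι := Fin m) (T := t) (x := fun t => corr v w t)
    (A := fun t => gain v w solo ηG t) (act := solo)
    (c := fun t => coef v w solo ηG t) (i := ks) (η := ηG) (L := 2 / e ^ 2) (M := 2 / e ^ 2)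
    (g := e ^ 8) (κ := e ^ 50) (κ₁ := e ^ 43) (y₀ := corr v w 0 ks)
    H.init_pos hηG0
    (by rw [le_div_iff₀ (by positivity)]; linarith [pow_le_one₀ he0.le H.he1 (n := 2)])
    (by rw [le_div_iff₀ (by positivity)]; linarith [pow_le_one₀ he0.le H.he1 (n := 2)])
    (by positivity) (pow_le_one₀ he0.le H.he1) (by positivity) (by positivity)
    (by
      have h : e ^ 50 * (16 * (2 / e ^ 2) ^ 2 * (2 / e ^ 2)) = 128 * e ^ (43 + 1) := by
        field_simp
        ring
      rw [h]
      exact mul_pow_le_pow he0.le H.he 1 43 (by norm_num) (by norm_num))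
    (by
      have := mul_pow_le_pow (c := 2000) he0.le H.he 35 8 (by norm_num) (by norm_num)
      norm_num at this
      linarith)
    (by
      have h1 : e ^ 50 * (θ ^ 20 / 2) ≤ e ^ 43 * corr v w 0 ks := by
        have := pow_le_pow_small he0.le H.he1 (p := 50) (q := 43) (by norm_num)
        gcongr
      have h2 := H.hη
      have h3 := H.hηG
      have h4 : 1000 * θ ^ 30 / e ^ 50 ≤ θ ^ 20 := H.theta_div_le (by norm_num) (by norm_num)
      rw [div_le_iff₀ (by positivity)] at h4
      linarith [pow_pos hθ0 30])
    (fun k => by simp [gain]) rfl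
    (fun k => by
      refine (H.init_le k).trans ?_
      rw [div_mul_eq_mul_div]
      gcongr
      linarith)
    (fun k hk => by
      have h1 : corr v w 0 k ≤ corr v w 0 ks - e ^ 6 * θ ^ 20 := H.hgap k hk
      have h2 := (abs_le.1 (H.init_le ks)).2
      have h3 : e ^ 8 * corr v w 0 ks ≤ e ^ 8 * (θ ^ 20 / e ^ 2) := by gcongr
      have h4 : e ^ 8 * (θ ^ 20 / e ^ 2) = e ^ 6 * θ ^ 20 := by field_simp
      linarith)
    (fun t' _ _ k => gain_succ t' k)
    (fun t' _ h k => by rw [gain_succ, coef, if_neg h, zero_mul, add_zero])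
    (fun t' _ _ => H.coef_nonneg t')
    (fun t' h hl Z hZ => by
      have h1 := H.norm_incr_le (h.le.trans ht) hZ
      have h2 : 0 < ‖incr v w t'‖ := by
        have h3 := H.sq_le_norm_incr (h.le.trans ht) ks
        have h4 := sq_pos_of_pos (hpos t' h)
        linarith
      rw [coef, if_pos hl, div_mul_eq_mul_div, div_le_div_iff₀ (by norm_num) h2]
      have := mul_le_mul_of_nonneg_left h1 hηG0.le
      have := (norm_nonneg (incr v w t')).trans h1
      nlinarith)
    (fun t' h hl k => H.coef_mul_sq_le (h.le.trans ht) k)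
    (fun t' h k => H.abs_corr_sub_le_early (h.trans ht) (hlt t' h) k)
  obtain ⟨h1, -, h3, h4⟩ := hrace t le_rfl
  refine ⟨?_, h3, h4⟩
  have h : 16 * (2 / e ^ 2) ^ 2 * (2 / e ^ 2) = 128 / e ^ 6 := by
    field_simp
    norm_num
  rw [h] at h1
  exact h1

theorem early_pos (t : ℕ) (ht : t ≤ T) (hs : η * t ≤ θ ^ 4) : 0 < corr v w t ks := by
  induction t using Nat.strong_induction_on with
  | _ t ih =>
    have hη0 := H.hη0
    have he0 := H.he0
    obtain ⟨-, -, h4⟩ := H.early_race ht hs fun t' h =>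
      ih t' h (h.le.trans ht) (le_trans (by gcongr) hs)
    have h5 := (abs_le.1 (h4 ks)).1
    have hA := H.gain_nonneg t ks
    have h0 := H.init_pos
    have h6 : 1000 * e ^ 43 ≤ e ^ 0 := H.tiny (by norm_num)
    rw [pow_zero] at h6
    nlinarith

end PowerSetup

/-! ### Domination after the early phase and the limiting direction. -/

namespace PowerSetup
variable {m d : ℕ} {v : ℕ → Vec d} {w : ℕ → Fin m → Vec d} {solo pair : ℕ → Prop}
    [DecidablePred solo] [DecidablePred pair] {ks : Fin m} {η ηG e θ : ℝ} {n T T₁ : ℕ}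
variable (H : PowerSetup v w solo pair ks η ηG e θ n T T₁)
include H

/-- By `T₁` the column has been pushed through a total length of at least `θ ^ 6`, far more than its
initial length `θ ^ 9`. From then on the initial vector is negligible. -/
theorem theta_six_le : θ ^ 6 ≤ ηG * Nat.count solo T₁ := by
  have he0 := H.he0
  have hθ0 := H.hθ0
  have h1 := H.time_le H.hT1
  have h2 : θ ^ 5 / 2 ≤ e ^ 200 * (ηG * T₁) := by
    calc θ ^ 5 / 2 = θ * (θ ^ 4 / 2) := by ring
      _ ≤ θ * (η * T₁) := by have := H.hs2; gcongr
      _ = θ * η * T₁ := by ring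
      _ ≤ e ^ 200 * ηG * T₁ := by have := H.hηG'; gcongr
      _ = _ := by ring
  have hηG0 := H.hηG0
  have h3 : e ^ 200 * (ηG * T₁) ≤ e ^ 3 * (ηG * T₁) := by
    have := pow_le_pow_small he0.le H.he1 (by norm_num : 3 ≤ 200)
    gcongr
  have h4 : 1000 * θ ^ 6 / e ^ 0 ≤ θ ^ 5 := H.theta_div_le (by norm_num) (by norm_num)
  have h5 : θ ^ 30 ≤ θ ^ 6 := pow_le_pow_small hθ0.le H.hθ1 (by norm_num)
  rw [pow_zero, div_one] at h4
  linarith [pow_pos hθ0 6]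

/-- The leading correlation is positive and dominates all others. -/
def Dominated (v : ℕ → Vec d) (w : ℕ → Fin m → Vec d) (ks : Fin m) (e : ℝ) (t : ℕ) : Prop :=
  0 < corr v w t ks ∧ ∀ k, k ≠ ks → |corr v w t k| ≤ e ^ 10 * corr v w t ks

/-- The race leaves the other gains at the geometric mean of initial and final leader, which is
polynomially smaller than `C`, plus the linear error with `κ = e ^ 43`. -/
theorem gain_other_early {k : Fin m} (hk : k ≠ ks) :
    gain v w solo ηG T₁ k ≤ e ^ 41 * (ηG * Nat.count solo T₁) := by
  have he0 := H.he0
  have hθ0 := H.hθ0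
  have hη0 := H.hη0
  obtain ⟨h1, h2, -⟩ := H.early_race H.hT1 H.hs1 fun t' h =>
    H.early_pos t' (h.le.trans H.hT1) (le_trans (by gcongr) H.hs1)
  have h3 := h2 k hk
  have h6 := H.theta_six_le
  have h7 := H.gain_le H.hT1 ks
  set C := ηG * (Nat.count solo T₁ : ℝ) with hC
  have hC0 : 0 < C := lt_of_lt_of_le (by positivity) h6
  have hA0 := H.gain_nonneg T₁ ks
  set A := gain v w solo ηG T₁ ks with hA
  have hy0 := H.init_pos
  have hy1 := (abs_le.1 (H.init_le ks)).2
  have hy2 : θ ^ 20 / e ^ 2 ≤ θ ^ 10 * C := by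
    have : 1000 * θ ^ 20 / e ^ 2 ≤ θ ^ 16 := H.theta_div_le (by norm_num) (by norm_num)
    have h8 : θ ^ 20 / e ^ 2 ≤ 1000 * θ ^ 20 / e ^ 2 := by
      gcongr
      linarith [pow_pos hθ0 20]
    calc θ ^ 20 / e ^ 2 ≤ θ ^ 16 := h8.trans this
      _ = θ ^ 10 * θ ^ 6 := by ring
      _ ≤ _ := by gcongr
  have hy3 : corr v w 0 ks ≤ θ ^ 10 * C := hy1.trans hy2
  have hθ10 : θ ^ 10 ≤ e ^ 200 := by
    calc θ ^ 10 ≤ θ ^ 1 := pow_le_pow_small hθ0.le H.hθ1 (by norm_num)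
      _ ≤ e ^ 200 := by rw [pow_one]; exact H.hθ
  have hyt : corr v w 0 ks + A ≤ 3 * C := by
    have : θ ^ 10 * C ≤ 1 * C := by
      gcongr
      exact pow_le_one₀ hθ0.le H.hθ1
    linarith
  have h4 := profile_le_sqrt (g := e ^ 8) (κ := e ^ 43) (by positivity) hy0
    (add_pos_of_pos_of_nonneg hy0 hA0)
  have hsq : √(corr v w 0 ks * (corr v w 0 ks + A)) ≤ 2 * e ^ 100 * C := by
    apply Real.sqrt_le_iff.2
    refine ⟨by positivity, ?_⟩
    calc _ ≤ (θ ^ 10 * C) * (3 * C) := by gcongr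
      _ ≤ (e ^ 200 * C) * (3 * C) := by gcongr
      _ ≤ _ := by ring_nf; nlinarith [mul_pos (sq_pos_of_pos hC0) (pow_pos he0 200)]
  have h5 : 2 / e ^ 8 * √(corr v w 0 ks * (corr v w 0 ks + A)) ≤ 4 * e ^ 92 * C := by
    calc _ ≤ 2 / e ^ 8 * (2 * e ^ 100 * C) := by gcongr
      _ = _ := by field_simp; norm_num
  have h8 : 20 * e ^ 43 * (corr v w 0 ks + A) ≤ 20 * e ^ 43 * (3 * C) := by gcongr
  have hik := (abs_le.1 (H.init_le k)).1
  have h9 : θ ^ 10 * C ≤ e ^ 200 * C := by gcongr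
  have e1 : 1000 * e ^ 43 ≤ e ^ 41 := H.tiny (by norm_num)
  have e2 : 1000 * e ^ 92 ≤ e ^ 41 := H.tiny (by norm_num)
  have e3 : 1000 * e ^ 200 ≤ e ^ 41 := H.tiny (by norm_num)
  have m1 := mul_le_mul_of_nonneg_right e1 hC0.le
  have m2 := mul_le_mul_of_nonneg_right e2 hC0.le
  have m3 := mul_le_mul_of_nonneg_right e3 hC0.le
  have : 0 < e ^ 41 * C := by positivity
  linarith

/-- After `T₁` the weights are no longer nearly orthonormal, since the leaders grow, but cross
products stay at most `e ^ 25` and self products at least `1 / 2`. In terms of the total step length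
`C`, the leading correlation is at least `2 e ^ 7 C`, and the others are at most `e ^ 17 C`. -/
theorem dominated_of_dominated {t : ℕ} (h1 : T₁ ≤ t) (ht : t ≤ T)
    (hD : ∀ i < t, T₁ ≤ i → Dominated v w ks e i) : Dominated v w ks e t := by
  have he0 := H.he0
  have hθ0 := H.hθ0
  have hη0 := H.hη0
  have hηG0 := H.hηG0
  obtain ⟨r1, -, -⟩ := H.early_race H.hT1 H.hs1 fun t' h =>
    H.early_pos t' (h.le.trans H.hT1) (le_trans (by gcongr) H.hs1)
  have h6 := H.theta_six_le
  have hcnt : ηG * (Nat.count solo T₁ : ℝ) ≤ ηG * Nat.count solo t := by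
    have := Nat.count_monotone solo h1
    gcongr
  have hother : ∀ k, k ≠ ks → gain v w solo ηG t k ≤ 3 * e ^ 20 * (ηG * Nat.count solo t) := by
    intro k hk
    have g1 := H.gain_other_early hk
    have g2 := H.gain_sub_le h1 ht k (ρ := 2 * e ^ 20) fun i hi hit _ => by
      have d1 := (hD i hit hi).2 k hk
      have d2 := H.coef_mul_sq_le (hit.le.trans ht) ks
      have d3 := H.coef_nonneg i
      calc coef v w solo ηG i * corr v w i k ^ 2 = coef v w solo ηG i * |corr v w i k| ^ 2 := by
            rw [sq_abs]
        _ ≤ coef v w solo ηG i * (e ^ 10 * corr v w i ks) ^ 2 := by gcongr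
        _ = e ^ 20 * (coef v w solo ηG i * corr v w i ks ^ 2) := by ring
        _ ≤ e ^ 20 * (2 * ηG) := by gcongr
        _ = _ := by ring
    have e1 : e ^ 41 ≤ e ^ 20 := pow_le_pow_small he0.le H.he1 (by norm_num)
    have e2 : e ^ 41 * (ηG * (Nat.count solo T₁ : ℝ)) ≤ e ^ 20 * (ηG * Nat.count solo T₁) := by
      gcongr
    have e3 : e ^ 20 * (ηG * (Nat.count solo T₁ : ℝ)) ≤ e ^ 20 * (ηG * Nat.count solo t) := by
      gcongr
    have e4 : 0 ≤ e ^ 20 * (ηG * (Nat.count solo T₁ : ℝ)) := by positivity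
    linarith
  have hlead : e ^ 6 * (ηG * Nat.count solo t) ≤ 128 * gain v w solo ηG t ks := by
    have g2 := H.le_gain_sub h1 ht ks (ρ := e / 2 / 2) fun i hi hit hs => by
      obtain ⟨d0, d1⟩ := hD i hit hi
      have hi' : i ≤ T := hit.le.trans ht
      have d3 : ‖incr v w i‖ ≤ 2 / e * corr v w i ks ^ 2 := by
        rw [incr, ← Finset.add_sum_erase _ _ (Finset.mem_univ ks)]
        refine (norm_add_le _ _).trans ?_
        have n1 : ‖corr v w i ks ^ 2 • w i ks‖ ≤ corr v w i ks ^ 2 * (1 / e) := by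
          rw [norm_smul, Real.norm_of_nonneg (sq_nonneg _)]
          have := H.hnorm i hi' ks
          gcongr
        have n2 : ‖∑ k ∈ Finset.univ.erase ks, corr v w i k ^ 2 • w i k‖
            ≤ corr v w i ks ^ 2 * (1 / e) := by
          calc _ ≤ ∑ k ∈ Finset.univ.erase ks, e ^ 20 * corr v w i ks ^ 2 * (1 / e) := by
                refine (norm_sum_le _ _).trans (Finset.sum_le_sum fun k hk => ?_)
                rw [norm_smul, Real.norm_of_nonneg (sq_nonneg _)]
                have := H.hnorm i hi' k
                have := d1 k (Finset.ne_of_mem_erase hk)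
                calc _ = |corr v w i k| ^ 2 * ‖w i k‖ := by rw [sq_abs]
                  _ ≤ (e ^ 10 * corr v w i ks) ^ 2 * (1 / e) := by gcongr
                  _ = _ := by ring
            _ ≤ m * (e ^ 20 * corr v w i ks ^ 2 * (1 / e)) := by
                rw [Finset.sum_const, nsmul_eq_mul]
                gcongr
                exact (Finset.card_le_univ _).trans (by simp)
            _ = (m * e) * e ^ 19 * (corr v w i ks ^ 2 * (1 / e)) := by ring
            _ ≤ 1 * (corr v w i ks ^ 2 * (1 / e)) := by
                gcongr
                have := H.hm
                have h1000 : 1000 * e ^ 19 ≤ e ^ 0 := H.tiny (by norm_num)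
                have : m * e * e ^ 19 ≤ 2 * e ^ 19 := by gcongr
                rw [pow_zero] at h1000
                linarith
            _ = _ := one_mul _
        calc _ ≤ _ := add_le_add n1 n2
          _ = _ := by ring
      have d4 : 0 < ‖incr v w i‖ := by
        have h3 := H.sq_le_norm_incr hi' ks
        have h4 := sq_pos_of_pos d0
        linarith
      rw [coef, if_pos hs, div_mul_eq_mul_div ηG, le_div_iff₀ d4]
      calc e / 2 / 2 * ηG * ‖incr v w i‖ ≤ e / 2 / 2 * ηG * (2 / e * corr v w i ks ^ 2) := by
            gcongr
        _ = ηG * (corr v w i ks ^ 2 / 2) := by field_simp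
        _ ≤ ηG * corr v w i ks ^ 2 := by
            have := sq_nonneg (corr v w i ks)
            gcongr
            linarith
    have k1 : e ^ 6 * (ηG * Nat.count solo T₁) ≤ 128 * gain v w solo ηG T₁ ks := by
      rw [div_mul_eq_mul_div, le_div_iff₀ (by positivity)] at r1
      linarith
    have k2 : e ^ 6 ≤ e / 2 / 2 := by
      have : 1000 * e ^ 6 ≤ e ^ 1 := H.tiny (by norm_num)
      have := pow_pos he0 6
      rw [pow_one] at *
      linarith
    have k3 : e ^ 6 * (ηG * Nat.count solo t - ηG * Nat.count solo T₁)
        ≤ e / 2 / 2 * (ηG * Nat.count solo t - ηG * Nat.count solo T₁) := by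
      have : 0 ≤ ηG * (Nat.count solo t : ℝ) - ηG * Nat.count solo T₁ := by linarith
      gcongr
    have k4 : 0 ≤ e / 2 / 2 * (ηG * Nat.count solo t - ηG * Nat.count solo T₁) := by
      have : 0 ≤ ηG * (Nat.count solo t : ℝ) - ηG * Nat.count solo T₁ := by linarith
      positivity
    linarith
  set C := ηG * (Nat.count solo t : ℝ) with hC
  have hC6 : θ ^ 6 ≤ C := h6.trans hcnt
  have hC0 : 0 < C := lt_of_lt_of_le (by positivity) hC6
  have hc7 : 1000 * (e ^ 7 * C) ≤ e ^ 6 * C := by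
    have : 1000 * e ^ 7 ≤ e ^ 6 := H.tiny (by norm_num)
    have := mul_le_mul_of_nonneg_right this hC0.le
    linarith
  -- the contributions of initialization, other weights and junk
  have hrest : ∀ k, |inner ℝ (w t k) (v 0)| + |inner ℝ (w t k) (junk v w solo ηG t)|
      ≤ e ^ 50 * C := by
    intro k
    have j1 := H.abs_inner_init_le ht k
    have j2 := H.abs_inner_junk_le ht k
    have j3 : 1000 * θ ^ 9 / e ^ 52 ≤ θ ^ 6 := H.theta_div_le (by norm_num) (by norm_num)
    have j4 : 1000 * θ ^ 30 / e ^ 52 ≤ θ ^ 6 := H.theta_div_le (by norm_num) (by norm_num)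
    have j5 : 1 / e * θ ^ 9 ≤ e ^ 50 * C / 100 := by
      rw [one_div, inv_mul_le_iff₀ he0]
      rw [div_le_iff₀ (by positivity)] at j3
      have : θ ^ 6 * e ^ 52 ≤ C * (e ^ 51 * 1) := by
        have := pow_le_pow_small he0.le H.he1 (by norm_num : 51 ≤ 52)
        rw [mul_one]
        gcongr
      have e1 : e * (e ^ 50 * C / 100) = C * (e ^ 51 * 1) / 100 := by ring
      rw [e1]
      linarith [pow_pos hθ0 9]
    have j6 : 1 / e * θ ^ 30 ≤ e ^ 50 * C / 100 := by
      refine le_trans ?_ j5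
      have := pow_le_pow_small hθ0.le H.hθ1 (by norm_num : 9 ≤ 30)
      gcongr
    have j7 : 1 / e * (e ^ 57 * C + 2 * θ ^ 30) = e ^ 56 * C + 2 * (1 / e * θ ^ 30) := by
      field_simp
    have j8 : 1000 * e ^ 56 ≤ e ^ 50 := H.tiny (by norm_num)
    have j9 := mul_le_mul_of_nonneg_right j8 hC0.le
    have j10 : 0 < e ^ 50 * C := by positivity
    rw [j7] at j2
    linarith
  have hcrosssum : ∀ k, |∑ k' ∈ Finset.univ.erase k, ∑ i ∈ Finset.range t,
      coef v w solo ηG i * corr v w i k' ^ 2 * inner ℝ (w t k) (w i k')| ≤ 4 * e ^ 24 * C := by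
    intro k
    calc _ ≤ ∑ k' ∈ Finset.univ.erase k, 2 * C * e ^ 25 := by
          refine (Finset.abs_sum_le_sum_abs _ _).trans (Finset.sum_le_sum fun k' hk' => ?_)
          calc _ ≤ ∑ i ∈ Finset.range t, coef v w solo ηG i * corr v w i k' ^ 2 * e ^ 25 := by
                refine (Finset.abs_sum_le_sum_abs _ _).trans (Finset.sum_le_sum fun i hi => ?_)
                have hc := H.coef_nonneg i
                rw [abs_mul, abs_of_nonneg (by positivity)]
                have := H.hcross t ht i ((Finset.mem_range.1 hi).le.trans ht) k k'
                  (Finset.ne_of_mem_erase hk').symm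
                gcongr
            _ = gain v w solo ηG t k' * e ^ 25 := by rw [gain, Finset.sum_mul]
            _ ≤ _ := by
                have := H.gain_le ht k'
                gcongr
      _ ≤ m * (2 * C * e ^ 25) := by
          rw [Finset.sum_const, nsmul_eq_mul]
          gcongr
          exact (Finset.card_le_univ _).trans (by simp)
      _ = (m * e) * (2 * C * e ^ 24) := by ring
      _ ≤ 2 * (2 * C * e ^ 24) := by have := H.hm; gcongr
      _ = _ := by ring
  have hsplit : ∀ k, corr v w t k = inner ℝ (w t k) (v 0)
      + (∑ i ∈ Finset.range t, coef v w solo ηG i * corr v w i k ^ 2 * inner ℝ (w t k) (w i k)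
      + ∑ k' ∈ Finset.univ.erase k, ∑ i ∈ Finset.range t,
          coef v w solo ηG i * corr v w i k' ^ 2 * inner ℝ (w t k) (w i k'))
      + inner ℝ (w t k) (junk v w solo ηG t) := by
    intro k
    rw [H.corr_eq t k, Finset.add_sum_erase _ (fun k' => ∑ i ∈ Finset.range t,
      coef v w solo ηG i * corr v w i k' ^ 2 * inner ℝ (w t k) (w i k')) (Finset.mem_univ k)]
  have hlow : 2 * (e ^ 7 * C) ≤ corr v w t ks := by
    have s1 : 1 / 2 * gain v w solo ηG t ks ≤ ∑ i ∈ Finset.range t,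
        coef v w solo ηG i * corr v w i ks ^ 2 * inner ℝ (w t ks) (w i ks) := by
      rw [gain, Finset.mul_sum]
      refine Finset.sum_le_sum fun i hi => ?_
      have hc := H.coef_nonneg i
      rw [mul_comm]
      have := H.hself t ht i ((Finset.mem_range.1 hi).le.trans ht) ks
      gcongr
    have s2 := (abs_le.1 (hcrosssum ks)).1
    have s3 := hrest ks
    have s4 := neg_abs_le (inner ℝ (w t ks) (v 0))
    have s5 := neg_abs_le (inner ℝ (w t ks) (junk v w solo ηG t))
    have s6 := hsplit ks
    have s7 : 1000 * e ^ 24 ≤ e ^ 7 := H.tiny (by norm_num)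
    have s8 : 1000 * e ^ 50 ≤ e ^ 7 := H.tiny (by norm_num)
    have s9 := mul_le_mul_of_nonneg_right s7 hC0.le
    have s10 := mul_le_mul_of_nonneg_right s8 hC0.le
    have : 0 < e ^ 7 * C := by positivity
    linarith
  have h7C : 0 < e ^ 7 * C := by positivity
  refine ⟨by linarith, fun k hk => ?_⟩
  have s1 : |∑ i ∈ Finset.range t, coef v w solo ηG i * corr v w i k ^ 2 * inner ℝ (w t k) (w i k)|
      ≤ 3 * e ^ 18 * C := by
    calc _ ≤ ∑ i ∈ Finset.range t, coef v w solo ηG i * corr v w i k ^ 2 * (1 / e * (1 / e)) := by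
          refine (Finset.abs_sum_le_sum_abs _ _).trans (Finset.sum_le_sum fun i hi => ?_)
          have hc := H.coef_nonneg i
          rw [abs_mul, abs_of_nonneg (by positivity)]
          have n1 := abs_real_inner_le_norm (w t k) (w i k)
          have n2 := H.hnorm t ht k
          have n3 := H.hnorm i ((Finset.mem_range.1 hi).le.trans ht) k
          have n4 : ‖w t k‖ * ‖w i k‖ ≤ 1 / e * (1 / e) := by gcongr
          have := n1.trans n4
          gcongr
      _ = gain v w solo ηG t k * (1 / e * (1 / e)) := by rw [gain, Finset.sum_mul]
      _ ≤ 3 * e ^ 20 * C * (1 / e * (1 / e)) := by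
          have := hother k hk
          gcongr
      _ = _ := by field_simp
  have s2 := hcrosssum k
  have s3 := hrest k
  have s4 : |corr v w t k| ≤ 3 * e ^ 18 * C + 4 * e ^ 24 * C + e ^ 50 * C := by
    rw [hsplit k]
    have a1 := abs_add_three (inner ℝ (w t k) (v 0))
      (∑ i ∈ Finset.range t, coef v w solo ηG i * corr v w i k ^ 2 * inner ℝ (w t k) (w i k)
      + ∑ k' ∈ Finset.univ.erase k, ∑ i ∈ Finset.range t,
          coef v w solo ηG i * corr v w i k' ^ 2 * inner ℝ (w t k) (w i k'))
      (inner ℝ (w t k) (junk v w solo ηG t))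
    have a2 := abs_add_le
      (∑ i ∈ Finset.range t, coef v w solo ηG i * corr v w i k ^ 2 * inner ℝ (w t k) (w i k))
      (∑ k' ∈ Finset.univ.erase k, ∑ i ∈ Finset.range t,
          coef v w solo ηG i * corr v w i k' ^ 2 * inner ℝ (w t k) (w i k'))
    linarith
  have e1 : 1000 * e ^ 18 ≤ e ^ 17 := H.tiny (by norm_num)
  have e2 : 1000 * e ^ 24 ≤ e ^ 17 := H.tiny (by norm_num)
  have e3 : 1000 * e ^ 50 ≤ e ^ 17 := H.tiny (by norm_num)
  have m1 := mul_le_mul_of_nonneg_right e1 hC0.le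
  have m2 := mul_le_mul_of_nonneg_right e2 hC0.le
  have m3 := mul_le_mul_of_nonneg_right e3 hC0.le
  have : 0 < e ^ 17 * C := by positivity
  calc |corr v w t k| ≤ e ^ 17 * C := by linarith
    _ = e ^ 10 * (e ^ 7 * C) := by ring
    _ ≤ _ := by
      gcongr
      linarith

theorem dominated (t : ℕ) (h1 : T₁ ≤ t) (ht : t ≤ T) : Dominated v w ks e t := by
  induction t using Nat.strong_induction_on with
  | _ t ih => exact H.dominated_of_dominated h1 ht fun t' h h' => ih t' h h' (h.le.trans ht)

/-- Divided by the leading squared correlation, the increment differs from `α u` by at most `7 / 4`,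
from the leading weight, plus `1 / 4`, from all others. -/
theorem norm_normalize_incr_sub_le {t : ℕ} (h1 : T₁ ≤ t) (ht : t ≤ T) {u : Vec d} {α : ℝ}
    (hu : ‖u‖ = 1) (hα : 0 < α) (hw : ‖w t ks - α • u‖ ≤ 7 / 4) :
    ‖‖incr v w t‖⁻¹ • incr v w t - u‖ ≤ 4 / α := by
  have he0 := H.he0
  obtain ⟨d0, d1⟩ := H.dominated t h1 ht
  have hc := sq_pos_of_pos d0
  refine (norm_normalize_sub_le hu (α := corr v w t ks ^ 2 * α) (by positivity)).trans ?_
  have h2 : ‖incr v w t - (corr v w t ks ^ 2 * α) • u‖ ≤ corr v w t ks ^ 2 * 2 := by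
    rw [incr, ← Finset.add_sum_erase _ _ (Finset.mem_univ ks), add_sub_right_comm]
    refine (norm_add_le _ _).trans ?_
    have n1 : ‖corr v w t ks ^ 2 • w t ks - (corr v w t ks ^ 2 * α) • u‖
        ≤ corr v w t ks ^ 2 * (7 / 4) := by
      rw [mul_smul, ← smul_sub, norm_smul, Real.norm_of_nonneg hc.le]
      gcongr
    have n2 : ‖∑ k ∈ Finset.univ.erase ks, corr v w t k ^ 2 • w t k‖
        ≤ corr v w t ks ^ 2 * (1 / 4) := by
      calc _ ≤ ∑ k ∈ Finset.univ.erase ks, e ^ 20 * corr v w t ks ^ 2 * (1 / e) := by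
            refine (norm_sum_le _ _).trans (Finset.sum_le_sum fun k hk => ?_)
            rw [norm_smul, Real.norm_of_nonneg (sq_nonneg _)]
            have := H.hnorm t ht k
            have := d1 k (Finset.ne_of_mem_erase hk)
            calc _ = |corr v w t k| ^ 2 * ‖w t k‖ := by rw [sq_abs]
              _ ≤ (e ^ 10 * corr v w t ks) ^ 2 * (1 / e) := by gcongr
              _ = _ := by ring
        _ ≤ m * (e ^ 20 * corr v w t ks ^ 2 * (1 / e)) := by
            rw [Finset.sum_const, nsmul_eq_mul]
            gcongr
            exact (Finset.card_le_univ _).trans (by simp)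
        _ = (m * e) * e ^ 18 * corr v w t ks ^ 2 := by field_simp
        _ ≤ 1 / 4 * corr v w t ks ^ 2 := by
            gcongr
            have := H.hm
            have h1000 : 1000 * e ^ 18 ≤ e ^ 0 := H.tiny (by norm_num)
            have : m * e * e ^ 18 ≤ 2 * e ^ 18 := by gcongr
            rw [pow_zero] at h1000
            linarith
        _ = _ := by ring
    linarith
  rw [div_le_div_iff₀ (by positivity) hα]
  calc 2 * ‖incr v w t - (corr v w t ks ^ 2 * α) • u‖ * α
      ≤ 2 * (corr v w t ks ^ 2 * 2) * α := by gcongr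
    _ = _ := by ring

/-- The final vector is a sum of steps of length at most `ηG`. Those before `T₂` may point anywhere
and cost at most two each, but they are a fraction `ρ₁`; the later ones point along `u` up to `ρ`.
The initial vector and the junk are covered by `e`. -/
theorem norm_final_sub_le {T₂ : ℕ} {u : Vec d} {ρ ρ₁ : ℝ} (h12 : T₁ ≤ T₂) (hT2 : T₂ ≤ T)
    (hu : ‖u‖ = 1) (hρ0 : 0 ≤ ρ)
    (hw : ∀ t, T₂ ≤ t → t ≤ T → ∃ α, 0 < α ∧ ‖w t ks - α • u‖ ≤ 7 / 4 ∧ 4 / α ≤ ρ)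
    (hρ₁ : (Nat.count solo T₂ : ℝ) ≤ ρ₁ * Nat.count solo T) :
    ‖‖v T‖⁻¹ • v T - u‖ ≤ 2 * (2 * ρ₁ + ρ + e) := by
  have he0 := H.he0
  have hθ0 := H.hθ0
  have hηG0 := H.hηG0
  have hsum : ∀ t, t ≤ T → ‖∑ i ∈ Finset.range t, coef v w solo ηG i • incr v w i
      - (ηG * Nat.count solo t) • u‖
      ≤ ρ * (ηG * Nat.count solo t) + 2 * (ηG * Nat.count solo (min t T₂)) := by
    intro t
    induction t with
    | zero => intro _; simp
    | succ t ih =>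
      intro ht
      have ih := ih (Nat.le_of_succ_le ht)
      rw [Finset.sum_range_succ]
      have hmono : (Nat.count solo (min t T₂) : ℝ) ≤ Nat.count solo (min (t + 1) T₂) := by
        have := Nat.count_monotone solo (min_le_min_right T₂ (Nat.le_succ t))
        exact_mod_cast this
      by_cases hs : solo t
      · have e1 : coef v w solo ηG t • incr v w t = ηG • (‖incr v w t‖⁻¹ • incr v w t) := by
          rw [coef, if_pos hs, smul_smul, div_eq_mul_inv]
        have e2 : ∑ i ∈ Finset.range t, coef v w solo ηG i • incr v w i
            + coef v w solo ηG t • incr v w t - (ηG * Nat.count solo (t + 1)) • u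
            = (∑ i ∈ Finset.range t, coef v w solo ηG i • incr v w i
              - (ηG * Nat.count solo t) • u) + ηG • (‖incr v w t‖⁻¹ • incr v w t - u) := by
          rw [e1, Nat.count_succ, if_pos hs]
          push_cast
          rw [mul_add, add_smul, smul_sub, mul_one]
          abel
        rw [e2]
        refine (norm_add_le _ _).trans ?_
        rw [norm_smul, Real.norm_of_nonneg hηG0.le, Nat.count_succ, if_pos hs]
        push_cast
        rcases lt_or_ge t T₂ with h | h
        · have n1 : ‖‖incr v w t‖⁻¹ • incr v w t - u‖ ≤ 2 := by
            refine (norm_sub_le _ _).trans ?_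
            rw [hu, norm_smul, norm_inv, norm_norm]
            have := inv_mul_le_one (a := ‖incr v w t‖)
            linarith
          rw [min_eq_left h, Nat.count_succ, if_pos hs]
          rw [min_eq_left h.le] at ih
          push_cast
          have : ηG * ‖‖incr v w t‖⁻¹ • incr v w t - u‖ ≤ ηG * 2 := by gcongr
          have : 0 ≤ ρ * ηG := by positivity
          linarith
        · obtain ⟨α, hα, hwα, hαρ⟩ := hw t h (Nat.le_of_succ_le ht)
          have n1 := (H.norm_normalize_incr_sub_le (h12.trans h) (Nat.le_of_succ_le ht) hu hα
            hwα).trans hαρ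
          have : ηG * ‖‖incr v w t‖⁻¹ • incr v w t - u‖ ≤ ηG * ρ := by gcongr
          have : ηG * (Nat.count solo (min t T₂) : ℝ) ≤ ηG * Nat.count solo (min (t + 1) T₂) := by
            gcongr
          linarith
      · have e1 : coef v w solo ηG t = 0 := if_neg hs
        rw [e1, zero_smul, add_zero, Nat.count_succ, if_neg hs, add_zero]
        have : ηG * (Nat.count solo (min t T₂) : ℝ) ≤ ηG * Nat.count solo (min (t + 1) T₂) := by
          gcongr
        linarith
  have h1 := hsum T le_rfl
  rw [min_eq_right hT2] at h1
  have h6 : θ ^ 6 ≤ ηG * Nat.count solo T := H.theta_six_le.trans (by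
    have := Nat.count_monotone solo H.hT1
    gcongr)
  set C := ηG * (Nat.count solo T : ℝ) with hC
  have hC0 : 0 < C := lt_of_lt_of_le (by positivity) h6
  refine (norm_normalize_sub_le hu hC0).trans ?_
  have hv : v T - C • u = v 0 + (∑ i ∈ Finset.range T, coef v w solo ηG i • incr v w i - C • u)
      + junk v w solo ηG T := by
    rw [junk]; abel
  have h2 : ηG * (Nat.count solo T₂ : ℝ) ≤ ρ₁ * C := by
    calc _ ≤ ηG * (ρ₁ * Nat.count solo T) := by gcongr
      _ = _ := by rw [hC]; ring
  have h3 := (H.norm_junk_le le_rfl).trans (H.pair_le le_rfl)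
  have h4 := H.hv0
  have h5 : ‖v T - C • u‖ ≤ (2 * ρ₁ + ρ + e) * C := by
    rw [hv]
    refine (norm_add₃_le).trans ?_
    have j3 : 1000 * θ ^ 9 / e ^ 1 ≤ θ ^ 6 := H.theta_div_le (by norm_num) (by norm_num)
    rw [div_le_iff₀ (by positivity), pow_one] at j3
    have j4 : θ ^ 30 ≤ θ ^ 9 := pow_le_pow_small hθ0.le H.hθ1 (by norm_num)
    have j5 : θ ^ 6 * e ≤ C * e := by gcongr
    have j6 : 1000 * e ^ 57 ≤ e ^ 1 := H.tiny (by norm_num)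
    have j7 := mul_le_mul_of_nonneg_right j6 hC0.le
    rw [pow_one] at j7
    have := mul_pos he0 hC0
    have := pow_pos hθ0 9
    linarith
  rw [div_le_iff₀ hC0]
  linarith

end PowerSetup

/-! ### The trajectory for good initializations and samples -/

/-- The latent vector whose only active coordinate is `j`. -/
def soloVec {m : ℕ} (j : Fin m) : Fin m → Bool := fun i => decide (i = j)

theorem generator_soloVec {m d : ℕ} (V : Rows m d) (j : Fin m) :
    generator V (soloVec j) = V j := by
  simp [generator, binComb, soloVec]

/-- An initialization from which training succeeds, up to the symmetry `flip`. -/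
structure GoodInit {mD mG d : ℕ} (S₀ : State mD mG d) (u : Fin 2 → Vec d) (iw : Fin 2 → Fin mD)
    (jv : Fin 2 → Fin mG) (e θ : ℝ) : Prop where
  ha : θ ≤ S₀.a * e ^ 200
  ha1 : S₀.a ≤ 1
  hb : S₀.b = 0
  hWW : ∀ k k', |inner ℝ (S₀.W k) (S₀.W k') - if k = k' then 1 else 0| ≤ θ
  hV : ∀ j, ‖S₀.V j‖ ≤ θ ^ 9
  hiw : iw 0 ≠ iw 1
  hwin : ∀ l, θ ^ 10 / 2 ≤ inner ℝ (S₀.W (iw l)) (u l)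
  hini : ∀ l k, e ^ 2 * |inner ℝ (S₀.W k) (u l)| ≤ θ ^ 10
  hgap : ∀ l k, k ≠ iw l →
    inner ℝ (S₀.W k) (u l) ≤ inner ℝ (S₀.W (iw l)) (u l) - e ^ 6 * θ ^ 10
  hvwin : ∀ l, θ ^ 20 / 2 ≤ inner ℝ (S₀.W (iw l)) (S₀.V (jv l))
  hvini : ∀ l k, e ^ 2 * |inner ℝ (S₀.W k) (S₀.V (jv l))| ≤ θ ^ 20
  hvgap : ∀ l k, k ≠ iw l → inner ℝ (S₀.W k) (S₀.V (jv l))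
    ≤ inner ℝ (S₀.W (iw l)) (S₀.V (jv l)) - e ^ 6 * θ ^ 20

/-- Training samples whose empirical frequencies are close to the expected ones. -/
structure GoodSamples {mG : ℕ} (lab : ℕ → Option (Fin 2)) (z : ℕ → Fin mG → Bool)
    (e cp ρ₁ : ℝ) (n T T₂ : ℕ) : Prop where
  hcount : ∀ t, t ≤ T → ∀ l, cp * t ≤ Nat.count (fun i => lab i = some l) t + n
  hbad : ∀ t, t ≤ T → (Nat.count (fun i => lab i = none) t : ℝ) ≤ e ^ 60 * t + n
  hsolo : ∀ t, t ≤ T → ∀ j, e ^ 3 * t ≤ Nat.count (fun i => z i = soloVec j) t + n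
  hpair : ∀ t, t ≤ T → ∀ j,
    (Nat.count (fun i => z i j = true ∧ z i ≠ soloVec j) t : ℝ) ≤ e ^ 60 * t + n
  hearly : ∀ j, (Nat.count (fun i => z i = soloVec j) T₂ : ℝ)
    ≤ ρ₁ * Nat.count (fun i => z i = soloVec j) T

/-- The relations between the parameters, where `e = 1 / log d` and `θ = d ^ (-1/20)`. -/
structure Scale (mD mG d : ℕ) (lam η ηG e θ cp ρ : ℝ) (n T T₂ : ℕ) : Prop where
  he0 : 0 < e
  he : e ≤ 1 / 1000
  hθ0 : 0 < θ
  hθ : θ ≤ e ^ 200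
  hη0 : 0 < η
  hη : η ≤ θ ^ 30
  hηG : ηG ≤ e ^ 60 * η
  hηG' : θ * η ≤ e ^ 200 * ηG
  hT : e * (2 + η * T) ≤ 1
  hgapT : 2 * (1 + η * T) ^ 4 + 2 ≤ Real.log (1 / e)
  hlam0 : 0 ≤ lam
  hlam : lam ≤ θ ^ 10
  hm : (mD : ℝ) * e ≤ 2
  hmG : (mG : ℝ) * e ^ 2 ≤ 1
  hcp : e ≤ cp
  hcp1 : cp ≤ 1
  hn : η * n ≤ θ ^ 30
  hT2 : T₂ ≤ T
  hT2' : θ ^ 4 ≤ η * T₂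
  hρ0 : 0 < ρ
  hρ : 4 / ρ ≤ cp * (η * T₂) / 2 - θ ^ 3
  htrunc : 2 / e ^ 3 < truncLevel d

section Path
variable {mD mG d : ℕ} {S₀ : State mD mG d} {u : Fin 2 → Vec d} {iw : Fin 2 → Fin mD}
    {jv : Fin 2 → Fin mG} {lam η ηG e θ cp ρ ρ₁ : ℝ} {n T T₂ : ℕ} {lab : ℕ → Option (Fin 2)}
    {z : ℕ → Fin mG → Bool} {X : ℕ → Vec d}

/-- A score `f` with `f + 1 ≤ log (1 / e)` has `exp f ≤ 1 / (2 e)`, hence `1 + exp f ≤ 1 / e`. -/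
theorem le_realGap {S : State mD mG d} {Y : Vec d} (he0 : 0 < e) (he : e ≤ 1 / 1000)
    (h : S.a * ∑ i, inner ℝ (S.W i) Y ^ 3 + lam * S.b + 1 ≤ Real.log (1 / e)) :
    e ≤ realGap lam S Y := by
  rw [realGap, Real.sigmoid_def, neg_neg]
  set f := S.a * ∑ i, inner ℝ (S.W i) Y ^ 3 + lam * S.b
  rw [le_inv_comm₀ he0 (by positivity)]
  have h1 : Real.exp (f + 1) ≤ 1 / e := by
    rw [← Real.exp_log (by positivity : 0 < 1 / e)]
    exact Real.exp_le_exp.2 h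
  have h2 : 2 ≤ Real.exp 1 := by linarith [Real.add_one_le_exp 1]
  rw [Real.exp_add] at h1
  have h3 : 1000 ≤ 1 / e := by rw [le_div_iff₀ he0]; linarith
  have h4 := Real.exp_pos f
  rw [one_div] at h1 h3
  nlinarith

theorem GoodInit.norm_W_le (hI : GoodInit S₀ u iw jv e θ) (hθ : θ ≤ 1 / 2) (k : Fin mD) :
    ‖S₀.W k‖ ≤ 3 / 2 := by
  have := (abs_le.1 (hI.hWW k k)).2
  rw [if_pos rfl, real_inner_self_eq_norm_sq] at this
  nlinarith [norm_nonneg (S₀.W k)]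

/-- Needs no information on the dynamics beyond the displacement bound `s = η t`: the score is at
most about `(1 + s) ^ 2 (1 + 2 s²)`, and `hgapT` keeps this below `log log d`. This is what limits
the training time. -/
theorem abs_score_le (hs : Scale mD mG d lam η ηG e θ cp ρ n T T₂)
    (hI : GoodInit S₀ u iw jv e θ) (hu : ∀ l, ‖u l‖ = 1) {t : ℕ} (ht : t ≤ T) (l : Fin 2) :
    (cubicRun lam η ηG X z S₀ t).a * ∑ i, inner ℝ ((cubicRun lam η ηG X z S₀ t).W i) (u l) ^ 3
      + lam * (cubicRun lam η ηG X z S₀ t).b + 1 ≤ Real.log (1 / e) := by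
  have hη0 := hs.hη0
  have he0 := hs.he0
  have hθ0 := hs.hθ0
  have hdisp := cubicRun_displacement (lam := lam) (etaG := ηG) (X := X) (z := z) (S₀ := S₀)
    hη0.le t
  set S := cubicRun lam η ηG X z S₀ t
  set s := η * (t : ℝ) with hsd
  have hs0 : 0 ≤ s := by positivity
  have hsT : s ≤ η * T := by
    have : (t : ℝ) ≤ T := by exact_mod_cast ht
    exact mul_le_mul_of_nonneg_left this hη0.le
  rw [hI.hb, sub_zero] at hdisp
  have d1 : |S.a - S₀.a| ≤ s := by linarith [abs_nonneg S.b, norm_nonneg (S.W - S₀.W)]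
  have d2 : |S.b| ≤ s := by linarith [abs_nonneg (S.a - S₀.a), norm_nonneg (S.W - S₀.W)]
  have d3 : ‖S.W - S₀.W‖ ≤ s := by linarith [abs_nonneg (S.a - S₀.a), abs_nonneg S.b]
  have ha0 : 0 < S₀.a := pos_of_mul_pos_left (hθ0.trans_le hI.ha) (by positivity)
  have ha : |S.a| ≤ 1 + s := by
    have := abs_add_le (S.a - S₀.a) S₀.a
    rw [sub_add_cancel, abs_of_pos ha0] at this
    linarith [hI.ha1]
  have he1 : e ≤ 1 := by linarith [hs.he]
  have hθ1 : θ ≤ e ^ 2 := hs.hθ.trans (pow_le_pow_small he0.le he1 (by norm_num))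
  have hθ1' : θ ≤ 1 := hθ1.trans (pow_le_one₀ he0.le he1)
  have hx0 : ∀ i, |inner ℝ (S₀.W i) (u l)| ≤ θ ^ 5 := fun i => by
    have := hI.hini l i
    have h1 : θ ^ 10 ≤ e ^ 2 * θ ^ 5 := by
      calc θ ^ 10 = θ ^ 4 * θ * θ ^ 5 := by ring
        _ ≤ 1 * e ^ 2 * θ ^ 5 := by
          gcongr
          exact pow_le_one₀ hθ0.le hθ1'
        _ = _ := by ring
    exact le_of_mul_le_mul_left (this.trans h1) (by positivity)
  have hdi : ∀ i, |inner ℝ (S.W i) (u l) - inner ℝ (S₀.W i) (u l)| ≤ ‖(S.W - S₀.W) i‖ := by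
    intro i
    rw [← inner_sub_left]
    refine (abs_real_inner_le_norm _ _).trans ?_
    rw [hu, mul_one]
    rfl
  have hθ5 : θ ^ 5 ≤ 1 := pow_le_one₀ hθ0.le hθ1'
  have hxi : ∀ i, |inner ℝ (S.W i) (u l)| ≤ 1 + s := fun i => by
    have h1 := abs_add_le (inner ℝ (S.W i) (u l) - inner ℝ (S₀.W i) (u l)) (inner ℝ (S₀.W i) (u l))
    rw [sub_add_cancel] at h1
    linarith [hdi i, hx0 i, norm_row_le (S.W - S₀.W) i]
  -- The squared displacements of the rows sum to the squared Frobenius norm, at most `s²`. Bounding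
  -- each row separately would lose the number of neurons, about `log d`.
  have hsq : ∑ i, inner ℝ (S.W i) (u l) ^ 2 ≤ 1 + 2 * s ^ 2 := by
    have h1 : ∀ i, inner ℝ (S.W i) (u l) ^ 2 ≤ 2 * (θ ^ 5) ^ 2 + 2 * ‖(S.W - S₀.W) i‖ ^ 2 := by
      intro i
      have k1 : (inner ℝ (S₀.W i) (u l)) ^ 2 ≤ (θ ^ 5) ^ 2 := by
        rw [← sq_abs]
        have := hx0 i
        gcongr
      have k2 : (inner ℝ (S.W i) (u l) - inner ℝ (S₀.W i) (u l)) ^ 2 ≤ ‖(S.W - S₀.W) i‖ ^ 2 := by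
        rw [← sq_abs]
        have := hdi i
        gcongr
      nlinarith [sq_nonneg (inner ℝ (S.W i) (u l) - inner ℝ (S₀.W i) (u l)
        - inner ℝ (S₀.W i) (u l))]
    have h2 : ∑ i, ‖(S.W - S₀.W) i‖ ^ 2 = ‖S.W - S₀.W‖ ^ 2 := (PiLp.norm_sq_eq_of_L2 _ _).symm
    calc _ ≤ ∑ i, (2 * (θ ^ 5) ^ 2 + 2 * ‖(S.W - S₀.W) i‖ ^ 2) := Finset.sum_le_sum fun i _ => h1 i
      _ = mD * (2 * (θ ^ 5) ^ 2) + 2 * ‖S.W - S₀.W‖ ^ 2 := by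
        simp only [Finset.sum_add_distrib, ← Finset.mul_sum, h2]
        simp only [Finset.sum_const, Finset.card_univ, Fintype.card_fin, nsmul_eq_mul]
        ring
      _ ≤ 1 + 2 * s ^ 2 := by
        have k1 : mD * (2 * (θ ^ 5) ^ 2) ≤ 1 := by
          calc mD * (2 * (θ ^ 5) ^ 2) = 2 * θ ^ 9 * (mD * θ) := by ring
            _ ≤ 2 * θ ^ 9 * (mD * e ^ 2) := by gcongr
            _ = 2 * θ ^ 9 * e * (mD * e) := by ring
            _ ≤ 2 * 1 * (1 / 1000) * 2 := by
              have := hs.hm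
              have := hs.he
              have : θ ^ 9 ≤ 1 := pow_le_one₀ hθ0.le hθ1'
              gcongr
            _ ≤ 1 := by norm_num
        gcongr
  have hcube : |∑ i, inner ℝ (S.W i) (u l) ^ 3| ≤ (1 + s) * (1 + 2 * s ^ 2) := by
    refine (abs_sum_cube_le _).trans ?_
    calc ∑ i, |inner ℝ (S.W i) (u l)| ^ 3 ≤ ∑ i, (1 + s) * inner ℝ (S.W i) (u l) ^ 2 := by
          refine Finset.sum_le_sum fun i _ => ?_
          rw [pow_succ', sq_abs]
          have := hxi i
          gcongr
      _ ≤ _ := by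
          rw [← Finset.mul_sum]
          gcongr
  have hlb : |lam * S.b| ≤ 1 := by
    rw [abs_mul, abs_of_nonneg hs.hlam0]
    calc lam * |S.b| ≤ θ ^ 10 * s := by
          have := hs.hlam
          gcongr
      _ = θ ^ 9 * θ * s := by ring
      _ ≤ 1 * e ^ 2 * s := by
          gcongr
          exact pow_le_one₀ hθ0.le hθ1'
      _ = e * (e * s) := by ring
      _ ≤ 1 * 1 := by
          have := hs.hT
          have : e * s ≤ e * (η * T) := by gcongr
          gcongr
          linarith
      _ = 1 := by norm_num
  have hmain : |S.a * ∑ i, inner ℝ (S.W i) (u l) ^ 3| ≤ (1 + s) * ((1 + s) * (1 + 2 * s ^ 2)) := by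
    rw [abs_mul]
    gcongr
  have hfin : (1 + s) * ((1 + s) * (1 + 2 * s ^ 2)) ≤ 2 * (1 + s) ^ 4 := by
    have h1 : 1 + 2 * s ^ 2 ≤ 2 * (1 + s) ^ 2 := by nlinarith
    calc _ ≤ (1 + s) * ((1 + s) * (2 * (1 + s) ^ 2)) := by gcongr
      _ = _ := by ring
  have hlast : 2 * (1 + s) ^ 4 ≤ 2 * (1 + η * T) ^ 4 := by gcongr
  have := hs.hgapT
  linarith [le_abs_self (S.a * ∑ i, inner ℝ (S.W i) (u l) ^ 3), le_abs_self (lam * S.b)]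

/-- Each column travels at most `ηG t ≤ e ^ 60 η t`, and the factor `e ^ 2` pays for summing over
all columns. -/
theorem generator_bound (hs : Scale mD mG d lam η ηG e θ cp ρ n T T₂)
    (hI : GoodInit S₀ u iw jv e θ) (t : ℕ) (ζ : Fin mG → Bool) :
    e ^ 2 * ‖generator (cubicRun lam η ηG X z S₀ t).V ζ‖ ≤ θ ^ 9 + e ^ 60 * (η * t) := by
  have hη0 := hs.hη0
  have he0 := hs.he0
  have hθ0 := hs.hθ0
  have hηG0 : 0 ≤ ηG := by
    have : 0 < e ^ 200 * ηG := (mul_pos hθ0 hη0).trans_le hs.hηG'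
    exact (pos_of_mul_pos_right this (by positivity)).le
  have h1 := cubicRun_displacement_V (lam := lam) (etaD := η) (X := X) (z := z) (S₀ := S₀) hηG0 t
  set S := cubicRun lam η ηG X z S₀ t
  have h2 : ∀ j, ‖S.V j‖ ≤ θ ^ 9 + e ^ 60 * (η * t) := fun j => by
    have h3 := norm_row_le (S.V - S₀.V) j
    rw [PiLp.sub_apply] at h3
    have h4 := norm_le_norm_add_norm_sub' (S.V j) (S₀.V j)
    have h5 := hI.hV j
    have h6 : ηG * (t : ℝ) ≤ e ^ 60 * η * t := by
      have := hs.hηG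
      gcongr
    linarith
  calc e ^ 2 * ‖generator S.V ζ‖ ≤ e ^ 2 * ∑ j, ‖S.V j‖ := by
        gcongr
        exact norm_generator_le _ _
    _ ≤ e ^ 2 * ∑ _j : Fin mG, (θ ^ 9 + e ^ 60 * (η * t)) := by
        gcongr with j
        exact h2 j
    _ = (mG * e ^ 2) * (θ ^ 9 + e ^ 60 * (η * t)) := by simp; ring
    _ ≤ 1 * (θ ^ 9 + e ^ 60 * (η * t)) := by
        have := hs.hmG
        gcongr
    _ = _ := one_mul _

theorem discSetup (hs : Scale mD mG d lam η ηG e θ cp ρ n T T₂)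
    (hI : GoodInit S₀ u iw jv e θ) (hg : GoodSamples lab z e cp ρ₁ n T T₂)
    (hu : ∀ l, ‖u l‖ = 1) (hγ0 : 0 ≤ inner ℝ (u 0) (u 1)) (hγ : inner ℝ (u 0) (u 1) ≤ e ^ 60)
    (hX : ∀ t l, lab t = some l → X t = u l) :
    DiscSetup (cubicRun lam η ηG X z S₀) X z u lab iw lam η ηG e θ cp n T where
  he0 := hs.he0
  he := hs.he
  hθ0 := hs.hθ0
  hθa := hI.ha
  ha1 := hI.ha1
  hb := hI.hb
  hη0 := hs.hη0
  hη := hs.hη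
  hT := hs.hT
  hlam0 := hs.hlam0
  hlam := hs.hlam
  hm := hs.hm
  hstep _ := rfl
  hu := hu
  hγ0 := hγ0
  hγ := hγ
  hX := hX
  hcp := hs.hcp
  hcp1 := hs.hcp1
  hcount := hg.hcount
  hbad := hg.hbad
  hn := hs.hn
  hG t _ := generator_bound hs hI t _
  hp t ht l _ := le_realGap hs.he0 hs.he (abs_score_le hs hI hu ht l)
  hW0 := hI.norm_W_le (by
    have h1 := hs.hθ
    have h2 := pow_le_pow_small hs.he0.le (by linarith [hs.he]) (by norm_num : 1 ≤ 200)
    rw [pow_one] at h2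
    linarith [hs.he])
  hiw := hI.hiw
  hwin := hI.hwin
  hini := hI.hini
  hgap := hI.hgap

end Path

/-! ### Inner products between the trained discriminator neurons. -/

namespace DiscSetup
variable {mD mG d : ℕ} {S : ℕ → State mD mG d} {X : ℕ → Vec d} {z : ℕ → Fin mG → Bool}
    {u : Fin 2 → Vec d} {lab : ℕ → Option (Fin 2)} {iw : Fin 2 → Fin mD}
    {lam η ηG e θ cp : ℝ} {n T : ℕ}
variable (H : DiscSetup S X z u lab iw lam η ηG e θ cp n T)
include H

theorem tiny {p q : ℕ} (h : q + 1 ≤ p) : 1000 * e ^ p ≤ e ^ q := by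
  refine le_trans ?_ (mul_pow_le_pow H.he0.le H.he 1 q (c := 1000) (by norm_num) (by norm_num))
  have := pow_le_pow_small H.he0.le H.he1 h
  linarith

section Cross
variable {T₁ : ℕ} (hT1 : T₁ ≤ T) (hs1 : η * T₁ ≤ θ ^ 4) (hs2 : θ ^ 4 / 2 ≤ η * T₁)
include hT1 hs1 hs2

theorem norm_resid_row_le {t : ℕ} (ht : t ≤ T) (k : Fin mD) :
    ‖resid S X z u lab lam η t k‖ ≤ 3 * e ^ 59 := by
  have h1 := H.norm_resid_le ht fun t' h => H.reg_all hT1 hs1 hs2 t' (h.le.trans ht)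
  have h2 := GAN.norm_row_le (resid S X z u lab lam η t) k
  have h3 : 2 * e ^ 60 * (η * t) ≤ 2 * e ^ 59 := by
    have he0 := H.he0
    calc 2 * e ^ 60 * (η * t) = 2 * e ^ 59 * (e * (η * t)) := by ring
      _ ≤ 2 * e ^ 59 * 1 := by
        gcongr
        linarith [H.s_le ht]
      _ = _ := by ring
  have h4 : θ ^ 30 ≤ e ^ 59 := by
    calc θ ^ 30 ≤ θ ^ 1 := pow_le_pow_small H.hθ0.le H.hθ1 (by norm_num)
      _ ≤ e ^ 200 := by rw [pow_one]; exact H.hθ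
      _ ≤ e ^ 59 := pow_le_pow_small H.he0.le H.he1 (by norm_num)
  linarith

theorem alpha_le_inv {t : ℕ} (ht : t ≤ T) (l : Fin 2) (k : Fin mD) :
    alpha S X z u lab lam η t l k ≤ 2 / e := by
  rw [le_div_iff₀ H.he0]
  have h1 := H.alpha_le ht (fun t' h => H.reg_all hT1 hs1 hs2 t' (h.le.trans ht)) l k
  have h2 := H.s_le ht
  have he0 := H.he0
  calc _ ≤ 2 * (η * t) * e := by gcongr
    _ ≤ 2 := by linarith

/-- Both rows are expanded as initial row, motion along the modes and residual. Beyond the initial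
inner product only the products of coefficients along the same mode are not negligible. -/
theorem inner_rows {t i : ℕ} (ht : t ≤ T) (hi : i ≤ T) (k k' : Fin mD) :
    |inner ℝ ((S t).W k) ((S i).W k') - inner ℝ ((S 0).W k) ((S 0).W k')
      - ∑ l, alpha S X z u lab lam η t l k * alpha S X z u lab lam η i l k'| ≤ e ^ 40 := by
  have he0 := H.he0
  have hθ0 := H.hθ0
  set r := resid S X z u lab lam η t k with hr
  set r' := resid S X z u lab lam η i k' with hr'
  have hrn : ‖r‖ ≤ 3 * e ^ 59 := H.norm_resid_row_le hT1 hs1 hs2 ht k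
  have hrn' : ‖r'‖ ≤ 3 * e ^ 59 := H.norm_resid_row_le hT1 hs1 hs2 hi k'
  have hα : ∀ {t}, t ≤ T → ∀ l k, |alpha S X z u lab lam η t l k| ≤ 2 / e := fun ht l k => by
    rw [abs_of_nonneg (H.alpha_nonneg (fun t' h => H.reg_all hT1 hs1 hs2 t' (h.le.trans ht)) l k)]
    exact H.alpha_le_inv hT1 hs1 hs2 ht l k
  have e1 := row_eq S X z u lab lam η t k
  have e2 := row_eq S X z u lab lam η i k'
  rw [← hr] at e1
  rw [← hr'] at e2
  have hWt := H.norm_row_le ht k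
  have hWi := H.norm_row_le hi k'
  have hs : ∀ l, inner ℝ (u l) (u l) = (1 : ℝ) := fun l => by
    rw [real_inner_self_eq_norm_sq, H.hu]; norm_num
  have key : inner ℝ ((S t).W k) ((S i).W k') - inner ℝ ((S 0).W k) ((S 0).W k')
      - ∑ l, alpha S X z u lab lam η t l k * alpha S X z u lab lam η i l k'
      = (∑ l, alpha S X z u lab lam η i l k' * align S u 0 l k
        + ∑ l, alpha S X z u lab lam η t l k * align S u 0 l k')
        + (alpha S X z u lab lam η t 0 k * alpha S X z u lab lam η i 1 k'
          + alpha S X z u lab lam η t 1 k * alpha S X z u lab lam η i 0 k') * inner ℝ (u 0) (u 1)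
        + (inner ℝ ((S t).W k) r' + inner ℝ r ((S i).W k') - inner ℝ r r') := by
    have e3 : inner ℝ ((S t).W k - r) ((S i).W k' - r') = inner ℝ ((S t).W k) ((S i).W k')
        - inner ℝ ((S t).W k) r' - inner ℝ r ((S i).W k') + inner ℝ r r' := by
      simp only [inner_sub_left, inner_sub_right]
      ring
    have e4 : (S t).W k - r = (S 0).W k + alpha S X z u lab lam η t 0 k • u 0
        + alpha S X z u lab lam η t 1 k • u 1 := by rw [e1]; abel
    have e5 : (S i).W k' - r' = (S 0).W k' + alpha S X z u lab lam η i 0 k' • u 0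
        + alpha S X z u lab lam η i 1 k' • u 1 := by rw [e2]; abel
    have e6 : inner ℝ ((S t).W k) ((S i).W k') = inner ℝ ((S t).W k - r) ((S i).W k' - r')
        + (inner ℝ ((S t).W k) r' + inner ℝ r ((S i).W k') - inner ℝ r r') := by
      rw [e3]; ring
    rw [e6, e4, e5]
    simp only [Fin.sum_univ_two, align, inner_add_left, inner_add_right, real_inner_smul_left,
      real_inner_smul_right, hs, real_inner_comm (u 0) (u 1), real_inner_comm ((S 0).W k') (u 0),
      real_inner_comm ((S 0).W k') (u 1)]
    ring
  rw [key]
  have b1 : ∀ {t}, t ≤ T → ∀ l k k', |alpha S X z u lab lam η t l k * align S u 0 l k'|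
      ≤ e ^ 50 := fun ht l k k' => by
    rw [abs_mul]
    have h1 := hα ht l k
    have h2 := H.init_le l k'
    have h3 : 1000 * θ ^ 10 / e ^ 53 ≤ θ ^ 1 := H.theta_div_le (by norm_num) (by norm_num)
    rw [div_le_iff₀ (by positivity)] at h3
    calc _ ≤ 2 / e * (θ ^ 10 / e ^ 2) := by gcongr
      _ = 2 * θ ^ 10 / e ^ 3 := by field_simp
      _ ≤ e ^ 50 := by
        rw [div_le_iff₀ (by positivity)]
        have : θ ^ 1 * e ^ 53 ≤ 1 * e ^ 53 := by
          gcongr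
          rw [pow_one]; exact H.hθ1
        have : e ^ 50 * e ^ 3 = e ^ 53 := by ring
        have := pow_pos hθ0 10
        linarith
  have b2 : ∀ l l', |alpha S X z u lab lam η t l k * alpha S X z u lab lam η i l' k'
      * inner ℝ (u 0) (u 1)| ≤ 4 * e ^ 58 := fun l l' => by
    rw [abs_mul, abs_mul, abs_of_nonneg H.hγ0]
    have h1 := hα ht l k
    have h2 := hα hi l' k'
    have h3 := H.hγ
    calc _ ≤ 2 / e * (2 / e) * e ^ 60 := by
          have := H.hγ0
          gcongr
      _ = _ := by field_simp; norm_num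
  have b3 : |inner ℝ ((S t).W k) r'| ≤ 3 * e ^ 58 := by
    refine (abs_real_inner_le_norm _ _).trans ?_
    calc _ ≤ 1 / e * (3 * e ^ 59) := by gcongr
      _ = _ := by field_simp
  have b4 : |inner ℝ r ((S i).W k')| ≤ 3 * e ^ 58 := by
    refine (abs_real_inner_le_norm _ _).trans ?_
    calc _ ≤ (3 * e ^ 59) * (1 / e) := by gcongr
      _ = _ := by field_simp
  have b5 : |inner ℝ r r'| ≤ 9 * e ^ 58 := by
    refine (abs_real_inner_le_norm _ _).trans ?_
    calc _ ≤ (3 * e ^ 59) * (3 * e ^ 59) := by gcongr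
      _ = 9 * (e ^ 58 * e ^ 60) := by ring
      _ ≤ 9 * (e ^ 58 * 1) := by
        gcongr
        exact pow_le_one₀ he0.le H.he1
      _ = _ := by ring
  have b6 : 1000 * e ^ 58 ≤ e ^ 40 := H.tiny (by norm_num)
  have b7 : 1000 * e ^ 50 ≤ e ^ 40 := H.tiny (by norm_num)
  have a1 := b1 hi 0 k' k
  have a2 := b1 hi 1 k' k
  have a3 := b1 ht 0 k k'
  have a4 := b1 ht 1 k k'
  have a5 := b2 0 1
  have a6 := b2 1 0
  simp only [Fin.sum_univ_two, add_mul]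
  rw [abs_le] at *
  have := pow_pos he0 58
  have := pow_pos he0 40
  constructor <;> linarith

/-- For each mode at most one of two distinct neurons is its leader; the other has coefficient at
most `e ^ 30`, which makes the product small although leaders may have coefficients up to `2 / e`.
-/
theorem abs_inner_rows_le (hWW : ∀ k k',
      |inner ℝ ((S 0).W k) ((S 0).W k') - if k = k' then 1 else 0| ≤ θ)
    {t i : ℕ} (ht : t ≤ T) (hi : i ≤ T) {k k' : Fin mD} (hk : k ≠ k') :
    |inner ℝ ((S t).W k) ((S i).W k')| ≤ e ^ 25 := by
  have he0 := H.he0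
  have h1 := H.inner_rows hT1 hs1 hs2 ht hi k k'
  have h2 := hWW k k'
  rw [if_neg hk, sub_zero] at h2
  have hnn : ∀ {t}, t ≤ T → ∀ l k, 0 ≤ alpha S X z u lab lam η t l k := fun ht l k =>
    H.alpha_nonneg (fun t' h => H.reg_all hT1 hs1 hs2 t' (h.le.trans ht)) l k
  have h3 : ∀ l, |alpha S X z u lab lam η t l k * alpha S X z u lab lam η i l k'| ≤ 2 * e ^ 29 := by
    intro l
    rw [abs_of_nonneg (mul_nonneg (hnn ht l k) (hnn hi l k'))]
    have hk0 := hnn ht l k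
    have hk0' := hnn hi l k'
    by_cases h : k = iw l
    · have g1 := H.alpha_other_le hT1 hs1 hs2 hi l (k := k') (fun hh => hk (h.trans hh.symm))
      have g2 := H.alpha_le_inv hT1 hs1 hs2 ht l k
      calc _ ≤ 2 / e * e ^ 30 := by gcongr
        _ = _ := by field_simp
    · have g1 := H.alpha_other_le hT1 hs1 hs2 ht l h
      have g2 := H.alpha_le_inv hT1 hs1 hs2 hi l k'
      calc _ ≤ e ^ 30 * (2 / e) := by gcongr
        _ = _ := by field_simp
  have h4 : θ ≤ e ^ 29 := H.hθ.trans (pow_le_pow_small he0.le H.he1 (by norm_num))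
  have h5 : 1000 * e ^ 29 ≤ e ^ 25 := H.tiny (by norm_num)
  have h6 : 1000 * e ^ 40 ≤ e ^ 25 := H.tiny (by norm_num)
  have h7 := h3 0
  have h8 := h3 1
  rw [Fin.sum_univ_two] at h1
  rw [abs_le] at *
  have := pow_pos he0 29
  have := pow_pos he0 40
  constructor <;> linarith

/-- The coefficients along the modes are nonnegative, so the motion only increases the product of a
row with its own past or future. -/
theorem half_le_inner_rows (hWW : ∀ k k',
      |inner ℝ ((S 0).W k) ((S 0).W k') - if k = k' then 1 else 0| ≤ θ)
    {t i : ℕ} (ht : t ≤ T) (hi : i ≤ T) (k : Fin mD) :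
    1 / 2 ≤ inner ℝ ((S t).W k) ((S i).W k) := by
  have he0 := H.he0
  have h1 := (abs_le.1 (H.inner_rows hT1 hs1 hs2 ht hi k k)).1
  have h2 := (abs_le.1 (hWW k k)).1
  rw [if_pos rfl] at h2
  have hnn : ∀ {t}, t ≤ T → ∀ l k, 0 ≤ alpha S X z u lab lam η t l k := fun ht l k =>
    H.alpha_nonneg (fun t' h => H.reg_all hT1 hs1 hs2 t' (h.le.trans ht)) l k
  have h3 := mul_nonneg (hnn ht 0 k) (hnn hi 0 k)
  have h4 := mul_nonneg (hnn ht 1 k) (hnn hi 1 k)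
  have h5 : θ ≤ e ^ 1 := H.hθ.trans (pow_le_pow_small he0.le H.he1 (by norm_num))
  have h6 : e ^ 40 ≤ e ^ 1 := pow_le_pow_small he0.le H.he1 (by norm_num)
  have := H.he
  rw [Fin.sum_univ_two] at h1
  rw [pow_one] at h5 h6
  linarith

theorem norm_lead_sub_le {t : ℕ} (ht : t ≤ T) (l : Fin 2) :
    ‖(S t).W (iw l) - alpha S X z u lab lam η t l (iw l) • u l‖ ≤ 7 / 4 := by
  have he0 := H.he0
  have h1 := row_eq S X z u lab lam η t (iw l)
  have h2 := H.norm_resid_row_le hT1 hs1 hs2 ht (iw l)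
  have h3 := H.hW0 (iw l)
  have h4 : 1000 * e ^ 30 ≤ e ^ 0 := H.tiny (by norm_num)
  have h5 : 1000 * e ^ 59 ≤ e ^ 0 := H.tiny (by norm_num)
  rw [pow_zero] at h4 h5
  obtain ⟨l', hl', hne⟩ : ∃ l' : Fin 2, ((S t).W (iw l)
      - alpha S X z u lab lam η t l (iw l) • u l = (S 0).W (iw l)
      + alpha S X z u lab lam η t l' (iw l) • u l' + resid S X z u lab lam η t (iw l))
      ∧ iw l ≠ iw l' := by
    rw [h1]
    fin_cases l
    · exact ⟨1, by simp only [Fin.zero_eta]; abel, H.hiw⟩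
    · exact ⟨0, by simp only [Fin.mk_one]; abel, H.hiw.symm⟩
  have h6 := H.alpha_other_le hT1 hs1 hs2 ht l' hne
  have h7 := H.alpha_nonneg (fun t' h => H.reg_all hT1 hs1 hs2 t' (h.le.trans ht)) l' (iw l)
  rw [hl']
  refine norm_add₃_le.trans ?_
  rw [norm_smul, H.hu, Real.norm_of_nonneg h7]
  linarith

end Cross
end DiscSetup

/-! ### The generator columns as normalized power iterations. -/

section Path
variable {mD mG d : ℕ} {S₀ : State mD mG d} {u : Fin 2 → Vec d} {iw : Fin 2 → Fin mD}
    {jv : Fin 2 → Fin mG} {lam η ηG e θ cp ρ ρ₁ : ℝ} {n T T₂ : ℕ} {lab : ℕ → Option (Fin 2)}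
    {z : ℕ → Fin mG → Bool} {X : ℕ → Vec d}

/-- Only row `j` has a nonzero gradient, so the positive scalar `3 a D(G)` cancels against the
normalizer. The discriminator influences the direction only through its weights and the sign of `a`.
-/
theorem cubicStep_V_solo {S : State mD mG d} {Y : Vec d} {j : Fin mG} (ha : 0 < S.a) :
    (cubicStep lam η ηG Y (soloVec j) S).V j = S.V j
      + (ηG / ‖∑ k, (inner ℝ (S.W k) (S.V j) ^ 2) • S.W k‖)
        • ∑ k, (inner ℝ (S.W k) (S.V j) ^ 2) • S.W k := by
  have hf := fakeScore_pos (lam := lam) (S := S) (z := soloVec j)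
  have hP : pull S (soloVec j) = ∑ k, (inner ℝ (S.W k) (S.V j) ^ 2) • S.W k := by
    simp only [pull, generator_soloVec]
  rw [← hP]
  have h1 : ‖gradV lam (soloVec j) S‖ = 3 * S.a * fakeScore lam S (soloVec j)
      * ‖pull S (soloVec j)‖ := by
    rw [PiLp.norm_eq_of_L2, Finset.sum_eq_single j]
    · simp only [gradV, soloVec, decide_true, if_true]
      rw [Real.sqrt_sq (norm_nonneg _), norm_smul, norm_neg, Real.norm_of_nonneg (by positivity)]
    · intro j' _ hj'
      simp [gradV, soloVec, hj']
    · simp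
  have h2 : (gradV lam (soloVec j) S) j
      = (-(3 * S.a * fakeScore lam S (soloVec j))) • pull S (soloVec j) := by
    simp [gradV, soloVec]
  have hc : 0 < 3 * S.a * fakeScore lam S (soloVec j) := by positivity
  simp only [cubicStep, PiLp.sub_apply, PiLp.smul_apply, h1, h2]
  rw [smul_smul, sub_eq_add_neg, ← neg_smul]
  congr 2
  field_simp

theorem normalize_generator_sub_le (hs : Scale mD mG d lam η ηG e θ cp ρ n T T₂)
    (hI : GoodInit S₀ u iw jv e θ) (hg : GoodSamples lab z e cp ρ₁ n T T₂)
    (hu : ∀ l, ‖u l‖ = 1) (hγ0 : 0 ≤ inner ℝ (u 0) (u 1)) (hγ : inner ℝ (u 0) (u 1) ≤ e ^ 60)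
    (hX : ∀ t l, lab t = some l → X t = u l) (l : Fin 2) :
    ‖‖(cubicRun lam η ηG X z S₀ T).V (jv l)‖⁻¹ • (cubicRun lam η ηG X z S₀ T).V (jv l) - u l‖
      ≤ 2 * (2 * ρ₁ + ρ + e) := by
  have H := discSetup (X := X) hs hI hg hu hγ0 hγ hX
  have hη0 := hs.hη0
  have hθ0 := hs.hθ0
  have hηG0 : 0 < ηG := by
    have : 0 < e ^ 200 * ηG := (mul_pos hθ0 hη0).trans_le hs.hηG'
    exact pos_of_mul_pos_right this (pow_nonneg hs.he0.le _)
  set S := cubicRun lam η ηG X z S₀ with hS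
  -- `T₁` is the last time with `η T₁ ≤ θ ^ 4`; rounding loses less than half because `η ≤ θ ^ 30`.
  obtain ⟨T₁, hs1, hs2⟩ : ∃ T₁ : ℕ, η * T₁ ≤ θ ^ 4 ∧ θ ^ 4 / 2 ≤ η * T₁ := by
    refine ⟨⌊θ ^ 4 / η⌋₊, ?_, ?_⟩
    · rw [mul_comm, ← le_div_iff₀ hη0]
      exact Nat.floor_le (by positivity)
    · have h1 := (Nat.lt_floor_add_one (θ ^ 4 / η)).le
      rw [div_le_iff₀ hη0] at h1
      have h2 : 1000 * θ ^ 30 / e ^ 0 ≤ θ ^ 4 := H.theta_div_le (by norm_num) (by norm_num)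
      rw [pow_zero, div_one] at h2
      have := hs.hη
      have := pow_pos hθ0 30
      linarith
  have h12 : T₁ ≤ T₂ := by
    have h := hs1.trans hs.hT2'
    have := le_of_mul_le_mul_left h hη0
    exact_mod_cast this
  have hT1 : T₁ ≤ T := h12.trans hs.hT2
  have P : PowerSetup (fun t => (S t).V (jv l)) (fun t k => (S t).W k)
      (fun t => z t = soloVec (jv l)) (fun t => z t (jv l) = true ∧ z t ≠ soloVec (jv l)) (iw l)
      η ηG e θ n T T₁ := 
    { he0 := hs.he0
      he := hs.he
      hθ0 := hs.hθ0
      hθ := hs.hθ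
      hη0 := hs.hη0
      hη := hs.hη
      hηG := hs.hηG.trans (mul_le_of_le_one_left hη0.le (pow_le_one₀ hs.he0.le H.he1))
      hηG' := hs.hηG'
      hm := hs.hm
      hstep := fun t ht h => by
        have ha := (H.reg_all hT1 hs1 hs2 t ht.le).1
        have := cubicStep_V_solo (lam := lam) (η := η) (ηG := ηG) (Y := X t) (j := jv l) ha
        rw [← h] at this
        exact this
      hpairstep := fun t _ => by
        have h1 := cubicStep_displacement_V (lam := lam) (etaD := η) (X := X t) (z := z t)
          (S := S t) hηG0.le
        exact (norm_row_le ((S (t + 1)).V - (S t).V) (jv l)).trans h1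
      hrest := fun t h1 h2 => by
        refine cubicStep_V_of_not ?_
        by_contra h3
        exact h2 ⟨by simpa using h3, h1⟩
      hdisj := fun t h1 h2 => h2.2 h1
      hT1 := hT1
      hs1 := hs1
      hs2 := hs2
      hnorm := fun t ht k => H.norm_row_le ht k
      hcross := fun t ht i hi k k' hk => H.abs_inner_rows_le hT1 hs1 hs2 hI.hWW ht hi hk
      hself := fun t ht i hi k => H.half_le_inner_rows hT1 hs1 hs2 hI.hWW ht hi k
      hdisp := fun t k => H.norm_row_sub_le t k
      hinit := hI.hWW
      hv0 := hI.hV _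
      hwin := hI.hvwin l
      hini := hI.hvini l
      hgap := hI.hvgap l
      hsolo := fun t ht => hg.hsolo t ht _
      hpair := fun t ht => hg.hpair t ht _
      hn := hs.hn }
  refine P.norm_final_sub_le h12 hs.hT2 (hu l) hs.hρ0.le (fun t h1 h2 => ?_) (hg.hearly _)
  refine ⟨alpha S X z u lab lam η t l (iw l), ?_, H.norm_lead_sub_le hT1 hs1 hs2 h2 l, ?_⟩
  all_goals
    have g1 := H.le_alpha_lead hT1 hs1 hs2 h2 l
    have g2 : cp * (η * T₂) ≤ cp * (η * t) := by
      have : 0 < cp := hs.he0.trans_le hs.hcp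
      gcongr
    have g3 := hs.hρ
    have g4 : 0 < 4 / ρ := div_pos (by norm_num) hs.hρ0
  · linarith
  · rw [div_le_comm₀ (by linarith) hs.hρ0]
    linarith

end Path

/-! ### Transfer to the truncated algorithm. -/

section

/-- The mode from which a data point with coefficients `s` is drawn, if it is a single one. -/
def modeOf (s : Fin 2 → Bool) : Option (Fin 2) :=
  if s = ![true, false] then some 0 else if s = ![false, true] then some 1 else none

theorem binComb_of_modeOf {d : ℕ} (u : Fin 2 → Vec d) {s : Fin 2 → Bool} {l : Fin 2}
    (h : modeOf s = some l) : binComb u s = u l := by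
  unfold modeOf at h
  split_ifs at h with h1 h2
  · obtain rfl : 0 = l := by simpa using h
    simp [binComb, h1]
  · obtain rfl : 1 = l := by simpa using h
    simp [binComb, h2]

theorem norm_binComb_le {d : ℕ} {u : Fin 2 → Vec d} (hu : ∀ l, ‖u l‖ = 1) (s : Fin 2 → Bool) :
    ‖binComb u s‖ ≤ 2 := by
  refine (norm_sum_le _ _).trans ?_
  have : ∀ i, ‖(if s i = true then (1 : ℝ) else 0) • u i‖ ≤ 1 := fun i => by
    split_ifs <;> simp [hu]
  calc _ ≤ ∑ _i : Fin 2, (1 : ℝ) := Finset.sum_le_sum fun i _ => this i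
    _ = 2 := by simp

variable {mD mG d : ℕ} {S₀ : State mD mG d} {u : Fin 2 → Vec d} {iw : Fin 2 → Fin mD}
    {jv : Fin 2 → Fin mG} {lam η ηG e θ cp ρ ρ₁ : ℝ} {n T T₂ : ℕ}
    {ω : ℕ → (Fin 2 → Bool) × (Fin mG → Bool)}

/-- Rows have norm at most `1 / e` and samples at most `2 / e ^ 2`, so all inner products are
polylogarithmic, below the polynomial truncation level. Absolute values do not see `flip`, so both
signs of `a` are covered. -/
theorem nsgda_eq_of_good (hs : Scale mD mG d lam η ηG e θ cp ρ n T T₂)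
    (hI : GoodInit S₀ u iw jv e θ)
    (hg : GoodSamples (fun t => modeOf (ω t).1) (fun t => (ω t).2) e cp ρ₁ n T T₂)
    (hu : ∀ l, ‖u l‖ = 1) (hγ0 : 0 ≤ inner ℝ (u 0) (u 1)) (hγ : inner ℝ (u 0) (u 1) ≤ e ^ 60)
    {S₁ : State mD mG d} (h₁ : S₁ = S₀ ∨ S₁ = flip S₀) :
    ∀ t, t ≤ T → nsgda lam η ηG u S₁ ω t
      = cubicRun lam η ηG (fun t => binComb u (ω t).1) (fun t => (ω t).2) S₁ t := by
  have he0 := hs.he0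
  have hθ0 := hs.hθ0
  have H := discSetup (X := fun t => binComb u (ω t).1) hs hI hg hu hγ0 hγ fun t l h =>
    binComb_of_modeOf u h
  refine nsgda_eq_cubicRun fun t ht i => ?_
  have hW := H.norm_row_le ht.le i
  have hG := generator_bound (X := fun t => binComb u (ω t).1) (z := fun t => (ω t).2) hs hI t (ω t).2
  set S := cubicRun lam η ηG (fun t => binComb u (ω t).1) (fun t => (ω t).2) S₀ with hS
  have hG1 : θ ^ 9 + e ^ 60 * (η * t) ≤ 2 := by
    have h1 : θ ^ 9 ≤ 1 := pow_le_one₀ hθ0.le H.hθ1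
    have h2 := H.s_le ht.le
    have h3 : e ^ 60 * (η * t) ≤ 1 := by
      calc e ^ 60 * (η * t) = e ^ 59 * (e * (η * t)) := by ring
        _ ≤ 1 * 1 := by
          gcongr
          · exact mul_nonneg he0.le (H.s_nonneg t)
          · exact pow_le_one₀ he0.le H.he1
          · linarith
        _ = 1 := one_mul 1
    linarith
  have hG2 : ‖generator (S t).V (ω t).2‖ ≤ 2 / e ^ 2 := by
    rw [le_div_iff₀ (by positivity)]
    linarith
  have hin : ∀ Y : Vec d, ‖Y‖ ≤ 2 / e ^ 2 → |inner ℝ ((S t).W i) Y| < truncLevel d := fun Y hY => by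
    refine lt_of_le_of_lt ((abs_real_inner_le_norm _ _).trans ?_) hs.htrunc
    calc _ ≤ 1 / e * (2 / e ^ 2) := by gcongr
      _ = _ := by field_simp
  have hX : ‖binComb u (ω t).1‖ ≤ 2 / e ^ 2 := by
    refine (norm_binComb_le hu _).trans ?_
    rw [le_div_iff₀ (by positivity)]
    have := pow_le_one₀ he0.le H.he1 (n := 2)
    linarith
  rcases h₁ with rfl | rfl
  · exact ⟨hin _ hX, hin _ hG2⟩
  · rw [cubicRun_flip]
    simp only [flip, PiLp.neg_apply, inner_neg_left, abs_neg]
    exact ⟨hin _ hX, hin _ hG2⟩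

/-- For a good initialization and good samples, some generator columns converge to the modes. -/
theorem normalize_nsgda_sub_le (hs : Scale mD mG d lam η ηG e θ cp ρ n T T₂)
    (hI : GoodInit S₀ u iw jv e θ ∨ GoodInit (flip S₀) u iw jv e θ)
    (hg : GoodSamples (fun t => modeOf (ω t).1) (fun t => (ω t).2) e cp ρ₁ n T T₂)
    (hu : ∀ l, ‖u l‖ = 1) (hγ0 : 0 ≤ inner ℝ (u 0) (u 1)) (hγ : inner ℝ (u 0) (u 1) ≤ e ^ 60)
    (l : Fin 2) :
    ‖‖(nsgda lam η ηG u S₀ ω T).V (jv l)‖⁻¹ • (nsgda lam η ηG u S₀ ω T).V (jv l) - u l‖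
      ≤ 2 * (2 * ρ₁ + ρ + e) := by
  have hX : ∀ t l, modeOf (ω t).1 = some l → (fun t => binComb u (ω t).1) t = u l :=
    fun t l h => binComb_of_modeOf u h
  rcases hI with hI | hI
  · rw [nsgda_eq_of_good hs hI hg hu hγ0 hγ (Or.inl rfl) T le_rfl]
    exact normalize_generator_sub_le hs hI hg hu hγ0 hγ hX l
  · have h := normalize_generator_sub_le hs hI hg hu hγ0 hγ hX l
    rw [cubicRun_flip] at h
    rw [nsgda_eq_of_good hs hI hg hu hγ0 hγ (Or.inr (flip_flip S₀).symm) T le_rfl]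
    exact h

end

/-! ### Independent standard Gaussian variables -/

/-- The law of `m` independent standard Gaussian variables. -/
def iid (m : ℕ) : Measure (Fin m → ℝ) := Measure.pi fun _ => gaussianReal 0 1

instance (m : ℕ) : IsProbabilityMeasure (iid m) := by unfold iid; infer_instance

/-- The density is at most `1 / 2`. -/
theorem gaussian_near_le (c r : ℝ) :
    gaussianReal 0 1 {x | |x - c| ≤ r} ≤ ENNReal.ofReal r := by
  rw [gaussianReal_apply _ one_ne_zero]
  have h1 : {x : ℝ | |x - c| ≤ r} = Set.Icc (c - r) (c + r) := by
    ext x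
    rw [Set.mem_setOf_eq, abs_le, Set.mem_Icc]
    constructor <;> rintro ⟨h, h'⟩ <;> constructor <;> linarith
  have h2 : ∀ x, gaussianPDF 0 1 x ≤ ENNReal.ofReal (1 / 2) := fun x => by
    rw [gaussianPDF]
    refine ENNReal.ofReal_le_ofReal ?_
    rw [gaussianPDFReal]
    have h3 : (2 : ℝ) ≤ √(2 * Real.pi * (1 : NNReal)) := by
      apply Real.le_sqrt_of_sq_le
      have := Real.pi_gt_three
      norm_num
      linarith
    have h4 : Real.exp (-(x - 0) ^ 2 / (2 * (1 : NNReal))) ≤ 1 := by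
      apply Real.exp_le_one_iff.2
      have := sq_nonneg (x - 0)
      exact div_nonpos_of_nonpos_of_nonneg (by linarith) (by positivity)
    calc _ ≤ (2 : ℝ)⁻¹ * 1 := by gcongr
      _ = _ := by norm_num
  calc ∫⁻ x in {x : ℝ | |x - c| ≤ r}, gaussianPDF 0 1 x
      ≤ ∫⁻ _ in {x : ℝ | |x - c| ≤ r}, ENNReal.ofReal (1 / 2) := lintegral_mono h2
    _ = ENNReal.ofReal r := by
      rw [lintegral_const, Measure.restrict_apply_univ, h1, Real.volume_Icc,
        ← ENNReal.ofReal_mul (by norm_num)]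
      congr 1
      ring

theorem gaussian_tail_le {L : ℝ} (hL : 0 < L) :
    gaussianReal 0 1 {x | L ≤ |x|} ≤ ENNReal.ofReal (1 / L ^ 2) := by
  have h := meas_ge_le_variance_div_sq (μ := gaussianReal 0 1) (X := fun x => x)
    (memLp_id_gaussianReal 2) hL
  rw [variance_fun_id_gaussianReal, integral_id_gaussianReal] at h
  simpa using h

theorem exists_gaussian_lt_one : ∃ c : ℝ, 0 ≤ c ∧ c < 1 ∧
    gaussianReal 0 1 {x | x < 1} = ENNReal.ofReal c := by
  refine ⟨(gaussianReal 0 1).real {x | x < 1}, measureReal_nonneg, ?_, ?_⟩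
  · have h1 : 0 < (gaussianReal 0 1).real {x : ℝ | x < 1}ᶜ := by
      have hne : (gaussianReal 0 1) {x : ℝ | x < 1}ᶜ ≠ 0 := by
        intro h0
        have := (gaussianReal_absolutelyContinuous' 0 one_ne_zero) h0
        rw [show {x : ℝ | x < 1}ᶜ = Set.Ici 1 by ext; simp] at this
        simp at this
      exact ENNReal.toReal_pos hne (measure_ne_top _ _)
    rw [measureReal_compl (show MeasurableSet {x : ℝ | x < 1} from measurableSet_Iio)] at h1
    simpa using h1
  · rw [measureReal_def, ENNReal.ofReal_toReal (measure_ne_top _ _)]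

/-- The `i`-th coordinate of `x` is the largest one, with a margin, and no coordinate is huge. -/
def Champ (e : ℝ) {m : ℕ} (x : Fin m → ℝ) (i : Fin m) : Prop :=
  1 / 2 ≤ x i ∧ (∀ k, e ^ 2 * |x k| ≤ 1) ∧ ∀ k, k ≠ i → x k ≤ x i - e ^ 6

/-- A version of `Champ` that is stable under small perturbations. -/
def StrongChamp (e : ℝ) {m : ℕ} (x : Fin m → ℝ) (i : Fin m) : Prop :=
  1 ≤ x i ∧ (∀ k, |x k| < 1 / (2 * e ^ 2)) ∧ ∀ k, k ≠ i → x k + 2 * e ^ 6 < x i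

theorem StrongChamp.champ {e : ℝ} {m : ℕ} {x y : Fin m → ℝ} {i : Fin m} (he0 : 0 < e)
    (he : e ≤ 1 / 1000) (h : StrongChamp e x i) (hxy : ∀ k, |x k - y k| ≤ e ^ 6 / 2) :
    Champ e y i := by
  have he6 : e ^ 6 ≤ 1 / 1000 := by
    calc e ^ 6 ≤ e ^ 1 := pow_le_pow_of_le_one he0.le (by linarith) (by norm_num)
      _ ≤ _ := by rw [pow_one]; exact he
  have he2 : e ^ 2 ≤ 1 := pow_le_one₀ he0.le (by linarith)
  refine ⟨?_, fun k => ?_, fun k hk => ?_⟩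
  · have := (abs_le.1 (hxy i)).2
    linarith [h.1]
  · have h1 := abs_sub_abs_le_abs_sub (y k) (x k)
    have h2 := hxy k
    rw [abs_sub_comm] at h2
    have h3 := (h.2.1 k).le
    have h4 : |y k| ≤ 1 / (2 * e ^ 2) + 1 / 2 := by linarith
    calc e ^ 2 * |y k| ≤ e ^ 2 * (1 / (2 * e ^ 2) + 1 / 2) := by gcongr
      _ = 1 / 2 + e ^ 2 / 2 := by field_simp
      _ ≤ 1 := by linarith
  · have h1 := h.2.2 k hk
    have h2 := (abs_le.1 (hxy k)).1
    have h3 := (abs_le.1 (hxy i)).2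
    linarith

theorem StrongChamp.unique {e : ℝ} {m : ℕ} {x : Fin m → ℝ} {i j : Fin m}
    (hi : StrongChamp e x i) (hj : StrongChamp e x j) : i = j := by
  by_contra hne
  have h1 := hi.2.2 j (Ne.symm hne)
  have h2 := hj.2.2 i hne
  have : 0 ≤ e ^ 6 := by positivity
  linarith

theorem Champ.unique {e : ℝ} (he0 : 0 < e) {m : ℕ} {x : Fin m → ℝ} {i j : Fin m}
    (hi : Champ e x i) (hj : Champ e x j) : i = j := by
  by_contra hne
  have h1 := hi.2.2 j (Ne.symm hne)
  have h2 := hj.2.2 i hne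
  have : 0 < e ^ 6 := by positivity
  linarith

theorem measurableSet_strongChamp (e : ℝ) {m : ℕ} (i : Fin m) :
    MeasurableSet {x : Fin m → ℝ | StrongChamp e x i} := by
  unfold StrongChamp
  measurability

theorem measurableSet_champ (e : ℝ) {m : ℕ} (i : Fin m) :
    MeasurableSet {x : Fin m → ℝ | Champ e x i} := by
  unfold Champ
  measurability

theorem iid_eval {m : ℕ} (k : Fin m) {s : Set ℝ} (hs : MeasurableSet s) :
    iid m {x | x k ∈ s} = gaussianReal 0 1 s :=
  (measurePreserving_eval (fun _ : Fin m => gaussianReal 0 1) k).measure_preimage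
    hs.nullMeasurableSet

theorem iid_pair_near_le {m : ℕ} {k k' : Fin m} (hk : k ≠ k') (r : ℝ) :
    iid m {x | |x k - x k'| ≤ r} ≤ ENNReal.ofReal r := by
  have hind : IndepFun (fun x : Fin m → ℝ => x k) (fun x => x k') (iid m) :=
    (iIndepFun_pi (μ := fun _ : Fin m => gaussianReal 0 1) (X := fun _ x => x)
      (fun _ => aemeasurable_id)).indepFun hk
  have h1 := (indepFun_iff_map_prod_eq_prod_map_map (measurable_pi_apply k).aemeasurable
    (measurable_pi_apply k').aemeasurable).1 hind
  have hev : ∀ k : Fin m, (iid m).map (fun x => x k) = gaussianReal 0 1 := fun k =>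
    (measurePreserving_eval (fun _ : Fin m => gaussianReal 0 1) k).map_eq
  rw [hev, hev] at h1
  have hS : MeasurableSet {p : ℝ × ℝ | |p.1 - p.2| ≤ r} := by measurability
  have h2 : iid m {x | |x k - x k'| ≤ r}
      = ((gaussianReal 0 1).prod (gaussianReal 0 1)) {p : ℝ × ℝ | |p.1 - p.2| ≤ r} := by
    rw [← h1, Measure.map_apply (by fun_prop) hS]
    rfl
  rw [h2, Measure.prod_apply_symm hS]
  calc _ ≤ ∫⁻ _, ENNReal.ofReal r ∂(gaussianReal 0 1) :=
        lintegral_mono fun c => gaussian_near_le c r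
    _ = _ := by simp

/-- If no coordinate is huge, no two are within `2 e ^ 6` and some coordinate reaches `1`, then the
largest one is a strong champion. The three terms bound the failures of these three properties. -/
theorem iid_no_strongChamp_le {e c : ℝ} (he0 : 0 < e) (m : ℕ) (hc0 : 0 ≤ c)
    (hc : gaussianReal 0 1 {x | x < 1} = ENNReal.ofReal c) :
    (iid m).real {x | ¬ ∃ i, StrongChamp e x i} ≤ m * (4 * e ^ 4) + m ^ 2 * (2 * e ^ 6) + c ^ m := by
  have hsub : {x : Fin m → ℝ | ¬ ∃ i, StrongChamp e x i} ⊆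
      ((⋃ k, {x | 1 / (2 * e ^ 2) ≤ |x k|})
        ∪ (⋃ p : Fin m × Fin m, {x | p.1 ≠ p.2 ∧ |x p.1 - x p.2| ≤ 2 * e ^ 6}))
        ∪ {x | ∀ k, x k < 1} := by
    intro x hx
    by_contra hcon
    simp only [Set.mem_union, Set.mem_iUnion, Set.mem_setOf_eq, not_or, not_exists, not_and,
      not_forall, not_le, not_lt, Prod.forall] at hcon
    obtain ⟨⟨h1, h2⟩, k0, h3⟩ := hcon
    have : Nonempty (Fin m) := ⟨k0⟩
    obtain ⟨i, hi⟩ := Finite.exists_max x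
    refine hx ⟨i, h3.trans (hi k0), h1, fun k hk => ?_⟩
    have h4 := h2 i k hk.symm
    rw [abs_of_nonneg (sub_nonneg.2 (hi k))] at h4
    linarith
  refine (measureReal_mono hsub).trans ?_
  refine (measureReal_union_le _ _).trans (add_le_add ((measureReal_union_le _ _).trans
    (add_le_add ?_ ?_)) ?_)
  · refine (measureReal_iUnion_fintype_le _).trans ?_
    calc _ ≤ ∑ _k : Fin m, 4 * e ^ 4 := by
          refine Finset.sum_le_sum fun k _ => ENNReal.toReal_le_of_le_ofReal (by positivity) ?_
          have h := gaussian_tail_le (L := 1 / (2 * e ^ 2)) (by positivity)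
          rw [← iid_eval (m := m) k (measurableSet_le measurable_const (by fun_prop))] at h
          refine h.trans (ENNReal.ofReal_le_ofReal (le_of_eq ?_))
          field_simp
          norm_num
      _ = _ := by simp
  · refine (measureReal_iUnion_fintype_le _).trans ?_
    calc _ ≤ ∑ _p : Fin m × Fin m, 2 * e ^ 6 := by
          refine Finset.sum_le_sum fun p _ => ENNReal.toReal_le_of_le_ofReal (by positivity) ?_
          by_cases hp : p.1 = p.2
          · simp [hp]
          · exact (measure_mono fun x hx => hx.2).trans
              (iid_pair_near_le hp _)
      _ = _ := by
          simp only [Finset.sum_const, Finset.card_univ, Fintype.card_prod, Fintype.card_fin,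
            nsmul_eq_mul]
          push_cast
          ring
  · refine ENNReal.toReal_le_of_le_ofReal (by positivity) ?_
    have h : {x : Fin m → ℝ | ∀ k, x k < 1} = Set.univ.pi fun _ => {x : ℝ | x < 1} := by
      ext x; simp
    rw [h, iid, Measure.pi_pi, hc]
    simp [ENNReal.ofReal_pow hc0]

/-- Exchangeability: swapping two coordinates preserves the law and exchanges the two events. -/
theorem iid_strongChamp_eq (e : ℝ) {m : ℕ} (i j : Fin m) :
    (iid m).real {x | StrongChamp e x i} = (iid m).real {x | StrongChamp e x j} := by
  have h := measurePreserving_piCongrLeft (fun _ : Fin m => gaussianReal 0 1) (Equiv.swap i j)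
  have h1 := h.measure_preimage (s := {x | StrongChamp e x i})
    (measurableSet_strongChamp e i).nullMeasurableSet
  have hval : ∀ (x : Fin m → ℝ) k,
      (MeasurableEquiv.piCongrLeft (fun _ : Fin m => ℝ) (Equiv.swap i j)) x k
        = x (Equiv.swap i j k) := fun x k => by
    have := Equiv.piCongrLeft_apply_apply (fun _ : Fin m => ℝ) (Equiv.swap i j) x
      (Equiv.swap i j k)
    rw [Equiv.swap_apply_self] at this
    exact this
  have h2 : (MeasurableEquiv.piCongrLeft (fun _ : Fin m => ℝ) (Equiv.swap i j)) ⁻¹'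
      {x | StrongChamp e x i} = {x | StrongChamp e x j} := by
    ext x
    simp only [Set.mem_preimage, Set.mem_setOf_eq, StrongChamp, hval, Equiv.swap_apply_left]
    refine and_congr_right fun _ => and_congr ?_ ?_
    · exact (Equiv.swap i j).forall_congr_left.trans (by simp)
    · constructor
      · intro h k hk
        have := h (Equiv.swap i j k) (fun hh => hk (by
          rw [← Equiv.swap_apply_self i j k, hh, Equiv.swap_apply_left]))
        rwa [Equiv.swap_apply_self] at this
      · intro h k hk
        exact h _ fun hh => hk (by rw [← Equiv.swap_apply_self i j k, hh, Equiv.swap_apply_right])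
  rw [h2] at h1
  rw [measureReal_def, measureReal_def]
  exact congrArg _ h1.symm

theorem sum_iid_strongChamp {e : ℝ} {m : ℕ} (i : Fin m) :
    m * (iid m).real {x | StrongChamp e x i} = 1 - (iid m).real {x | ¬ ∃ i, StrongChamp e x i} := by
  have h1 : (iid m).real (⋃ i, {x : Fin m → ℝ | StrongChamp e x i})
      = ∑ i, (iid m).real {x | StrongChamp e x i} :=
    measureReal_iUnion_fintype (fun i j hij => Set.disjoint_left.2 fun x hi hj =>
      hij (StrongChamp.unique hi hj)) (fun i => measurableSet_strongChamp e i)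
  have h2 : {x : Fin m → ℝ | ¬ ∃ i, StrongChamp e x i}
      = (⋃ i, {x : Fin m → ℝ | StrongChamp e x i})ᶜ := by
    ext x; simp
  rw [h2, probReal_compl_eq_one_sub (MeasurableSet.iUnion fun i => measurableSet_strongChamp e i),
    h1, Finset.sum_congr rfl fun j _ => iid_strongChamp_eq e j i]
  simp

/-! ### Projections of Gaussian vectors -/

/-- The coordinates of `g` along the vectors `o i`. -/
def proj {r d : ℕ} (o : Fin r → Vec d) (g : Fin d → ℝ) : Fin r → ℝ :=
  fun i => inner ℝ (o i) (WithLp.toLp 2 g)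

theorem measurable_inner_toLp {d : ℕ} (u : Vec d) :
    Measurable fun g : Fin d → ℝ => (inner ℝ u (WithLp.toLp 2 g) : ℝ) := by
  fun_prop

theorem measurable_proj {r d : ℕ} (o : Fin r → Vec d) : Measurable (proj o) :=
  measurable_pi_lambda _ fun i => measurable_inner_toLp (o i)

/-- Rotation invariance, by comparison of characteristic functions: a combination of orthonormal
vectors has the norm of its coefficient vector. -/
theorem iid_map_proj {r d : ℕ} {o : Fin r → Vec d} (ho : Orthonormal ℝ o) :
    (iid d).map (proj o) = iid r := by
  have h1 : (iid d).map (fun g => WithLp.toLp 2 (proj o g))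
      = stdGaussian (EuclideanSpace ℝ (Fin r)) := by
    have hm : Measurable fun g : Fin d → ℝ =>
        (WithLp.toLp 2 (proj o g) : EuclideanSpace ℝ (Fin r)) := by
      have := measurable_proj o
      fun_prop
    have : IsFiniteMeasure ((iid d).map
        (fun g => (WithLp.toLp 2 (proj o g) : EuclideanSpace ℝ (Fin r)))) :=
      Measure.isFiniteMeasure_map _ _
    refine Measure.ext_of_charFun (E := EuclideanSpace ℝ (Fin r)) ?_
    ext t
    have h2 : ∀ g : Fin d → ℝ, (inner ℝ (WithLp.toLp 2 (proj o g) : EuclideanSpace ℝ (Fin r)) t : ℝ)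
        = inner ℝ (WithLp.toLp 2 g : Vec d) (∑ i, t i • o i) := fun g => by
      rw [inner_sum, PiLp.inner_apply]
      refine Finset.sum_congr rfl fun i _ => ?_
      rw [real_inner_smul_right, real_inner_comm (o i)]
      simp [proj]
    have h3 : ‖∑ i, t i • o i‖ ^ 2 = ‖t‖ ^ 2 := by
      rw [← real_inner_self_eq_norm_sq, ho.inner_sum, EuclideanSpace.real_norm_sq_eq]
      simp [sq]
    have h4 := charFun_stdGaussian (E := Vec d) (∑ i, t i • o i)
    rw [← map_pi_eq_stdGaussian, charFun_apply, integral_map (by fun_prop) (by fun_prop)] at h4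
    rw [charFun_apply, integral_map hm.aemeasurable (by fun_prop), charFun_stdGaussian]
    simp_rw [h2]
    rw [← Complex.ofReal_pow, ← h3, Complex.ofReal_pow, ← h4]
    rfl
  have h5 : (stdGaussian (EuclideanSpace ℝ (Fin r))).map WithLp.ofLp = iid r := by
    rw [← map_pi_eq_stdGaussian, Measure.map_map (by fun_prop) (by fun_prop)]
    exact Measure.map_id
  rw [← h5, ← h1, Measure.map_map (by fun_prop) (by have := measurable_proj o; fun_prop)]
  rfl

theorem measurePreserving_proj {r d : ℕ} {o : Fin r → Vec d} (ho : Orthonormal ℝ o) :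
    MeasurePreserving (proj o) (iid d) (iid r) :=
  ⟨measurable_proj o, iid_map_proj ho⟩

theorem measurePreserving_inner {d : ℕ} {u : Vec d} (hu : ‖u‖ = 1) :
    MeasurePreserving (fun g : Fin d → ℝ => (inner ℝ u (WithLp.toLp 2 g) : ℝ)) (iid d)
      (gaussianReal 0 1) := by
  have ho : Orthonormal ℝ (fun _ : Fin 1 => u) :=
    ⟨fun _ => hu, fun i j hij => absurd (Subsingleton.elim i j) hij⟩
  exact (measurePreserving_eval (fun _ : Fin 1 => gaussianReal 0 1) 0).comp
    (measurePreserving_proj ho)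

theorem iid_inner_tail_le {d : ℕ} (x : Vec d) {L : ℝ} (hL : 0 < L) :
    iid d {g | L ≤ |inner ℝ x (WithLp.toLp 2 g)|} ≤ ENNReal.ofReal (‖x‖ ^ 2 / L ^ 2) := by
  by_cases hx : x = 0
  · subst hx
    simp [not_le.2 hL]
  have hx' : 0 < ‖x‖ := norm_pos_iff.2 hx
  have hu : ‖(‖x‖⁻¹ • x)‖ = 1 := by
    rw [norm_smul, norm_inv, norm_norm, inv_mul_cancel₀ hx'.ne']
  have h1 := (measurePreserving_inner hu).measure_preimage
    (s := {y | L / ‖x‖ ≤ |y|}) (measurableSet_le measurable_const (by fun_prop)).nullMeasurableSet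
  have h2 : (fun g : Fin d → ℝ => (inner ℝ (‖x‖⁻¹ • x) (WithLp.toLp 2 g) : ℝ)) ⁻¹'
      {y | L / ‖x‖ ≤ |y|} = {g | L ≤ |inner ℝ x (WithLp.toLp 2 g)|} := by
    ext g
    simp only [Set.mem_preimage, Set.mem_setOf_eq, real_inner_smul_left, abs_mul, abs_inv,
      abs_norm]
    rw [div_le_iff₀ hx', mul_comm _ ‖x‖, mul_inv_cancel_left₀ hx'.ne']
  rw [h2] at h1
  rw [h1]
  refine (gaussian_tail_le (by positivity)).trans (ENNReal.ofReal_le_ofReal (le_of_eq ?_))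
  field_simp

/-- The law of `m` independent standard Gaussian vectors of `ℝ^d`. -/
def gaussRows (m d : ℕ) : Measure (Fin m → Fin d → ℝ) := Measure.pi fun _ => iid d

instance (m d : ℕ) : IsProbabilityMeasure (gaussRows m d) := by unfold gaussRows; infer_instance

theorem gaussRows_eval {m d : ℕ} (k : Fin m) {s : Set (Fin d → ℝ)} (hs : MeasurableSet s) :
    gaussRows m d {g | g k ∈ s} = iid d s :=
  (measurePreserving_eval (fun _ : Fin m => iid d) k).measure_preimage hs.nullMeasurableSet

theorem gaussRows_eval_pair {m d : ℕ} {k k' : Fin m} (hk : k ≠ k')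
    {s : Set ((Fin d → ℝ) × (Fin d → ℝ))} (hs : MeasurableSet s) :
    gaussRows m d {g | (g k, g k') ∈ s} = ((iid d).prod (iid d)) s := by
  have hind : IndepFun (fun x : Fin m → Fin d → ℝ => x k) (fun x => x k') (gaussRows m d) :=
    (iIndepFun_pi (μ := fun _ : Fin m => iid d) (X := fun _ x => x)
      (fun _ => aemeasurable_id)).indepFun hk
  have h1 := (indepFun_iff_map_prod_eq_prod_map_map (measurable_pi_apply k).aemeasurable
    (measurable_pi_apply k').aemeasurable).1 hind
  have hev : ∀ k : Fin m, (gaussRows m d).map (fun x => x k) = iid d := fun k =>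
    (measurePreserving_eval (fun _ : Fin m => iid d) k).map_eq
  rw [hev, hev] at h1
  rw [← h1, Measure.map_apply (by fun_prop) hs]
  rfl

theorem prod_le_of_section_le {α β : Type*} [MeasurableSpace α] [MeasurableSpace β]
    {μ : Measure α} {ν : Measure β} [IsProbabilityMeasure μ] [SFinite ν] {s : Set (α × β)}
    (hs : MeasurableSet s) {c : ENNReal} (h : ∀ x, ν {y | (x, y) ∈ s} ≤ c) :
    (μ.prod ν) s ≤ c := by
  rw [Measure.prod_apply hs]
  calc _ ≤ ∫⁻ _, c ∂μ := lintegral_mono h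
    _ = c := by simp

theorem gaussRows_prod_proj {m d : ℕ} {u v : Vec d} (hu : ‖u‖ = 1) (hv : ‖v‖ = 1)
    (huv : inner ℝ u v = (0 : ℝ)) :
    MeasurePreserving (fun g : Fin m → Fin d → ℝ =>
      ((fun k => (inner ℝ u (WithLp.toLp 2 (g k)) : ℝ)),
        (fun k => (inner ℝ v (WithLp.toLp 2 (g k)) : ℝ))))
      (gaussRows m d) ((iid m).prod (iid m)) := by
  have ho : Orthonormal ℝ ![u, v] := by
    rw [orthonormal_iff_ite]
    intro i j
    fin_cases i <;> fin_cases j <;>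
      simp [hu, hv, huv, real_inner_comm u v]
  have h1 : MeasurePreserving (fun g : Fin d → ℝ =>
      ((inner ℝ u (WithLp.toLp 2 g) : ℝ), (inner ℝ v (WithLp.toLp 2 g) : ℝ))) (iid d)
      ((gaussianReal 0 1).prod (gaussianReal 0 1)) :=
    (measurePreserving_finTwoArrow (gaussianReal 0 1)).comp (measurePreserving_proj ho)
  have h2 : MeasurePreserving (fun (g : Fin m → Fin d → ℝ) k =>
      ((inner ℝ u (WithLp.toLp 2 (g k)) : ℝ), (inner ℝ v (WithLp.toLp 2 (g k)) : ℝ)))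
      (gaussRows m d) (Measure.pi fun _ => (gaussianReal 0 1).prod (gaussianReal 0 1)) :=
    measurePreserving_pi _ _ fun _ => h1
  exact (measurePreserving_arrowProdEquivProdArrow ℝ ℝ (Fin m) (fun _ => gaussianReal 0 1)
    (fun _ => gaussianReal 0 1)).comp h2

/-! ### Near-orthonormality of Gaussian vectors -/

/-- The variance of the square of a standard Gaussian variable. -/
def sqVar : ℝ := Var[fun x : ℝ => x ^ 2; gaussianReal 0 1]

theorem sqVar_nonneg : 0 ≤ sqVar := variance_nonneg _ _

theorem memLp_sq_gaussian : MemLp (fun x : ℝ => x ^ 2) 2 (gaussianReal 0 1) := by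
  have h := (memLp_id_gaussianReal (μ := 0) (v := 1) 4)
  have h2 := (memLp_two_iff_integrable_sq (f := fun x : ℝ => x ^ 2)
    (μ := gaussianReal 0 1) (by fun_prop)).2 ?_
  · exact h2
  · have h3 := h.integrable_norm_pow (by norm_num)
    refine h3.congr (ae_of_all _ fun x => ?_)
    simp only [id, Real.norm_eq_abs]
    rw [← pow_mul]
    norm_num [abs_of_nonneg, pow_abs, abs_of_nonneg (show (0:ℝ) ≤ x ^ 4 by positivity)]

theorem integral_sq_gaussian : ∫ x : ℝ, x ^ 2 ∂(gaussianReal 0 1) = 1 := by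
  have h := variance_of_integral_eq_zero (X := fun x : ℝ => x) (μ := gaussianReal 0 1)
    (by fun_prop) (by simp)
  rw [variance_fun_id_gaussianReal] at h
  simpa using h.symm

theorem iid_norm_sq_near {d : ℕ} (hd : 0 < d) {θ : ℝ} (hθ : 0 < θ) :
    iid d {g | θ ≤ |‖(WithLp.toLp 2 g : Vec d)‖ ^ 2 / d - 1|}
      ≤ ENNReal.ofReal (sqVar / (d * θ ^ 2)) := by
  have hd' : (0 : ℝ) < d := by exact_mod_cast hd
  have hml : MemLp (∑ i : Fin d, fun g : Fin d → ℝ => g i ^ 2) 2 (iid d) :=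
    memLp_finset_sum' _ fun i _ => memLp_sq_gaussian.comp_measurePreserving
      (measurePreserving_eval (fun _ : Fin d => gaussianReal 0 1) i)
  have h := meas_ge_le_variance_div_sq hml (c := d * θ) (by positivity)
  have hvar : Var[∑ i : Fin d, fun g : Fin d → ℝ => g i ^ 2; iid d] = d * sqVar := by
    rw [iid, variance_sum_pi (X := fun (_ : Fin d) (x : ℝ) => x ^ 2) fun _ => memLp_sq_gaussian]
    simp [sqVar]
  have hint : ∫ g, (∑ i : Fin d, fun g : Fin d → ℝ => g i ^ 2) g ∂(iid d) = d := by
    simp only [Finset.sum_apply]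
    rw [integral_finset_sum]
    · have : ∀ i : Fin d, ∫ g : Fin d → ℝ, g i ^ 2 ∂(iid d) = 1 := fun i => by
        rw [← integral_sq_gaussian]
        have := (measurePreserving_eval (fun _ : Fin d => gaussianReal 0 1) i)
        rw [← this.map_eq, integral_map (measurable_pi_apply i).aemeasurable (by fun_prop)]
        rfl
      simp [this]
    · intro i _
      exact (memLp_sq_gaussian.comp_measurePreserving
        (measurePreserving_eval (fun _ : Fin d => gaussianReal 0 1) i)).integrable (by norm_num)
  rw [hvar, hint] at h
  have hset : {g | θ ≤ |‖(WithLp.toLp 2 g : Vec d)‖ ^ 2 / d - 1|}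
      = {g : Fin d → ℝ | d * θ ≤ |(∑ i : Fin d, fun g : Fin d → ℝ => g i ^ 2) g - d|} := by
    ext g
    simp only [Set.mem_setOf_eq, Finset.sum_apply]
    rw [EuclideanSpace.real_norm_sq_eq]
    have : (∑ i, g i ^ 2) - d = d * ((∑ i, g i ^ 2) / d - 1) := by field_simp
    rw [this, abs_mul, abs_of_pos hd', mul_le_mul_iff_right₀ hd']
  rw [hset]
  refine h.trans (ENNReal.ofReal_le_ofReal (le_of_eq ?_))
  field_simp

/-- The first vector satisfies `‖·‖² ≤ 2 d` outside a small event; for such a fixed vector the inner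
product has variance at most `2 d`, and Chebyshev's inequality applies. -/
theorem iid_prod_inner_near {d : ℕ} (hd : 0 < d) {θ : ℝ} (hθ : 0 < θ) :
    ((iid d).prod (iid d)) {p | θ ≤ |inner ℝ (WithLp.toLp 2 p.1 : Vec d) (WithLp.toLp 2 p.2) / d|}
      ≤ ENNReal.ofReal (sqVar / d + 2 / (d * θ ^ 2)) := by
  have hd' : (0 : ℝ) < d := by exact_mod_cast hd
  have hsub : {p : (Fin d → ℝ) × (Fin d → ℝ) |
        θ ≤ |inner ℝ (WithLp.toLp 2 p.1 : Vec d) (WithLp.toLp 2 p.2) / d|}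
      ⊆ {p | 1 ≤ |‖(WithLp.toLp 2 p.1 : Vec d)‖ ^ 2 / d - 1|}
        ∪ {p | ‖(WithLp.toLp 2 p.1 : Vec d)‖ ^ 2 ≤ 2 * d ∧
          θ ≤ |inner ℝ (WithLp.toLp 2 p.1 : Vec d) (WithLp.toLp 2 p.2) / d|} := by
    intro p hp
    by_cases h : ‖(WithLp.toLp 2 p.1 : Vec d)‖ ^ 2 ≤ 2 * d
    · exact Or.inr ⟨h, hp⟩
    · refine Or.inl ?_
      rw [Set.mem_setOf_eq]
      refine le_abs.2 (Or.inl ?_)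
      rw [le_sub_iff_add_le, le_div_iff₀ hd']
      linarith
  have hm : Measurable fun p : (Fin d → ℝ) × (Fin d → ℝ) =>
      (inner ℝ (WithLp.toLp 2 p.1 : Vec d) (WithLp.toLp 2 p.2) : ℝ) := by fun_prop
  refine (measure_mono hsub).trans ((measure_union_le _ _).trans ?_)
  rw [ENNReal.ofReal_add (div_nonneg sqVar_nonneg hd'.le) (by positivity)]
  refine add_le_add ?_ (prod_le_of_section_le ?_ fun g => ?_)
  · have h := (measurePreserving_fst (μ := iid d) (ν := iid d)).measure_preimage
      (s := {g | 1 ≤ |‖(WithLp.toLp 2 g : Vec d)‖ ^ 2 / d - 1|})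
      (measurableSet_le measurable_const (by fun_prop)).nullMeasurableSet
    refine (le_of_eq h).trans ((iid_norm_sq_near hd one_pos).trans_eq ?_)
    simp
  · have hm1 : Measurable fun p : (Fin d → ℝ) × (Fin d → ℝ) =>
        ‖(WithLp.toLp 2 p.1 : Vec d)‖ ^ 2 := by fun_prop
    exact (measurableSet_le hm1 measurable_const).inter
      (measurableSet_le measurable_const (hm.div_const _).abs)
  · by_cases h : ‖(WithLp.toLp 2 g : Vec d)‖ ^ 2 ≤ 2 * d
    · have h1 := iid_inner_tail_le (WithLp.toLp 2 g : Vec d) (L := θ * d) (by positivity)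
      refine (measure_mono fun y hy => ?_).trans (h1.trans (ENNReal.ofReal_le_ofReal ?_))
      · have h2 := hy.2
        rw [abs_div, abs_of_pos hd', le_div_iff₀ hd'] at h2
        exact h2
      · calc _ ≤ 2 * (d : ℝ) / (θ * d) ^ 2 := by gcongr
          _ = _ := by field_simp
    · simp [h]

/-- Normalized by `d`, the vectors `g k` are orthonormal up to `θ`. -/
def GramNear (θ : ℝ) {m d : ℕ} (g : Fin m → Fin d → ℝ) : Prop :=
  ∀ k k', |inner ℝ (WithLp.toLp 2 (g k) : Vec d) (WithLp.toLp 2 (g k')) / d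
    - if k = k' then 1 else 0| < θ

theorem measurableSet_gramNear (θ : ℝ) (m d : ℕ) :
    MeasurableSet {g : Fin m → Fin d → ℝ | GramNear θ g} := by
  have : {g : Fin m → Fin d → ℝ | GramNear θ g} = ⋂ k, ⋂ k', {g |
      |inner ℝ (WithLp.toLp 2 (g k) : Vec d) (WithLp.toLp 2 (g k')) / d
        - if k = k' then 1 else 0| < θ} := by
    ext g; simp [GramNear]
  rw [this]
  refine MeasurableSet.iInter fun k => MeasurableSet.iInter fun k' =>
    measurableSet_lt ?_ measurable_const
  have h : Measurable fun g : Fin m → Fin d → ℝ =>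
      (inner ℝ (WithLp.toLp 2 (g k) : Vec d) (WithLp.toLp 2 (g k')) : ℝ) := by fun_prop
  exact ((h.div_const _).sub_const _).abs

theorem gaussRows_not_gramNear_le {m d : ℕ} (hd : 0 < d) {θ : ℝ} (hθ : 0 < θ) (hθ1 : θ ≤ 1) :
    (gaussRows m d).real {g | ¬ GramNear θ g} ≤ m ^ 2 * ((sqVar + 2) / (d * θ ^ 2)) := by
  have hd' : (0 : ℝ) < d := by exact_mod_cast hd
  have hC := sqVar_nonneg
  have hsub : {g : Fin m → Fin d → ℝ | ¬ GramNear θ g} ⊆ ⋃ p : Fin m × Fin m, {g |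
      θ ≤ |inner ℝ (WithLp.toLp 2 (g p.1) : Vec d) (WithLp.toLp 2 (g p.2)) / d
        - if p.1 = p.2 then 1 else 0|} := by
    intro g hg
    simp only [GramNear, Set.mem_setOf_eq, not_forall, not_lt] at hg
    obtain ⟨k, k', h⟩ := hg
    exact Set.mem_iUnion.2 ⟨(k, k'), h⟩
  refine (measureReal_mono hsub).trans ((measureReal_iUnion_fintype_le _).trans ?_)
  calc _ ≤ ∑ _p : Fin m × Fin m, (sqVar + 2) / (d * θ ^ 2) := by
        refine Finset.sum_le_sum fun p _ => ENNReal.toReal_le_of_le_ofReal (by positivity) ?_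
        by_cases hp : p.1 = p.2
        · have h := gaussRows_eval (m := m) p.1
            (s := {g | θ ≤ |‖(WithLp.toLp 2 g : Vec d)‖ ^ 2 / d - 1|})
            (measurableSet_le measurable_const (by fun_prop))
          simp only [hp, if_true, real_inner_self_eq_norm_sq]
          rw [hp] at h
          refine (le_of_eq h).trans ((iid_norm_sq_near hd hθ).trans
            (ENNReal.ofReal_le_ofReal ?_))
          gcongr
          linarith
        · have hm : Measurable fun p : (Fin d → ℝ) × (Fin d → ℝ) =>
              (inner ℝ (WithLp.toLp 2 p.1 : Vec d) (WithLp.toLp 2 p.2) : ℝ) := by fun_prop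
          have h := gaussRows_eval_pair (m := m) hp
            (s := {p | θ ≤ |inner ℝ (WithLp.toLp 2 p.1 : Vec d) (WithLp.toLp 2 p.2) / d|})
            (measurableSet_le measurable_const (hm.div_const _).abs)
          simp only [hp, if_false, sub_zero]
          refine (le_of_eq h).trans ((iid_prod_inner_near hd hθ).trans
            (ENNReal.ofReal_le_ofReal ?_))
          rw [add_div]
          gcongr
          calc (d : ℝ) * θ ^ 2 ≤ d * 1 := by gcongr; exact pow_le_one₀ hθ.le hθ1
            _ = d := mul_one _
    _ = _ := by
        simp only [Finset.sum_const, Finset.card_univ, Fintype.card_prod, Fintype.card_fin,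
          nsmul_eq_mul]
        push_cast
        ring

theorem gaussRows_norm_sq_le {m d : ℕ} (hd : 0 < d) :
    (gaussRows m d).real {g | ¬ ∀ k, ‖(WithLp.toLp 2 (g k) : Vec d)‖ ^ 2 ≤ 2 * d}
      ≤ m * (sqVar / d) := by
  have hd' : (0 : ℝ) < d := by exact_mod_cast hd
  have hsub : {g : Fin m → Fin d → ℝ | ¬ ∀ k, ‖(WithLp.toLp 2 (g k) : Vec d)‖ ^ 2 ≤ 2 * d}
      ⊆ ⋃ k, {g | g k ∈ {g | 1 ≤ |‖(WithLp.toLp 2 g : Vec d)‖ ^ 2 / d - 1|}} := by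
    intro g hg
    simp only [Set.mem_setOf_eq, not_forall, not_le] at hg
    obtain ⟨k, h⟩ := hg
    refine Set.mem_iUnion.2 ⟨k, ?_⟩
    rw [Set.mem_setOf_eq, Set.mem_setOf_eq]
    refine le_abs.2 (Or.inl ?_)
    rw [le_sub_iff_add_le, le_div_iff₀ hd']
    linarith
  refine (measureReal_mono hsub).trans ((measureReal_iUnion_fintype_le _).trans ?_)
  calc _ ≤ ∑ _k : Fin m, sqVar / d := by
        refine Finset.sum_le_sum fun k _ => ENNReal.toReal_le_of_le_ofReal
          (div_nonneg sqVar_nonneg hd'.le) ?_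
        rw [gaussRows_eval k (measurableSet_le measurable_const (by fun_prop))]
        simpa using iid_norm_sq_near hd one_pos
    _ = _ := by simp

/-! ### Orthonormalization of nearly orthonormal vectors -/

open InnerProductSpace in
theorem gramSchmidt_eq_sub_sum_normed {E : Type*} [NormedAddCommGroup E] [InnerProductSpace ℝ E]
    {m : ℕ} (w : Fin m → E) (n : Fin m) :
    gramSchmidt ℝ w n = w n - ∑ i ∈ Finset.Iio n,
      (inner ℝ (gramSchmidtNormed ℝ w i) (w n) : ℝ) • gramSchmidtNormed ℝ w i := by
  rw [gramSchmidt_def]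
  congr 1
  refine Finset.sum_congr rfl fun i _ => ?_
  rw [Submodule.starProjection_singleton]
  simp only [gramSchmidtNormed, real_inner_smul_left, smul_smul]
  congr 1
  simp only [RCLike.ofReal_real_eq_id, id]
  field_simp

open InnerProductSpace in
-- Gram–Schmidt with a bound on all coefficients: by induction each is at most `2 θ`, because `θ + 4
-- m θ²`, divided by a norm of at least `9 / 10`, stays below `2 θ`.
theorem exists_orthonormal_near {E : Type*} [NormedAddCommGroup E] [InnerProductSpace ℝ E]
    {m : ℕ} {w : Fin m → E} {θ : ℝ} (hθ : 0 ≤ θ) (hm : m * θ ≤ 1 / 100)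
    (hw : ∀ k k', |inner ℝ (w k) (w k') - if k = k' then 1 else 0| ≤ θ) :
    ∃ o : Fin m → E, Orthonormal ℝ o ∧ ∀ k, ‖w k - o k‖ ≤ 5 * (m * θ) := by
  set o := gramSchmidtNormed ℝ w with ho
  have hnormed : ∀ k, gramSchmidt ℝ w k = ‖gramSchmidt ℝ w k‖ • o k := fun k => by
    by_cases h : gramSchmidt ℝ w k = 0
    · simp [h]
    · rw [ho, gramSchmidtNormed, smul_smul]
      simp [h]
  have hole : ∀ k, ‖o k‖ ≤ 1 := fun k => by
    by_cases h : o k = 0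
    · simp [h]
    · exact (gramSchmidtNormed_unit_length' h).le
  have hwn : ∀ k, |‖w k‖ - 1| ≤ θ := fun k => by
    have h1 := hw k k
    rw [if_pos rfl, real_inner_self_eq_norm_sq] at h1
    have h2 : ‖w k‖ ^ 2 - 1 = (‖w k‖ - 1) * (‖w k‖ + 1) := by ring
    rw [h2, abs_mul, abs_of_nonneg (by positivity : 0 ≤ ‖w k‖ + 1)] at h1
    have := abs_nonneg (‖w k‖ - 1)
    nlinarith [norm_nonneg (w k)]
  have hone : ∀ k : Fin m, (1 : ℝ) ≤ m := fun k => by exact_mod_cast k.pos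
  have key : ∀ n, (∀ k, n < k → |inner ℝ (o n) (w k)| ≤ 2 * θ) ∧
      ‖w n - gramSchmidt ℝ w n‖ ≤ 2 * (m * θ) ∧ 9 / 10 ≤ ‖gramSchmidt ℝ w n‖ := by
    intro n
    induction n using WellFoundedLT.induction with
    | ind n ih => ?_
    have hθm : θ ≤ m * θ := by nlinarith [hone n]
    have hcard : ((Finset.Iio n).card : ℝ) ≤ m := by
      rw [Fin.card_Iio]
      exact_mod_cast n.2.le
    have hclose : ‖w n - gramSchmidt ℝ w n‖ ≤ 2 * (m * θ) := by
      rw [gramSchmidt_eq_sub_sum_normed, sub_sub_cancel]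
      calc _ ≤ ∑ i ∈ Finset.Iio n, 2 * θ := by
            refine norm_sum_le_of_le _ fun i hi => ?_
            have hi' := Finset.mem_Iio.1 hi
            rw [norm_smul, Real.norm_eq_abs]
            calc _ ≤ 2 * θ * 1 := mul_le_mul ((ih i hi').1 n hi') (hole i) (norm_nonneg _)
                  (by positivity)
              _ = _ := mul_one _
        _ = (Finset.Iio n).card * (2 * θ) := by simp
        _ ≤ m * (2 * θ) := by gcongr
        _ = _ := by ring
    have hbig : 9 / 10 ≤ ‖gramSchmidt ℝ w n‖ := by
      have h1 := norm_sub_norm_le (w n) (gramSchmidt ℝ w n)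
      have h2 := (abs_le.1 (hwn n)).1
      linarith
    refine ⟨fun k hk => ?_, hclose, hbig⟩
    have h1 : |inner ℝ (gramSchmidt ℝ w n) (w k)| ≤ θ + m * θ * (4 * θ) := by
      rw [gramSchmidt_eq_sub_sum_normed, inner_sub_left, sum_inner]
      have h2 := hw n k
      rw [if_neg hk.ne, sub_zero] at h2
      refine (abs_sub _ _).trans (add_le_add h2 ?_)
      calc _ ≤ ∑ i ∈ Finset.Iio n, 2 * θ * (2 * θ) := by
            refine (Finset.abs_sum_le_sum_abs _ _).trans (Finset.sum_le_sum fun i hi => ?_)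
            have hi' := Finset.mem_Iio.1 hi
            rw [real_inner_smul_left, abs_mul]
            exact mul_le_mul ((ih i hi').1 n hi') ((ih i hi').1 k (hi'.trans hk)) (abs_nonneg _)
              (by positivity)
        _ = (Finset.Iio n).card * (2 * θ * (2 * θ)) := by simp
        _ ≤ m * (2 * θ * (2 * θ)) := by gcongr
        _ = _ := by ring
    rw [hnormed, real_inner_smul_left, abs_mul, abs_norm] at h1
    have h3 : 9 / 10 * |inner ℝ (o n) (w k)| ≤ θ + m * θ * (4 * θ) :=
      (mul_le_mul_of_nonneg_right hbig (abs_nonneg _)).trans h1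
    nlinarith
  have hne : ∀ k, gramSchmidt ℝ w k ≠ 0 := fun k h => by
    have := (key k).2.2
    rw [h, norm_zero] at this
    linarith
  have hunit : ∀ k, ‖o k‖ = 1 := fun k => by
    refine gramSchmidtNormed_unit_length' fun h => hne k ?_
    have := hnormed k
    rw [ho, h, smul_zero] at this
    exact this
  refine ⟨o, ⟨hunit, fun i j hij => ?_⟩, fun k => ?_⟩
  · simp only [ho, gramSchmidtNormed, real_inner_smul_left, real_inner_smul_right,
      gramSchmidt_orthogonal ℝ w hij, mul_zero]
  · have hθm : θ ≤ m * θ := by nlinarith [hone k]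
    have h1 := (key k).2.1
    have h2 : ‖gramSchmidt ℝ w k - o k‖ ≤ 3 * (m * θ) := by
      have h3 : gramSchmidt ℝ w k - o k = (‖gramSchmidt ℝ w k‖ - 1) • o k := by
        rw [sub_smul, one_smul, ← hnormed]
      rw [h3, norm_smul, hunit, mul_one, Real.norm_eq_abs]
      have h4 := abs_norm_sub_norm_le (w k) (gramSchmidt ℝ w k)
      have h5 := hwn k
      rw [abs_le] at *
      constructor <;> linarith
    calc ‖w k - o k‖ ≤ ‖w k - gramSchmidt ℝ w k‖ + ‖gramSchmidt ℝ w k - o k‖ :=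
          norm_sub_le_norm_sub_add_norm_sub _ _ _
      _ ≤ _ := by linarith

/-! ### Champions among the initial neurons -/

/-- For an exactly orthonormal family the projections are independent, and a strong champion
survives perturbations by `e ^ 6 / 2`. The subtracted term bounds the probability that passing to
the nearby orthonormal family changes some projection by more. -/
theorem iid_champ_ge {e θ : ℝ} (he0 : 0 < e) (he : e ≤ 1 / 1000) {m d : ℕ} {w : Fin m → Vec d}
    (hθ : 0 ≤ θ) (hm : m * θ ≤ 1 / 100)
    (hw : ∀ k k', |inner ℝ (w k) (w k') - if k = k' then 1 else 0| ≤ θ) (i : Fin m) :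
    (iid m).real {x | StrongChamp e x i} - m * ((5 * (m * θ)) ^ 2 / (e ^ 6 / 2) ^ 2)
      ≤ (iid d).real {h | Champ e (proj w h) i} := by
  obtain ⟨o, ho, hwo⟩ := exists_orthonormal_near hθ hm hw
  have h1 : (iid m).real {x | StrongChamp e x i} = (iid d).real {h | StrongChamp e (proj o h) i} :=
    congrArg ENNReal.toReal ((measurePreserving_proj ho).measure_preimage
      (measurableSet_strongChamp e i).nullMeasurableSet).symm
  have hsub : {h | StrongChamp e (proj o h) i} ⊆ {h | Champ e (proj w h) i} ∪
      ⋃ k, {h | e ^ 6 / 2 ≤ |inner ℝ (w k - o k) (WithLp.toLp 2 h)|} := by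
    intro h hh
    by_contra hcon
    simp only [Set.mem_union, Set.mem_setOf_eq, Set.mem_iUnion, not_or, not_exists, not_le] at hcon
    refine hcon.1 (StrongChamp.champ he0 he hh fun k => ?_)
    have := (hcon.2 k).le
    rwa [inner_sub_left, abs_sub_comm] at this
  have h2 : (iid d).real (⋃ k, {h | e ^ 6 / 2 ≤ |inner ℝ (w k - o k) (WithLp.toLp 2 h)|})
      ≤ m * ((5 * (m * θ)) ^ 2 / (e ^ 6 / 2) ^ 2) := by
    refine (measureReal_iUnion_fintype_le _).trans ?_
    calc _ ≤ ∑ _k : Fin m, (5 * (m * θ)) ^ 2 / (e ^ 6 / 2) ^ 2 := by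
          refine Finset.sum_le_sum fun k _ => ENNReal.toReal_le_of_le_ofReal (by positivity) ?_
          refine (iid_inner_tail_le _ (by positivity)).trans (ENNReal.ofReal_le_ofReal ?_)
          gcongr
          exact hwo k
      _ = _ := by simp
  have h3 := (measureReal_mono (μ := iid d) hsub).trans (measureReal_union_le _ _)
  linarith

theorem iid_strongChamp_le {e : ℝ} {m : ℕ} (i : Fin m) :
    m * (iid m).real {x | StrongChamp e x i} ≤ 1 := by
  rw [sum_iid_strongChamp]
  linarith [measureReal_nonneg (μ := iid m) (s := {x | ¬ ∃ i, StrongChamp e x i})]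

/-- Every mode has its own champion among the rows `g k`. -/
def ModeChamps (e : ℝ) {m d : ℕ} (u : Fin 2 → Vec d) (g : Fin m → Fin d → ℝ)
    (iw : Fin 2 → Fin m) : Prop :=
  iw 0 ≠ iw 1 ∧ ∀ l, Champ e (fun k => inner ℝ (u l) (WithLp.toLp 2 (g k))) (iw l)

/-- The alignments with the two modes are nearly independent, each with a uniformly placed champion,
so the champions coincide with probability at most `m (1 / m)² = 1 / m`. -/
theorem gaussRows_no_modeChamps_le {e : ℝ} (he0 : 0 < e) (he : e ≤ 1 / 1000) {m d : ℕ}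
    (hm : 0 < m) {u : Fin 2 → Vec d} (hu : ∀ l, ‖u l‖ = 1) (hγ0 : 0 ≤ (inner ℝ (u 0) (u 1) : ℝ))
    (hγ : (inner ℝ (u 0) (u 1) : ℝ) ≤ e ^ 10) :
    (gaussRows m d).real {g | ¬ ∃ iw, ModeChamps e u g iw}
      ≤ 2 * (iid m).real {x | ¬ ∃ i, StrongChamp e x i} + 1 / m := by
  set γ : ℝ := inner ℝ (u 0) (u 1) with hγd
  have hm' : (0 : ℝ) < m := by exact_mod_cast hm
  have he10 : e ^ 10 ≤ 1 / 1000 := by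
    calc e ^ 10 ≤ e ^ 1 := pow_le_pow_of_le_one he0.le (by linarith) (by norm_num)
      _ ≤ _ := by rw [pow_one]; exact he
  have hγ2 : γ ^ 2 ≤ γ := by nlinarith
  set c : ℝ := √(1 - γ ^ 2) with hc
  have hc2 : c ^ 2 = 1 - γ ^ 2 := Real.sq_sqrt (by linarith)
  have hc0 : 0 < c := Real.sqrt_pos.2 (by linarith)
  have hc1 : c ≤ 1 := by nlinarith
  -- The component of `u 1` orthogonal to `u 0`, normalized. Projections on `u 0` and `v` are
  -- exactly independent, and using `v` for `u 1` changes coordinates by at most `γ / e ^ 2 ≤ e ^ 6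
  -- / 2`.
  set v : Vec d := c⁻¹ • (u 1 - γ • u 0) with hv
  have hn : ‖u 1 - γ • u 0‖ = c := by
    have : ‖u 1 - γ • u 0‖ ^ 2 = c ^ 2 := by
      rw [norm_sub_sq_real, norm_smul, hu, hu, real_inner_smul_right, real_inner_comm, ← hγd, hc2,
        Real.norm_eq_abs, mul_one, sq_abs]
      ring
    exact (sq_eq_sq₀ (norm_nonneg _) hc0.le).1 this
  have hv1 : ‖v‖ = 1 := by
    rw [hv, norm_smul, hn, norm_inv, Real.norm_eq_abs, abs_of_pos hc0, inv_mul_cancel₀ hc0.ne']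
  have huv : (inner ℝ (u 0) v : ℝ) = 0 := by
    rw [hv, real_inner_smul_right, inner_sub_right, real_inner_smul_right, ← hγd,
      real_inner_self_eq_norm_sq, hu]
    ring
  have hu1 : ∀ x : Vec d, (inner ℝ (u 1) x : ℝ) = γ * inner ℝ (u 0) x + c * inner ℝ v x := by
    intro x
    rw [hv, real_inner_smul_left, mul_inv_cancel_left₀ hc0.ne', inner_sub_left,
      real_inner_smul_left]
    ring
  have hΦ := gaussRows_prod_proj (m := m) (hu 0) hv1 huv
  set Φ := fun g : Fin m → Fin d → ℝ => ((fun k => (inner ℝ (u 0) (WithLp.toLp 2 (g k)) : ℝ)),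
        (fun k => (inner ℝ v (WithLp.toLp 2 (g k)) : ℝ))) with hΦd
  set A : Set (Fin m → ℝ) := {x | ¬ ∃ i, StrongChamp e x i} with hA
  have hAm : MeasurableSet A := by
    have : A = (⋃ i, {x : Fin m → ℝ | StrongChamp e x i})ᶜ := by ext x; simp [hA]
    rw [this]
    exact (MeasurableSet.iUnion fun i => measurableSet_strongChamp e i).compl
  have hsub : {g | ¬ ∃ iw, ModeChamps e u g iw} ⊆ Φ ⁻¹' ((A ×ˢ Set.univ) ∪ (Set.univ ×ˢ A) ∪
      ⋃ i, {x | StrongChamp e x i} ×ˢ {x | StrongChamp e x i}) := by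
    intro g hg
    by_contra hcon
    simp only [Set.mem_preimage, Set.mem_union, Set.mem_prod, Set.mem_univ, and_true, true_and,
      Set.mem_iUnion, not_or, hA, Set.mem_setOf_eq, not_not] at hcon
    obtain ⟨⟨⟨i, hi⟩, i', hi'⟩, hne⟩ := hcon
    simp only [not_exists, not_and] at hne
    refine hg ⟨![i, i'], fun h => ?_, fun l => ?_⟩
    · have h : i = i' := h
      subst h
      exact hne i hi hi'
    · fin_cases l
      · exact StrongChamp.champ he0 he hi fun k => by
          simp only [hΦd, Fin.zero_eta, sub_self, abs_zero]
          positivity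
      · refine StrongChamp.champ he0 he hi' fun k => ?_
        have h1 := (hi.2.1 k).le
        have h2 := (hi'.2.1 k).le
        simp only [hΦd, Fin.mk_one] at h1 h2 ⊢
        rw [hu1]
        set x : ℝ := inner ℝ (u 0) (WithLp.toLp 2 (g k))
        set y : ℝ := inner ℝ v (WithLp.toLp 2 (g k))
        have h3 : 1 - c ≤ γ := by nlinarith
        calc |y - (γ * x + c * y)| = |(1 - c) * y - γ * x| := by ring_nf
          _ ≤ |(1 - c) * y| + |γ * x| := abs_sub _ _
          _ = (1 - c) * |y| + γ * |x| := by
              rw [abs_mul, abs_mul, abs_of_nonneg (sub_nonneg.2 hc1), abs_of_nonneg hγ0]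
          _ ≤ γ * (1 / (2 * e ^ 2)) + γ * (1 / (2 * e ^ 2)) := by gcongr
          _ = γ / e ^ 2 := by field_simp; ring
          _ ≤ e ^ 10 / e ^ 2 := by gcongr
          _ = e ^ 6 * e ^ 2 := by field_simp
          _ ≤ e ^ 6 * (1 / 2) := by gcongr; nlinarith
          _ = _ := by ring
  have hmeas : MeasurableSet ((A ×ˢ Set.univ) ∪ (Set.univ ×ˢ A) ∪
      ⋃ i, {x : Fin m → ℝ | StrongChamp e x i} ×ˢ {x : Fin m → ℝ | StrongChamp e x i}) :=
    ((hAm.prod MeasurableSet.univ).union (MeasurableSet.univ.prod hAm)).union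
      (MeasurableSet.iUnion fun i =>
        (measurableSet_strongChamp e i).prod (measurableSet_strongChamp e i))
  have hpre := hΦ.measure_preimage hmeas.nullMeasurableSet
  refine (measureReal_mono hsub).trans ?_
  rw [measureReal_def, hpre, ← measureReal_def]
  refine (measureReal_union_le _ _).trans (add_le_add ((measureReal_union_le _ _).trans ?_) ?_)
  · rw [measureReal_prod_prod, measureReal_prod_prod]
    simp only [probReal_univ]
    linarith
  · refine (measureReal_iUnion_fintype_le _).trans ?_
    calc _ ≤ ∑ _i : Fin m, (1 / (m : ℝ)) * (1 / m) := by
          refine Finset.sum_le_sum fun i _ => ?_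
          rw [measureReal_prod_prod]
          have h1 : (iid m).real {x | StrongChamp e x i} ≤ 1 / m := by
            rw [le_div_iff₀ hm', mul_comm]
            exact iid_strongChamp_le i
          gcongr
      _ = _ := by
          rw [Finset.sum_const, Finset.card_univ, Fintype.card_fin, nsmul_eq_mul]
          field_simp

/-- The neurons `g k`, scaled to `N(0, I / d)`. -/
def scaled {m d : ℕ} (g : Fin m → Fin d → ℝ) (k : Fin m) : Vec d :=
  (√d)⁻¹ • WithLp.toLp 2 (g k)

theorem inner_scaled {m d : ℕ} (g : Fin m → Fin d → ℝ) (k k' : Fin m) :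
    (inner ℝ (scaled g k) (scaled g k') : ℝ)
      = inner ℝ (WithLp.toLp 2 (g k) : Vec d) (WithLp.toLp 2 (g k')) / d := by
  rw [scaled, scaled, real_inner_smul_left, real_inner_smul_right, ← mul_assoc, ← mul_inv,
    Real.mul_self_sqrt (Nat.cast_nonneg d), inv_mul_eq_div]

/-- No row `h j` has the same champion as the vector `u`. -/
def NoMatch (e : ℝ) {m M d : ℕ} (u : Vec d) (g : Fin m → Fin d → ℝ) (h : Fin M → Fin d → ℝ) :
    Prop :=
  ∃ i, Champ e (fun k => inner ℝ u (WithLp.toLp 2 (g k))) i ∧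
    ∀ j, ¬ Champ e (proj (scaled g) (h j)) i

theorem measurableSet_noMatch (e : ℝ) (m M : ℕ) {d : ℕ} (u : Vec d) :
    MeasurableSet {p : (Fin m → Fin d → ℝ) × (Fin M → Fin d → ℝ) | NoMatch e u p.1 p.2} := by
  have h : {p : (Fin m → Fin d → ℝ) × (Fin M → Fin d → ℝ) | NoMatch e u p.1 p.2}
      = ⋃ i, ({p | Champ e (fun k => inner ℝ u (WithLp.toLp 2 (p.1 k))) i} ∩
        ⋂ j, {p | Champ e (proj (scaled p.1) (p.2 j)) i}ᶜ) := by
    ext p; simp [NoMatch]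
  rw [h]
  refine MeasurableSet.iUnion fun i => MeasurableSet.inter ?_ (MeasurableSet.iInter fun j =>
    MeasurableSet.compl ?_)
  · exact (show Measurable fun (p : (Fin m → Fin d → ℝ) × (Fin M → Fin d → ℝ)) (k : Fin m) =>
      (inner ℝ u (WithLp.toLp 2 (p.1 k)) : ℝ) from measurable_pi_lambda _ fun k => by fun_prop)
      (measurableSet_champ e i)
  · exact (show Measurable fun (p : (Fin m → Fin d → ℝ) × (Fin M → Fin d → ℝ)) =>
      proj (scaled p.1) (p.2 j) from measurable_pi_lambda _ fun k => by
        unfold proj scaled; fun_prop) (measurableSet_champ e i)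

/-- Given the discriminator rows, the generator rows are independent, and each has the required
champion with probability at least `q`. -/
theorem prod_noMatch_le {e θ q : ℝ} (he0 : 0 < e) (he : e ≤ 1 / 1000) {m M d : ℕ}
    (hθ : 0 ≤ θ) (hm : m * θ ≤ 1 / 100) (u : Vec d) (hq : q ≤ 1)
    (hqs : ∀ i : Fin m, q + m * ((5 * (m * θ)) ^ 2 / (e ^ 6 / 2) ^ 2)
      ≤ (iid m).real {x | StrongChamp e x i}) :
    ((gaussRows m d).prod (gaussRows M d)).real {p | GramNear θ p.1 ∧ NoMatch e u p.1 p.2}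
      ≤ (1 - q) ^ M := by
  refine ENNReal.toReal_le_of_le_ofReal (pow_nonneg (by linarith) _)
    (prod_le_of_section_le ?_ fun g => ?_)
  · exact (measurable_fst (measurableSet_gramNear θ m d)).inter (measurableSet_noMatch e m M u)
  by_cases hg : GramNear θ g
  swap
  · simp [hg]
  by_cases hi : ∃ i, Champ e (fun k => (inner ℝ u (WithLp.toLp 2 (g k)) : ℝ)) i
  swap
  · have : {y : Fin M → Fin d → ℝ | (g, y) ∈ {p : (Fin m → Fin d → ℝ) × (Fin M → Fin d → ℝ) |
        GramNear θ p.1 ∧ NoMatch e u p.1 p.2}} = ∅ := by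
      ext y
      simp only [Set.mem_setOf_eq, Set.mem_empty_iff_false, iff_false]
      exact fun h => hi ⟨_, h.2.choose_spec.1⟩
    rw [this]
    simp
  obtain ⟨i, hi⟩ := hi
  have hsub : {y : Fin M → Fin d → ℝ | (g, y) ∈ {p : (Fin m → Fin d → ℝ) × (Fin M → Fin d → ℝ) |
      GramNear θ p.1 ∧ NoMatch e u p.1 p.2}}
      ⊆ Set.univ.pi fun _ => {h | Champ e (proj (scaled g) h) i}ᶜ := by
    rintro y ⟨-, i', hi', hy⟩ j -
    rw [Champ.unique he0 hi hi']
    exact hy j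
  refine (measure_mono hsub).trans ?_
  have h1 := iid_champ_ge (w := scaled g) he0 he hθ hm
    (fun k k' => by rw [inner_scaled]; exact (hg k k').le) i
  have hms : MeasurableSet {h : Fin d → ℝ | Champ e (proj (scaled g) h) i} :=
    measurable_proj (scaled g) (measurableSet_champ e i)
  have h2 : iid d {h | Champ e (proj (scaled g) h) i}ᶜ ≤ ENNReal.ofReal (1 - q) := by
    rw [← ofReal_measureReal, probReal_compl_eq_one_sub hms]
    refine ENNReal.ofReal_le_ofReal ?_
    linarith [hqs i]
  rw [gaussRows, Measure.pi_pi]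
  calc _ ≤ ∏ _j : Fin M, ENNReal.ofReal (1 - q) := Finset.prod_le_prod' fun _ _ => h2
    _ = _ := by simp [ENNReal.ofReal_pow (sub_nonneg.2 hq)]

/-! ### The initialization is good with high probability -/

/-- Rows that are not usable as an initialization. -/
def BadRows (e θ : ℝ) {m M d : ℕ} (u : Fin 2 → Vec d)
    (p : (Fin m → Fin d → ℝ) × (Fin M → Fin d → ℝ)) : Prop :=
  ¬ GramNear θ p.1 ∨ (¬ ∀ j, ‖(WithLp.toLp 2 (p.2 j) : Vec d)‖ ^ 2 ≤ 2 * d) ∨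
    (¬ ∃ iw, ModeChamps e u p.1 iw) ∨ ∃ l, GramNear θ p.1 ∧ NoMatch e (u l) p.1 p.2

theorem prod_badRows_le {e θ q : ℝ} (he0 : 0 < e) (he : e ≤ 1 / 1000) {m M d : ℕ} (hd : 0 < d)
    (hm : 0 < m) (hθ0 : 0 < θ) (hmθ : m * θ ≤ 1 / 100) {u : Fin 2 → Vec d} (hu : ∀ l, ‖u l‖ = 1)
    (hγ0 : 0 ≤ (inner ℝ (u 0) (u 1) : ℝ)) (hγ : (inner ℝ (u 0) (u 1) : ℝ) ≤ e ^ 10) (hq : q ≤ 1)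
    (hqs : ∀ i : Fin m, q + m * ((5 * (m * θ)) ^ 2 / (e ^ 6 / 2) ^ 2)
      ≤ (iid m).real {x | StrongChamp e x i}) :
    ((gaussRows m d).prod (gaussRows M d)).real {p | BadRows e θ u p}
      ≤ m ^ 2 * ((sqVar + 2) / (d * θ ^ 2)) + (M * (sqVar / d) +
        ((2 * (iid m).real {x | ¬ ∃ i, StrongChamp e x i} + 1 / m) + 2 * (1 - q) ^ M)) := by
  have hθ1 : θ ≤ 1 := by
    have : (1 : ℝ) ≤ m := by exact_mod_cast hm
    nlinarith
  have hfst : ∀ s : Set (Fin m → Fin d → ℝ),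
      ((gaussRows m d).prod (gaussRows M d)).real {p | p.1 ∈ s} = (gaussRows m d).real s := by
    intro s
    have : {p : (Fin m → Fin d → ℝ) × (Fin M → Fin d → ℝ) | p.1 ∈ s} = s ×ˢ Set.univ := by
      ext; simp
    rw [this, measureReal_prod_prod, probReal_univ, mul_one]
  have hsnd : ∀ s : Set (Fin M → Fin d → ℝ),
      ((gaussRows m d).prod (gaussRows M d)).real {p | p.2 ∈ s} = (gaussRows M d).real s := by
    intro s
    have : {p : (Fin m → Fin d → ℝ) × (Fin M → Fin d → ℝ) | p.2 ∈ s} = Set.univ ×ˢ s := by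
      ext; simp
    rw [this, measureReal_prod_prod, probReal_univ, one_mul]
  have hset : {p : (Fin m → Fin d → ℝ) × (Fin M → Fin d → ℝ) | BadRows e θ u p}
      = {p | p.1 ∈ {g | ¬ GramNear θ g}} ∪
        ({p | p.2 ∈ {h | ¬ ∀ j, ‖(WithLp.toLp 2 (h j) : Vec d)‖ ^ 2 ≤ 2 * d}} ∪
        ({p | p.1 ∈ {g | ¬ ∃ iw, ModeChamps e u g iw}} ∪
          ⋃ l, {p | GramNear θ p.1 ∧ NoMatch e (u l) p.1 p.2})) := by
    ext p
    simp [BadRows]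
  rw [hset]
  refine (measureReal_union_le _ _).trans (add_le_add ?_ ((measureReal_union_le _ _).trans
    (add_le_add ?_ ((measureReal_union_le _ _).trans (add_le_add ?_ ?_)))))
  · rw [hfst]
    exact gaussRows_not_gramNear_le hd hθ0 hθ1
  · rw [hsnd]
    exact gaussRows_norm_sq_le hd
  · rw [hfst]
    exact gaussRows_no_modeChamps_le he0 he hm hu hγ0 hγ
  · refine (measureReal_iUnion_fintype_le _).trans ?_
    calc _ ≤ ∑ _l : Fin 2, (1 - q) ^ M := Finset.sum_le_sum fun l _ =>
          prod_noMatch_le he0 he hθ0.le hmθ (u l) hq hqs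
      _ = _ := by simp

/-- Translation of the scale-free Gaussian events: `⟪w_k, u_l⟫` is `θ ^ 10` times a standard
projection and `⟪w_k, v_j⟫` is `θ ^ 20` times one. -/
theorem exists_goodInit {e θ : ℝ} {mD mG d : ℕ} {S₀ : State mD mG d} {u : Fin 2 → Vec d}
    {g : Fin mD → Fin d → ℝ} {h : Fin mG → Fin d → ℝ} (hθ0 : 0 < θ) (hθ : 2 * θ ^ 2 ≤ 1)
    (hd : θ ^ 10 = (√d)⁻¹) (ha : θ ≤ S₀.a * e ^ 200) (ha1 : S₀.a ≤ 1) (hb : S₀.b = 0)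
    (hW : ∀ k, S₀.W k = scaled g k) (hV : ∀ j, S₀.V j = θ ^ 20 • WithLp.toLp 2 (h j))
    (hgood : ¬ BadRows e θ u (g, h)) : ∃ iw jv, GoodInit S₀ u iw jv e θ := by
  simp only [BadRows, not_or, not_not] at hgood
  obtain ⟨hgram, hnorm, ⟨iw, hne, hchamp⟩, hmatch⟩ := hgood
  simp only [not_exists, not_and] at hmatch
  have hd20 : θ ^ 20 * d = 1 := by
    have h0 : 0 < θ ^ 10 := by positivity
    have h1 : (√(d : ℝ)) ≠ 0 := fun h0' => by
      rw [h0', inv_zero] at hd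
      linarith
    calc θ ^ 20 * d = (θ ^ 10) ^ 2 * d := by ring
      _ = (√(d : ℝ))⁻¹ ^ 2 * (√d) ^ 2 := by rw [hd, Real.sq_sqrt (Nat.cast_nonneg d)]
      _ = 1 := by field_simp
  have hWu : ∀ k l, (inner ℝ (S₀.W k) (u l) : ℝ)
      = θ ^ 10 * inner ℝ (u l) (WithLp.toLp 2 (g k)) := fun k l => by
    rw [hW, scaled, real_inner_smul_left, hd, real_inner_comm]
  have hWV : ∀ k j, (inner ℝ (S₀.W k) (S₀.V j) : ℝ) = θ ^ 20 * proj (scaled g) (h j) k :=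
    fun k j => by rw [hW, hV, real_inner_smul_right, proj]
  have hex : ∀ l, ∃ j, Champ e (proj (scaled g) (h j)) (iw l) := fun l => by
    by_contra hcon
    exact hmatch l hgram ⟨iw l, hchamp l, fun j hj => hcon ⟨j, hj⟩⟩
  choose jv hjv using hex
  refine ⟨iw, jv, ha, ha1, hb, fun k k' => ?_, fun j => ?_, hne, fun l => ?_, fun l k => ?_,
    fun l k hk => ?_, fun l => ?_, fun l k => ?_, fun l k hk => ?_⟩
  · rw [hW, hW, inner_scaled]
    exact (hgram k k').le
  · rw [hV, norm_smul, Real.norm_eq_abs, abs_of_pos (by positivity)]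
    refine abs_le_of_sq_le_sq' ?_ (by positivity) |>.2
    calc (θ ^ 20 * ‖(WithLp.toLp 2 (h j) : Vec d)‖) ^ 2
        = θ ^ 40 * ‖(WithLp.toLp 2 (h j) : Vec d)‖ ^ 2 := by ring
      _ ≤ θ ^ 40 * (2 * d) := by gcongr; exact hnorm j
      _ = θ ^ 18 * (2 * θ ^ 2) * (θ ^ 20 * d) := by ring
      _ ≤ θ ^ 18 * 1 * 1 := by rw [hd20]; gcongr
      _ = _ := by ring
  · rw [hWu]
    have := (hchamp l).1
    nlinarith [pow_pos hθ0 10]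
  · rw [hWu, abs_mul, abs_of_pos (pow_pos hθ0 10), mul_left_comm]
    have := (hchamp l).2.1 k
    simpa using mul_le_mul_of_nonneg_left this (pow_pos hθ0 10).le
  · rw [hWu, hWu]
    have := (hchamp l).2.2 k hk
    simp only at this
    nlinarith [pow_pos hθ0 10]
  · rw [hWV]
    have := (hjv l).1
    nlinarith [pow_pos hθ0 20]
  · rw [hWV, abs_mul, abs_of_pos (pow_pos hθ0 20), mul_left_comm]
    have := (hjv l).2.1 k
    simpa using mul_le_mul_of_nonneg_left this (pow_pos hθ0 20).le
  · rw [hWV, hWV]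
    have := (hjv l).2.2 k hk
    nlinarith [pow_pos hθ0 20]

theorem measurePreserving_gaussian_scale {v : NNReal} {c : ℝ} (hc : c ^ 2 * v = 1) :
    MeasurePreserving (fun x : ℝ => c * x) (gaussianReal 0 v) (gaussianReal 0 1) := by
  refine ⟨by fun_prop, ?_⟩
  rw [gaussianReal_map_const_mul, mul_zero]
  congr 1
  ext
  simpa using hc

theorem measurePreserving_rows_scale (m d : ℕ) {v : NNReal} {c : ℝ} (hc : c ^ 2 * v = 1) :
    MeasurePreserving (fun (x : Fin m → Fin d → ℝ) k i => c * x k i)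
      (Measure.pi fun _ => Measure.pi fun _ => gaussianReal 0 v) (gaussRows m d) :=
  measurePreserving_pi _ _ fun _ => measurePreserving_pi _ _ fun _ =>
    measurePreserving_gaussian_scale hc

theorem measurePreserving_gaussRows_neg (m d : ℕ) :
    MeasurePreserving (fun g : Fin m → Fin d → ℝ => -g) (gaussRows m d) (gaussRows m d) := by
  have h := measurePreserving_rows_scale m d (v := 1) (c := -1) (by norm_num)
  have h2 : (fun (x : Fin m → Fin d → ℝ) k i => -1 * x k i) = fun g => -g := by
    ext; simp
  rw [h2] at h
  exact h

/-- Holds for arbitrary sets, so the measurability of bad events need not be established. -/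
theorem MeasurePreserving.preimage_real_le {α β : Type*} [MeasurableSpace α] [MeasurableSpace β]
    {μ : Measure α} {ν : Measure β} [IsFiniteMeasure ν] {f : α → β} (hf : MeasurePreserving f μ ν)
    (s : Set β) : μ.real (f ⁻¹' s) ≤ ν.real s := by
  refine ENNReal.toReal_mono (measure_ne_top _ _) ?_
  rw [← hf.map_eq]
  exact Measure.le_map_apply hf.measurable.aemeasurable s

instance (mD mG d : ℕ) (va : ℝ) : IsProbabilityMeasure (initLaw mD mG d va) := by
  unfold initLaw; infer_instance

/-- The sign of `a` decides whether the rows `g` or `-g` must be good. Both are required at once,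
which costs the factor two since the two laws agree. -/
theorem initLaw_bad_le {e θ q va : ℝ} (he0 : 0 < e) (he : e ≤ 1 / 1000) {mD mG d : ℕ} (hd : 0 < d)
    (hm : 0 < mD) (hθ0 : 0 < θ) (hmθ : mD * θ ≤ 1 / 100) (hdθ : θ ^ 10 = (√d)⁻¹) (hva : 0 < va)
    {u : Fin 2 → Vec d} (hu : ∀ l, ‖u l‖ = 1)
    (hγ0 : 0 ≤ (inner ℝ (u 0) (u 1) : ℝ)) (hγ : (inner ℝ (u 0) (u 1) : ℝ) ≤ e ^ 10) (hq : q ≤ 1)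
    (hqs : ∀ i : Fin mD, q + mD * ((5 * (mD * θ)) ^ 2 / (e ^ 6 / 2) ^ 2)
      ≤ (iid mD).real {x | StrongChamp e x i}) :
    (initLaw mD mG d va).real {x | ¬ ∃ iw jv, GoodInit (initState x) u iw jv e θ ∨
      GoodInit (flip (initState x)) u iw jv e θ} ≤ θ / e ^ 200 / √va + va +
      2 * (mD ^ 2 * ((sqVar + 2) / (d * θ ^ 2)) + (mG * (sqVar / d) +
        ((2 * (iid mD).real {x | ¬ ∃ i, StrongChamp e x i} + 1 / mD) + 2 * (1 - q) ^ mG))) := by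
  have hd' : (0 : ℝ) < d := by exact_mod_cast hd
  have hsd : 0 < √(d : ℝ) := Real.sqrt_pos.2 hd'
  have hsv : 0 < √va := Real.sqrt_pos.2 hva
  set P := (gaussRows mD d).prod (gaussRows mG d) with hP
  set Ψ : InitSample mD mG d → ℝ × (Fin mD → Fin d → ℝ) × (Fin mG → Fin d → ℝ) :=
    Prod.map (fun a => (√va)⁻¹ * a) (Prod.map (fun x k i => √d * x k i) (fun x k i => d * x k i))
    with hΨd
  have hΨ : MeasurePreserving Ψ (initLaw mD mG d va) ((gaussianReal 0 1).prod P) := by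
    refine MeasurePreserving.prod (measurePreserving_gaussian_scale ?_)
      (MeasurePreserving.prod (measurePreserving_rows_scale _ _ ?_)
        (measurePreserving_rows_scale _ _ ?_))
    · rw [inv_pow, Real.sq_sqrt hva.le, Real.coe_toNNReal _ hva.le, inv_mul_cancel₀ hva.ne']
    · rw [Real.sq_sqrt hd'.le]
      push_cast
      field_simp
    · push_cast
      field_simp
  have hneg : MeasurePreserving (Prod.map (fun g => -g) id) P P :=
    (measurePreserving_gaussRows_neg mD d).prod (MeasurePreserving.id _)
  -- In the original scale: `a` is too close to zero, or `|a| ≥ 1`. Anti-concentration and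
  -- Chebyshev's inequality give the terms `θ / e ^ 200 / √va` and `va`.
  set A : Set ℝ := {a | |a - 0| ≤ θ / e ^ 200 / √va} ∪ {a | 1 / √va ≤ |a|} with hA
  set R : Set ((Fin mD → Fin d → ℝ) × (Fin mG → Fin d → ℝ)) := {p | BadRows e θ u p} with hR
  have hmain : {x : InitSample mD mG d | ¬ ∃ iw jv, GoodInit (initState x) u iw jv e θ ∨
      GoodInit (flip (initState x)) u iw jv e θ} ⊆
      Ψ ⁻¹' ((A ×ˢ Set.univ) ∪ (Set.univ ×ˢ (R ∪ Prod.map (fun g => -g) id ⁻¹' R))) := by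
    intro x hx
    by_contra hcon
    simp only [Set.mem_preimage, Set.mem_union, Set.mem_prod, Set.mem_univ, and_true, true_and,
      not_or, hA, hR, Set.mem_setOf_eq, not_le, sub_zero] at hcon
    obtain ⟨⟨h1, h2⟩, h3, h4⟩ := hcon
    have hθ2 : 2 * θ ^ 2 ≤ 1 := by
      have : (1 : ℝ) ≤ mD := by exact_mod_cast hm
      have h : θ ≤ 1 / 100 := by nlinarith
      nlinarith
    have ha : |(Ψ x).1| = |x.1| / √va := by
      rw [hΨd, Prod.map_fst, abs_mul, abs_inv, abs_of_pos hsv, inv_mul_eq_div]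
    rw [ha] at h1 h2
    have h1' : θ ≤ |x.1| * e ^ 200 := by
      rw [div_lt_div_iff_of_pos_right hsv, div_lt_iff₀ (by positivity)] at h1
      exact h1.le
    have h2' : |x.1| ≤ 1 := ((div_lt_div_iff_of_pos_right hsv).1 h2).le
    have hVeq : ∀ j, (initState x).V j = θ ^ 20 • WithLp.toLp 2 ((Ψ x).2.2 j) := fun j => by
      have h20 : θ ^ 20 = (d : ℝ)⁻¹ := by
        rw [show θ ^ 20 = (θ ^ 10) ^ 2 by ring, hdθ, inv_pow, Real.sq_sqrt hd'.le]
      ext i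
      simp [initState, hΨd, h20, hd'.ne']
    have hWeq : ∀ k, (initState x).W k = scaled (Ψ x).2.1 k := fun k => by
      ext i
      simp [initState, hΨd, scaled, hsd.ne']
    rcases le_total 0 x.1 with h0 | h0
    · rw [abs_of_nonneg h0] at h1' h2'
      obtain ⟨iw, jv, h⟩ := exists_goodInit (S₀ := initState x) (g := (Ψ x).2.1)
        (h := (Ψ x).2.2) hθ0 hθ2 hdθ h1' h2' rfl hWeq hVeq h3
      exact hx ⟨iw, jv, Or.inl h⟩
    · rw [abs_of_nonpos h0] at h1' h2'
      obtain ⟨iw, jv, h⟩ := exists_goodInit (S₀ := flip (initState x)) (g := -(Ψ x).2.1)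
        (h := (Ψ x).2.2) hθ0 hθ2 hdθ h1' h2' rfl (fun k => by
          change -((initState x).W k) = _
          rw [hWeq]
          ext i
          simp [scaled]) hVeq h4
      exact hx ⟨iw, jv, Or.inr h⟩
  have hRle := prod_badRows_le (M := mG) he0 he hd hm hθ0 hmθ hu hγ0 hγ hq hqs
  refine (measureReal_mono hmain).trans ((MeasurePreserving.preimage_real_le hΨ _).trans
    ((measureReal_union_le _ _).trans (add_le_add ?_ ?_)))
  · rw [measureReal_prod_prod, probReal_univ, mul_one]
    refine (measureReal_union_le _ _).trans (add_le_add ?_ ?_)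
    · exact ENNReal.toReal_le_of_le_ofReal (by positivity) (gaussian_near_le _ _)
    · refine ENNReal.toReal_le_of_le_ofReal hva.le ((gaussian_tail_le (by positivity)).trans
        (ENNReal.ofReal_le_ofReal (le_of_eq ?_)))
      rw [div_pow, one_pow, one_div_one_div, Real.sq_sqrt hva.le]
  · rw [measureReal_prod_prod, probReal_univ, one_mul]
    refine (measureReal_union_le _ _).trans ?_
    have := MeasurePreserving.preimage_real_le hneg R
    linarith

/-! ### The size parameters as functions of the dimension -/

/-- The parameter `e = 1 / log d`. -/
def logInv (d : ℕ) : ℝ := 1 / Real.log d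

/-- The parameter `θ = d ^ (-1/20)`. -/
def smallPow (d : ℕ) : ℝ := (d : ℝ) ^ (-(1 / 20) : ℝ)

theorem tendsto_log_natCast : Tendsto (fun d : ℕ => Real.log d) atTop atTop :=
  Real.tendsto_log_atTop.comp tendsto_natCast_atTop_atTop

theorem tendsto_log_log_natCast : Tendsto (fun d : ℕ => Real.log (Real.log d)) atTop atTop :=
  Real.tendsto_log_atTop.comp tendsto_log_natCast

theorem tendsto_logInv : Tendsto logInv atTop (𝓝 0) := by
  have h := tendsto_inv_atTop_zero.comp tendsto_log_natCast
  refine h.congr fun d => ?_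
  simp [logInv]

theorem smallPow_pos {d : ℕ} (hd : 0 < d) : 0 < smallPow d :=
  Real.rpow_pos_of_pos (by exact_mod_cast hd) _

theorem smallPow_pow (d n : ℕ) : smallPow d ^ n = (d : ℝ) ^ (-(n / 20) : ℝ) := by
  rw [smallPow, ← Real.rpow_natCast, ← Real.rpow_mul (Nat.cast_nonneg d)]
  congr 1
  ring

theorem smallPow_pow_ten (d : ℕ) : smallPow d ^ 10 = (√(d : ℝ))⁻¹ := by
  rw [smallPow_pow, Real.sqrt_eq_rpow, ← Real.rpow_neg (Nat.cast_nonneg d)]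
  norm_num

theorem smallPow_pow_twenty (d : ℕ) : smallPow d ^ 20 = (d : ℝ)⁻¹ := by
  rw [smallPow_pow, ← Real.rpow_neg_one]
  norm_num

theorem eventually_smallPow_le (n : ℕ) : ∀ᶠ d : ℕ in atTop, smallPow d ≤ logInv d ^ n := by
  have h1 := (Real.tendsto_pow_mul_exp_neg_atTop_nhds_zero n).comp
    (tendsto_log_natCast.atTop_div_const (by norm_num : (0 : ℝ) < 20))
  have h2 : ∀ᶠ d : ℕ in atTop,
      (Real.log d / 20) ^ n * Real.exp (-(Real.log d / 20)) ≤ (1 / 20) ^ n :=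
    (h1.eventually (gt_mem_nhds (by positivity))).mono fun d h => h.le
  filter_upwards [h2, tendsto_log_natCast.eventually_ge_atTop 1, eventually_ge_atTop 1]
    with d h hL hd
  have hd' : (0 : ℝ) < d := by exact_mod_cast hd
  have h3 : smallPow d = Real.exp (-(Real.log d / 20)) := by
    rw [smallPow, Real.rpow_def_of_pos hd']
    congr 1
    ring
  rw [h3, logInv, one_div, inv_pow, ← one_div, le_div_iff₀ (by positivity)]
  rw [div_pow, one_div, inv_pow, ← one_div, div_mul_eq_mul_div,
    div_le_div_iff_of_pos_right (by positivity)] at h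
  linarith

theorem eventually_logInv_le {c : ℝ} (hc : 0 < c) : ∀ᶠ d : ℕ in atTop, logInv d ≤ c :=
  (tendsto_logInv.eventually (gt_mem_nhds hc)).mono fun _ h => h.le

theorem eventually_logInv_pos : ∀ᶠ d : ℕ in atTop, 0 < logInv d :=
  (tendsto_log_natCast.eventually_gt_atTop 0).mono fun _ h => one_div_pos.2 h

theorem one_le_numD_mul {d : ℕ} (h : 0 < logInv d) : 1 ≤ numD d * logInv d := by
  have hL : 0 < Real.log d := one_div_pos.1 h
  rw [logInv, mul_one_div, le_div_iff₀ hL, one_mul]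
  exact Nat.le_ceil _

theorem numD_mul_le {d : ℕ} (h : 0 < logInv d) (h1 : logInv d ≤ 1) : numD d * logInv d ≤ 2 := by
  have hL : 0 < Real.log d := one_div_pos.1 h
  rw [logInv, div_le_one hL] at h1
  rw [logInv, mul_one_div, div_le_iff₀ hL]
  have := (Nat.ceil_lt_add_one hL.le).le
  unfold numD
  linarith

theorem numG_mul_le {d : ℕ} (h : 0 < logInv d) (h1 : logInv d ≤ 1) :
    numG d * logInv d ^ 2 ≤ 1 := by
  have hL : 0 < Real.log d := one_div_pos.1 h
  rw [logInv, div_le_one hL] at h1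
  rw [logInv, one_div, inv_pow, ← div_eq_mul_inv, div_le_one (by positivity)]
  have h2 := Real.log_le_sub_one_of_pos hL
  have h3 := (Nat.ceil_lt_add_one (mul_nonneg hL.le (Real.log_nonneg h1))).le
  unfold numG
  nlinarith

theorem log_log_le_numG_div {d : ℕ} (h : 0 < logInv d) (h1 : logInv d ≤ 1) :
    Real.log (Real.log d) / 8 * (4 * numD d) ≤ numG d := by
  have hL : 0 < Real.log d := one_div_pos.1 h
  have h2 := numD_mul_le h h1
  rw [logInv, div_le_one hL] at h1
  rw [logInv, mul_one_div, div_le_iff₀ hL] at h2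
  have h3 := Nat.le_ceil (Real.log d * Real.log (Real.log d))
  have h4 := Real.log_nonneg h1
  unfold numG
  nlinarith

theorem one_sub_one_div_pow_le {x : ℝ} (hx : 1 ≤ x) (n : ℕ) :
    (1 - 1 / x) ^ n ≤ Real.exp (-(n / x)) := by
  have h1 : 1 - 1 / x ≤ Real.exp (-(1 / x)) := by
    linarith [Real.add_one_le_exp (-(1 / x))]
  have h0 : 0 ≤ 1 - 1 / x := by
    rw [sub_nonneg, div_le_one (by positivity)]; exact hx
  calc (1 - 1 / x) ^ n ≤ Real.exp (-(1 / x)) ^ n := pow_le_pow_left₀ h0 h1 n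
    _ = _ := by
      rw [← Real.exp_nat_mul]
      congr 1
      ring

/-- All error terms are at most constants times `e`, except that no coordinate exceeds one, bounded
by `c ^ m`, and that no column matches, bounded by `(1 - 1 / (4 m)) ^ M ≤ exp (-(log log d) / 8)`.
-/
theorem eventually_initLaw_bad_le (K B : ℕ) (hK : 1 ≤ K) {ε : ℝ} (hε : 0 < ε) :
    ∀ᶠ d : ℕ in atTop, ∀ (u : Fin 2 → Vec d) (va : ℝ), (∀ l, ‖u l‖ = 1) →
      0 ≤ (inner ℝ (u 0) (u 1) : ℝ) → (inner ℝ (u 0) (u 1) : ℝ) ≤ logInv d ^ 60 →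
      InvPolylog K B d (numD d * va) →
      (initLaw (numD d) (numG d) d va).real {x | ¬ ∃ iw jv,
        GoodInit (initState x) u iw jv (logInv d) (smallPow d) ∨
        GoodInit (flip (initState x)) u iw jv (logInv d) (smallPow d)} ≤ ε := by
  obtain ⟨c, hc0, hc1, hc⟩ := exists_gaussian_lt_one
  have hC := sqVar_nonneg
  have hnumD : Tendsto numD atTop atTop := tendsto_nat_ceil_atTop.comp tendsto_log_natCast
  have hcm : Tendsto (fun d => c ^ numD d) atTop (𝓝 0) :=
    (tendsto_pow_atTop_nhds_zero_of_lt_one hc0 hc1).comp hnumD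
  have hexp : Tendsto (fun d : ℕ => Real.exp (-(Real.log (Real.log d) / 8))) atTop (𝓝 0) :=
    Real.tendsto_exp_neg_atTop_nhds_zero.comp
      (tendsto_log_log_natCast.atTop_div_const (by norm_num))
  have hlim : Tendsto (fun d : ℕ => (4 * sqVar + 12) * logInv d + 4 * c ^ numD d
      + 4 * Real.exp (-(Real.log (Real.log d) / 8))) atTop (𝓝 0) := by
    simpa using ((tendsto_logInv.const_mul (4 * sqVar + 12)).add (hcm.const_mul 4)).add
      (hexp.const_mul 4)
  filter_upwards [hlim.eventually (gt_mem_nhds hε), eventually_smallPow_le (B + 203),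
    eventually_logInv_pos, eventually_logInv_le (by norm_num : (0 : ℝ) < 1 / 1000),
    hcm.eventually (gt_mem_nhds (by norm_num : (0 : ℝ) < 1 / 4)), eventually_gt_atTop 0]
    with d hF hθ he0 he hc4 hd
  intro u va hu hγ0 hγ hva
  have hθ0 := smallPow_pos hd
  have hm1 := one_le_numD_mul he0
  have hm2 := numD_mul_le he0 (by linarith)
  have hM1 := numG_mul_le he0 (by linarith)
  have hMm := log_log_le_numG_div he0 (by linarith)
  have hd20 := smallPow_pow_twenty d
  have hd10 := smallPow_pow_ten d
  set e := logInv d with hed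
  set θ := smallPow d
  set m := numD d
  set M := numG d
  have hd' : (0 : ℝ) < d := by exact_mod_cast hd
  have he1 : e ≤ 1 := by linarith
  have hle : ∀ {i j : ℕ}, i ≤ j → e ^ j ≤ e ^ i := fun h => pow_le_pow_of_le_one he0.le he1 h
  have hm0 : (0 : ℝ) < m := by
    by_contra h
    have : (m : ℝ) * e ≤ 0 := mul_nonpos_of_nonpos_of_nonneg (not_lt.1 h) he0.le
    linarith
  have hmN : 0 < m := by exact_mod_cast hm0
  have hm1' : (1 : ℝ) ≤ m := by exact_mod_cast hmN
  have hθ20 : θ ≤ e ^ 20 := hθ.trans (hle (by omega))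
  have hθ1 : θ ≤ 1 := hθ20.trans (pow_le_one₀ he0.le he1)
  have hva1 : va ≤ e := by
    have h1 := hva.2
    have h2 : 1 / Real.log d ^ K = e ^ K := by rw [hed, logInv, div_pow, one_pow]
    rw [h2] at h1
    have h3 : e ^ K ≤ e := by simpa using hle hK
    by_cases hv : va ≤ 0
    · linarith
    · nlinarith
  have hva2 : e ^ (B + 2) ≤ va := by
    have h1 := hva.1
    have h2 : 1 / Real.log d ^ B = e ^ B := by rw [hed, logInv, div_pow, one_pow]
    rw [h2] at h1
    have h3 : 0 < va := by
      by_contra h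
      have := mul_nonpos_of_nonneg_of_nonpos hm0.le (not_lt.1 h)
      have := pow_pos he0 B
      linarith
    calc e ^ (B + 2) = e ^ B * (e * e) := by ring
      _ ≤ m * va * (e * e) := by gcongr
      _ = (m * e) * e * va := by ring
      _ ≤ 2 * e * va := by gcongr
      _ ≤ 1 * va := by gcongr; linarith
      _ = va := one_mul _
  have hva0 : 0 < va := lt_of_lt_of_le (by positivity) hva2
  have hsv : e ^ (B + 2) ≤ √va := by
    refine hva2.trans (Real.le_sqrt_of_sq_le ?_)
    nlinarith
  have hν := iid_no_strongChamp_le he0 m hc0 hc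
  set ν := (iid m).real {x | ¬ ∃ i, StrongChamp e x i}
  have hν1 : ν ≤ e + c ^ m := by
    have h1 : m * (4 * e ^ 4) ≤ 8 * e ^ 3 := by
      calc m * (4 * e ^ 4) = 4 * e ^ 3 * (m * e) := by ring
        _ ≤ 4 * e ^ 3 * 2 := by gcongr
        _ = _ := by ring
    have h2 : (m : ℝ) ^ 2 * (2 * e ^ 6) ≤ 8 * e ^ 4 := by
      calc (m : ℝ) ^ 2 * (2 * e ^ 6) = 2 * e ^ 4 * (m * e) ^ 2 := by ring
        _ ≤ 2 * e ^ 4 * 2 ^ 2 := by gcongr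
        _ = _ := by ring
    have h3 : e ^ 2 ≤ 1 / 1000 := (by simpa using hle (i := 1) (j := 2) (by norm_num) : e ^ 2 ≤ e).trans he
    nlinarith [pow_nonneg he0.le 3, pow_nonneg he0.le 2]
  have hmθ : m * θ ≤ 1 / 100 := by
    calc m * θ ≤ m * e ^ 20 := by gcongr
      _ = (m * e) * e ^ 19 := by ring
      _ ≤ 2 * e ^ 1 := mul_le_mul hm2 (hle (by norm_num)) (by positivity) (by norm_num)
      _ ≤ _ := by linarith
  have hsmall : (m : ℝ) * ((5 * (m * θ)) ^ 2 / (e ^ 6 / 2) ^ 2) ≤ 1 / (4 * m) := by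
    rw [le_div_iff₀ (by positivity)]
    calc (m : ℝ) * ((5 * (m * θ)) ^ 2 / (e ^ 6 / 2) ^ 2) * (4 * m)
        ≤ (m : ℝ) * ((5 * (m * e ^ 20)) ^ 2 / (e ^ 6 / 2) ^ 2) * (4 * m) := by gcongr
      _ = 400 * (m * e) ^ 4 * e ^ 24 := by field_simp; ring
      _ ≤ 400 * 2 ^ 4 * e ^ 2 := by
        gcongr 400 * ?_ ^ 4 * ?_
        exact hle (by norm_num)
      _ ≤ 1 := by nlinarith
  -- Each coordinate is a strong champion with probability `(1 - ν) / m ≥ 1 / (2 m)`; half of this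
  -- is given up for the perturbation, leaving `q = 1 / (4 m)`.
  have hbound := initLaw_bad_le (mG := M) (q := 1 / (4 * m)) he0 he hd hmN hθ0 hmθ hd10 hva0 hu hγ0
    (hγ.trans (hle (by norm_num)))
    (by rw [div_le_one (by positivity)]; linarith) (fun i => by
      have h1 := sum_iid_strongChamp (e := e) i
      have h2 : (iid m).real {x | StrongChamp e x i} = (1 - ν) / m := by
        rw [eq_div_iff hm0.ne', mul_comm]
        exact h1
      rw [h2]
      calc _ ≤ 1 / (4 * (m : ℝ)) + 1 / (4 * m) := by gcongr
        _ = (1 / 2) / m := by field_simp; norm_num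
        _ ≤ _ := by gcongr; linarith)
  refine hbound.trans (le_trans ?_ hF.le)
  have t1 : θ / e ^ 200 / √va ≤ e := by
    calc θ / e ^ 200 / √va ≤ e ^ (B + 203) / e ^ 200 / e ^ (B + 2) := by gcongr
      _ = e := by
        rw [div_div, ← pow_add, div_eq_iff (by positivity), ← pow_succ']
        congr 1
        omega
  have hinv : (d : ℝ)⁻¹ = θ ^ 20 := hd20.symm
  have t2 : (m : ℝ) ^ 2 * ((sqVar + 2) / (d * θ ^ 2)) ≤ (sqVar + 2) * e := by
    have h1 : (sqVar + 2) / (d * θ ^ 2) = (sqVar + 2) * θ ^ 18 := by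
      rw [div_eq_mul_inv, mul_inv, hinv]
      field_simp
    calc (m : ℝ) ^ 2 * ((sqVar + 2) / (d * θ ^ 2)) = (sqVar + 2) * (m ^ 2 * θ ^ 18) := by
          rw [h1]; ring
      _ ≤ (sqVar + 2) * (m ^ 2 * e ^ 20) := by
          gcongr
          calc θ ^ 18 ≤ θ ^ 1 := pow_le_pow_of_le_one hθ0.le hθ1 (by norm_num)
            _ ≤ _ := by rw [pow_one]; exact hθ20
      _ = (sqVar + 2) * ((m * e) ^ 2 * e ^ 17 * e) := by ring
      _ ≤ (sqVar + 2) * (1 * e) := by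
          gcongr
          calc (m * e) ^ 2 * e ^ 17 ≤ 2 ^ 2 * e ^ 1 :=
                mul_le_mul (by gcongr) (hle (by norm_num)) (by positivity) (by norm_num)
            _ ≤ 1 := by linarith
      _ = _ := by ring
  have t3 : (M : ℝ) * (sqVar / d) ≤ sqVar * e := by
    have h1 : θ ^ 20 ≤ e ^ 20 :=
      (pow_le_of_le_one hθ0.le hθ1 (by norm_num)).trans hθ20
    calc (M : ℝ) * (sqVar / d) = sqVar * (M * θ ^ 20) := by rw [div_eq_mul_inv, hinv]; ring
      _ ≤ sqVar * (M * e ^ 20) := by gcongr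
      _ = sqVar * ((M * e ^ 2) * e ^ 18) := by ring
      _ ≤ sqVar * (1 * e) := by
          refine mul_le_mul_of_nonneg_left (mul_le_mul hM1 ?_ (by positivity) (by norm_num)) hC
          exact pow_le_of_le_one he0.le he1 (by norm_num)
      _ = _ := by ring
  have t4 : 1 / (m : ℝ) ≤ e := by
    rw [div_le_iff₀ hm0]; linarith
  have t5 : (1 - 1 / (4 * (m : ℝ))) ^ M ≤ Real.exp (-(Real.log (Real.log d) / 8)) := by
    refine (one_sub_one_div_pow_le (by linarith) M).trans ?_
    rw [Real.exp_le_exp, neg_le_neg_iff, le_div_iff₀ (by positivity)]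
    exact hMm
  linarith

/-! ### Empirical frequencies of independent samples -/

section Frequencies
variable {Ω : Type*}

/-- The number of visits to `A` before time `t`. -/
def hitSum (A : Set Ω) (ω : ℕ → Ω) (t : ℕ) : ℝ :=
  ∑ i ∈ Finset.range t, A.indicator (fun _ => (1 : ℝ)) (ω i)

theorem count_eq_hitSum {A : Set Ω} {ω : ℕ → Ω} {p : ℕ → Prop} [DecidablePred p]
    (h : ∀ i, p i ↔ ω i ∈ A) (t : ℕ) : (Nat.count p t : ℝ) = hitSum A ω t := by
  induction t with
  | zero => simp [hitSum]
  | succ t ih =>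
    rw [Nat.count_succ, hitSum, Finset.sum_range_succ, ← hitSum, ← ih]
    push_cast
    by_cases ht : p t
    · rw [if_pos ht, Set.indicator_of_mem ((h t).1 ht)]
    · rw [if_neg ht, Set.indicator_of_notMem (fun hh => ht ((h t).2 hh))]

theorem hitSum_mono (A : Set Ω) (ω : ℕ → Ω) {s t : ℕ} (h : s ≤ t) : hitSum A ω s ≤ hitSum A ω t :=
  Finset.sum_le_sum_of_subset_of_nonneg (Finset.range_mono h) fun _ _ _ =>
    Set.indicator_nonneg (fun _ _ => zero_le_one) _

variable [MeasurableSpace Ω]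

theorem hitSum_dev_le (μ : Measure Ω) [IsProbabilityMeasure μ] {A : Set Ω} (hA : MeasurableSet A)
    (t : ℕ) {r : ℝ} (hr : 0 < r) :
    (Measure.infinitePi fun _ : ℕ => μ).real {ω | r ≤ |hitSum A ω t - t * μ.real A|}
      ≤ t / r ^ 2 := by
  set P := Measure.infinitePi fun _ : ℕ => μ with hP
  set X : ℕ → (ℕ → Ω) → ℝ := fun i ω => A.indicator (fun _ => (1 : ℝ)) (ω i) with hX
  have hm : Measurable (A.indicator fun _ => (1 : ℝ)) := measurable_const.indicator hA
  have hmX : ∀ i, Measurable (X i) := fun i => hm.comp (measurable_pi_apply i)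
  have hb : ∀ i ω, X i ω ∈ Set.Icc (0 : ℝ) 1 := fun i ω =>
    ⟨Set.indicator_nonneg (fun _ _ => zero_le_one) _,
      Set.indicator_le_self' (fun _ _ => zero_le_one) _⟩
  have hL : ∀ i, MemLp (X i) 2 P := fun i =>
    memLp_of_bounded (ae_of_all _ fun ω => hb i ω) (hmX i).aestronglyMeasurable 2
  have hmean : ∀ i, ∫ ω, X i ω ∂P = μ.real A := fun i => by
    have h := measurePreserving_eval_infinitePi (fun _ : ℕ => μ) i
    have h1 : ∫ ω, X i ω ∂P = ∫ x, A.indicator (fun _ => (1 : ℝ)) x ∂μ := by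
      rw [← h.map_eq, integral_map (measurable_pi_apply i).aemeasurable hm.aestronglyMeasurable]
    rw [h1, integral_indicator hA]
    simp
  have hsum : hitSum A = fun ω t => (∑ i ∈ Finset.range t, X i) ω := by
    ext ω t
    simp [hitSum, hX]
  have hvar : Var[∑ i ∈ Finset.range t, X i; P] ≤ t := by
    have hind : iIndepFun X P := iIndepFun_infinitePi (fun _ => hm)
    rw [IndepFun.variance_sum (fun i _ => hL i) fun i _ j _ hij => hind.indepFun hij]
    calc _ ≤ ∑ _i ∈ Finset.range t, (1 : ℝ) := by
          refine Finset.sum_le_sum fun i _ => ?_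
          refine (variance_le_sq_of_bounded (ae_of_all _ (hb i)) (hmX i).aemeasurable).trans ?_
          norm_num
      _ = t := by simp
  have hint : ∫ ω, (∑ i ∈ Finset.range t, X i) ω ∂P = t * μ.real A := by
    simp only [Finset.sum_apply]
    rw [integral_finset_sum _ fun i _ => (hL i).integrable (by norm_num)]
    simp [hmean]
  have h := meas_ge_le_variance_div_sq (memLp_finset_sum' _ fun i _ => hL i : MemLp
    (∑ i ∈ Finset.range t, X i) 2 P) hr
  rw [hint] at h
  refine ENNReal.toReal_le_of_le_ofReal (by positivity) ?_
  simp only [hsum]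
  refine h.trans (ENNReal.ofReal_le_ofReal ?_)
  gcongr

/-- Chebyshev's inequality is used only at multiples of `n`. Between grid points the count is
monotone and its mean changes by at most `n`, so the deviation at most doubles. -/
theorem prefix_dev_le (μ : Measure Ω) [IsProbabilityMeasure μ] {A : Set Ω} (hA : MeasurableSet A)
    (T : ℕ) {n : ℕ} (hn : 0 < n) :
    (Measure.infinitePi fun _ : ℕ => μ).real
        {ω | ¬ ∀ t ≤ T, |hitSum A ω t - t * μ.real A| ≤ 2 * n}
      ≤ (T / n + 2) * ((T + n) / n ^ 2) := by
  have hn' : (0 : ℝ) < n := by exact_mod_cast hn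
  have hp0 : 0 ≤ μ.real A := measureReal_nonneg
  have hp1 : μ.real A ≤ 1 := measureReal_le_one
  have hsub : {ω : ℕ → Ω | ¬ ∀ t ≤ T, |hitSum A ω t - t * μ.real A| ≤ 2 * n} ⊆
      ⋃ k ∈ Finset.range (T / n + 2),
        {ω | (n : ℝ) ≤ |hitSum A ω (k * n) - (k * n : ℕ) * μ.real A|} := by
    intro ω hω
    by_contra hcon
    simp only [Set.mem_iUnion, Set.mem_setOf_eq, not_exists, not_le, Finset.mem_range] at hcon
    refine hω fun t ht => ?_
    have hdiv : t / n ≤ T / n := Nat.div_le_div_right ht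
    have h1 := abs_lt.1 (hcon (t / n) (by omega))
    have h2 := abs_lt.1 (hcon (t / n + 1) (by omega))
    have hlt : t / n * n ≤ t := Nat.div_mul_le_self t n
    have hgt : t ≤ (t / n + 1) * n := by
      have := Nat.lt_div_mul_add (a := t) hn
      rw [add_mul, one_mul]
      exact this.le
    have m1 := hitSum_mono A ω hlt
    have m2 := hitSum_mono A ω hgt
    have c1 : ((t / n * n : ℕ) : ℝ) ≤ t := by exact_mod_cast hlt
    have c2 : (t : ℝ) ≤ ((t / n + 1) * n : ℕ) := by exact_mod_cast hgt
    have c3 : (((t / n + 1) * n : ℕ) : ℝ) = (t / n * n : ℕ) + n := by push_cast; ring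
    rw [abs_le]
    constructor <;> nlinarith
  refine (measureReal_mono hsub (measure_ne_top _ _)).trans
    ((measureReal_biUnion_finset_le _ _).trans ?_)
  calc _ ≤ ∑ _k ∈ Finset.range (T / n + 2), (T + n) / (n : ℝ) ^ 2 := by
        refine Finset.sum_le_sum fun k hk => (hitSum_dev_le μ hA _ hn').trans ?_
        have h1 : k * n ≤ T + n := by
          have : k ≤ T / n + 1 := by
            have := Finset.mem_range.1 hk
            omega
          calc k * n ≤ (T / n + 1) * n := Nat.mul_le_mul_right _ this
            _ = T / n * n + n := by ring
            _ ≤ T + n := by gcongr; exact Nat.div_mul_le_self T n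
        have h2 : ((k * n : ℕ) : ℝ) ≤ T + n := by exact_mod_cast h1
        gcongr
    _ = ((T / n : ℕ) + 2 : ℝ) * ((T + n) / n ^ 2) := by simp
    _ ≤ _ := by
        gcongr
        exact Nat.cast_div_le

end Frequencies

/-! ### The training samples are good with high probability -/

section Samples
variable {m : ℕ} (ps : PMF (Fin 2 → Bool)) (pz : PMF (Fin m → Bool))

/-- The law of one training sample. -/
def sampleLaw : Measure ((Fin 2 → Bool) × (Fin m → Bool)) := ps.toMeasure.prod pz.toMeasure

instance : IsProbabilityMeasure (sampleLaw ps pz) := by unfold sampleLaw; infer_instance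

theorem measurableSet_of_finite {α : Type*} [Finite α] [MeasurableSpace α]
    [MeasurableSingletonClass α] (s : Set α) : MeasurableSet s := (Set.toFinite s).measurableSet

theorem sampleLaw_fst (s : Set (Fin 2 → Bool)) :
    (sampleLaw ps pz).real {x | x.1 ∈ s} = ps.toMeasure.real s := by
  have : {x : (Fin 2 → Bool) × (Fin m → Bool) | x.1 ∈ s} = s ×ˢ Set.univ := by ext; simp
  rw [this, sampleLaw, measureReal_prod_prod, probReal_univ, mul_one]

theorem sampleLaw_snd (s : Set (Fin m → Bool)) :
    (sampleLaw ps pz).real {x | x.2 ∈ s} = pz.toMeasure.real s := by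
  have : {x : (Fin 2 → Bool) × (Fin m → Bool) | x.2 ∈ s} = Set.univ ×ˢ s := by ext; simp
  rw [this, sampleLaw, measureReal_prod_prod, probReal_univ, one_mul]

theorem toMeasure_real_singleton {α : Type*} [MeasurableSpace α] [MeasurableSingletonClass α]
    (p : PMF α) (x : α) : p.toMeasure.real {x} = (p x).toReal := by
  rw [measureReal_def, PMF.toMeasure_apply_singleton _ _ (measurableSet_singleton x)]

theorem le_mode_prob {d : ℕ} {p₀ γ : ℝ} {u : Fin 2 → Vec d} {ps : PMF (Fin 2 → Bool)}
    (h : DataStructure p₀ γ u ps) (l : Fin 2) :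
    p₀ ≤ ps.toMeasure.real {s | modeOf s = some l} := by
  have key : ∀ s, modeOf s = some l → p₀ ≤ (ps s).toReal →
      p₀ ≤ ps.toMeasure.real {s | modeOf s = some l} := fun s hs hp => by
    rw [← toMeasure_real_singleton] at hp
    exact hp.trans (measureReal_mono (Set.singleton_subset_iff.2 hs))
  fin_cases l
  · exact key _ (by simp [modeOf]) h.2.1
  · exact key _ (by simp [modeOf]) h.2.2.1

theorem no_mode_prob_le {d : ℕ} {p₀ γ : ℝ} {u : Fin 2 → Vec d} {ps : PMF (Fin 2 → Bool)}
    (h : DataStructure p₀ γ u ps) (hγ : 0 ≤ γ) :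
    ps.toMeasure.real {s | modeOf s = none} ≤ 2 * γ := by
  have hsub : {s : Fin 2 → Bool | modeOf s = none}
      ⊆ {![true, true]} ∪ {![false, false]} := by
    intro s hs
    have hs' : s = ![s 0, s 1] := by ext i; fin_cases i <;> rfl
    rw [Set.mem_setOf_eq, hs'] at hs
    rw [hs']
    revert hs
    cases s 0 <;> cases s 1 <;> simp [modeOf]
  refine (measureReal_mono hsub).trans ((measureReal_union_le _ _).trans ?_)
  rw [toMeasure_real_singleton, toMeasure_real_singleton]
  rcases h.2.2.2 with ⟨-, h1, h2⟩ | ⟨-, h1, h2⟩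
  · rw [h1, h2]
    simpa using hγ
  · linarith

/-- A vector with `z j` active that is not solo has a second active coordinate; the union bound over
it costs a factor `m`, against `1 / m ^ 2` in the pair probabilities. -/
theorem pair_prob_le {K B d : ℕ} {c₁ c₂ : ℝ} {pz : PMF (Fin m → Bool)}
    (h : LatentStructure K B d c₁ c₂ pz) (hd : 0 < logInv d) (j : Fin m) :
    pz.toMeasure.real {z | z j = true ∧ z ≠ soloVec j} ≤ logInv d ^ K := by
  have hm : (1 : ℝ) ≤ m := by exact_mod_cast j.pos
  have hsub : {z : Fin m → Bool | z j = true ∧ z ≠ soloVec j}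
      ⊆ ⋃ i, {z | i ≠ j ∧ z i = true ∧ z j = true} := by
    rintro z ⟨h1, h2⟩
    by_contra hcon
    simp only [Set.mem_iUnion, Set.mem_setOf_eq, not_exists, not_and] at hcon
    refine h2 (funext fun i => ?_)
    by_cases hi : i = j
    · subst hi
      simp [soloVec, h1]
    · have := fun hz => hcon i hi hz h1
      simp [soloVec, hi, Bool.eq_false_iff.2 this]
  have hK : 1 / Real.log d ^ K = logInv d ^ K := by rw [logInv, div_pow, one_pow]
  refine (measureReal_mono hsub).trans ((measureReal_iUnion_fintype_le _).trans ?_)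
  calc _ ≤ ∑ _i : Fin m, logInv d ^ K / m ^ 2 := by
        refine Finset.sum_le_sum fun i _ => ?_
        by_cases hi : i = j
        · simp only [hi, ne_eq, not_true_eq_false, false_and, Set.setOf_false,
            measureReal_empty]
          positivity
        · have h1 := (h.2.2 i j hi).2
          rw [hK] at h1
          rw [le_div_iff₀ (by positivity), mul_comm]
          refine le_trans ?_ h1
          exact mul_le_mul_of_nonneg_left (measureReal_mono fun z hz => hz.2) (by positivity)
    _ = logInv d ^ K / m := by
        rw [Finset.sum_const, Finset.card_univ, Fintype.card_fin, nsmul_eq_mul]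
        field_simp
    _ ≤ logInv d ^ K := div_le_self (by positivity) hm

theorem le_solo_prob {K B d : ℕ} {c₁ c₂ : ℝ} {pz : PMF (Fin m → Bool)}
    (h : LatentStructure K B d c₁ c₂ pz) (hd : 0 < logInv d) (j : Fin m) :
    c₁ / m - logInv d ^ K ≤ pz.toMeasure.real {z | z = soloVec j} := by
  have hsub : {z : Fin m → Bool | z j = true}
      ⊆ {z | z = soloVec j} ∪ {z | z j = true ∧ z ≠ soloVec j} := by
    intro z hz
    by_cases h : z = soloVec j
    · exact Or.inl h
    · exact Or.inr ⟨hz, h⟩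
  have h1 := (measureReal_mono (μ := pz.toMeasure) hsub).trans (measureReal_union_le _ _)
  have h2 := pair_prob_le h hd j
  have h3 := (h.2.1 j).1
  linarith

/-- The events whose frequencies are controlled. -/
def sampleEvent (m : ℕ) :
    Option (Fin 2) ⊕ (Fin m ⊕ Fin m) → Set ((Fin 2 → Bool) × (Fin m → Bool))
  | .inl o => {x | modeOf x.1 = o}
  | .inr (.inl j) => {x | x.2 = soloVec j}
  | .inr (.inr j) => {x | x.2 j = true ∧ x.2 ≠ soloVec j}

theorem exists_event_dev_le (T : ℕ) {n : ℕ} (hn : 0 < n) :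
    (Measure.infinitePi fun _ : ℕ => sampleLaw ps pz).real
        {ω | ¬ ∀ i, ∀ t ≤ T, |hitSum (sampleEvent m i) ω t
          - t * (sampleLaw ps pz).real (sampleEvent m i)| ≤ 2 * n}
      ≤ (3 + 2 * m) * ((T / n + 2) * ((T + n) / n ^ 2)) := by
  have hset : {ω | ¬ ∀ i, ∀ t ≤ T, |hitSum (sampleEvent m i) ω t
          - t * (sampleLaw ps pz).real (sampleEvent m i)| ≤ 2 * n}
      = ⋃ i, {ω | ¬ ∀ t ≤ T, |hitSum (sampleEvent m i) ω t
          - t * (sampleLaw ps pz).real (sampleEvent m i)| ≤ 2 * n} := by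
    ext ω
    simp only [Set.mem_setOf_eq, Set.mem_iUnion, not_forall]
  rw [hset]
  refine (measureReal_iUnion_fintype_le _).trans ?_
  calc _ ≤ ∑ _i : Option (Fin 2) ⊕ (Fin m ⊕ Fin m),
        ((T / n + 2) * ((T + n) / n ^ 2) : ℝ) := Finset.sum_le_sum fun i _ =>
          prefix_dev_le _ (measurableSet_of_finite _) T hn
    _ = _ := by
        rw [Finset.sum_const, nsmul_eq_mul]
        congr 1
        simp only [Finset.card_univ, Fintype.card_sum, Fintype.card_option, Fintype.card_fin]
        push_cast
        ring

variable {ps pz} in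
-- Deviations of `2 n` explain the `2 * n` in the conclusion; correspondingly, `spacing` has a
-- factor two in its denominator.
theorem goodSamples_of_dev {e cp ρ₁ : ℝ} {n T T₂ : ℕ}
    {ω : ℕ → (Fin 2 → Bool) × (Fin m → Bool)}
    (hdev : ∀ i, ∀ t ≤ T, |hitSum (sampleEvent m i) ω t
          - t * (sampleLaw ps pz).real (sampleEvent m i)| ≤ 2 * n)
    (hmode : ∀ l, cp ≤ ps.toMeasure.real {s | modeOf s = some l})
    (hnone : ps.toMeasure.real {s | modeOf s = none} ≤ e ^ 60)
    (hsolo : ∀ j, e ^ 3 ≤ pz.toMeasure.real {z | z = soloVec j})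
    (hpair : ∀ j, pz.toMeasure.real {z | z j = true ∧ z ≠ soloVec j} ≤ e ^ 60)
    (hρ0 : 0 ≤ ρ₁) (hρ1 : ρ₁ ≤ 1) (hT₂ : T₂ ≤ ρ₁ / 2 * T) (hn : 8 * n ≤ ρ₁ * e ^ 3 * T) :
    GoodSamples (fun t => modeOf (ω t).1) (fun t => (ω t).2) e cp ρ₁ (2 * n) T T₂ := by
  have hT : T₂ ≤ T := by
    have h1 : (T₂ : ℝ) ≤ T := by nlinarith [Nat.cast_nonneg (α := ℝ) T]
    exact_mod_cast h1
  have e1 : ∀ o, (sampleLaw ps pz).real (sampleEvent m (.inl o))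
      = ps.toMeasure.real {s | modeOf s = o} := fun o => sampleLaw_fst ps pz {s | modeOf s = o}
  have e2 : ∀ j, (sampleLaw ps pz).real (sampleEvent m (.inr (.inl j)))
      = pz.toMeasure.real {z | z = soloVec j} := fun j => sampleLaw_snd ps pz {z | z = soloVec j}
  have e3 : ∀ j, (sampleLaw ps pz).real (sampleEvent m (.inr (.inr j)))
      = pz.toMeasure.real {z | z j = true ∧ z ≠ soloVec j} :=
    fun j => sampleLaw_snd ps pz {z | z j = true ∧ z ≠ soloVec j}
  have c1 : ∀ o t, (Nat.count (fun i => modeOf (ω i).1 = o) t : ℝ)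
      = hitSum (sampleEvent m (.inl o)) ω t := fun o t =>
    count_eq_hitSum (p := fun i => modeOf (ω i).1 = o) (fun _ => Iff.rfl) t
  have c2 : ∀ j t, (Nat.count (fun i => (ω i).2 = soloVec j) t : ℝ)
      = hitSum (sampleEvent m (.inr (.inl j))) ω t :=
    fun j t =>
    count_eq_hitSum (p := fun i => (ω i).2 = soloVec j) (fun _ => Iff.rfl) t
  have c3 : ∀ j t, (Nat.count (fun i => (ω i).2 j = true ∧ (ω i).2 ≠ soloVec j) t : ℝ)
      = hitSum (sampleEvent m (.inr (.inr j))) ω t :=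
    fun j t =>
    count_eq_hitSum (p := fun i => (ω i).2 j = true ∧ (ω i).2 ≠ soloVec j) (fun _ => Iff.rfl) t
  constructor
  · intro t ht l
    have h := (abs_le.1 (hdev (.inl (some l)) t ht)).1
    rw [e1, ← c1] at h
    have h2 := mul_le_mul_of_nonneg_left (hmode l) (Nat.cast_nonneg (α := ℝ) t)
    push_cast
    linarith
  · intro t ht
    have h := (abs_le.1 (hdev (.inl none) t ht)).2
    rw [e1, ← c1] at h
    have h2 := mul_le_mul_of_nonneg_left hnone (Nat.cast_nonneg (α := ℝ) t)
    push_cast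
    linarith
  · intro t ht j
    have h := (abs_le.1 (hdev (.inr (.inl j)) t ht)).1
    rw [e2, ← c2] at h
    have h2 := mul_le_mul_of_nonneg_left (hsolo j) (Nat.cast_nonneg (α := ℝ) t)
    push_cast
    linarith
  · intro t ht j
    have h := (abs_le.1 (hdev (.inr (.inr j)) t ht)).2
    rw [e3, ← c3] at h
    have h2 := mul_le_mul_of_nonneg_left (hpair j) (Nat.cast_nonneg (α := ℝ) t)
    push_cast
    linarith
  -- Since `T₂ ≤ ρ₁ T / 2`, an expected count of `ρ₁ T p / 2` is left over, and `hn` makes it pay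
  -- for the deviations at both times.
  · intro j
    have h := (abs_le.1 (hdev (.inr (.inl j)) T₂ hT)).2
    have h' := (abs_le.1 (hdev (.inr (.inl j)) T le_rfl)).1
    rw [e2, ← c2] at h h'
    set p := pz.toMeasure.real {z | z = soloVec j}
    have hp0 : 0 ≤ p := measureReal_nonneg
    have h1 : T₂ * p ≤ ρ₁ / 2 * T * p := mul_le_mul_of_nonneg_right hT₂ hp0
    have h2 : ρ₁ * T * e ^ 3 ≤ ρ₁ * T * p :=
      mul_le_mul_of_nonneg_left (hsolo j) (by positivity)
    have h3 := mul_le_mul_of_nonneg_left h' hρ0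
    have h4 : ρ₁ * (2 * n) ≤ 2 * n := by nlinarith [Nat.cast_nonneg (α := ℝ) n]
    nlinarith

end Samples

/-! ### The choice of the time scales -/

/-- The rescaled training time `(log log d) ^ (1/8)`. -/
def horizon (d : ℕ) : ℝ := Real.log (Real.log d) ^ (1 / 8 : ℝ)

theorem tendsto_horizon : Tendsto horizon atTop atTop :=
  (tendsto_rpow_atTop (by norm_num)).comp tendsto_log_log_natCast

theorem horizon_pow {d : ℕ} (h : 0 ≤ Real.log (Real.log d)) :
    horizon d ^ 8 = Real.log (1 / logInv d) := by
  rw [horizon, ← Real.rpow_natCast, ← Real.rpow_mul h, logInv, one_div_one_div]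
  norm_num

/-- The number of training steps. -/
def numSteps (τ η : ℝ) : ℕ := ⌈τ / η⌉₊

/-- The length of the initial stage of the training. -/
def numEarly (ρ τ η : ℝ) : ℕ := ⌈ρ / 4 * numSteps τ η⌉₊

/-- The spacing of the times at which the frequencies are controlled. -/
def spacing (θ η : ℝ) : ℕ := ⌊θ ^ 30 / (2 * η)⌋₊

section Times
variable {τ η ρ θ : ℝ}

theorem le_mul_numSteps (hη : 0 < η) : τ ≤ η * numSteps τ η := by
  have := Nat.le_ceil (τ / η)
  rwa [div_le_iff₀' hη] at this

theorem mul_numSteps_le (hη : 0 < η) (hη1 : η ≤ 1) (hτ : 0 ≤ τ) :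
    η * numSteps τ η ≤ τ + 1 := by
  have h := (Nat.ceil_lt_add_one (div_nonneg hτ hη.le)).le
  calc η * numSteps τ η ≤ η * (τ / η + 1) := by gcongr; exact h
    _ = τ + η := by field_simp
    _ ≤ _ := by linarith

theorem le_mul_numEarly (hη : 0 < η) (hρ : 0 < ρ) : ρ / 4 * τ ≤ η * numEarly ρ τ η := by
  calc ρ / 4 * τ ≤ ρ / 4 * (η * numSteps τ η) := by gcongr; exact le_mul_numSteps hη
    _ = η * (ρ / 4 * numSteps τ η) := by ring
    _ ≤ _ := by gcongr; exact Nat.le_ceil _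

theorem numEarly_le (hη : 0 < η) (hρ : 0 < ρ) (h : 4 * η ≤ ρ * τ) :
    (numEarly ρ τ η : ℝ) ≤ ρ / 2 * numSteps τ η := by
  have h1 := (Nat.ceil_lt_add_one (a := ρ / 4 * (numSteps τ η : ℝ)) (by positivity)).le
  have h2 := le_mul_numSteps (τ := τ) hη
  have h3 : 1 ≤ ρ / 4 * (numSteps τ η : ℝ) := by
    have h4 : η * 4 ≤ η * (ρ * numSteps τ η) := by nlinarith
    have := le_of_mul_le_mul_left h4 hη
    linarith
  unfold numEarly
  linarith

theorem mul_spacing_le (hη : 0 < η) (hθ : 0 < θ) : η * spacing θ η ≤ θ ^ 30 / 2 := by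
  have := Nat.floor_le (a := θ ^ 30 / (2 * η)) (by positivity)
  calc η * spacing θ η ≤ η * (θ ^ 30 / (2 * η)) := by gcongr; exact this
    _ = _ := by field_simp

theorem le_mul_spacing (hη : 0 < η) (h : 4 * η ≤ θ ^ 30) : θ ^ 30 / 4 ≤ η * spacing θ η := by
  have h1 := (Nat.lt_floor_add_one (θ ^ 30 / (2 * η))).le
  have h2 : η * (θ ^ 30 / (2 * η)) ≤ η * (spacing θ η + 1) := by gcongr; exact h1
  have h3 : η * (θ ^ 30 / (2 * η)) = θ ^ 30 / 2 := by field_simp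
  linarith

/-- With `η T` polylogarithmic and `η n ≥ θ ^ 31`, the expression is at most `η / θ ^ 97`. Crude
second moment bounds thus suffice because `η ≤ θ ^ 200`. -/
theorem deviation_bound_le {e M : ℝ} (he0 : 0 < e) (he : e ≤ 1 / 1000) (hθ0 : 0 < θ)
    (hθ : θ ≤ e ^ 300) (hη0 : 0 < η) (hη : η ≤ θ ^ 200) (hτ : 0 ≤ τ) (hτe : e * (2 + τ) ≤ 1)
    (hM0 : 0 ≤ M) (hM : M * e ^ 2 ≤ 1) :
    (3 + 2 * M) * ((numSteps τ η / spacing θ η + 2) *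
      ((numSteps τ η + spacing θ η) / (spacing θ η : ℝ) ^ 2)) ≤ θ := by
  have he1 : e ≤ 1 := by linarith
  have hθe : θ ≤ e ^ 3 := hθ.trans (pow_le_pow_of_le_one he0.le he1 (by norm_num))
  have hθ1 : θ ≤ 1 := hθe.trans (pow_le_one₀ he0.le he1)
  have hθs : θ ≤ 1 / 1000 := hθe.trans ((pow_le_of_le_one he0.le he1 (by norm_num)).trans he)
  have hη1 : η ≤ 1 := hη.trans (pow_le_one₀ hθ0.le hθ1)
  have h4 : 4 * η ≤ θ ^ 30 := by
    calc 4 * η ≤ 4 * θ ^ 200 := by gcongr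
      _ = 4 * θ ^ 170 * θ ^ 30 := by ring
      _ ≤ 4 * θ * θ ^ 30 := by
        gcongr
        exact pow_le_of_le_one hθ0.le hθ1 (by norm_num)
      _ ≤ 1 * θ ^ 30 := by gcongr; linarith
      _ = _ := one_mul _
  have hx := mul_numSteps_le hη0 hη1 hτ
  have hy := le_mul_spacing hη0 h4
  have hy2 := mul_spacing_le hη0 hθ0
  set T : ℝ := (numSteps τ η : ℝ)
  set n : ℝ := (spacing θ η : ℝ)
  have hT0 : 0 ≤ T := Nat.cast_nonneg _
  have hn0 : 0 < n := by
    by_contra h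
    have h1 := mul_nonpos_of_nonneg_of_nonpos hη0.le (not_lt.1 h)
    have := pow_pos hθ0 30
    linarith
  have hy3 : θ ^ 31 ≤ η * n := by
    calc θ ^ 31 = θ ^ 30 * θ := by ring
      _ ≤ θ ^ 30 * (1 / 4) := by gcongr; linarith
      _ ≤ _ := by linarith
  have hθx : θ * (η * T) ≤ e ^ 2 := by
    calc θ * (η * T) ≤ e ^ 3 * (τ + 1) := by gcongr
      _ = e ^ 2 * (e * (τ + 1)) := by ring
      _ ≤ e ^ 2 * 1 := by gcongr; linarith
      _ = _ := mul_one _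
  have he2 : e ^ 2 ≤ 1 / 1000 := (pow_le_of_le_one he0.le he1 (by norm_num)).trans he
  have b1 : T / n + 2 ≤ 1 / θ ^ 33 := by
    have h1 : T / n = (η * T) / (η * n) := by field_simp
    rw [h1, le_div_iff₀ (by positivity)]
    calc ((η * T) / (η * n) + 2) * θ ^ 33 ≤ ((η * T) / θ ^ 31 + 2) * θ ^ 33 := by gcongr
      _ = θ * (θ * (η * T)) + 2 * θ ^ 33 := by field_simp
      _ ≤ 1 * e ^ 2 + 2 * θ := by
        gcongr
        exact pow_le_of_le_one hθ0.le hθ1 (by norm_num)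
      _ ≤ 1 := by linarith
  have b2 : (T + n) / n ^ 2 ≤ η / θ ^ 63 := by
    have h1 : (T + n) / n ^ 2 = η * ((η * T + η * n) / (η * n) ^ 2) := by field_simp
    rw [h1, div_eq_mul_one_div η (θ ^ 63)]
    refine mul_le_mul_of_nonneg_left ?_ hη0.le
    rw [le_div_iff₀ (by positivity)]
    calc (η * T + η * n) / (η * n) ^ 2 * θ ^ 63
        ≤ (η * T + θ ^ 30 / 2) / (θ ^ 31) ^ 2 * θ ^ 63 := by gcongr
      _ = θ * (η * T) + θ * θ ^ 30 / 2 := by field_simp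
      _ ≤ e ^ 2 + θ * 1 / 2 := by gcongr; exact pow_le_one₀ hθ0.le hθ1
      _ ≤ 1 := by linarith
  have b3 : 3 + 2 * M ≤ 1 / θ := by
    rw [le_div_iff₀ hθ0]
    calc (3 + 2 * M) * θ ≤ (3 + 2 * M) * e ^ 3 := by gcongr
      _ = e * (3 * e ^ 2 + 2 * (M * e ^ 2)) := by ring
      _ ≤ e * (3 * 1 + 2 * 1) := by gcongr; linarith
      _ ≤ 1 := by linarith
  calc (3 + 2 * M) * ((T / n + 2) * ((T + n) / n ^ 2))
      ≤ (1 / θ) * ((1 / θ ^ 33) * (η / θ ^ 63)) := by gcongr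
    _ = η / θ ^ 97 := by field_simp
    _ ≤ θ ^ 200 / θ ^ 97 := by gcongr
    _ = θ ^ 102 * θ := by field_simp
    _ ≤ 1 * θ := by gcongr; exact pow_le_one₀ hθ0.le hθ1
    _ = θ := one_mul θ

end Times

theorem truncLevel_eq (d : ℕ) (hd : 0 < d) : truncLevel d * smallPow d ^ 4 = 1 := by
  have hd' : (0 : ℝ) < d := by exact_mod_cast hd
  rw [smallPow_pow, truncLevel, ← Real.rpow_add hd']
  norm_num

set_option maxHeartbeats 1000000 in
-- The decisive requirement is `2 (2 + τ) ^ 4 + 2 ≤ log (1 / e) = τ ^ 8`, which holds for `τ ≥ 3`.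
-- The remaining ones compare powers of `e` and `θ`.
theorem exists_scale {d B : ℕ} {lam η ηG τ cp ρ ρ₁ : ℝ} (hd : 0 < d) (he0 : 0 < logInv d)
    (he : logInv d ≤ 1 / 1000) (hcp : logInv d ≤ cp) (hcp1 : cp ≤ 1) (heρ : logInv d ≤ ρ₁)
    (hρ₁ : ρ₁ ≤ 1) (hρ0 : 0 < ρ) (hθ : smallPow d ≤ logInv d ^ (B + 300)) (hτ : 3 ≤ τ)
    (hτ8 : τ ^ 8 = Real.log (1 / logInv d)) (hρτ : 4 / ρ + 1 ≤ cp * (ρ₁ / 4 * τ) / 2)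
    (hη0 : 0 < η) (hη : η ≤ smallPow d ^ 200) (hηG : logInv d ^ B ≤ ηG / η)
    (hηG' : ηG / η ≤ logInv d ^ 60) (hlam0 : 0 ≤ lam) (hlam : √d * lam ≤ 1) :
    Scale (numD d) (numG d) d lam η ηG (logInv d) (smallPow d) cp ρ (2 * spacing (smallPow d) η)
      (numSteps τ η) (numEarly ρ₁ τ η) ∧ logInv d * (2 + τ) ≤ 1 ∧
      8 * (spacing (smallPow d) η : ℝ) ≤ ρ₁ * logInv d ^ 3 * numSteps τ η ∧
      (numEarly ρ₁ τ η : ℝ) ≤ ρ₁ / 2 * numSteps τ η := by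
  have hθ0 := smallPow_pos hd
  have hd10 := smallPow_pow_ten d
  have htr := truncLevel_eq d hd
  have hmD := numD_mul_le he0 (by linarith)
  have hmG := numG_mul_le he0 (by linarith)
  set e := logInv d
  set θ := smallPow d
  have hd' : (0 : ℝ) < d := by exact_mod_cast hd
  have he1 : e ≤ 1 := by linarith
  have hle : ∀ {i j : ℕ}, i ≤ j → e ^ j ≤ e ^ i := fun h => pow_le_pow_of_le_one he0.le he1 h
  have hθn : ∀ n : ℕ, n ≤ B + 300 → θ ≤ e ^ n := fun n hn => hθ.trans (hle hn)
  have hθ1 : θ ≤ 1 := (hθn 0 (by omega)).trans_eq (pow_zero e)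
  have hθs : θ ≤ e := (hθn 1 (by omega)).trans_eq (pow_one e)
  have hη1 : η ≤ 1 := hη.trans (pow_le_one₀ hθ0.le hθ1)
  have hηθ : η ≤ θ := hη.trans (pow_le_of_le_one hθ0.le hθ1 (by norm_num))
  have hρ₁0 : 0 < ρ₁ := he0.trans_le heρ
  have hT1 := le_mul_numSteps (τ := τ) hη0
  have hT2 := mul_numSteps_le (τ := τ) hη0 hη1 (by linarith)
  have hE1 := le_mul_numEarly (τ := τ) hη0 hρ₁0
  have hθ2 : θ ≤ e * e := (hθn 2 (by omega)).trans_eq (sq e)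
  have hηe : 4 * η ≤ e := by nlinarith
  have hE2 := numEarly_le (τ := τ) hη0 hρ₁0 (by nlinarith)
  have hn := mul_spacing_le hη0 hθ0
  have hlog : Real.log (1 / e) ≤ 1 / e - 1 := Real.log_le_sub_one_of_pos (by positivity)
  have h1e : e * (1 / e) = 1 := by field_simp
  have hτ4 : 81 ≤ τ ^ 4 := by
    calc (81 : ℝ) = 3 ^ 4 := by norm_num
      _ ≤ τ ^ 4 := by gcongr
  have hτ5 : (2 + τ) ^ 4 ≤ 8 * τ ^ 4 := by
    calc (2 + τ) ^ 4 ≤ (5 / 3 * τ) ^ 4 := by gcongr; linarith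
      _ = 625 / 81 * τ ^ 4 := by ring
      _ ≤ _ := by gcongr; norm_num
  have hτ88 : 81 * τ ^ 4 ≤ τ ^ 8 := by
    calc 81 * τ ^ 4 ≤ τ ^ 4 * τ ^ 4 := by gcongr
      _ = τ ^ 8 := by ring
  have hτle : τ + 4 ≤ τ ^ 8 := by
    have : τ ≤ τ ^ 4 := le_self_pow₀ (by linarith) (by norm_num)
    linarith
  have hτe : e * (3 + τ) ≤ 1 := by
    calc e * (3 + τ) ≤ e * (1 / e) := by gcongr; linarith
      _ = 1 := h1e
  have h40 : (numEarly ρ₁ τ η : ℝ) ≤ numSteps τ η :=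
    hE2.trans (by nlinarith [Nat.cast_nonneg (α := ℝ) (numSteps τ η)])
  refine ⟨⟨he0, he, hθ0, hθn 200 (by omega), hη0, ?_, ?_, ?_, ?_, ?_, hlam0, ?_, hmD, hmG, hcp,
    hcp1, ?_, ?_, ?_, hρ0, ?_, ?_⟩, ?_, ?_, hE2⟩
  · exact hη.trans (pow_le_pow_of_le_one hθ0.le hθ1 (by norm_num))
  · rwa [div_le_iff₀ hη0] at hηG'
  · rw [le_div_iff₀ hη0] at hηG
    calc θ * η ≤ e ^ (200 + B) * η := by gcongr; exact hθn _ (by omega)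
      _ = e ^ 200 * (e ^ B * η) := by rw [pow_add]; ring
      _ ≤ _ := by gcongr
  · calc e * (2 + η * numSteps τ η) ≤ e * (3 + τ) :=
          mul_le_mul_of_nonneg_left (by linarith) he0.le
      _ ≤ 1 := hτe
  · rw [← hτ8]
    have h := pow_le_pow_left₀ (by positivity : 0 ≤ 1 + η * numSteps τ η)
      (by linarith : _ ≤ 2 + τ) 4
    linarith
  · rw [hd10, ← one_div, le_div_iff₀ (Real.sqrt_pos.2 hd'), mul_comm]
    exact hlam
  · push_cast
    linarith
  · exact_mod_cast h40
  · have h1 : θ ^ 4 ≤ θ := pow_le_of_le_one hθ0.le hθ1 (by norm_num)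
    have h2 : e * 3 ≤ ρ₁ * τ := by gcongr
    have h3 : e * e ≤ e * (1 / 1000) := by gcongr
    linarith
  · have h1 : θ ^ 3 ≤ 1 := pow_le_one₀ hθ0.le hθ1
    have h2 : cp * (ρ₁ / 4 * τ) / 2 ≤ cp * (η * numEarly ρ₁ τ η) / 2 := by
      have : 0 ≤ cp := he0.le.trans hcp
      gcongr
    linarith
  · rw [div_lt_iff₀ (by positivity)]
    have h1 : 0 < truncLevel d := by
      by_contra h
      have := mul_nonpos_of_nonpos_of_nonneg (not_lt.1 h) (pow_pos hθ0 4).le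
      linarith
    have h2 : 2 * θ ^ 4 < e ^ 3 := by
      calc 2 * θ ^ 4 ≤ 2 * θ := by gcongr; exact pow_le_of_le_one hθ0.le hθ1 (by norm_num)
        _ ≤ 2 * e ^ 4 := by gcongr; exact hθn 4 (by omega)
        _ = (2 * e) * e ^ 3 := by ring
        _ < 1 * e ^ 3 := by gcongr; linarith
        _ = _ := one_mul _
    calc (2 : ℝ) = truncLevel d * (2 * θ ^ 4) := by linarith
      _ < _ := by gcongr
  · linarith [mul_comm e τ, hτe]
  · have h1 : η * (8 * spacing θ η) ≤ η * (ρ₁ * e ^ 3 * numSteps τ η) := by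
      calc η * (8 * spacing θ η) ≤ 4 * θ ^ 30 := by linarith
        _ ≤ 4 * e ^ 5 := by
          gcongr
          exact (pow_le_of_le_one hθ0.le hθ1 (by norm_num)).trans (hθn 5 (by omega))
        _ = (4 * e) * (e * e ^ 3) := by ring
        _ ≤ 1 * (ρ₁ * e ^ 3) := by gcongr; linarith
        _ = ρ₁ * e ^ 3 * 1 := by ring
        _ ≤ ρ₁ * e ^ 3 * (η * numSteps τ η) := by gcongr; linarith
        _ = _ := by ring
    exact le_of_mul_le_mul_left h1 hη0

/-! ### Recovery of both modes -/

/-- For all admissible data, both modes are recovered up to `ε`, with probability `1 - ε`. -/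
def Recovers (K q B : ℕ) (τ : ℕ → ℝ) (p₀ c₁ c₂ ε : ℝ) (d : ℕ) : Prop :=
  ∀ (u : Fin 2 → Vec d) (ps : PMF (Fin 2 → Bool)) (pz : PMF (Fin (numG d) → Bool))
    (γ va lam etaD etaG : ℝ),
    InvPolylog K B d γ →
    DataStructure p₀ γ u ps →
    LatentStructure K B d c₁ c₂ pz →
    InvPolylog K B d (numD d * va) →
    InvPolylog K B d (Real.sqrt d * lam) →
    0 < etaD → etaD ≤ 1 / (d : ℝ) ^ K →
    InvPolylog K B d (etaG / etaD) →
    trainLaw (numD d) (numG d) d va ps pz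
      {ω | ¬ ∀ l : Fin 2,
        1 / Real.log d ^ q ≤
          pz.toMeasure.real {z |
            let V := (nsgda lam etaD etaG u (initState ω.1) ω.2 ⌈τ d / etaD⌉₊).V
            ‖‖generator V z‖⁻¹ • generator V z - u l‖ ≤ ε}}
      ≤ ENNReal.ofReal ε

theorem Recovers.mono {K q B : ℕ} {τ : ℕ → ℝ} {p₀ c₁ c₂ ε ε' : ℝ} {d : ℕ} (hε : ε ≤ ε')
    (h : Recovers K q B τ p₀ c₁ c₂ ε d) : Recovers K q B τ p₀ c₁ c₂ ε' d := by
  intro u ps pz γ va lam etaD etaG h1 h2 h3 h4 h5 h6 h7 h8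
  refine (measure_mono fun ω hω => ?_).trans
    ((h u ps pz γ va lam etaD etaG h1 h2 h3 h4 h5 h6 h7 h8).trans (ENNReal.ofReal_le_ofReal hε))
  refine fun hall => hω fun l => (hall l).trans (measureReal_mono fun z hz => ?_)
  exact le_trans hz hε

/-- Diagonal choice: the infimum of the admissible accuracies plus `1 / (d + 1)`. The infimum need
not be admissible itself, and monotonicity makes anything above it admissible. -/
theorem exists_tendsto_zero_of_forall {P : ℝ → ℕ → Prop}
    (hmono : ∀ ε ε' d, ε ≤ ε' → P ε d → P ε' d) (h : ∀ ε, 0 < ε → ∀ᶠ d in atTop, P ε d) :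
    ∃ ε : ℕ → ℝ, Tendsto ε atTop (𝓝 0) ∧ ∀ᶠ d in atTop, P (ε d) d := by
  set S : ℕ → Set ℝ := fun d => {x | 0 < x ∧ P x d} with hS
  have hbdd : ∀ d, BddBelow (S d) := fun d => ⟨0, fun x hx => hx.1.le⟩
  have hnn : ∀ d, 0 ≤ sInf (S d) := fun d => Real.sInf_nonneg fun x hx => hx.1.le
  refine ⟨fun d => sInf (S d) + 1 / ((d : ℝ) + 1), ?_, ?_⟩
  · have h1 : Tendsto (fun d => sInf (S d)) atTop (𝓝 0) := by
      rw [Metric.tendsto_atTop']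
      intro δ hδ
      obtain ⟨N, hN⟩ := eventually_atTop.1 (h (δ / 2) (by positivity))
      refine ⟨N, fun d hd => ?_⟩
      have := csInf_le (hbdd d) (show δ / 2 ∈ S d from ⟨by positivity, hN d hd.le⟩)
      rw [Real.dist_eq, sub_zero, abs_of_nonneg (hnn d)]
      linarith
    simpa using h1.add tendsto_one_div_add_atTop_nhds_zero_nat
  · filter_upwards [h 1 one_pos] with d hd
    obtain ⟨x, hx, hlt⟩ := exists_lt_of_csInf_lt (show (S d).Nonempty from ⟨1, one_pos, hd⟩)
      (show sInf (S d) < sInf (S d) + 1 / ((d : ℝ) + 1) from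
        lt_add_of_pos_right _ (by positivity))
    exact hmono _ _ _ hlt.le hx.2

theorem trainLaw_le {mD mG d : ℕ} {va : ℝ} {ps : PMF (Fin 2 → Bool)} {pz : PMF (Fin mG → Bool)}
    {A : Set (InitSample mD mG d)} {R : Set (ℕ → (Fin 2 → Bool) × (Fin mG → Bool))}
    {S : Set (InitSample mD mG d × (ℕ → (Fin 2 → Bool) × (Fin mG → Bool)))} {a r : ℝ}
    (hA : (initLaw mD mG d va).real A ≤ a)
    (hR : (Measure.infinitePi fun _ : ℕ => sampleLaw ps pz).real R ≤ r)
    (hS : ∀ ω ∈ S, ω.1 ∈ A ∨ ω.2 ∈ R) :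
    trainLaw mD mG d va ps pz S ≤ ENNReal.ofReal (a + r) := by
  have ha : 0 ≤ a := measureReal_nonneg.trans hA
  have hr : 0 ≤ r := measureReal_nonneg.trans hR
  have hsub : S ⊆ (A ×ˢ Set.univ) ∪ (Set.univ ×ˢ R) := fun ω hω => by
    rcases hS ω hω with h | h
    · exact Or.inl ⟨h, trivial⟩
    · exact Or.inr ⟨trivial, h⟩
  have htl : trainLaw mD mG d va ps pz
      = (initLaw mD mG d va).prod (Measure.infinitePi fun _ : ℕ => sampleLaw ps pz) := rfl
  rw [htl]
  refine (measure_mono hsub).trans ((measure_union_le _ _).trans ?_)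
  rw [Measure.prod_prod, Measure.prod_prod, measure_univ, measure_univ, mul_one, one_mul,
    ENNReal.ofReal_add ha hr, ← ofReal_measureReal (μ := initLaw mD mG d va),
    ← ofReal_measureReal (μ := Measure.infinitePi fun _ : ℕ => sampleLaw ps pz)]
  exact add_le_add (ENNReal.ofReal_le_ofReal hA) (ENNReal.ofReal_le_ofReal hR)

theorem eventually_recovers (B : ℕ) {p₀ c₁ c₂ : ℝ} (hp₀ : 0 < p₀) (hc₁ : 0 < c₁) {ε : ℝ}
    (hε : 0 < ε) : ∀ᶠ d : ℕ in atTop, Recovers 100 3 B horizon p₀ c₁ c₂ ε d := by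
  -- The final error is `2 (2 ρ₁ + ρ + e)` with `ρ₁ = ρ`, hence `6 ρ + 2 e ≤ ε` once `e ≤ ε / 8`.
  set ρ : ℝ := min ε 1 / 16 with hρd
  have hρ0 : 0 < ρ := by positivity
  have hρ1 : ρ ≤ 1 := by linarith [min_le_right ε 1]
  have hρε : ρ ≤ ε / 16 := by linarith [min_le_left ε 1]
  filter_upwards [eventually_initLaw_bad_le 100 B (by norm_num) (half_pos hε),
    eventually_smallPow_le (B + 300), eventually_logInv_pos,
    eventually_logInv_le (by norm_num : (0 : ℝ) < 1 / 1000), eventually_logInv_le hp₀,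
    eventually_logInv_le hρ0, eventually_logInv_le (by positivity : 0 < ε / 8),
    eventually_logInv_le (half_pos hc₁), tendsto_horizon.eventually_ge_atTop 3,
    tendsto_horizon.eventually_ge_atTop ((4 / ρ + 1) * 8 / (p₀ * ρ)),
    tendsto_log_log_natCast.eventually_ge_atTop 0, eventually_gt_atTop 0]
    with d hinit hθ he0 he hep heρ heε hec hτ hτ' hll hd
  intro u ps pz γ va lam etaD etaG hγ hdata hlat hva hlam hη0 hη hηG
  have hθ0 := smallPow_pos hd
  have hpow : ∀ n : ℕ, 1 / Real.log d ^ n = logInv d ^ n := fun n => by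
    rw [logInv, div_pow, one_pow]
  simp only [InvPolylog, hpow] at hγ hlam hηG
  have hd' : (0 : ℝ) < d := by exact_mod_cast hd
  have hsd : 0 < √(d : ℝ) := Real.sqrt_pos.2 hd'
  have he1 : logInv d ≤ 1 := by linarith
  have hle : ∀ {i j : ℕ}, i ≤ j → logInv d ^ j ≤ logInv d ^ i :=
    fun h => pow_le_pow_of_le_one he0.le he1 h
  have hθe : smallPow d ≤ logInv d ^ 1 := hθ.trans (hle (by omega))
  rw [pow_one] at hθe
  have hηθ : etaD ≤ smallPow d ^ 200 := by
    refine hη.trans ?_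
    rw [one_div, ← inv_pow, ← smallPow_pow_twenty, ← pow_mul]
    exact pow_le_pow_of_le_one hθ0.le (hθe.trans he1) (by norm_num)
  have hlam0 : 0 ≤ lam := nonneg_of_mul_nonneg_right ((pow_pos he0 B).le.trans hlam.1) hsd
  have hp1 : p₀ ≤ 1 := hdata.2.1.trans (ENNReal.toReal_le_of_le_ofReal zero_le_one
    (by simpa using PMF.coe_le_one ps _))
  have hγ0 : 0 ≤ γ := (pow_pos he0 B).le.trans hγ.1
  have hγe : γ ≤ logInv d ^ 60 := hγ.2.trans (hle (by norm_num))
  obtain ⟨hscale, hτe, hsp, hearly⟩ := exists_scale (B := B) (lam := lam) (η := etaD) (ηG := etaG)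
    (τ := horizon d) (cp := p₀) (ρ := ρ) (ρ₁ := ρ) hd he0 he hep hp1 heρ hρ1 hρ0 hθ hτ
    (horizon_pow hll) (by
      rw [div_le_iff₀ (by positivity)] at hτ'
      linarith) hη0 hηθ hηG.1 (hηG.2.trans (hle (by norm_num))) hlam0
    (hlam.2.trans (pow_le_one₀ he0.le he1))
  have hinner : 0 ≤ (inner ℝ (u 0) (u 1) : ℝ) ∧ (inner ℝ (u 0) (u 1) : ℝ) ≤ logInv d ^ 60 := by
    rcases hdata.2.2.2 with h | h
    · rw [h.1]
      exact ⟨hγ0, hγe⟩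
    · rw [h.1]
      exact ⟨le_rfl, by positivity⟩
  have hsolo : ∀ j, logInv d ^ 3 ≤ pz.toMeasure.real {z | z = soloVec j} := fun j => by
    refine le_trans ?_ (le_solo_prob hlat he0 j)
    have hm : (0 : ℝ) < numG d := by exact_mod_cast j.pos
    have h1 : 2 * logInv d * logInv d ^ 2 ≤ c₁ / numG d := by
      rw [le_div_iff₀ hm]
      calc 2 * logInv d * logInv d ^ 2 * numG d
          = 2 * logInv d * (numG d * logInv d ^ 2) := by ring
        _ ≤ c₁ * 1 := mul_le_mul (by linarith) (numG_mul_le he0 he1) (by positivity) hc₁.le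
        _ = c₁ := mul_one _
    have h2 : logInv d ^ 100 ≤ logInv d ^ 3 := hle (by norm_num)
    have h3 : 2 * logInv d * logInv d ^ 2 = 2 * logInv d ^ 3 := by ring
    linarith
  have hpair : ∀ j, pz.toMeasure.real {z | z j = true ∧ z ≠ soloVec j} ≤ logInv d ^ 60 :=
    fun j => (pair_prob_le hlat he0 j).trans (hle (by norm_num))
  have hnone : ps.toMeasure.real {s | modeOf s = none} ≤ logInv d ^ 60 := by
    refine (no_mode_prob_le hdata hγ0).trans ?_
    calc 2 * γ ≤ 2 * logInv d ^ 100 := by linarith [hγ.2]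
      _ ≤ 2 * logInv d ^ 61 := by linarith [hle (show 61 ≤ 100 by norm_num)]
      _ = (2 * logInv d) * logInv d ^ 60 := by ring
      _ ≤ 1 * logInv d ^ 60 := by gcongr; linarith
      _ = _ := one_mul _
  have hn0 : 0 < spacing (smallPow d) etaD := by
    have h4 : 4 * etaD ≤ smallPow d ^ 30 := by
      have h5 : smallPow d ^ 200 ≤ smallPow d ^ 31 :=
        pow_le_pow_of_le_one hθ0.le (hθe.trans he1) (by norm_num)
      have h6 : smallPow d ^ 31 = smallPow d * smallPow d ^ 30 := by ring
      nlinarith [pow_pos hθ0 30]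
    have h1 := le_mul_spacing hη0 h4
    by_contra h
    rw [Nat.eq_zero_of_not_pos h] at h1
    have := pow_pos hθ0 30
    push_cast at h1
    linarith
  have hdevle := (exists_event_dev_le ps pz (numSteps (horizon d) etaD) hn0).trans
    (deviation_bound_le he0 he hθ0 (hθ.trans (hle (by omega))) hη0 hηθ (by linarith) hτe
      (Nat.cast_nonneg _) (numG_mul_le he0 he1))
  have hmain := trainLaw_le (hinit u va hdata.1 hinner.1 hinner.2 hva) hdevle
    (S := {ω | ¬ ∀ l : Fin 2, 1 / Real.log d ^ 3 ≤ pz.toMeasure.real {z |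
            let V := (nsgda lam etaD etaG u (initState ω.1) ω.2 ⌈horizon d / etaD⌉₊).V
            ‖‖generator V z‖⁻¹ • generator V z - u l‖ ≤ ε}}) ?_
  · refine hmain.trans (ENNReal.ofReal_le_ofReal ?_)
    linarith
  · intro ω hω
    by_contra hcon
    rw [not_or, Set.mem_setOf_eq, not_not, Set.mem_setOf_eq, not_not] at hcon
    obtain ⟨⟨iw, jv, hI⟩, hdev⟩ := hcon
    refine hω fun l => ?_
    have hg := goodSamples_of_dev hdev (le_mode_prob hdata) hnone hsolo hpair hρ0.le hρ1 hearly hsp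
    have hfin := normalize_nsgda_sub_le hscale hI hg hdata.1 hinner.1 hinner.2 l
    rw [hpow]
    -- The single latent vector with only `jv l` active generates the column itself and has
    -- probability at least `e ^ 3`. This is where the exponent `q = 3` comes from.
    refine (hsolo (jv l)).trans (measureReal_mono fun z hz => ?_)
    rw [Set.mem_setOf_eq] at hz
    subst hz
    simp only [Set.mem_setOf_eq, generator_soloVec]
    refine hfin.trans ?_
    linarith

theorem eventually_horizon_mem : ∀ᶠ d : ℕ in atTop,
    1 / Real.log d ^ 3 ≤ horizon d ∧ horizon d ≤ Real.log d ^ 3 := by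
  filter_upwards [tendsto_horizon.eventually_ge_atTop 1,
    tendsto_log_natCast.eventually_ge_atTop 1] with d hτ hL
  have h1 := horizon_pow (Real.log_nonneg hL)
  rw [logInv, one_div_one_div] at h1
  have h2 : horizon d ≤ horizon d ^ 8 := le_self_pow₀ hτ (by norm_num)
  have h3 := Real.log_le_sub_one_of_pos (by linarith : 0 < Real.log d)
  have h4 : Real.log d ≤ Real.log d ^ 3 := le_self_pow₀ hL (by norm_num)
  refine ⟨le_trans ?_ hτ, by linarith⟩
  rw [div_le_one (by positivity)]
  exact one_le_pow₀ hL

end GAN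
end

theorem mainTheorem2 :
    ∃ (K q : ℕ) (τ : ℕ → ℝ),
      (∀ᶠ d : ℕ in atTop, 1 / Real.log d ^ q ≤ τ d ∧ τ d ≤ Real.log d ^ q) ∧
      ∀ (B : ℕ) (p₀ c₁ c₂ : ℝ), 0 < p₀ → 0 < c₁ → 0 < c₂ →
      ∃ ε : ℕ → ℝ, Tendsto ε atTop (𝓝 0) ∧
      ∀ᶠ d : ℕ in atTop,
      ∀ (u : Fin 2 → GAN.Vec d) (ps : PMF (Fin 2 → Bool)) (pz : PMF (Fin (GAN.numG d) → Bool))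
        (γ va lam etaD etaG : ℝ),
        GAN.InvPolylog K B d γ →
        GAN.DataStructure p₀ γ u ps →
        GAN.LatentStructure K B d c₁ c₂ pz →
        GAN.InvPolylog K B d (GAN.numD d * va) →
        GAN.InvPolylog K B d (Real.sqrt d * lam) →
        0 < etaD → etaD ≤ 1 / (d : ℝ) ^ K →
        GAN.InvPolylog K B d (etaG / etaD) →
        GAN.trainLaw (GAN.numD d) (GAN.numG d) d va ps pz
          {ω | ¬ ∀ l : Fin 2,
            1 / Real.log d ^ q ≤
              pz.toMeasure.real {z |
                let V := (GAN.nsgda lam etaD etaG u (GAN.initState ω.1) ω.2 ⌈τ d / etaD⌉₊).V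
                ‖‖GAN.generator V z‖⁻¹ • GAN.generator V z - u l‖ ≤ ε d}}
          ≤ ENNReal.ofReal (ε d) := by
  exact ⟨100, 3, GAN.horizon, GAN.eventually_horizon_mem, fun B p₀ c₁ c₂ hp₀ hc₁ _ =>
    GAN.exists_tendsto_zero_of_forall (P := GAN.Recovers 100 3 B GAN.horizon p₀ c₁ c₂)
      (fun _ _ _ h hR => hR.mono h) fun _ hε => GAN.eventually_recovers B hp₀ hc₁ hε⟩
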